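/- Let $\mathbb K$ be a field of characteristic $0$ and let $A=(V,\cdot,\{\,,\})$ be a (not necessarily unital) Poisson algebra over $\mathbb K$. **Finite cohomology complex.** For $n\ge 1$ let $\mathcal Q(n)$ be the set of quivers without loops (multiple arrows allowed, isomorphic quivers identified) on the vertex set $\{1,\dots,n\}$, and let $R(n)\subset\mathbb K\mathcal Q(n)$ be spanned by the quivers whose underlying graph contains a cycle and by the sums $\sum_{e\in C}\Gamma\setminus e$ with $C$ a directed cycle of $\Gamma$. Put $P^{\mathrm{fn}}_V(n)=\mathrm{Hom}((\mathbb K\mathcal Q(n)/R(n))\otimes V^{\otimes n},V)$, with elements written $f^\Gamma(v_1,\dots,v_n)$, with the right action $(f^\sigma)^\Gamma(v_1,\dots,v_n)=f^{\sigma\Gamma}(v_{\sigma^{-1}(1)},\dots,v_{\sigma^{-1}(n)})$, and with the composition $\circ_1$ given by $(f\circ_1 g)^\Gamma(v_1,\dots,v_{a+b+1})=f^{\Gamma''}(g^{\Gamma'}(v_1,\dots,v_{b+1}),v_{b+2},\dots,v_{a+b+1})$ for $f$ of arity $a+1$ and $g$ of arity $b+1$, where $\Gamma'$ is the full subquiver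 of $\Gamma$ on the first $b+1$ vertices and $\Gamma''$ is obtained by collapsing them to one vertex. For $n\ge0$ let $\mathfrak g^{n}=\{f\in P^{\mathrm{fn}}_V(n+1): f^\sigma=\mathrm{sgn}(\sigma)f \text{ for all }\sigma\in\mathfrak S_{n+1}\}$, with $f\,\square\, g=\sum_{\sigma}\mathrm{sgn}(\sigma)(f\circ_1 g)^{\sigma^{-1}}$ for $f\in\mathfrak g^a$, $g\in\mathfrak g^b$, the sum being over the $(b+1,a)$-shuffles, and $[f,g]=f\,\square\, g-(-1)^{ab}g\,\square\, f$. Let $X=X_h+X_v\in\mathfrak g^1$, where $X_h$ is supported on the quiver without arrows, with value $\{v_1,v_2\}$, and $X_v$ on the quivers with one arrow, with value $v_1\cdot v_2$ on $1\to2$ and $-v_1\cdot v_2$ on $2\to 1$. Then $[X,X]=0$, and $\mathfrak g^{\mathrm{fn}}_A=(\bigoplus_{n\ge0}\mathfrak g^n,\ d_X=[X,-])$ is a cochain complex. **Poisson cohomology bicomplex.** On the words $(v_1,\dots,v_n)\in V^{\otimes n}$ let $\star$ be the signed shuffle product (all letters of degree one), let $f*g=\star \circ(f\otimes g)\circ\Delta$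 be the convolution with respect to the deconcatenation $\Delta$, with unit $u\varepsilon$, and let $e^{(1)}=\sum_{k\ge1}\frac{(-1)^{k+1}}{k}(\mathrm{id}-u\varepsilon)^{*k}$ and $e^{(p)}=\frac1{p!}(e^{(1)})^{*p}$ be the Eulerian idempotents. For $n\ge1$ let $C^n_{(p)}=\{f\in\mathrm{Hom}(V^{\otimes n},V): f\circ e^{(p)}=f\}$ and $C^{p,q}_{\mathrm{Pois}}(A,A)=C^{p+q}_{(p)}$ for $p\ge1$, $q\ge0$, and $0$ for all other $p,q\in\mathbb Z$. The vertical differential $d:C^{n}_{(p)}\to C^{n+1}_{(p)}$ is the Hochschild coboundary $df(a_1,\dots,a_{n+1})=a_1f(a_2,\dots)+\sum_{i=1}^n(-1)^if(\dots,a_ia_{i+1},\dots)+(-1)^{n+1}f(a_1,\dots,a_n)a_{n+1}$. Let $L$ be the space of words of positive length modulo the shuffles of two words of positive length (the cofree Lie coalgebra on $V$ placed in degree one); $f\in C^n_{(p)}$ corresponds to the function $F(w_1\cdots w_p)=\frac1{p!}f(e^{(1)}w_1\star \cdots\star e^{(1)}w_p)$ on the $p$-th graded symmetric power of $L$, and $f(v_1,\dots,v_n)=\sum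 F(w_1\cdots w_p)$, the sum over all ways to cut $(v_1,\dots,v_n)$ into $p$ nonempty words. The horizontal differential $\delta_{\mathrm{CE}}:C^n_{(p)}\to C^{n+1}_{(p+1)}$ corresponds to the Chevalley–Eilenberg coboundary $$F\mapsto\sum_i\pm[w_i,F(w_0\cdots\widehat{w_i}\cdots w_p)]-\sum_{i<j}\pm F([w_i,w_j]w_0\cdots\widehat{w_i}\cdots\widehat{w_j}\cdots w_p),$$ where $\pm$ are the Koszul signs of moving $w_i$, respectively $w_iw_j$, to the front, $[w,m]$ is $\{a,m\}$ if $w=(a)$ and $0$ if $w$ has more than one letter, and $[(a_1,\dots,a_s),(b_1,\dots,b_t)]=\sum_{i,j}\pm((a_1,\dots,a_{i-1})\star (b_1,\dots,b_{j-1}))\,\{a_i,b_j\}\,((a_{i+1},\dots,a_s)\star (b_{j+1},\dots,b_t))$ with the sign $(-1)^{j(s-i)+i-1}$ (the Koszul sign for letters of degree one and an operation $\{\,,\}$ of degree $-1$). **Theorem.** For $p,q\in\mathbb Z$ with $n=p+q\ge 0$ let $\mathfrak g^{p,q}\subset\mathfrak g^{n}$ be the subspace of the $f$ such that $f^{\Lambda}=0$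 for every disjoint union $\Lambda$ of directed lines on $\{1,\dots,n+1\}$ (each line starting at its smallest vertex) whose number of lines is not $p$; for $p+q<0$ let $\mathfrak g^{p,q}=0$. Then $\mathfrak g^n=\bigoplus_{p=1}^{n+1}\mathfrak g^{p,n-p}$ and $\mathfrak g^{p,n-p}=0$ for all other $p$. The differential splits as $d_X=d_h+d_v$ with $d_h=[X_h,-]:\mathfrak g^{p,q}\to\mathfrak g^{p+1,q}$ and $d_v=[X_v,-]:\mathfrak g^{p,q}\to\mathfrak g^{p,q+1}$, and $d_h^2=0$, $d_v^2=0$, $d_hd_v+d_vd_h=0$; so $\mathfrak g^{\mathrm{fn}}_A$ is the total complex of the bicomplex $(\mathfrak g^{\bullet,\bullet},d_h,d_v)$. There are linear isomorphisms $\Phi:\mathfrak g^{p,q}\to C^{p,q+1}_{\mathrm{Pois}}(A,A)$ for all $p,q$ with $\Phi d_h=\delta_{\mathrm{CE}}\Phi$ and $\Phi d_v=d\,\Phi$. Moreover, for $p=1$ they satisfy $\Phi(Y)=(-1)^{n(n-1)/2}\,Y^{\Lambda_{n+1}}$ for $Y\in\mathfrak g^{1,n-1}$, where $\Lambda_{n+1}$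 is the line $1\to2\to\cdots\to n+1$; the spaces $C^{n+1}_{(1)}$ are equal to the spaces of Harrison cochains (the multilinear maps that vanish on the signed shuffles of two nonempty words); and the map $Y\mapsto(-1)^{n(n-1)/2}\,Y^{\Lambda_{n+1}}$, which vanishes on $\mathfrak g^{p,n-p}$ for $p\neq1$, is a surjective morphism of cochain complexes from $\mathfrak g^{\mathrm{fn}}_A$ onto the Harrison complex of $(V,\cdot)$ (with the Harrison cochains of $n+1$ variables placed in degree $n$). -/

import Mathlib

noncomputable section

namespace PoissonFinite

/-- A (not necessarily unital) Poisson algebra structure on a vector space `V`: a commutative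
associative product and a Lie bracket that is a biderivation of the product. -/
structure PoissonAlgebra (K V : Type*) [Field K] [AddCommGroup V] [Module K V] where
  mul : V →ₗ[K] V →ₗ[K] V
  bracket : V →ₗ[K] V →ₗ[K] V
  mul_comm : ∀ x y, mul x y = mul y x
  mul_assoc : ∀ x y z, mul (mul x y) z = mul x (mul y z)
  antisymm : ∀ x y, bracket x y = -bracket y x
  jacobi : ∀ x y z, bracket x (bracket y z) = bracket (bracket x y) z + bracket y (bracket x z)
  leibniz : ∀ x y z, bracket x (mul y z) = mul (bracket x y) z + mul y (bracket x z)

/-- The functions `Vⁿ → V` that are multilinear, i.e. `Hom(V^{⊗n}, V)`, as a subspace of the space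
of all functions `Vⁿ → V`. -/
def multilinear (K V : Type*) [Field K] [AddCommGroup V] [Module K V] (n : ℕ) :
    Submodule K ((Fin n → V) → V) where
  carrier := {f | ∃ g : MultilinearMap K (fun _ : Fin n => V) V, ⇑g = f}
  add_mem' := by
    rintro _ _ ⟨f, rfl⟩ ⟨g, rfl⟩
    exact ⟨f + g, rfl⟩
  zero_mem' := ⟨0, rfl⟩
  smul_mem' := by
    rintro c _ ⟨f, rfl⟩
    exact ⟨c • f, rfl⟩

/-- `σ` is an `(m, n - m)`-shuffle: it is increasing on the first `m` indices and on the
remaining ones. -/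
def IsShuffle {n : ℕ} (m : ℕ) (σ : Equiv.Perm (Fin n)) : Prop :=
  ∀ i j : Fin n, i < j → (j.val < m ∨ m ≤ i.val) → σ i < σ j

/-! ### Quivers -/

/-- `n`-quivers without loops: finite multisets of arrows `(source, target)` on the labelled
vertex set `Fin n`; multiple arrows are allowed. -/
def Quiv (n : ℕ) : Type := {E : Multiset (Fin n × Fin n) // ∀ e ∈ E, e.1 ≠ e.2}

namespace Quiv

/-- The left action of permutations by relabelling the vertices. -/
def relabel {n : ℕ} (σ : Equiv.Perm (Fin n)) (Γ : Quiv n) : Quiv n :=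
  ⟨Γ.1.map (fun e => (σ e.1, σ e.2)), by
    intro e he
    obtain ⟨a, ha, rfl⟩ := Multiset.mem_map.1 he
    exact fun h => Γ.2 a ha (σ.injective h)⟩

/-- Removal of (one copy of) the arrow `e`. -/
def erase {n : ℕ} (Γ : Quiv n) (e : Fin n × Fin n) : Quiv n :=
  ⟨Γ.1.erase e, fun a ha => Γ.2 a (Multiset.mem_of_mem_erase ha)⟩

/-- The underlying undirected multigraph of `Γ` contains a cycle, with distinct vertices
`v 0, …, v k` and pairwise different edges joining `v i` and `v (i + 1)` (indices mod `k + 1`);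
`o i` tells whether the `i`-th edge is traversed along its direction. -/
def HasCycle {n : ℕ} (Γ : Quiv n) : Prop :=
  ∃ (k : ℕ) (v : Fin (k + 1) → Fin n) (o : Fin (k + 1) → Bool), Function.Injective v ∧
    (Finset.univ : Finset (Fin (k + 1))).val.map
      (fun i => if o i then (v i, v (i + 1)) else (v (i + 1), v i)) ≤ Γ.1

/-- `v 0 → v 1 → ⋯ → v k → v 0` is a directed cycle of `Γ`. -/
def IsDirectedCycle {n : ℕ} (Γ : Quiv n) {k : ℕ} (v : Fin (k + 1) → Fin n) : Prop :=
  Function.Injective v ∧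
    (Finset.univ : Finset (Fin (k + 1))).val.map (fun i => (v i, v (i + 1))) ≤ Γ.1

/-- The quiver obtained by collapsing the vertices `0, …, b` to the vertex `0` (a vertex `b + i`
becomes `i`), with the arrows among the collapsed vertices dropped. -/
def collapse {a b N : ℕ} (h : a + b = N) (Γ : Quiv (N + 1)) : Quiv (a + 1) :=
  ⟨(Γ.1.map (fun e => ((⟨e.1.val - b, by omega⟩ : Fin (a + 1)),
      (⟨e.2.val - b, by omega⟩ : Fin (a + 1))))).filter (fun e => e.1 ≠ e.2),
    fun _ he => (Multiset.mem_filter.1 he).2⟩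

/-- The full subquiver on the first `b + 1` vertices. -/
def restrict {N : ℕ} (b : ℕ) (Γ : Quiv (N + 1)) : Quiv (b + 1) :=
  ⟨Γ.1.filterMap (fun e => if h : e.1.val < b + 1 ∧ e.2.val < b + 1 then
      some ((⟨e.1.val, h.1⟩ : Fin (b + 1)), (⟨e.2.val, h.2⟩ : Fin (b + 1))) else none), by
    intro e he
    obtain ⟨x, hx, hxe⟩ := (Multiset.mem_filterMap _ _).1 he
    split_ifs at hxe with hlt
    obtain rfl := Option.some.inj hxe
    intro h
    have h2 := Fin.mk.inj h
    exact Γ.2 x hx (Fin.ext h2)⟩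

/-- The line `0 → 1 → ⋯ → n` on `n + 1` vertices. -/
def line (n : ℕ) : Quiv (n + 1) :=
  ⟨(Finset.univ : Finset (Fin n)).val.map (fun i => (i.castSucc, i.succ)), by
    intro e he
    obtain ⟨i, -, rfl⟩ := Multiset.mem_map.1 he
    exact (Fin.castSucc_lt_succ (i := i)).ne⟩

/-- `L` lists the lines of a disjoint union of lines on `Fin n`: its members are nonempty lists,
every vertex occurs exactly once, every line starts with its smallest vertex, and the lines
are ordered by their starting vertices. -/
def IsLinePartition {n : ℕ} (L : List (List (Fin n))) : Prop :=
  (∀ l ∈ L, l ≠ []) ∧ L.flatten.Perm (List.finRange n) ∧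
    (∀ l ∈ L, ∀ x ∈ l.head?, ∀ y ∈ l, x ≤ y) ∧
    L.Pairwise (fun l l' => ∀ x ∈ l.head?, ∀ y ∈ l'.head?, x < y)

/-- The arrows of the disjoint union of the lines in `L`: those from each vertex of a line
to the next one. -/
def lineArrows {n : ℕ} (L : List (List (Fin n))) : Multiset (Fin n × Fin n) :=
  ((L.map (fun l => l.zip l.tail)).flatten : List (Fin n × Fin n))

end Quiv

/-! ### The finite operad and its cohomology complex -/

/-- All functions `(Γ, v₁, …, vₙ) ↦ f^Γ(v₁, …, vₙ)`. -/
abbrev QuivFun (V : Type*) (n : ℕ) : Type _ := Quiv n → (Fin n → V) → V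

/-- The arity `n` component `Hom((K Q(n) / R(n)) ⊗ V^{⊗n}, V)` of the finite operad of `V`:
the functions `f^Γ(v₁, …, vₙ)`, multilinear in the `vᵢ`, whose linear extension in `Γ` vanishes on
the cycle relations, i.e. on the quivers whose underlying graph has a cycle and on the sums
`∑ Γ \ e` over the arrows `e` of a directed cycle of `Γ`. -/
def finOp (K V : Type*) [Field K] [AddCommGroup V] [Module K V] (n : ℕ) :
    Submodule K (QuivFun V n) where
  carrier := {f | (∀ Γ, f Γ ∈ multilinear K V n) ∧ (∀ Γ : Quiv n, Γ.HasCycle → f Γ = 0) ∧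
    ∀ (Γ : Quiv n) (k : ℕ) (v : Fin (k + 1) → Fin n), Γ.IsDirectedCycle v →
      ∑ i, f (Γ.erase (v i, v (i + 1))) = 0}
  add_mem' := by
    rintro f g ⟨hf1, hf2, hf3⟩ ⟨hg1, hg2, hg3⟩
    refine ⟨fun Γ => add_mem (hf1 Γ) (hg1 Γ), fun Γ h => ?_, fun Γ k v h => ?_⟩
    · simp [hf2 Γ h, hg2 Γ h]
    · simp [Finset.sum_add_distrib, hf3 Γ k v h, hg3 Γ k v h]
  zero_mem' := ⟨fun Γ => zero_mem _, fun Γ h => rfl, fun Γ k v h => by simp⟩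
  smul_mem' := by
    rintro c f ⟨hf1, hf2, hf3⟩
    refine ⟨fun Γ => Submodule.smul_mem _ c (hf1 Γ), fun Γ h => ?_, fun Γ k v h => ?_⟩
    · simp [hf2 Γ h]
    · simp [← Finset.smul_sum, hf3 Γ k v h]

/-- The right action `(f^σ)^Γ(v₁, …, vₙ) = f^{σΓ}(v_{σ⁻¹(1)}, …, v_{σ⁻¹(n)})`. -/
def act {V : Type*} {n : ℕ} (σ : Equiv.Perm (Fin n)) (f : QuivFun V n) : QuivFun V n :=
  fun Γ v => f (Γ.relabel σ) (fun i => v (σ⁻¹ i))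

/-- The infinitesimal composition `f ∘₁ g = f(g, 1, …, 1)` for `f` of arity `a + 1` and `g` of
arity `b + 1`. -/
def circ {V : Type*} {a b N : ℕ} (h : a + b = N) (f : QuivFun V (a + 1)) (g : QuivFun V (b + 1)) :
    QuivFun V (N + 1) :=
  fun Γ v => f (Γ.collapse h) (fun i : Fin (a + 1) =>
    if i = 0 then g (Γ.restrict b) (fun j => v ⟨j.val, by omega⟩) else v ⟨i.val + b, by omega⟩)

open Classical in
/-- The pre-Lie product `f □ g`: the sum over all `(b + 1, a)`-shuffles `σ` of `(f ∘₁ g)^{σ⁻¹}`,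
where the action is the one twisted by the signature. -/
def box {V : Type*} [AddCommGroup V] {a b N : ℕ} (h : a + b = N) (f : QuivFun V (a + 1))
    (g : QuivFun V (b + 1)) : QuivFun V (N + 1) :=
  ∑ σ : Equiv.Perm (Fin (N + 1)) with IsShuffle (b + 1) σ,
    ((Equiv.Perm.sign σ : ℤˣ) : ℤ) • act σ⁻¹ (circ h f g)

/-- The graded commutator `[f, g] = f □ g - (-1)^{ab} g □ f` for `f` of degree `a` and `g` of
degree `b` (arity is degree plus one). -/
def lieBracket {V : Type*} [AddCommGroup V] {a b N : ℕ} (h : a + b = N) (f : QuivFun V (a + 1))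
    (g : QuivFun V (b + 1)) : QuivFun V (N + 1) :=
  box h f g - ((-1 : ℤ) ^ (a * b)) • box ((Nat.add_comm b a).trans h) g f

/-- The degree `n` component of the graded Lie algebra `𝔤(Lie, P^fn_V)`: the elements `f` of
arity `n + 1` of the finite operad with `f^σ = sgn(σ) f` for all `σ`. -/
def finCx (K V : Type*) [Field K] [AddCommGroup V] [Module K V] (n : ℕ) :
    Submodule K (QuivFun V (n + 1)) where
  carrier := {f | f ∈ finOp K V (n + 1) ∧
    ∀ σ : Equiv.Perm (Fin (n + 1)), act σ f = ((Equiv.Perm.sign σ : ℤˣ) : ℤ) • f}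
  add_mem' := by
    rintro f g ⟨hf, hf'⟩ ⟨hg, hg'⟩
    refine ⟨add_mem hf hg, fun σ => ?_⟩
    rw [smul_add, ← hf' σ, ← hg' σ]
    rfl
  zero_mem' := ⟨zero_mem _, fun σ => by rw [smul_zero]; rfl⟩
  smul_mem' := by
    rintro c f ⟨hf, hf'⟩
    refine ⟨Submodule.smul_mem _ c hf, fun σ => ?_⟩
    rw [smul_comm, ← hf' σ]
    rfl

/-- The component `𝔤^{p,q}` with `p + q = n` of the degree `n` part: the elements that vanish on
all disjoint unions of lines whose number of lines is not `p`. -/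
def finBi (K V : Type*) [Field K] [AddCommGroup V] [Module K V] (p n : ℕ) :
    Submodule K (QuivFun V (n + 1)) where
  carrier := {f | f ∈ finCx K V n ∧ ∀ (L : List (List (Fin (n + 1)))) (Γ : Quiv (n + 1)),
    Quiv.IsLinePartition L → Γ.1 = Quiv.lineArrows L → L.length ≠ p → f Γ = 0}
  add_mem' := by
    rintro f g ⟨hf, hf'⟩ ⟨hg, hg'⟩
    refine ⟨add_mem hf hg, fun L Γ h1 h2 h3 => ?_⟩
    simp [hf' L Γ h1 h2 h3, hg' L Γ h1 h2 h3]
  zero_mem' := ⟨zero_mem _, fun _ _ _ _ _ => rfl⟩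
  smul_mem' := by
    rintro c f ⟨hf, hf'⟩
    refine ⟨Submodule.smul_mem _ c hf, fun L Γ h1 h2 h3 => ?_⟩
    simp [hf' L Γ h1 h2 h3]

namespace PoissonAlgebra

variable {K V : Type*} [Field K] [AddCommGroup V] [Module K V] (A : PoissonAlgebra K V)

/-- The part of the Maurer-Cartan element supported on the quiver `• •`: the Poisson bracket. -/
def Xh : QuivFun V 2 := fun Γ v => if Γ.1 = 0 then A.bracket (v 0) (v 1) else 0

/-- The part of the Maurer-Cartan element supported on the quivers with one arrow: the product on
`0 → 1` and, as the cycle relations force, its negative on `1 → 0`. -/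
def Xv : QuivFun V 2 := fun Γ v =>
  if Γ.1 = {(0, 1)} then A.mul (v 0) (v 1)
  else if Γ.1 = {(1, 0)} then -A.mul (v 0) (v 1) else 0

/-- The Maurer-Cartan element of the finite operad that corresponds to the Poisson algebra. -/
def X : QuivFun V 2 := fun Γ v =>
  if Γ.1 = 0 then A.bracket (v 0) (v 1)
  else if Γ.1 = {(0, 1)} then A.mul (v 0) (v 1)
  else if Γ.1 = {(1, 0)} then -A.mul (v 0) (v 1) else 0

/-- The differential `d_X = [X, -]` of the finite cohomology complex. -/
def dX (n : ℕ) (Y : QuivFun V (n + 1)) : QuivFun V (n + 1 + 1) :=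
  lieBracket (a := 1) (b := n) (Nat.add_comm 1 n) A.X Y

/-- `d_h = [X_h, -]`. -/
def dh (n : ℕ) (Y : QuivFun V (n + 1)) : QuivFun V (n + 1 + 1) :=
  lieBracket (a := 1) (b := n) (Nat.add_comm 1 n) A.Xh Y

/-- `d_v = [X_v, -]`. -/
def dv (n : ℕ) (Y : QuivFun V (n + 1)) : QuivFun V (n + 1 + 1) :=
  lieBracket (a := 1) (b := n) (Nat.add_comm 1 n) A.Xv Y

end PoissonAlgebra

/-! ### Words, signed shuffles and Eulerian idempotents

The tensor coalgebra is handled through formal linear combinations of words `(v₁, …, vₙ)`; on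
these, multilinear functions are evaluated. -/

/-- Formal linear combinations of words with letters in `V`. -/
abbrev Words (K V : Type*) [Field K] : Type _ := List V →₀ K

section words

variable (K : Type*) {V : Type*} [Field K]

/-- The signed shuffle product of two words (all letters have degree one). -/
def shuffle : List V → List V → Words K V
  | [], v => Finsupp.single v 1
  | a :: u, [] => Finsupp.single (a :: u) 1
  | a :: u, b :: v =>
      Finsupp.mapDomain (List.cons a) (shuffle u (b :: v)) +
        (-1 : K) ^ (u.length + 1) • Finsupp.mapDomain (List.cons b) (shuffle (a :: u) v)
termination_by u v => u.length + v.length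

/-- The bilinear extension of the shuffle product. -/
def shuffleProd : Words K V →ₗ[K] Words K V →ₗ[K] Words K V :=
  Finsupp.linearCombination K (fun u => Finsupp.linearCombination K (shuffle K u))

/-- The bilinear extension of the concatenation of words. -/
def concat : Words K V →ₗ[K] Words K V →ₗ[K] Words K V :=
  Finsupp.linearCombination K (fun u =>
    Finsupp.linearCombination K (fun v => Finsupp.single (u ++ v) (1 : K)))

/-- The convolution `μ ∘ (f ⊗ g) ∘ Δ`, with `μ` the shuffle product and `Δ` the
deconcatenation. -/
def conv (f g : Words K V →ₗ[K] Words K V) : Words K V →ₗ[K] Words K V :=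
  Finsupp.linearCombination K (fun w => ∑ i ∈ Finset.range (w.length + 1),
    shuffleProd K (f (Finsupp.single (w.take i) 1)) (g (Finsupp.single (w.drop i) 1)))

/-- The projection `uε` to the span of the empty word, which is the unit of the convolution. -/
def convUnit : Words K V →ₗ[K] Words K V :=
  Finsupp.linearCombination K (fun w => if w.length = 0 then Finsupp.single [] 1 else 0)

/-- Convolution powers. -/
def convPow (f : Words K V →ₗ[K] Words K V) : ℕ → (Words K V →ₗ[K] Words K V)
  | 0 => convUnit K
  | k + 1 => conv K f (convPow f k)

/-- The first Eulerian idempotent, the convolution logarithm of the identity: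
`e⁽¹⁾ = ∑_{k ≥ 1} (-1)^{k+1} (id - uε)^{*k} / k`. On words of length `n` the terms with `k > n`
vanish. -/
def eulerian₁ : Words K V →ₗ[K] Words K V :=
  Finsupp.linearCombination K (fun w => ∑ k ∈ Finset.Icc 1 w.length,
    ((-1 : K) ^ (k + 1) / (k : K)) •
      convPow K (LinearMap.id - convUnit K) k (Finsupp.single w 1))

/-- The Eulerian idempotents `e⁽ᵖ⁾ = (e⁽¹⁾)^{*p} / p!`. -/
def eulerian (p : ℕ) : Words K V →ₗ[K] Words K V :=
  ((p.factorial : K)⁻¹) • convPow K (eulerian₁ K) p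

variable {K}
variable [AddCommGroup V] [Module K V]

/-- The value of a function of `n` variables on a combination of words; words whose length is not
`n` are sent to `0`. -/
def evalWords {n : ℕ} (f : (Fin n → V) → V) : Words K V →ₗ[K] V :=
  Finsupp.linearCombination K (fun w =>
    if h : w.length = n then f (fun i => w.get (i.cast h.symm)) else 0)

end words

/-! ### The Poisson cohomology bicomplex -/

/-- The Eulerian component `C_{(p)}^n(A, A) = Hom(e⁽ᵖ⁾ V^{⊗n}, V)` of the Hochschild cochains:
the multilinear `f` with `f ∘ e⁽ᵖ⁾ = f`. For `n > 0` this is the component of bidegree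
`(p, n - p)` of the Poisson cohomology bicomplex (it is zero if `p = 0` or `p > n`). -/
def poisBi (K V : Type*) [Field K] [AddCommGroup V] [Module K V] (p n : ℕ) :
    Submodule K ((Fin n → V) → V) where
  carrier := {f | f ∈ multilinear K V n ∧ ∀ v : Fin n → V,
    evalWords f (eulerian K p (Finsupp.single (List.ofFn v) 1)) = f v}
  add_mem' := by
    rintro f g ⟨hf, hf'⟩ ⟨hg, hg'⟩
    refine ⟨add_mem hf hg, fun v => ?_⟩
    have key : (evalWords (f + g) : Words K V →ₗ[K] V) = evalWords f + evalWords g := by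
      refine Finsupp.lhom_ext' fun w => LinearMap.ext_ring ?_
      by_cases h : w.length = n <;> simp [evalWords, h]
    rw [key, LinearMap.add_apply, hf' v, hg' v]
    rfl
  zero_mem' := by
    refine ⟨zero_mem _, fun v => ?_⟩
    have key : (evalWords (0 : (Fin n → V) → V) : Words K V →ₗ[K] V) = 0 := by
      refine Finsupp.lhom_ext' fun w => LinearMap.ext_ring ?_
      simp [evalWords]
    rw [key]
    rfl
  smul_mem' := by
    rintro c f ⟨hf, hf'⟩
    refine ⟨Submodule.smul_mem _ c hf, fun v => ?_⟩
    have key : (evalWords (c • f) : Words K V →ₗ[K] V) = c • evalWords f := by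
      refine Finsupp.lhom_ext' fun w => LinearMap.ext_ring ?_
      by_cases h : w.length = n <;> simp [evalWords, h]
    rw [key, LinearMap.smul_apply, hf' v]
    rfl

/-- The Harrison cochains `Hom(ch_n(A), V)`: the multilinear functions that vanish on the signed
shuffles of two nonempty words. -/
def harrison (K V : Type*) [Field K] [AddCommGroup V] [Module K V] (n : ℕ) :
    Submodule K ((Fin n → V) → V) where
  carrier := {f | f ∈ multilinear K V n ∧ ∀ u v : List V, u ≠ [] → v ≠ [] →
    u.length + v.length = n → evalWords f (shuffle K u v) = 0}
  add_mem' := by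
    rintro f g ⟨hf, hf'⟩ ⟨hg, hg'⟩
    refine ⟨add_mem hf hg, fun u v hu hv h => ?_⟩
    have key : (evalWords (f + g) : Words K V →ₗ[K] V) = evalWords f + evalWords g := by
      refine Finsupp.lhom_ext' fun w => LinearMap.ext_ring ?_
      by_cases h : w.length = n <;> simp [evalWords, h]
    rw [key, LinearMap.add_apply, hf' u v hu hv h, hg' u v hu hv h, add_zero]
  zero_mem' := by
    refine ⟨zero_mem _, fun u v hu hv h => ?_⟩
    have key : (evalWords (0 : (Fin n → V) → V) : Words K V →ₗ[K] V) = 0 := by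
      refine Finsupp.lhom_ext' fun w => LinearMap.ext_ring ?_
      simp [evalWords]
    rw [key]
    rfl
  smul_mem' := by
    rintro c f ⟨hf, hf'⟩
    refine ⟨Submodule.smul_mem _ c hf, fun u v hu hv h => ?_⟩
    have key : (evalWords (c • f) : Words K V →ₗ[K] V) = c • evalWords f := by
      refine Finsupp.lhom_ext' fun w => LinearMap.ext_ring ?_
      by_cases h : w.length = n <;> simp [evalWords, h]
    rw [key, LinearMap.smul_apply, hf' u v hu hv h, smul_zero]

/-- The number of letters in the words before the `i`-th one. -/
def lengthBefore {V : Type*} (ws : List (List V)) (i : ℕ) : ℕ := (ws.take i).flatten.length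

namespace PoissonAlgebra

variable {K V : Type*} [Field K] [AddCommGroup V] [Module K V] (A : PoissonAlgebra K V)

/-- The Hochschild coboundary of the product, on cochains with values in the algebra. -/
def hochschild {n : ℕ} (f : (Fin n → V) → V) : (Fin (n + 1) → V) → V := fun a =>
  A.mul (a 0) (f (fun i => a i.succ)) +
    ∑ i : Fin n, (-1 : K) ^ (i.val + 1) •
      f (Fin.contractNth i.castSucc (fun x y => A.mul x y) a) +
    (-1 : K) ^ (n + 1) • A.mul (f (fun i => a i.castSucc)) (a (Fin.last n))

/-- The bracket of degree `-1` induced by the Poisson bracket on words, all letters being of degree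
one: for `u = (a₁, …, aₛ)` and `v = (b₁, …, bₜ)`, the sum over `i, j` of
`± ((a₁, …, aᵢ₋₁) ⧢ (b₁, …, bⱼ₋₁)) · {aᵢ, bⱼ} · ((aᵢ₊₁, …, aₛ) ⧢ (bⱼ₊₁, …, bₜ))` with the Koszul sign
(the bracket operation itself being odd). Modulo shuffles it is the shifted Lie bracket of the
cofree Lie coalgebra. Below, `i` and `j` are counted from zero. -/
def wordBracket (u v : List V) : Words K V :=
  ∑ i : Fin u.length, ∑ j : Fin v.length,
    (-1 : K) ^ ((j.val + 1) * (u.length - 1 - i.val) + i.val) •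
      concat K (shuffle K (u.take i.val) (v.take j.val))
        (concat K (Finsupp.single [A.bracket (u.get i) (v.get j)] 1)
          (shuffle K (u.drop (i.val + 1)) (v.drop (j.val + 1))))

/-- The action of a word on an element of the module `A`: by the Poisson bracket for words with
one letter, and zero for the other ones. -/
def wordAct : List V → V → V
  | [a], m => A.bracket a m
  | _, _ => 0

/-- The Chevalley-Eilenberg coboundary for the shifted Lie algebra of words, on functions
`F(w₀, …, w_p)` of lists of words. The signs are the Koszul signs of moving `wᵢ`, respectively
`wᵢ wⱼ`, to the front; on words with one letter they are `(-1)^i` and, with the minus sign in front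
of the second sum, `(-1)^{i+j}`. -/
def chevalleyEilenberg (F : List (List V) → V) : List (List V) → V := fun ws =>
  (∑ i : Fin ws.length,
    (-1 : K) ^ ((ws.get i).length * lengthBefore ws i.val) •
      A.wordAct (ws.get i) (F (ws.eraseIdx i.val))) -
  ∑ i : Fin ws.length, ∑ j : Fin ws.length, if i < j then
    (-1 : K) ^ ((ws.get i).length * lengthBefore ws i.val +
        (ws.get j).length * (lengthBefore ws j.val + (ws.get i).length)) •
      Finsupp.linearCombination K
        (fun w => F (w :: (ws.eraseIdx j.val).eraseIdx i.val))
        (A.wordBracket (ws.get i) (ws.get j))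
    else 0

end PoissonAlgebra

section symmetric

variable (K : Type*) {V : Type*} [Field K] [AddCommGroup V] [Module K V]

/-- The identification of `Hom(e⁽ᵖ⁾ V^{⊗n}, V)` with the functions on the `p`-th symmetric power of
the cofree Lie coalgebra: `f` becomes
`F(w₁, …, w_p) = f(e⁽¹⁾w₁ ⧢ ⋯ ⧢ e⁽¹⁾w_p) / p!`. -/
def toSymmetric {n : ℕ} (p : ℕ) (f : (Fin n → V) → V) : List (List V) → V := fun ws =>
  ((p.factorial : K)⁻¹) • evalWords f
    (ws.foldr (fun w x => shuffleProd K (eulerian₁ K (Finsupp.single w 1)) x)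
      (Finsupp.single [] 1))

/-- The inverse identification: precomposition with the `p`-fold deconcatenation,
`f(v₁, …, vₙ) = ∑ F(w₁, …, w_p)`, the sum being over all ways to cut `(v₁, …, vₙ)` into `p`
nonempty words. -/
def ofSymmetric (n p : ℕ) (F : List (List V) → V) : (Fin n → V) → V := fun v =>
  ∑ c : Composition n, if c.length = p then F ((List.ofFn v).splitWrtComposition c) else 0

end symmetric

/-- The horizontal differential from `C_{(p)}^n` to `C_{(p+1)}^{n+1}` of the Poisson cohomology
bicomplex: the Chevalley-Eilenberg coboundary, transported along the identification of the Eulerian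
components with the functions on the symmetric powers. -/
def PoissonAlgebra.deltaCE {K V : Type*} [Field K] [AddCommGroup V] [Module K V]
    (A : PoissonAlgebra K V) (p : ℕ) {n : ℕ} (f : (Fin n → V) → V) : (Fin (n + 1) → V) → V :=
  ofSymmetric (n + 1) (p + 1) (A.chevalleyEilenberg (toSymmetric K p f))

/-- Evaluation on the line `0 → 1 → ⋯ → n` with the sign `(-1)^{n(n-1)/2}` that makes it compatible
with the differentials. -/
def lineMap {V : Type*} [AddCommGroup V] (n : ℕ) (Y : QuivFun V (n + 1)) :
    (Fin (n + 1) → V) → V :=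
  ((-1 : ℤ) ^ (n.choose 2)) • Y (Quiv.line n)

end PoissonFinite

end

/-! An element `Y` of the complex is determined by its values on unions of lines, and these values
are the same data as a cochain. The relation of a cycle of length two says that reversing an arrow
changes the sign. The relation of a triangle says, up to reversals, that the two arrows `c → a`, `c
→ b` are the sum of the paths `c → a → b` and `c → b → a`. Together with the vanishing on cyclic
graphs these two rules imply all cycle relations (`mem_finOp_iff`). By the second rule two lines
with a common starting point combine to the lines along their shuffles, so unions of lines span all
quivers (`finOp_ext_lines`). For skew `Y` the function `lineValue Y` of the words along the lines is
Koszul symmetric and vanishes on shuffles in every argument; it is thus a function on a symmetric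
power of the cofree Lie coalgebra. Summing it over the cuts of a word into `p` words gives, up to
sign, the cochain `Φ Y` (`cochainOf`).

Conversely, a cochain `f` in the `p`-th Eulerian component gives an element of the operad: its value
on a quiver with `n - p` arrows on `n` vertices is `f / p!` on the signed sum of all orderings of
the vertices in which sources precede targets (`ofCochain`). If the arrows leave `k` classes of
vertices, this sum is a combination of shuffle products of `k` words, and `f` kills products of more
than `p` words. Hence `f` vanishes when there is a cycle, and the two orderings of the ends of an
arrow cancel, because forgetting the arrow leaves one class too many. The triangle rule already
holds for the orderings.

The facts about Eulerian idempotents come from the convolution powers of the identity. They are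
multiplicative and polynomial in the exponent `k`, and `e⁽¹⁾` is the linear coefficient, so it
vanishes on shuffles (`eulerian₁_shuffle`). Cutting a product of words into `p` pieces while killing
shuffles detaches whole factors one by one, which gives zero for more than `p` factors and `p!`
equal terms for exactly `p` (`cutSum_prodWords`).

For the differential, letters are sets of base points with a vector, and merging letters is taking
unions. Then `□` becomes a signed sum over unshuffles of a list, and the pre-Lie identity follows
from coassociativity and cocommutativity of unshuffling. The squares of the differentials reduce to
three letters, where they are the Jacobi identity, associativity with commutativity, and the Leibniz
rule. The bigrading is the number of arrows, which is additive under composition.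

On a union of lines, `[X_v, -]` sees only the ends of the lines and consecutive letters, since the
product needs exactly one arrow. This is the Hochschild coboundary on each word (`lineValue_dv`),
which commutes with cutting. `[X_h, -]` sees only lines with one letter and pairs of letters without
an arrow between them. Merging two such letters of one line closes a cycle and gives zero. Merging
letters of two lines gives a crossing, whose incoming and outgoing halves are resolved into
shuffles. This is the bracket of words in the Chevalley-Eilenberg coboundary (`lineValue_dh`). -/

noncomputable section

namespace PoissonFinite

/-! ### The signed shuffle algebra -/

section ShuffleAlgebra

variable {K : Type*} {α β : Type*} [Field K]

/-- Prepending a letter. -/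
def consWord (K : Type*) [Field K] {α : Type*} (a : α) : Words K α →ₗ[K] Words K α :=
  Finsupp.lmapDomain K K (List.cons a)

/-- The sign `(-1)^length`. -/
def signTwist (K : Type*) [Field K] {α : Type*} : Words K α →ₗ[K] Words K α :=
  Finsupp.linearCombination K (fun w => Finsupp.single w ((-1 : K) ^ w.length))

/-- The combinations of words of length `k`. -/
def wordsOfLength (K : Type*) [Field K] (α : Type*) (k : ℕ) : Submodule K (Words K α) :=
  Finsupp.supported K K {w | w.length = k}

@[simp] lemma consWord_single (a : α) (w : List α) (c : K) :
    consWord K a (Finsupp.single w c) = Finsupp.single (a :: w) c := by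
  simp [consWord, Finsupp.lmapDomain_apply, Finsupp.mapDomain_single]

lemma signTwist_single (w : List α) (c : K) :
    signTwist K (Finsupp.single w c) = (-1 : K) ^ w.length • Finsupp.single w c := by
  simp [signTwist, mul_comm]

lemma single_eq_smul_one (w : List α) (c : K) :
    (Finsupp.single w c : Words K α) = c • Finsupp.single w 1 := by
  simp

lemma words_induction {p : Words K α → Prop} (x : Words K α) (h0 : p 0)
    (hadd : ∀ x y, p x → p y → p (x + y)) (hsmul : ∀ (c : K) x, p x → p (c • x))
    (h1 : ∀ w, p (Finsupp.single w 1)) : p x := by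
  induction x using Finsupp.induction_linear with
  | zero => exact h0
  | add f g hf hg => exact hadd f g hf hg
  | single w c => rw [single_eq_smul_one]; exact hsmul c _ (h1 w)

lemma words_hom_ext {M : Type*} [AddCommGroup M] [Module K M] {f g : Words K α →ₗ[K] M}
    (h : ∀ w, f (Finsupp.single w 1) = g (Finsupp.single w 1)) : f = g :=
  Finsupp.lhom_ext' fun w => LinearMap.ext_ring (h w)

@[simp] lemma shuffle_nil_left (v : List α) : shuffle K [] v = Finsupp.single v 1 := by
  simp [shuffle]

@[simp] lemma shuffle_nil_right (v : List α) : shuffle K v [] = Finsupp.single v 1 := by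
  cases v <;> simp [shuffle]

lemma shuffle_cons_cons (a b : α) (u v : List α) : shuffle K (a :: u) (b :: v) =
    consWord K a (shuffle K u (b :: v)) +
      (-1 : K) ^ (u.length + 1) • consWord K b (shuffle K (a :: u) v) := by
  rw [shuffle]; rfl

@[simp] lemma shuffleProd_single (u v : List α) :
    shuffleProd K (Finsupp.single u 1) (Finsupp.single v 1) = shuffle K u v := by
  simp [shuffleProd]

@[simp] lemma shuffleProd_nil_left (x : Words K α) :
    shuffleProd K (Finsupp.single [] 1) x = x := by
  have : shuffleProd K (Finsupp.single ([] : List α) 1) = LinearMap.id :=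
    words_hom_ext fun w => by simp
  rw [this]; rfl

@[simp] lemma shuffleProd_nil_right (x : Words K α) :
    shuffleProd K x (Finsupp.single [] 1) = x := by
  have : (shuffleProd K).flip (Finsupp.single ([] : List α) 1) = LinearMap.id :=
    words_hom_ext fun w => by simp
  rw [← LinearMap.flip_apply, this]; rfl

/-- The sign in the recursion depends on the length of the left word; for combinations of words of
different lengths it is carried by `signTwist`. -/
lemma shuffleProd_cons_cons (a b : α) (x y : Words K α) :
    shuffleProd K (consWord K a x) (consWord K b y) =
      consWord K a (shuffleProd K x (consWord K b y)) +
        consWord K b (shuffleProd K (signTwist K (consWord K a x)) y) := by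
  induction x using words_induction with
  | h0 => simp
  | hadd x x' hx hx' => simp only [map_add, LinearMap.add_apply, hx, hx']; abel
  | hsmul c x hx => simp only [map_smul, LinearMap.smul_apply, hx, smul_add]
  | h1 u =>
    induction y using words_induction with
    | h0 => simp
    | hadd x x' hx hx' => simp only [map_add, hx, hx']; abel
    | hsmul c x hx => simp only [map_smul, hx, smul_add]
    | h1 v =>
      simp only [consWord_single, shuffleProd_single, shuffle_cons_cons, signTwist_single,
        map_smul, LinearMap.smul_apply, List.length_cons]

lemma mem_wordsOfLength_single (w : List α) (c : K) :
    (Finsupp.single w c : Words K α) ∈ wordsOfLength K α w.length :=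
  Finsupp.single_mem_supported K c rfl

lemma wordsOfLength_induction {k : ℕ} {p : Words K α → Prop} {x : Words K α}
    (hx : x ∈ wordsOfLength K α k) (h0 : p 0)
    (hadd : ∀ x y, p x → p y → p (x + y)) (hsmul : ∀ (c : K) x, p x → p (c • x))
    (h1 : ∀ w : List α, w.length = k → p (Finsupp.single w 1)) : p x := by
  rw [wordsOfLength, Finsupp.supported_eq_span_single] at hx
  induction hx using Submodule.span_induction with
  | mem x h => obtain ⟨w, hw, rfl⟩ := h; exact h1 w hw
  | zero => exact h0
  | add x y _ _ hx hy => exact hadd x y hx hy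
  | smul c x _ hx => exact hsmul c x hx

lemma consWord_mem {k : ℕ} {x : Words K α} (a : α) (hx : x ∈ wordsOfLength K α k) :
    consWord K a x ∈ wordsOfLength K α (k + 1) := by
  refine wordsOfLength_induction (p := fun x => consWord K a x ∈ wordsOfLength K α (k + 1)) hx
    ?_ ?_ ?_ ?_
  · simp
  · intro x y hx hy; rw [map_add]; exact add_mem hx hy
  · intro c x hx; rw [map_smul]; exact Submodule.smul_mem _ _ hx
  · intro w hw; subst hw; rw [consWord_single]; exact mem_wordsOfLength_single (a :: w) 1

lemma shuffle_mem (u v : List α) : shuffle K u v ∈ wordsOfLength K α (u.length + v.length) := by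
  induction u generalizing v with
  | nil => simpa using mem_wordsOfLength_single (K := K) v 1
  | cons a u ihu =>
    induction v with
    | nil => simpa using mem_wordsOfLength_single (K := K) (a :: u) 1
    | cons b v ihv =>
      rw [shuffle_cons_cons]
      refine add_mem ?_ (Submodule.smul_mem _ _ ?_)
      · have := consWord_mem a (ihu (b :: v))
        simpa [add_assoc, add_comm, add_left_comm] using this
      · have := consWord_mem b ihv
        simpa [add_assoc, add_comm, add_left_comm] using this

lemma shuffleProd_mem {j k : ℕ} {x y : Words K α} (hx : x ∈ wordsOfLength K α j)
    (hy : y ∈ wordsOfLength K α k) : shuffleProd K x y ∈ wordsOfLength K α (j + k) := by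
  refine wordsOfLength_induction (p := fun x => shuffleProd K x y ∈ wordsOfLength K α (j + k)) hx
    ?_ ?_ ?_ ?_
  · simp
  · intro x y hx hy; rw [map_add]; exact add_mem hx hy
  · intro c x hx; rw [map_smul]; exact Submodule.smul_mem _ _ hx
  · rintro w rfl
    refine wordsOfLength_induction (p := fun y => shuffleProd K (Finsupp.single w 1) y ∈
      wordsOfLength K α (w.length + k)) hy ?_ ?_ ?_ ?_
    · simp
    · intro x y hx hy; rw [map_add]; exact add_mem hx hy
    · intro c x hx; rw [map_smul]; exact Submodule.smul_mem _ _ hx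
    · rintro v rfl; rw [shuffleProd_single]; exact shuffle_mem w v

lemma signTwist_of_mem {k : ℕ} {x : Words K α} (hx : x ∈ wordsOfLength K α k) :
    signTwist K x = (-1 : K) ^ k • x := by
  refine wordsOfLength_induction (p := fun x => signTwist K x = (-1 : K) ^ k • x) hx ?_ ?_ ?_ ?_
  · simp
  · intro x y hx hy; rw [map_add, hx, hy, smul_add]
  · intro c x hx; rw [map_smul, hx, smul_comm]
  · rintro w rfl; exact signTwist_single w 1

lemma signTwist_shuffle (u v : List α) :
    signTwist K (shuffle K u v) = (-1 : K) ^ (u.length + v.length) • shuffle K u v :=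
  signTwist_of_mem (shuffle_mem u v)

lemma neg_one_pow_mul_self (k : ℕ) : (-1 : K) ^ k * (-1 : K) ^ k = 1 := by
  rw [← mul_pow]; simp

lemma shuffle_comm (u v : List α) :
    shuffle K u v = (-1 : K) ^ (u.length * v.length) • shuffle K v u := by
  induction u generalizing v with
  | nil => simp
  | cons a u ihu =>
    induction v with
    | nil => simp
    | cons b v ihv =>
      rw [shuffle_cons_cons, shuffle_cons_cons, ihu (b :: v), ihv]
      simp only [map_smul, smul_smul, smul_add, List.length_cons]
      rw [add_comm]
      congr 2
      · rw [← pow_add]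
        refine neg_one_pow_congr ?_
        simp only [Nat.even_add, Nat.even_mul, Nat.even_add_one]; tauto
      · rw [← pow_add]
        refine neg_one_pow_congr ?_
        simp only [Nat.even_add, Nat.even_mul, Nat.even_add_one]; tauto

lemma shuffleProd_comm {j k : ℕ} {x y : Words K α} (hx : x ∈ wordsOfLength K α j)
    (hy : y ∈ wordsOfLength K α k) :
    shuffleProd K x y = (-1 : K) ^ (j * k) • shuffleProd K y x := by
  refine wordsOfLength_induction (p := fun x => shuffleProd K x y =
    (-1 : K) ^ (j * k) • shuffleProd K y x) hx ?_ ?_ ?_ ?_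
  · simp
  · intro x y hx hy; simp only [map_add, LinearMap.add_apply, hx, hy, smul_add]
  · intro c x hx; simp only [map_smul, LinearMap.smul_apply, hx]; rw [smul_comm]
  · rintro w rfl
    refine wordsOfLength_induction (p := fun y => shuffleProd K (Finsupp.single w 1) y =
      (-1 : K) ^ (w.length * k) • shuffleProd K y (Finsupp.single w 1)) hy ?_ ?_ ?_ ?_
    · simp
    · intro x y hx hy; simp only [map_add, LinearMap.add_apply, hx, hy, smul_add]
    · intro c x hx; simp only [map_smul, LinearMap.smul_apply, hx]; rw [smul_comm]
    · rintro v rfl; simp only [shuffleProd_single]; exact shuffle_comm w v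

lemma shuffle_assoc (u v w : List α) :
    shuffleProd K (shuffle K u v) (Finsupp.single w 1) =
      shuffleProd K (Finsupp.single u 1) (shuffle K v w) := by
  induction u generalizing v w with
  | nil => simp
  | cons a u ihu =>
    induction v generalizing w with
    | nil => simp
    | cons b v ihv =>
      induction w with
      | nil => simp
      | cons c w ihw =>
        have e : ∀ (d : α) (l : List α), (Finsupp.single (d :: l) 1 : Words K α) =
          consWord K d (Finsupp.single l 1) := fun d l => (consWord_single d l 1).symm
        have h1 := ihu (b :: v) (c :: w)
        have h2 := ihv (c :: w)
        have h3 := ihw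
        rw [shuffle_cons_cons a b, e c, map_add, LinearMap.add_apply, shuffleProd_cons_cons,
          map_smul, LinearMap.smul_apply, shuffleProd_cons_cons, ← e c, h1, h2]
        -- The terms that begin with `c`: the two contributions reassemble to the shuffle of `a ::
        -- u` and `b :: v`. It is homogeneous, so `signTwist` acts on it as a scalar, and the
        -- induction on `w` applies.
        have key : consWord K c (shuffleProd K (signTwist K (consWord K a (shuffle K u (b :: v))))
              (Finsupp.single w 1)) +
            (-1 : K) ^ (u.length + 1) • consWord K c (shuffleProd K (signTwist K
              (consWord K b (shuffle K (a :: u) v))) (Finsupp.single w 1)) =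
            (-1 : K) ^ ((a :: u).length + (b :: v).length) • consWord K c (shuffleProd K
              (Finsupp.single (a :: u) 1) (shuffle K (b :: v) w)) := by
          rw [← h3, ← map_smul, ← map_add, ← LinearMap.smul_apply, ← map_smul,
            ← LinearMap.add_apply, ← map_add, ← map_smul, ← map_add, ← shuffle_cons_cons,
            signTwist_shuffle, map_smul, LinearMap.smul_apply, map_smul]
        rw [smul_add, add_add_add_comm, key, shuffle_cons_cons b c, e a]
        simp only [map_add, map_smul]
        rw [shuffleProd_cons_cons, shuffleProd_cons_cons, ← e a, signTwist_single]
        simp only [smul_add, map_smul, LinearMap.smul_apply, smul_smul, List.length_cons]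
        rw [← pow_add]
        have e1 : (-1 : K) ^ (v.length + 1 + (u.length + 1)) =
          (-1 : K) ^ (u.length + 1 + (v.length + 1)) := by rw [add_comm]
        rw [e1]
        abel

lemma shuffleProd_assoc (x y z : Words K α) :
    shuffleProd K (shuffleProd K x y) z = shuffleProd K x (shuffleProd K y z) := by
  induction x using words_induction with
  | h0 => simp
  | hadd x x' hx hx' => simp only [map_add, LinearMap.add_apply, hx, hx']
  | hsmul c x hx => simp only [map_smul, LinearMap.smul_apply, hx]
  | h1 u =>
    induction y using words_induction with
    | h0 => simp
    | hadd x x' hx hx' => simp only [map_add, LinearMap.add_apply, hx, hx']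
    | hsmul c x hx => simp only [map_smul, LinearMap.smul_apply, hx]
    | h1 v =>
      induction z using words_induction with
      | h0 => simp
      | hadd x x' hx hx' => simp only [map_add, hx, hx']
      | hsmul c x hx => simp only [map_smul, hx]
      | h1 w => simpa using shuffle_assoc u v w

end ShuffleAlgebra

/-! ### Deconcatenation and convolution -/

section Deconcatenation

variable {K : Type*} {α : Type*} [Field K] {M : Type*} [AddCommGroup M] [Module K M]

/-- The sum of `β x y` over all ways to write a word as a concatenation `x ++ y`. -/
def deconcSum {α M : Type*} [AddCommGroup M] : (List α → List α → M) → List α → M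
  | β, [] => β [] []
  | β, a :: w => β [] (a :: w) + deconcSum (fun x y => β (a :: x) y) w

lemma deconcSum_eq_sum (β : List α → List α → M) (w : List α) :
    deconcSum β w = ∑ i ∈ Finset.range (w.length + 1), β (w.take i) (w.drop i) := by
  induction w generalizing β with
  | nil => simp [deconcSum]
  | cons a w ih =>
    rw [deconcSum, ih, List.length_cons, Finset.sum_range_succ' _ (w.length + 1), add_comm]
    simp

lemma deconcSum_congr {β γ : List α → List α → M} {w : List α}
    (h : ∀ x y, x ++ y = w → β x y = γ x y) : deconcSum β w = deconcSum γ w := by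
  rw [deconcSum_eq_sum, deconcSum_eq_sum]
  exact Finset.sum_congr rfl fun i _ => h _ _ (List.take_append_drop i w)

lemma deconcSum_add (β γ : List α → List α → M) (w : List α) :
    deconcSum (fun x y => β x y + γ x y) w = deconcSum β w + deconcSum γ w := by
  simp only [deconcSum_eq_sum, Finset.sum_add_distrib]

lemma deconcSum_smul (c : K) (β : List α → List α → M) (w : List α) :
    deconcSum (fun x y => c • β x y) w = c • deconcSum β w := by
  simp only [deconcSum_eq_sum, Finset.smul_sum]

lemma deconcSum_zero (w : List α) : deconcSum (fun _ _ => (0 : M)) w = 0 := by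
  simp [deconcSum_eq_sum]

lemma map_deconcSum {N : Type*} [AddCommGroup N] [Module K N] (f : M →ₗ[K] N)
    (β : List α → List α → M) (w : List α) :
    f (deconcSum β w) = deconcSum (fun x y => f (β x y)) w := by
  simp only [deconcSum_eq_sum, map_sum]

lemma deconcSum_sum {ι : Type*} (s : Finset ι) (β : ι → List α → List α → M) (w : List α) :
    deconcSum (fun x y => ∑ i ∈ s, β i x y) w = ∑ i ∈ s, deconcSum (β i) w := by
  simp only [deconcSum_eq_sum]; exact Finset.sum_comm

lemma deconcSum_ite_nil (Z : List α → M) (w : List α) :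
    deconcSum (fun x y => if x = [] then Z y else 0) w = Z w := by
  cases w <;> simp [deconcSum, deconcSum_zero]

lemma deconcSum_mem (p : Submodule K M) {β : List α → List α → M} {w : List α}
    (h : ∀ x y, x ++ y = w → β x y ∈ p) : deconcSum β w ∈ p := by
  rw [deconcSum_eq_sum]
  exact sum_mem fun i _ => h _ _ (List.take_append_drop i w)

/-- The linear map `B ∘ Δ`, with `Δ` the deconcatenation. -/
def cutMap (B : Words K α →ₗ[K] Words K α →ₗ[K] M) : Words K α →ₗ[K] M :=
  Finsupp.linearCombination K
    (deconcSum fun x y => B (Finsupp.single x 1) (Finsupp.single y 1))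

lemma cutMap_single (B : Words K α →ₗ[K] Words K α →ₗ[K] M) (w : List α) :
    cutMap B (Finsupp.single w 1) =
      deconcSum (fun x y => B (Finsupp.single x 1) (Finsupp.single y 1)) w := by
  simp [cutMap]

lemma cutMap_consWord (B : Words K α →ₗ[K] Words K α →ₗ[K] M) (a : α) (x : Words K α) :
    cutMap B (consWord K a x) =
      B (Finsupp.single [] 1) (consWord K a x) + cutMap (B ∘ₗ consWord K a) x := by
  induction x using words_induction with
  | h0 => simp
  | hadd x y hx hy => simp only [map_add, hx, hy]; abel
  | hsmul c x hx => simp only [map_smul, hx, smul_add]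
  | h1 w => simp [cutMap_single, deconcSum]

/-- Deconcatenation is a morphism of algebras for the signed shuffle product. An arbitrary bilinear
`B` plays the role of the tensor product; the sign is the one for moving `v'` past `u''`. Peeling
off a first letter replaces `B` by its composition with `consWord`, which is why the induction is
over all `B`. -/
lemma cutMap_shuffle (B : Words K α →ₗ[K] Words K α →ₗ[K] M) (u v : List α) :
    cutMap B (shuffle K u v) = deconcSum (fun u' u'' => deconcSum (fun v' v'' =>
      (-1 : K) ^ (u''.length * v'.length) • B (shuffle K u' v') (shuffle K u'' v'')) v) u := by
  induction u generalizing v B with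
  | nil => simp [deconcSum, cutMap_single]
  | cons a u ihu =>
    induction v generalizing B with
    | nil => simp [deconcSum, cutMap_single]
    | cons b v ihv =>
      have L : cutMap B (shuffle K (a :: u) (b :: v)) =
          B (Finsupp.single [] 1) (shuffle K (a :: u) (b :: v)) +
          (cutMap (B ∘ₗ consWord K a) (shuffle K u (b :: v)) +
          (-1 : K) ^ (u.length + 1) • cutMap (B ∘ₗ consWord K b) (shuffle K (a :: u) v)) := by
        rw [shuffle_cons_cons, map_add, map_smul, cutMap_consWord, cutMap_consWord]
        simp only [map_add, map_smul, smul_add]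
        abel
      rw [L, ihu, ihv]
      have R1 : ∀ u' u'' : List α, deconcSum (fun v' v'' =>
          (-1 : K) ^ (u''.length * v'.length) • B (shuffle K (a :: u') v') (shuffle K u'' v''))
            (b :: v) = deconcSum (fun v' v'' =>
          (-1 : K) ^ (u''.length * v'.length) • B (consWord K a (shuffle K u' v'))
            (shuffle K u'' v'')) (b :: v) + deconcSum (fun v' v'' =>
          (-1 : K) ^ (u''.length * (v'.length + 1)) • (-1 : K) ^ (u'.length + 1) •
            B (consWord K b (shuffle K (a :: u') v')) (shuffle K u'' v'')) v := by
        intro u' u''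
        simp only [deconcSum, shuffle_cons_cons, map_add, LinearMap.add_apply, smul_add,
          shuffle_nil_right, consWord_single, deconcSum_add, List.length_cons, map_smul,
          LinearMap.smul_apply]
        abel
      rw [deconcSum, deconcSum]
      simp only [R1, deconcSum_add]
      simp only [shuffle_nil_left, LinearMap.comp_apply]
      rw [deconcSum]
      simp only [consWord_single]
      rw [smul_add]
      have R2 : ∀ x : List α, deconcSum (fun u' u'' => deconcSum (fun v' v'' =>
          (-1 : K) ^ (u''.length * (v'.length + 1)) • (-1 : K) ^ (u'.length + 1) •
            B (consWord K b (shuffle K (a :: u') v')) (shuffle K u'' v'')) v) u =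
          (-1 : K) ^ (u.length + 1) • deconcSum (fun u' u'' => deconcSum (fun v' v'' =>
          (-1 : K) ^ (u''.length * v'.length) •
            B (consWord K b (shuffle K (a :: u') v')) (shuffle K u'' v'')) v) u := by
        intro _
        rw [← deconcSum_smul]
        refine deconcSum_congr fun u' u'' h => ?_
        rw [← deconcSum_smul]
        refine deconcSum_congr fun v' v'' _ => ?_
        subst h
        simp only [smul_smul, ← pow_add, List.length_append]
        congr 1
        refine neg_one_pow_congr ?_
        simp only [Nat.even_add, Nat.even_mul, Nat.even_add_one]; tauto
      rw [R2 []]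
      have R3 : deconcSum (fun v' v'' => (-1 : K) ^ ((a :: u).length * (b :: v').length) •
            B (Finsupp.single (b :: v') 1) (shuffle K (a :: u) v'')) v =
          (-1 : K) ^ (u.length + 1) • deconcSum (fun v' v'' =>
            (-1 : K) ^ ((a :: u).length * v'.length) •
            B (Finsupp.single (b :: v') 1) (shuffle K (a :: u) v'')) v := by
        rw [← deconcSum_smul]
        refine deconcSum_congr fun v' v'' _ => ?_
        rw [smul_smul, ← pow_add]
        congr 1
        refine neg_one_pow_congr ?_
        simp only [List.length_cons, Nat.even_add, Nat.even_mul, Nat.even_add_one]; tauto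
      rw [R3]
      simp only [List.length_nil, mul_zero, pow_zero, one_smul]
      abel

/-- The compatibility of the shuffle product with the deconcatenation, for bilinear maps that
vanish on products and on the unit in the first argument. -/
lemma cutMap_shuffleProd (B : Words K α →ₗ[K] Words K α →ₗ[K] M)
    (h0 : B (Finsupp.single [] 1) = 0)
    (h : ∀ u v : List α, u ≠ [] → v ≠ [] → B (shuffle K u v) = 0) (w : List α) (x : Words K α) :
    cutMap B (shuffleProd K (Finsupp.single w 1) x) =
      deconcSum (fun w' w'' => B (Finsupp.single w' 1)
        (shuffleProd K (Finsupp.single w'' 1) x)) w +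
      cutMap ((B ∘ₗ (signTwist K) ^ w.length).compl₂ (shuffleProd K (Finsupp.single w 1))) x := by
  have tw : ∀ (k : ℕ) (v : List α), ((signTwist K) ^ k) (Finsupp.single v 1) =
      (-1 : K) ^ (k * v.length) • Finsupp.single v 1 := by
    intro k v
    induction k with
    | zero => simp
    | succ k ih => rw [pow_succ, Module.End.mul_apply, signTwist_single, map_smul, ih, smul_smul,
        ← pow_add]; congr 2; ring
  induction x using words_induction with
  | h0 => simp [deconcSum_zero]
  | hadd x y hx hy => simp only [map_add, hx, hy, deconcSum_add]; abel
  | hsmul c x hx => simp only [map_smul, hx, smul_add, deconcSum_smul]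
  | h1 v =>
    rw [shuffleProd_single, cutMap_shuffle, cutMap_single]
    simp only [LinearMap.compl₂_apply, LinearMap.comp_apply, tw, shuffleProd_single, map_smul,
      LinearMap.smul_apply]
    -- A term survives only if its left part comes from one factor. An empty left part of `v` gives
    -- the first sum, an empty left part of `w` the second, and `h0` removes the overlap.
    rw [← deconcSum_ite_nil (fun w'' => deconcSum (fun x y => (-1 : K) ^ (w.length * x.length) •
      B (Finsupp.single x 1) (shuffle K w y)) v) w, ← deconcSum_add]
    refine deconcSum_congr fun u' u'' hu => ?_
    by_cases hu' : u' = []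
    · subst hu'
      simp only [List.nil_append] at hu
      subst hu
      simp [h0]
    · rw [if_neg hu', add_zero, ← deconcSum_ite_nil
        (fun v'' => B (Finsupp.single u' 1) (shuffle K u'' v'')) v]
      refine deconcSum_congr fun v' v'' hv => ?_
      by_cases hv' : v' = []
      · subst hv'; simp
      · rw [if_neg hv', h u' v' hu' hv']; simp

lemma conv_single (f g : Words K α →ₗ[K] Words K α) (w : List α) :
    conv K f g (Finsupp.single w 1) = deconcSum (fun x y =>
      shuffleProd K (f (Finsupp.single x 1)) (g (Finsupp.single y 1))) w := by
  simp [conv, deconcSum_eq_sum]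

lemma conv_eq_cutMap (f g : Words K α →ₗ[K] Words K α) :
    conv K f g = cutMap ((shuffleProd K ∘ₗ f).compl₂ g) :=
  words_hom_ext fun w => by rw [conv_single, cutMap_single]; rfl

lemma convUnit_single (w : List α) :
    convUnit K (Finsupp.single w 1) = if w = [] then (Finsupp.single [] 1 : Words K α) else 0 := by
  cases w <;> simp [convUnit]

lemma conv_convUnit (f : Words K α →ₗ[K] Words K α) : conv K f (convUnit K) = f := by
  refine words_hom_ext fun w => ?_
  rw [conv_single]
  have : ∀ (g : List α → Words K α), deconcSum (fun x y =>
      shuffleProd K (g x) (convUnit K (Finsupp.single y 1))) w = g w := by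
    induction w with
    | nil => intro g; simp [deconcSum, convUnit_single]
    | cons a w ih => intro g; rw [deconcSum, ih (fun x => g (a :: x))]; simp [convUnit_single]
  exact this _

lemma conv_mem {f g : Words K α →ₗ[K] Words K α} (hf : ∀ w : List α,
    f (Finsupp.single w 1) ∈ wordsOfLength K α w.length) (hg : ∀ w : List α,
    g (Finsupp.single w 1) ∈ wordsOfLength K α w.length) (w : List α) :
    conv K f g (Finsupp.single w 1) ∈ wordsOfLength K α w.length := by
  rw [conv_single]
  refine deconcSum_mem _ fun x y h => ?_
  rw [← h, List.length_append]
  exact shuffleProd_mem (hf x) (hg y)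

lemma convUnit_mem (w : List α) :
    convUnit K (Finsupp.single w 1) ∈ wordsOfLength K α w.length := by
  rw [convUnit_single]
  split_ifs with h
  · subst h; exact mem_wordsOfLength_single [] 1
  · exact zero_mem _

lemma convPow_mem {f : Words K α →ₗ[K] Words K α} (hf : ∀ w : List α,
    f (Finsupp.single w 1) ∈ wordsOfLength K α w.length) (k : ℕ) (w : List α) :
    convPow K f k (Finsupp.single w 1) ∈ wordsOfLength K α w.length := by
  induction k generalizing w with
  | zero => exact convUnit_mem w
  | succ k ih => exact conv_mem hf ih w

/-- The convolution powers of the identity are multiplicative. -/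
lemma convPow_id_shuffle (k : ℕ) (u v : List α) :
    convPow K LinearMap.id k (shuffle K u v) =
      shuffleProd K (convPow K LinearMap.id k (Finsupp.single u 1))
        (convPow K LinearMap.id k (Finsupp.single v 1)) := by
  induction k generalizing u v with
  | zero =>
    simp only [convPow]
    rcases u with _ | ⟨a, u⟩
    · simp [convUnit_single]
    · have h0 : ∀ x ∈ wordsOfLength K α ((a :: u).length + v.length), convUnit K x = 0 := by
        intro x hx
        refine wordsOfLength_induction (p := fun x => convUnit K x = 0) hx ?_ ?_ ?_ ?_
        · simp
        · intro x y hx hy; rw [map_add, hx, hy, add_zero]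
        · intro c x hx; rw [map_smul, hx, smul_zero]
        · intro w hw
          rw [convUnit_single, if_neg]
          rintro rfl
          simp at hw; omega
      rw [h0 _ (shuffle_mem _ _)]
      simp [convUnit_single]
  | succ k ih =>
    set ψ : Words K α →ₗ[K] Words K α := convPow K LinearMap.id k with hψ
    have hm : ∀ w : List α, ψ (Finsupp.single w 1) ∈ wordsOfLength K α w.length :=
      convPow_mem (fun w => mem_wordsOfLength_single w 1) k
    change conv K LinearMap.id ψ (shuffle K u v) = shuffleProd K
      (conv K LinearMap.id ψ (Finsupp.single u 1)) (conv K LinearMap.id ψ (Finsupp.single v 1))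
    rw [conv_eq_cutMap, cutMap_shuffle, cutMap_single, cutMap_single]
    rw [← LinearMap.flip_apply, map_deconcSum]
    refine deconcSum_congr fun u' u'' _ => ?_
    rw [LinearMap.flip_apply, map_deconcSum]
    refine deconcSum_congr fun v' v'' _ => ?_
    simp only [LinearMap.compl₂_apply, LinearMap.comp_apply, LinearMap.id_apply, ih]
    rw [← shuffleProd_single u' v', shuffleProd_assoc, shuffleProd_assoc]
    rw [← shuffleProd_assoc (Finsupp.single v' 1),
      shuffleProd_comm (mem_wordsOfLength_single v' 1) (hm u''), ← shuffleProd_assoc,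
      map_smul, map_smul, LinearMap.smul_apply, smul_smul, mul_comm v'.length,
      neg_one_pow_mul_self, one_smul, shuffleProd_assoc, shuffleProd_assoc]

end Deconcatenation

/-! ### The first Eulerian idempotent vanishes on products -/

section Eulerian

variable {K : Type*} {α : Type*} [Field K]

/-- The projection to the words of positive length. -/
abbrev augProj (K : Type*) [Field K] (α : Type*) : Words K α →ₗ[K] Words K α :=
  LinearMap.id - convUnit K

lemma augProj_single (w : List α) :
    augProj K α (Finsupp.single w 1) = if w = [] then 0 else Finsupp.single w 1 := by
  rw [LinearMap.sub_apply, convUnit_single]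
  split_ifs with h <;> simp [h]

lemma convPow_augProj_succ (k : ℕ) (w : List α) :
    convPow K (augProj K α) (k + 1) (Finsupp.single w 1) = deconcSum (fun x y =>
      if x = [] then 0 else shuffleProd K (Finsupp.single x 1)
        (convPow K (augProj K α) k (Finsupp.single y 1))) w := by
  change conv K _ _ _ = _
  rw [conv_single]
  refine deconcSum_congr fun x y _ => ?_
  rw [augProj_single]
  split_ifs <;> simp

lemma convPow_augProj_of_lt {k : ℕ} {w : List α} (h : w.length < k) :
    convPow K (augProj K α) k (Finsupp.single w 1) = 0 := by
  induction k generalizing w with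
  | zero => simp at h
  | succ k ih =>
    rw [convPow_augProj_succ]
    refine (deconcSum_congr fun x y hxy => ?_).trans (deconcSum_zero w)
    split_ifs with hx
    · rfl
    · rw [ih, map_zero]
      have := List.length_pos_iff.2 hx
      rw [← hxy, List.length_append] at h
      omega

/-- The binomial theorem for the identity as the sum of the unit and the projection `augProj`. The
powers of `augProj` beyond the length of the word vanish, so any bound `N` serves and the value is a
polynomial in `k`. -/
lemma convPow_id_single (k N : ℕ) (w : List α) (hN : w.length ≤ N) :
    convPow K LinearMap.id k (Finsupp.single w 1) = ∑ j ∈ Finset.range (N + 1),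
      (k.choose j : K) • convPow K (augProj K α) j (Finsupp.single w 1) := by
  induction k generalizing w with
  | zero =>
    rw [Finset.sum_eq_single 0]
    · simp [convPow]
    · intro b _ hb
      rw [Nat.choose_eq_zero_of_lt (Nat.pos_of_ne_zero hb)]; simp
    · simp
  | succ k ih =>
    have e : convPow K LinearMap.id (k + 1) (Finsupp.single w 1) =
        convPow K LinearMap.id k (Finsupp.single w 1) +
        ∑ j ∈ Finset.range (N + 1), (k.choose j : K) •
          convPow K (augProj K α) (j + 1) (Finsupp.single w 1) := by
      simp only [convPow_augProj_succ, ← deconcSum_smul, ← deconcSum_sum]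
      change conv K _ _ _ = _
      rw [conv_single, ← deconcSum_ite_nil
        (fun y => convPow K LinearMap.id k (Finsupp.single y (1 : K))) w, ← deconcSum_add]
      refine deconcSum_congr fun x y h => ?_
      by_cases hx : x = []
      · subst hx; simp
      · simp only [if_neg hx, zero_add, LinearMap.id_apply]
        rw [ih y, map_sum]
        · simp only [map_smul]
        · rw [← h, List.length_append] at hN; omega
    rw [e, ih w hN, Finset.sum_range_succ' _ N, Finset.sum_range_succ (fun j =>
      (k.choose j : K) • convPow K (augProj K α) (j + 1) (Finsupp.single w 1)) N,
      Finset.sum_range_succ' _ N, convPow_augProj_of_lt (Nat.lt_succ_of_le hN)]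
    simp only [Nat.choose_succ_succ, Nat.cast_add, add_smul, Finset.sum_add_distrib,
      Nat.choose_zero_right, smul_zero]
    abel

/-- The binomial coefficient as a polynomial. -/
def binomPoly (K : Type*) [Field K] (j : ℕ) : Polynomial K :=
  Polynomial.C ((j.factorial : K)⁻¹) * descPochhammer K j

lemma binomPoly_eval [CharZero K] (j k : ℕ) : (binomPoly K j).eval (k : K) = (k.choose j : K) := by
  rw [binomPoly, Polynomial.eval_mul, Polynomial.eval_C, descPochhammer_eval_eq_descFactorial,
    Nat.descFactorial_eq_factorial_mul_choose, Nat.cast_mul,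
    inv_mul_cancel_left₀ (Nat.cast_ne_zero.2 (Nat.factorial_ne_zero j))]

lemma descPochhammer_eval_neg_one (j : ℕ) :
    (descPochhammer K j).eval (-1) = (-1) ^ j * (j.factorial : K) := by
  induction j with
  | zero => simp
  | succ j ih =>
    rw [descPochhammer_succ_right, Polynomial.eval_mul, ih, Nat.factorial_succ]
    simp
    ring

lemma binomPoly_coeff_zero (j : ℕ) : (binomPoly K (j + 1)).coeff 0 = 0 := by
  simp [binomPoly, descPochhammer_succ_left, Polynomial.mul_coeff_zero]

/-- The coefficients of the logarithm are the linear coefficients of the binomial polynomials: the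
logarithm is the derivative of the power map at exponent zero. -/
lemma binomPoly_coeff_one [CharZero K] (j : ℕ) :
    (binomPoly K (j + 1)).coeff 1 = (-1 : K) ^ (j + 1 + 1) / ((j + 1 : ℕ) : K) := by
  have h : (j.factorial : K) ≠ 0 := Nat.cast_ne_zero.2 (Nat.factorial_ne_zero j)
  have h' : ((j : K) + 1) ≠ 0 := by exact_mod_cast Nat.succ_ne_zero j
  rw [binomPoly, Polynomial.coeff_C_mul, descPochhammer_succ_left, Polynomial.coeff_X_mul,
    Polynomial.coeff_zero_eq_eval_zero, Polynomial.eval_comp]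
  simp only [Polynomial.eval_sub, Polynomial.eval_X, Polynomial.eval_one, zero_sub,
    descPochhammer_eval_neg_one, Nat.factorial_succ, Nat.cast_mul, pow_succ]
  push_cast
  field_simp

lemma eulerian₁_single [CharZero K] (w : List α) (N : ℕ) (hN : w.length ≤ N) :
    eulerian₁ K (Finsupp.single w 1) = ∑ j ∈ Finset.range (N + 1),
      ((binomPoly K j).coeff 1) • convPow K (augProj K α) j (Finsupp.single w 1) := by
  have h1 : eulerian₁ K (Finsupp.single w 1) = ∑ k ∈ Finset.range w.length,
      ((-1 : K) ^ (k + 1 + 1) / ((k + 1 : ℕ) : K)) •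
      convPow K (augProj K α) (k + 1) (Finsupp.single w 1) := by
    rw [Finset.range_eq_Ico, Finset.sum_Ico_add' (fun k => ((-1 : K) ^ (k + 1) / ((k : ℕ) : K)) •
      convPow K (augProj K α) k (Finsupp.single w 1)) 0 w.length 1]
    simp only [eulerian₁, Finsupp.linearCombination_single, one_smul]
    rfl
  rw [h1, Finset.sum_range_succ' _ N]
  have h0 : (binomPoly K 0).coeff 1 = 0 := by simp [binomPoly, Polynomial.coeff_one]
  rw [h0, zero_smul, add_zero]
  simp only [binomPoly_coeff_one]
  refine Finset.sum_subset (Finset.range_mono hN) fun k _ hk => ?_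
  rw [convPow_augProj_of_lt, smul_zero]
  simp only [Finset.mem_range, not_lt] at hk
  omega

/-- Multiplicativity of the `k`-th convolution power of the identity holds for all natural `k`,
hence is an identity of polynomials in `k` in characteristic zero. On the right, the factors without
constant term have a product without linear term, and the summands with index zero vanish because
`u` and `v` are nonempty. The linear coefficient on the left is `e⁽¹⁾` of the shuffle. -/
lemma eulerian₁_shuffle [CharZero K] {u v : List α} (hu : u ≠ []) (hv : v ≠ []) :
    eulerian₁ K (shuffle K u v) = 0 := by
  set N := u.length + v.length with hN
  have hψ : ∀ (k : ℕ) (x : Words K α), x ∈ wordsOfLength K α N →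
      convPow K LinearMap.id k x = ∑ j ∈ Finset.range (N + 1),
      (k.choose j : K) • convPow K (augProj K α) j x := by
    intro k x hx
    refine wordsOfLength_induction (p := fun x => convPow K LinearMap.id k x =
      ∑ j ∈ Finset.range (N + 1), (k.choose j : K) • convPow K (augProj K α) j x) hx ?_ ?_ ?_ ?_
    · simp
    · intro x y hx hy; simp only [map_add, hx, hy, smul_add, Finset.sum_add_distrib]
    · intro c x hx; simp only [map_smul, hx, Finset.smul_sum, smul_comm c]
    · intro w hw; exact convPow_id_single k N w hw.le
  have he : ∀ (x : Words K α), x ∈ wordsOfLength K α N →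
      eulerian₁ K x = ∑ j ∈ Finset.range (N + 1),
      ((binomPoly K j).coeff 1) • convPow K (augProj K α) j x := by
    intro x hx
    refine wordsOfLength_induction (p := fun x => eulerian₁ K x =
      ∑ j ∈ Finset.range (N + 1), ((binomPoly K j).coeff 1) • convPow K (augProj K α) j x)
      hx ?_ ?_ ?_ ?_
    · simp
    · intro x y hx hy; simp only [map_add, hx, hy, smul_add, Finset.sum_add_distrib]
    · intro c x hx; simp only [map_smul, hx, Finset.smul_sum, smul_comm c]
    · intro w hw; exact eulerian₁_single w N hw.le
  have hS := shuffle_mem (K := K) u v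
  rw [he _ hS]
  -- Taking the coefficient of a fixed word `t` makes the identity one of scalars, so that
  -- polynomials over `K` can be used.
  ext t
  set a : ℕ → K := fun j => convPow K (augProj K α) j (shuffle K u v) t with ha
  set b : ℕ → ℕ → K := fun i j => (shuffleProd K (convPow K (augProj K α) i (Finsupp.single u 1))
    (convPow K (augProj K α) j (Finsupp.single v 1))) t with hb
  have hab : ∀ k : ℕ, ∑ j ∈ Finset.range (N + 1), (k.choose j : K) * a j =
      ∑ i ∈ Finset.range (N + 1), ∑ j ∈ Finset.range (N + 1),
        (k.choose i : K) * ((k.choose j : K) * b i j) := by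
    intro k
    have h1 := convPow_id_shuffle (K := K) k u v
    rw [hψ k _ hS, convPow_id_single k N u (by omega), convPow_id_single k N v (by omega)] at h1
    have h2 := congrArg (fun x => x t) h1
    simp only [map_sum, map_smul, LinearMap.sum_apply, LinearMap.smul_apply, Finsupp.finsetSum_apply,
      Finsupp.smul_apply, smul_eq_mul] at h2
    rw [h2]
    simp only [Finset.mul_sum]
    rw [Finset.sum_comm]
    refine Finset.sum_congr rfl fun i _ => Finset.sum_congr rfl fun j _ => ?_
    ring
  have hpoly : ∑ j ∈ Finset.range (N + 1), binomPoly K j * Polynomial.C (a j) =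
      ∑ i ∈ Finset.range (N + 1), ∑ j ∈ Finset.range (N + 1),
        binomPoly K i * (binomPoly K j * Polynomial.C (b i j)) := by
    refine Polynomial.eq_of_infinite_eval_eq _ _ (Set.infinite_of_injective_forall_mem
      (f := fun k : ℕ => (k : K)) Nat.cast_injective fun k => ?_)
    simp only [Set.mem_ofPred_eq, Polynomial.eval_finsetSum, Polynomial.eval_mul,
      Polynomial.eval_C, binomPoly_eval]
    exact hab k
  have h1 := congrArg (fun P => Polynomial.coeff P 1) hpoly
  simp only [Polynomial.finsetSum_coeff, ← mul_assoc, Polynomial.coeff_mul_C] at h1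
  simp only [Finsupp.finsetSum_apply, Finsupp.smul_apply, smul_eq_mul, Finsupp.coe_zero,
    Pi.zero_apply]
  rw [h1]
  refine Finset.sum_eq_zero fun i _ => Finset.sum_eq_zero fun j _ => ?_
  rcases i with _ | i
  · have : b 0 j = 0 := by
      simp only [hb, convPow, convUnit_single, if_neg hu, map_zero, LinearMap.zero_apply]
      rfl
    rw [this, mul_zero]
  rcases j with _ | j
  · have : b (i + 1) 0 = 0 := by
      simp only [hb, convPow, convUnit_single, if_neg hv, map_zero]
      rfl
    rw [this, mul_zero]
  rw [Polynomial.mul_coeff_one, binomPoly_coeff_zero, binomPoly_coeff_zero]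
  simp

lemma eulerian₁_mem (w : List α) :
    eulerian₁ K (Finsupp.single w 1) ∈ wordsOfLength K α w.length := by
  simp only [eulerian₁, Finsupp.linearCombination_single, one_smul]
  refine sum_mem fun k _ => Submodule.smul_mem _ _ (convPow_mem (fun v => ?_) k w)
  refine sub_mem (mem_wordsOfLength_single v 1) (convUnit_mem v)

lemma eulerian₁_nil : eulerian₁ K (Finsupp.single ([] : List α) 1) = 0 := by
  simp [eulerian₁]

/-- The span of the shuffle products of two nonempty words. -/
def decomposables (K : Type*) [Field K] (α : Type*) : Submodule K (Words K α) :=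
  Submodule.span K {x | ∃ u v : List α, u ≠ [] ∧ v ≠ [] ∧ x = shuffle K u v}

lemma shuffleProd_mem_decomposables {u : List α} (hu : u ≠ []) {k : ℕ} {y : Words K α}
    (hy : y ∈ wordsOfLength K α (k + 1)) :
    shuffleProd K (Finsupp.single u 1) y ∈ decomposables K α := by
  refine wordsOfLength_induction (p := fun y => shuffleProd K (Finsupp.single u 1) y ∈
    decomposables K α) hy ?_ ?_ ?_ ?_
  · simp
  · intro x y hx hy; rw [map_add]; exact add_mem hx hy
  · intro c x hx; rw [map_smul]; exact Submodule.smul_mem _ _ hx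
  · intro v hv
    rw [shuffleProd_single]
    refine Submodule.subset_span ⟨u, v, hu, ?_, rfl⟩
    rintro rfl
    simp at hv

/-- In the logarithm the term `k = 1` is `w` itself, and the terms with `k ≥ 2` are sums of products
of at least two nonempty words. -/
lemma eulerian₁_sub_mem_decomposables {w : List α} (hw : w ≠ []) :
    eulerian₁ K (Finsupp.single w 1) - Finsupp.single w 1 ∈ decomposables K α := by
  have hlen := List.length_pos_iff.2 hw
  have h1 : convPow K (augProj K α) 1 (Finsupp.single w 1) = Finsupp.single w 1 := by
    change conv K _ (convUnit K) _ = _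
    rw [conv_convUnit, augProj_single, if_neg hw]
  simp only [eulerian₁, Finsupp.linearCombination_single, one_smul]
  rw [← Finset.add_sum_Ioc_eq_sum_Icc (by omega : 1 ≤ w.length)]
  change _ • convPow K (augProj K α) 1 (Finsupp.single w 1) + _ - _ ∈ _
  rw [h1]
  simp only [Nat.cast_one, div_one, one_add_one_eq_two, even_two, Even.neg_pow, one_pow, one_smul,
    add_sub_cancel_left]
  refine sum_mem fun k hk => Submodule.smul_mem _ _ ?_
  obtain ⟨k, rfl⟩ : ∃ j, k = j + 1 + 1 := ⟨k - 2, by simp at hk; omega⟩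
  change convPow K (augProj K α) (k + 1 + 1) (Finsupp.single w 1) ∈ _
  rw [convPow_augProj_succ]
  refine deconcSum_mem _ fun x y hxy => ?_
  split_ifs with hx
  · exact zero_mem _
  rcases y with _ | ⟨b, y⟩
  · rw [convPow_augProj_of_lt (by simp), map_zero]; exact zero_mem _
  · exact shuffleProd_mem_decomposables hx (convPow_mem (fun v =>
      sub_mem (mem_wordsOfLength_single v 1) (convUnit_mem v)) (k + 1) (b :: y))

end Eulerian

/-! ### Cutting products of words -/

section CutSums

variable {K : Type*} {α β : Type*} [Field K] {M : Type*} [AddCommGroup M] [Module K M]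

/-- The sum of `G ws` over all ways to cut a word into a list `ws` of `p` nonempty words. -/
def cutSum {α M : Type*} [AddCommGroup M] : ℕ → (List (List α) → M) → List α → M
  | 0, G, w => if w = [] then G [] else 0
  | p + 1, G, w => deconcSum (fun x y => if x = [] then 0 else cutSum p (fun ws => G (x :: ws)) y) w

lemma cutSum_add (p : ℕ) (G H : List (List α) → M) (w : List α) :
    cutSum p (fun ws => G ws + H ws) w = cutSum p G w + cutSum p H w := by
  induction p generalizing G H w with
  | zero => simp only [cutSum]; split_ifs <;> simp
  | succ p ih =>
    simp only [cutSum, ih, ← deconcSum_add]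
    refine deconcSum_congr fun x y _ => ?_
    split_ifs <;> simp

lemma cutSum_smul (p : ℕ) (c : K) (G : List (List α) → M) (w : List α) :
    cutSum p (fun ws => c • G ws) w = c • cutSum p G w := by
  induction p generalizing G w with
  | zero => simp only [cutSum]; split_ifs <;> simp
  | succ p ih =>
    simp only [cutSum, ih, ← deconcSum_smul]
    refine deconcSum_congr fun x y _ => ?_
    split_ifs <;> simp

lemma map_cutSum {N : Type*} [AddCommGroup N] [Module K N] (f : M →ₗ[K] N)
    (p : ℕ) (G : List (List α) → M) (w : List α) :
    f (cutSum p G w) = cutSum p (fun ws => f (G ws)) w := by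
  induction p generalizing G w with
  | zero => simp only [cutSum]; split_ifs <;> simp
  | succ p ih =>
    simp only [cutSum, map_deconcSum]
    refine deconcSum_congr fun x y _ => ?_
    split_ifs
    · simp
    · exact ih _ _

lemma cutSum_congr {p : ℕ} {G H : List (List α) → M} {w : List α}
    (h : ∀ ws : List (List α), ws.flatten = w → ws.length = p → (∀ x ∈ ws, x ≠ []) →
      G ws = H ws) : cutSum p G w = cutSum p H w := by
  induction p generalizing G H w with
  | zero =>
    simp only [cutSum]
    split_ifs with hw
    · exact h [] (by simp [hw]) rfl (by simp)
    · rfl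
  | succ p ih =>
    simp only [cutSum]
    refine deconcSum_congr fun x y hxy => ?_
    split_ifs with hx
    · rfl
    · refine ih fun ws h1 h2 h3 => h _ (by simp [h1, hxy]) (by simp [h2]) ?_
      simpa using ⟨hx, h3⟩

lemma cutSum_zero_fun (p : ℕ) (w : List α) : cutSum p (fun _ => (0 : M)) w = 0 := by
  induction p generalizing w with
  | zero => simp [cutSum]
  | succ p ih => simp [cutSum, ih, deconcSum_zero]

lemma linearCombination_cutSum (p : ℕ) (H : List β → List (List α) → M) (y : List α)
    (x : Words K β) :
    Finsupp.linearCombination K (fun w => cutSum p (H w) y) x =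
      cutSum p (fun ws => Finsupp.linearCombination K (fun w => H w ws) x) y := by
  induction x using words_induction with
  | h0 => simp [cutSum_zero_fun]
  | hadd x x' hx hx' => simp only [map_add, hx, hx', cutSum_add]
  | hsmul c x hx => simp only [map_smul, hx, cutSum_smul]
  | h1 w => simp

lemma linearCombination_map {N : Type*} [AddCommGroup N] [Module K N] (f : M →ₗ[K] N)
    (φ : List α → M) (x : Words K α) :
    Finsupp.linearCombination K (fun w => f (φ w)) x = f (Finsupp.linearCombination K φ x) := by
  induction x using words_induction with
  | h0 => simp
  | hadd x x' hx hx' => simp only [map_add, hx, hx']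
  | hsmul c x hx => simp only [map_smul, hx]
  | h1 w => simp

lemma linearCombination_congr {k : ℕ} {φ ψ : List α → M} {x : Words K α}
    (hx : x ∈ wordsOfLength K α k) (h : ∀ w : List α, w.length = k → φ w = ψ w) :
    Finsupp.linearCombination K φ x = Finsupp.linearCombination K ψ x := by
  refine wordsOfLength_induction (p := fun x => Finsupp.linearCombination K φ x =
    Finsupp.linearCombination K ψ x) hx ?_ ?_ ?_ ?_
  · simp
  · intro x y hx hy; rw [map_add, map_add, hx, hy]
  · intro c x hx; rw [map_smul, map_smul, hx]
  · intro w hw; simp [h w hw]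

/-- The shuffle product of a list of words. -/
def prodWords (K : Type*) [Field K] {α : Type*} (ws : List (List α)) : Words K α :=
  ws.foldr (fun w x => shuffleProd K (Finsupp.single w 1) x) (Finsupp.single [] 1)

@[simp] lemma prodWords_nil : prodWords K ([] : List (List α)) = Finsupp.single [] 1 := rfl

@[simp] lemma prodWords_cons (w : List α) (ws : List (List α)) :
    prodWords K (w :: ws) = shuffleProd K (Finsupp.single w 1) (prodWords K ws) := rfl

lemma prodWords_append (A B : List (List α)) :
    prodWords K (A ++ B) = shuffleProd K (prodWords K A) (prodWords K B) := by
  induction A with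
  | nil => simp
  | cons w A ih => simp [ih, shuffleProd_assoc]

lemma prodWords_mem (ws : List (List α)) :
    prodWords K ws ∈ wordsOfLength K α ws.flatten.length := by
  induction ws with
  | nil => exact mem_wordsOfLength_single [] 1
  | cons w ws ih =>
    rw [List.flatten_cons, List.length_append]
    exact shuffleProd_mem (mem_wordsOfLength_single w 1) ih

/-- The sum of `φ A x B` over all ways to write a list as `A ++ x :: B`. -/
def splitSum {β M : Type*} [AddCommGroup M] : (List β → β → List β → M) → List β → M
  | _, [] => 0
  | φ, x :: l => φ [] x l + splitSum (fun A y B => φ (x :: A) y B) l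

lemma splitSum_congr {φ ψ : List β → β → List β → M} {l : List β}
    (h : ∀ A x B, l = A ++ x :: B → φ A x B = ψ A x B) : splitSum φ l = splitSum ψ l := by
  induction l generalizing φ ψ with
  | nil => rfl
  | cons x l ih =>
    simp only [splitSum]
    rw [h [] x l rfl, ih fun A y B hl => h (x :: A) y B (by simp [hl])]

lemma splitSum_const (m : M) (l : List β) : splitSum (fun _ _ _ => m) l = l.length • m := by
  induction l with
  | nil => simp [splitSum]
  | cons x l ih => rw [splitSum, ih, List.length_cons, succ_nsmul, add_comm]

lemma signTwist_pow_of_mem {k : ℕ} {x : Words K α} (hx : x ∈ wordsOfLength K α k) (n : ℕ) :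
    ((signTwist K) ^ n) x = (-1 : K) ^ (n * k) • x := by
  induction n with
  | zero => simp
  | succ n ih =>
    rw [pow_succ, Module.End.mul_apply, signTwist_of_mem hx, map_smul, ih, smul_smul, ← pow_add]
    congr 2; ring

/-- Iteration of `cutMap_shuffleProd`: the left part of a cut comes from a single factor `w`, and
all other factors stay on the right. The sign moves the detached part `w'` past the letters of the
preceding factors. -/
lemma cutMap_prodWords (B : Words K α →ₗ[K] Words K α →ₗ[K] M)
    (h0 : B (Finsupp.single [] 1) = 0)
    (h : ∀ u v : List α, u ≠ [] → v ≠ [] → B (shuffle K u v) = 0) (ws : List (List α)) :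
    cutMap B (prodWords K ws) = splitSum (fun A w C => deconcSum (fun w' w'' =>
      (-1 : K) ^ (A.flatten.length * w'.length) •
        B (Finsupp.single w' 1) (prodWords K (A ++ w'' :: C))) w) ws := by
  induction ws generalizing B with
  | nil => simp [splitSum, cutMap_single, deconcSum, h0]
  | cons w ws ih =>
    rw [prodWords_cons, cutMap_shuffleProd B h0 h, ih, splitSum]
    · congr 1
      · simp
      · refine splitSum_congr fun A v C _ => deconcSum_congr fun v' v'' _ => ?_
        simp only [LinearMap.compl₂_apply, LinearMap.comp_apply,
          signTwist_pow_of_mem (mem_wordsOfLength_single (K := K) v' 1), map_smul, LinearMap.smul_apply,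
          smul_smul, ← pow_add]
        simp [← add_mul, add_comm]
    · refine LinearMap.ext fun x => ?_
      simp [signTwist_pow_of_mem (mem_wordsOfLength_single (K := K) ([] : List α) 1), h0]
    · intro u v hu hv
      have := signTwist_pow_of_mem (shuffle_mem (K := K) u v) w.length
      refine LinearMap.ext fun x => ?_
      simp [this, h u v hu hv]

/-- `G` vanishes on the shuffles of two nonempty words in every argument. -/
def KillsShuffles (K : Type*) [Field K] {α M : Type*} [AddCommGroup M] [Module K M]
    (G : List (List α) → M) : Prop :=
  ∀ (A B : List (List α)) (u v : List α), u ≠ [] → v ≠ [] →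
    Finsupp.linearCombination K (fun w => G (A ++ w :: B)) (shuffle K u v) = 0

/-- `G` is symmetric with the Koszul signs of letters of degree one. -/
def KoszulSymmetric (K : Type*) [Field K] {α M : Type*} [AddCommGroup M] [Module K M]
    (G : List (List α) → M) : Prop :=
  ∀ (A B : List (List α)) (u v : List α),
    G (A ++ u :: v :: B) = (-1 : K) ^ (u.length * v.length) • G (A ++ v :: u :: B)

lemma KillsShuffles.cons {G : List (List α) → M} (h : KillsShuffles K G) (w : List α) :
    KillsShuffles K (fun ws => G (w :: ws)) :=
  fun A B u v hu hv => h (w :: A) B u v hu hv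

lemma KoszulSymmetric.cons {G : List (List α) → M} (h : KoszulSymmetric K G) (w : List α) :
    KoszulSymmetric K (fun ws => G (w :: ws)) :=
  fun A B u v => h (w :: A) B u v

lemma KoszulSymmetric.move {G : List (List α) → M} (h : KoszulSymmetric K G)
    (A B : List (List α)) (w : List α) :
    G (A ++ w :: B) = (-1 : K) ^ (A.flatten.length * w.length) • G (w :: (A ++ B)) := by
  induction A generalizing G with
  | nil => simp
  | cons v A ih =>
    have h1 := ih (h.cons v)
    have h2 := h [] (A ++ B) v w
    simp only [List.nil_append] at h2
    simp only [List.cons_append, List.flatten_cons, List.length_append] at h1 ⊢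
    rw [h1, h2, smul_smul, ← pow_add]
    congr 2; ring

/-- Summation over the cuts, as the composition of a bilinear map with the deconcatenation. -/
lemma linearCombination_cutSum_succ (p : ℕ) (G : List (List α) → M) :
    Finsupp.linearCombination K (cutSum (p + 1) G) =
      cutMap (Finsupp.linearCombination K (fun x : List α => if x = [] then 0 else
        Finsupp.linearCombination K (cutSum p (fun ws => G (x :: ws))))) := by
  refine words_hom_ext fun w => ?_
  rw [cutMap_single]
  simp only [Finsupp.linearCombination_single, one_smul, cutSum]
  refine deconcSum_congr fun x y _ => ?_
  split_ifs <;> simp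

lemma linearCombination_cutSum_kills (p : ℕ) {G : List (List α) → M} (hG : KillsShuffles K G)
    {u v : List α} (hu : u ≠ []) (hv : v ≠ []) :
    Finsupp.linearCombination K (fun x : List α => if x = [] then 0 else
        Finsupp.linearCombination K (cutSum p (fun ws => G (x :: ws)))) (shuffle K u v) = 0 := by
  rw [linearCombination_congr (ψ := fun x : List α =>
      Finsupp.linearCombination K (cutSum p (fun ws => G (x :: ws)))) (shuffle_mem u v)]
  · refine words_hom_ext fun y => ?_
    have e : ∀ z : Words K α, (Finsupp.linearCombination K (fun x : List α =>
        Finsupp.linearCombination K (cutSum p (fun ws => G (x :: ws)))) z) (Finsupp.single y 1) =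
        Finsupp.linearCombination K (fun x : List α => cutSum p (fun ws => G (x :: ws)) y) z := by
      intro z
      induction z using words_induction with
      | h0 => simp
      | hadd x x' hx hx' => simp only [map_add, LinearMap.add_apply, hx, hx']
      | hsmul c x hx => simp only [map_smul, LinearMap.smul_apply, hx]
      | h1 w => simp
    rw [e, linearCombination_cutSum p (fun x ws => G (x :: ws))]
    rw [LinearMap.zero_apply, ← cutSum_zero_fun p y]
    congr 1
    funext ws
    exact hG [] ws u v hu hv
  · intro w hw
    rw [if_neg]
    rintro rfl
    have := List.length_pos_iff.2 hu
    simp at hw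
    omega

lemma flatten_length_pos {ws : List (List α)} (h : ∀ w ∈ ws, w ≠ []) (h' : ws ≠ []) :
    0 < ws.flatten.length := by
  obtain ⟨w, ws, rfl⟩ := List.exists_cons_of_ne_nil h'
  have := List.length_pos_iff.2 (h w (by simp))
  simp; omega

/-- Every cut detaches a piece of one factor only, so `p` cuts cannot exhaust more than `p` nonempty
factors. -/
lemma cutSum_prodWords_of_lt {p : ℕ} {G : List (List α) → M} (hG : KillsShuffles K G)
    {ws : List (List α)} (hws : ∀ w ∈ ws, w ≠ []) (hp : p < ws.length) :
    Finsupp.linearCombination K (cutSum p G) (prodWords K ws) = 0 := by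
  induction p generalizing G ws with
  | zero =>
    rw [linearCombination_congr (ψ := fun _ => (0 : M)) (prodWords_mem ws)]
    · have : Finsupp.linearCombination K (fun _ : List α => (0 : M)) = 0 :=
        words_hom_ext fun w => by simp
      rw [this]; rfl
    · intro w hw
      have := flatten_length_pos hws (List.length_pos_iff.1 hp)
      simp only [cutSum]
      rw [if_neg]
      rintro rfl
      simp at hw; simp at this; omega
  | succ p ih =>
    rw [linearCombination_cutSum_succ, cutMap_prodWords _ (by simp)
      fun u v => linearCombination_cutSum_kills p hG]
    rw [splitSum_congr (ψ := fun _ _ _ => 0), splitSum_const, smul_zero]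
    rintro A w C rfl
    refine (deconcSum_congr fun x y hxy => ?_).trans (deconcSum_zero w)
    simp only [Finsupp.linearCombination_single, one_smul]
    split_ifs with hx
    · simp
    have hAC : ∀ z ∈ A ++ C, z ≠ [] := fun z hz => hws z (by simp at hz ⊢; tauto)
    rcases eq_or_ne y [] with rfl | hy
    · have : prodWords K (A ++ [] :: C) = prodWords K (A ++ C) := by
        rw [prodWords_append, prodWords_append]; simp
      rw [this, ih (hG.cons x) hAC, smul_zero]
      simp at hp ⊢; omega
    · rw [ih (hG.cons x), smul_zero]
      · intro z hz
        simp only [List.mem_append, List.mem_cons] at hz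
        rcases hz with hz | rfl | hz
        · exact hAC z (by simp [hz])
        · exact hy
        · exact hAC z (by simp [hz])
      · simp at hp ⊢; omega

/-- With as many cuts as factors, each cut must take a whole factor. The factors are taken in `p!`
orders, and by Koszul symmetry all of them contribute `G ws`; the sign of `KoszulSymmetric.move`
cancels the one of `cutMap_prodWords`. -/
lemma cutSum_prodWords {p : ℕ} {G : List (List α) → M} (hG : KillsShuffles K G)
    (hG' : KoszulSymmetric K G)
    {ws : List (List α)} (hws : ∀ w ∈ ws, w ≠ []) (hp : ws.length = p) :
    Finsupp.linearCombination K (cutSum p G) (prodWords K ws) = p.factorial • G ws := by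
  induction p generalizing G ws with
  | zero =>
    rw [List.length_eq_zero_iff] at hp
    subst hp
    simp [cutSum]
  | succ p ih =>
    rw [linearCombination_cutSum_succ, cutMap_prodWords _ (by simp)
      fun u v => linearCombination_cutSum_kills p hG]
    rw [splitSum_congr (ψ := fun _ _ _ => p.factorial • G ws), splitSum_const, hp, smul_smul,
      Nat.factorial_succ]
    rintro A w C rfl
    have hAC : ∀ z ∈ A ++ C, z ≠ [] := fun z hz => hws z (by simp at hz ⊢; tauto)
    have hw : w ≠ [] := hws w (by simp)
    -- Isolates the term of the deconcatenation in which the factor is detached completely.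
    have key : ∀ (l : List α), ∀ β : List α → M, deconcSum (fun x y =>
        if y = [] then β x else 0) l = β l := by
      intro l
      induction l with
      | nil => intro β; simp [deconcSum]
      | cons a l ihl =>
        intro β
        simp only [deconcSum]
        rw [ihl fun x => β (a :: x)]
        simp
    rw [← key w (fun _ => p.factorial • G (A ++ w :: C))]
    refine deconcSum_congr fun x y hxy => ?_
    simp only [Finsupp.linearCombination_single, one_smul]
    split_ifs with hx hy hy
    · subst hx hy; simp at hxy; exact absurd hxy hw
    · simp
    · subst hy
      rw [List.append_nil] at hxy
      subst hxy
      have : prodWords K (A ++ [] :: C) = prodWords K (A ++ C) := by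
        rw [prodWords_append, prodWords_append]; simp
      rw [this, ih (hG.cons x) (hG'.cons x) hAC (by simp at hp ⊢; omega), hG'.move A C x,
        smul_comm]
    · rw [cutSum_prodWords_of_lt (hG.cons x), smul_zero]
      · intro z hz
        simp only [List.mem_append, List.mem_cons] at hz
        rcases hz with hz | rfl | hz
        · exact hAC z (by simp [hz])
        · exact hy
        · exact hAC z (by simp [hz])
      · simp at hp ⊢; omega

/-- The shuffle product of the images of words under the first Eulerian idempotent. -/
def prodEulerian (K : Type*) [Field K] {α : Type*} (ws : List (List α)) : Words K α :=
  ws.foldr (fun w x => shuffleProd K (eulerian₁ K (Finsupp.single w 1)) x) (Finsupp.single [] 1)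

@[simp] lemma prodEulerian_cons (w : List α) (ws : List (List α)) : prodEulerian K (w :: ws) =
    shuffleProd K (eulerian₁ K (Finsupp.single w 1)) (prodEulerian K ws) := rfl

lemma convPow_eulerian₁_single (p : ℕ) (w : List α) :
    convPow K (eulerian₁ K) p (Finsupp.single w 1) = cutSum p (prodEulerian K) w := by
  induction p generalizing w with
  | zero => simp only [convPow, convUnit_single, cutSum]; rfl
  | succ p ih =>
    change conv K _ _ _ = _
    rw [conv_single, cutSum]
    refine deconcSum_congr fun x y _ => ?_
    split_ifs with hx
    · subst hx; rw [eulerian₁_nil]; simp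
    · rw [ih, map_cutSum]; rfl

lemma killsShuffles_prodEulerian [CharZero K] :
    KillsShuffles K (prodEulerian K : List (List α) → Words K α) := by
  intro A B u v hu hv
  induction A with
  | nil =>
    have : Finsupp.linearCombination K (fun w : List α => prodEulerian K ([] ++ w :: B)) =
        (shuffleProd K).flip (prodEulerian K B) ∘ₗ eulerian₁ K :=
      words_hom_ext fun w => by simp
    rw [this, LinearMap.comp_apply, eulerian₁_shuffle hu hv, map_zero]
  | cons a A ih =>
    simp only [List.cons_append, prodEulerian_cons]
    rw [linearCombination_map (shuffleProd K (eulerian₁ K (Finsupp.single a 1))), ih, map_zero]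

lemma eulerian_prodWords_of_lt [CharZero K] {p : ℕ} {ws : List (List α)} (hws : ∀ w ∈ ws, w ≠ [])
    (hp : p < ws.length) : eulerian K p (prodWords K ws) = 0 := by
  have : convPow K (eulerian₁ K) p = Finsupp.linearCombination K
      (cutSum p (prodEulerian K : List (List α) → Words K α)) :=
    words_hom_ext fun w => by simp [convPow_eulerian₁_single]
  rw [eulerian, LinearMap.smul_apply, this,
    cutSum_prodWords_of_lt killsShuffles_prodEulerian hws hp, smul_zero]

/-- Modulo products of two nonempty words `e⁽¹⁾ w` is `w`. Replacing the factors one at a time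
therefore changes the product by products with one more factor, which `g` kills. -/
lemma map_prodEulerian (g : Words K α →ₗ[K] M) {ws : List (List α)} (hws : ∀ w ∈ ws, w ≠ [])
    (hg : ∀ vs : List (List α), (∀ w ∈ vs, w ≠ []) → vs.length = ws.length + 1 →
      g (prodWords K vs) = 0) : g (prodEulerian K ws) = g (prodWords K ws) := by
  induction ws generalizing g with
  | nil => rfl
  | cons w ws ih =>
    rw [prodEulerian_cons, prodWords_cons]
    have hw : w ≠ [] := hws w (by simp)
    have hws' : ∀ w ∈ ws, w ≠ [] := fun v hv => hws v (by simp [hv])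
    have h1 : g (shuffleProd K (eulerian₁ K (Finsupp.single w 1)) (prodEulerian K ws)) =
        g (shuffleProd K (eulerian₁ K (Finsupp.single w 1)) (prodWords K ws)) := by
      refine wordsOfLength_induction (p := fun x => g (shuffleProd K x (prodEulerian K ws)) =
        g (shuffleProd K x (prodWords K ws))) (eulerian₁_mem w) ?_ ?_ ?_ ?_
      · simp
      · intro x y hx hy; simp only [map_add, LinearMap.add_apply, hx, hy]
      · intro c x hx; simp only [map_smul, LinearMap.smul_apply, hx]
      · intro v hv
        refine ih (g ∘ₗ shuffleProd K (Finsupp.single v 1)) hws' fun vs hvs hlen => ?_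
        refine hg (v :: vs) ?_ (by simp [hlen])
        have hv' : v ≠ [] := by
          rintro rfl
          exact hw (List.length_eq_zero_iff.1 (by simpa using hv.symm))
        simpa using ⟨hv', hvs⟩
    rw [h1, ← sub_eq_zero, ← map_sub, ← LinearMap.sub_apply,
      ← map_sub (shuffleProd K)]
    have hD := eulerian₁_sub_mem_decomposables (K := K) hw
    generalize eulerian₁ K (Finsupp.single w (1 : K)) - Finsupp.single w 1 = d at hD
    induction hD using Submodule.span_induction with
    | mem x h =>
      obtain ⟨u, v, hu, hv, rfl⟩ := h
      rw [← shuffleProd_single, shuffleProd_assoc]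
      refine hg (u :: v :: ws) ?_ (by simp)
      simpa using ⟨hu, hv, hws'⟩
    | zero => simp
    | add x y _ _ hx hy => simp only [map_add, LinearMap.add_apply, hx, hy, add_zero]
    | smul c x _ hx => simp only [map_smul, LinearMap.smul_apply, hx, smul_zero]

end CutSums

/-! ### The Poisson side -/

section Compositions

variable {α M : Type*} [AddCommGroup M]

/-- The lists of `p` positive numbers with sum `n`. -/
def positiveLists : ℕ → ℕ → Finset (List ℕ)
  | 0, n => if n = 0 then {[]} else ∅
  | p + 1, n => (Finset.Icc 1 n).biUnion fun k =>
      (positiveLists p (n - k)).map ⟨List.cons k, List.cons_injective⟩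

lemma mem_positiveLists {p n : ℕ} {b : List ℕ} :
    b ∈ positiveLists p n ↔ b.length = p ∧ b.sum = n ∧ ∀ x ∈ b, 0 < x := by
  induction p generalizing n b with
  | zero =>
    rw [positiveLists, List.length_eq_zero_iff]
    split_ifs with h
    · constructor
      · intro hb; rw [Finset.mem_singleton] at hb; subst hb; simp [h]
      · rintro ⟨rfl, -, -⟩; simp
    · constructor
      · intro hb; simp at hb
      · rintro ⟨rfl, hb, -⟩; simp at hb; omega
  | succ p ih =>
    simp only [positiveLists, Finset.mem_biUnion, Finset.mem_map, Function.Embedding.coeFn_mk, ih,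
      Finset.mem_Icc]
    constructor
    · rintro ⟨k, hk, c, ⟨h1, h2, h3⟩, rfl⟩
      refine ⟨by simp [h1], by simp [h2]; omega, ?_⟩
      intro x hx
      rcases List.mem_cons.1 hx with rfl | hx
      · omega
      · exact h3 x hx
    · rintro ⟨h1, h2, h3⟩
      obtain ⟨k, c, rfl⟩ := List.exists_cons_of_length_eq_add_one h1
      have := h3 k (by simp)
      simp only [List.sum_cons] at h2
      exact ⟨k, by omega, c, ⟨by simpa using h1, by omega,
        fun x hx => h3 x (by simp [hx])⟩, rfl⟩

lemma cutSum_eq_sum (p : ℕ) (G : List (List α) → M) (l : List α) :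
    cutSum p G l = ∑ b ∈ positiveLists p l.length, G (l.splitWrtCompositionAux b) := by
  induction p generalizing G l with
  | zero =>
    rcases l with _ | ⟨a, l⟩
    · simp [cutSum, positiveLists, List.splitWrtCompositionAux]
    · simp [cutSum, positiveLists]
  | succ p ih =>
    rw [positiveLists, Finset.sum_biUnion]
    · simp only [Finset.sum_map, Function.Embedding.coeFn_mk, cutSum]
      rw [deconcSum_eq_sum, Finset.range_eq_Ico, Finset.sum_eq_sum_Ico_succ_bot (by omega)]
      simp only [List.take_zero, if_true, zero_add]
      have e : Finset.Ico 1 (l.length + 1) = Finset.Icc 1 l.length := by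
        ext; simp
      rw [e]
      refine Finset.sum_congr rfl fun k hk => ?_
      rw [Finset.mem_Icc] at hk
      rw [if_neg, ih, List.length_drop]
      · simp only [List.splitWrtCompositionAux_cons]
      · intro h
        have := congrArg List.length h
        rw [List.length_take, List.length_nil] at this
        omega
    · intro i _ j _ hij
      rw [Function.onFun, Finset.disjoint_left]
      intro b hb hb'
      simp only [Finset.mem_map, Function.Embedding.coeFn_mk] at hb hb'
      obtain ⟨c, -, rfl⟩ := hb
      obtain ⟨c', -, h⟩ := hb'
      exact hij (List.cons.inj h).1.symm

/-- A composition with `p` blocks is a list of `p` positive numbers with the given sum; the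
recursive form `cutSum` is the one suited to induction. -/
lemma ofSymmetric_eq_cutSum {V : Type*} [AddCommGroup V] (n p : ℕ) (F : List (List V) → V)
    (v : Fin n → V) : ofSymmetric n p F v = cutSum p F (List.ofFn v) := by
  rw [cutSum_eq_sum, ofSymmetric, ← Finset.sum_filter]
  refine Finset.sum_bij (fun c _ => c.blocks) ?_ ?_ ?_ ?_
  · intro c hc
    rw [mem_positiveLists, List.length_ofFn]
    exact ⟨(Finset.mem_filter.1 hc).2, c.blocks_sum, fun x hx => c.blocks_pos hx⟩
  · intro c _ c' _ h
    exact Composition.ext h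
  · intro b hb
    rw [mem_positiveLists, List.length_ofFn] at hb
    exact ⟨⟨b, fun {x} hx => hb.2.2 x hx, hb.2.1⟩, by simp [Composition.length, hb.1], rfl⟩
  · intro c _
    rfl

end Compositions

section PoissonSide

variable {K V : Type*} [Field K] [AddCommGroup V] [Module K V] {n : ℕ}

lemma evalWords_single (f : (Fin n → V) → V) (w : List V) (h : w.length = n) :
    evalWords f (Finsupp.single w (1 : K)) = f (fun i => w.get (i.cast h.symm)) := by
  simp [evalWords, h]

lemma evalWords_ofFn (f : (Fin n → V) → V) (v : Fin n → V) :
    evalWords f (Finsupp.single (List.ofFn v) (1 : K)) = f v := by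
  rw [evalWords_single _ _ (List.length_ofFn)]
  congr 1
  funext i
  simp

lemma evalWords_of_ne (f : (Fin n → V) → V) {k : ℕ} (hk : k ≠ n) {x : Words K V}
    (hx : x ∈ wordsOfLength K V k) : evalWords f x = 0 := by
  refine wordsOfLength_induction (p := fun x => evalWords f x = 0) hx ?_ ?_ ?_ ?_
  · simp
  · intro x y hx hy; rw [map_add, hx, hy, add_zero]
  · intro c x hx; rw [map_smul, hx, smul_zero]
  · rintro w rfl; simp [evalWords, hk]

lemma evalWords_eq {φ : List V → V} {f : (Fin n → V) → V} (h : ∀ v, f v = φ (List.ofFn v))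
    {x : Words K V} (hx : x ∈ wordsOfLength K V n) :
    evalWords f x = Finsupp.linearCombination K φ x := by
  refine wordsOfLength_induction (p := fun x => evalWords f x = Finsupp.linearCombination K φ x)
    hx ?_ ?_ ?_ ?_
  · simp
  · intro x y hx hy; rw [map_add, map_add, hx, hy]
  · intro c x hx; rw [map_smul, map_smul, hx]
  · rintro w rfl
    rw [evalWords_single f w rfl, h]
    simp

lemma eulerian_mem {K α : Type*} [Field K] (p : ℕ) (w : List α) :
    eulerian K p (Finsupp.single w 1) ∈ wordsOfLength K α w.length :=
  Submodule.smul_mem _ _ (convPow_mem eulerian₁_mem p w)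

lemma evalWords_eulerian {p : ℕ} {f : (Fin n → V) → V} (hf : f ∈ poisBi K V p n)
    (x : Words K V) : evalWords f (eulerian K p x) = evalWords f x := by
  induction x using words_induction with
  | h0 => simp
  | hadd x y hx hy => simp only [map_add, hx, hy]
  | hsmul c x hx => simp only [map_smul, hx]
  | h1 w =>
    by_cases hw : w.length = n
    · subst hw
      have := hf.2 w.get
      rw [List.ofFn_get] at this
      rw [this, evalWords_single f w rfl]
      rfl
    · rw [evalWords_of_ne f hw (eulerian_mem p w), evalWords_of_ne f hw (mem_wordsOfLength_single w 1)]

lemma evalWords_prodWords_of_lt [CharZero K] {p : ℕ} {f : (Fin n → V) → V}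
    (hf : f ∈ poisBi K V p n) {ws : List (List V)} (hws : ∀ w ∈ ws, w ≠ []) (hp : p < ws.length) :
    evalWords f (prodWords K ws) = 0 := by
  rw [← evalWords_eulerian hf, eulerian_prodWords_of_lt hws hp, map_zero]

/-- The values of a cochain on the Eulerian idempotent, through its values on products. -/
lemma evalWords_eulerian_single [CharZero K] {p : ℕ} {f : (Fin n → V) → V}
    (hf : ∀ ws : List (List V), (∀ w ∈ ws, w ≠ []) → ws.length = p + 1 →
      evalWords f (prodWords K ws) = 0) (w : List V) :
    evalWords f (eulerian K p (Finsupp.single w 1)) =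
      cutSum p (fun ws => (p.factorial : K)⁻¹ • evalWords f (prodWords K ws)) w := by
  rw [eulerian, LinearMap.smul_apply, map_smul, convPow_eulerian₁_single, map_cutSum, cutSum_smul]
  congr 1
  refine cutSum_congr fun ws _ h1 h2 => ?_
  exact map_prodEulerian _ h2 fun vs hvs hlen => hf vs hvs (by omega)

lemma eq_cutSum_of_mem_poisBi [CharZero K] {p : ℕ} {f : (Fin n → V) → V}
    (hf : f ∈ poisBi K V p n) (v : Fin n → V) :
    f v = cutSum p (fun ws => (p.factorial : K)⁻¹ • evalWords f (prodWords K ws)) (List.ofFn v) := by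
  rw [← evalWords_eulerian_single (fun ws h1 h2 => evalWords_prodWords_of_lt hf h1 (by omega)),
    hf.2 v]

lemma evalWords_ofSymmetric_of_lt {p : ℕ} {F : List (List V) → V} (hF : KillsShuffles K F) {ws : List (List V)} (hws : ∀ w ∈ ws, w ≠ [])
    (hp : p < ws.length) : evalWords (ofSymmetric n p F) (prodWords K ws) = 0 := by
  by_cases h : ws.flatten.length = n
  · subst h
    rw [evalWords_eq (ofSymmetric_eq_cutSum _ p F) (prodWords_mem ws)]
    exact cutSum_prodWords_of_lt hF hws hp
  · exact evalWords_of_ne _ h (prodWords_mem ws)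

lemma evalWords_ofSymmetric {p : ℕ} {F : List (List V) → V} (hF : KillsShuffles K F)
    (hF' : KoszulSymmetric K F) {ws : List (List V)} (hws : ∀ w ∈ ws, w ≠ [])
    (hp : ws.length = p) (hn : ws.flatten.length = n) :
    evalWords (ofSymmetric n p F) (prodWords K ws) = p.factorial • F ws := by
  subst hn
  rw [evalWords_eq (ofSymmetric_eq_cutSum _ p F) (prodWords_mem ws)]
  exact cutSum_prodWords hF hF' hws hp

/-- As `ofSymmetric n p F` kills products of `p + 1` words, the idempotents `e⁽¹⁾` in `toSymmetric`
may be omitted; the factor `p!` of `cutSum_prodWords` is then cancelled by the denominator. -/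
lemma toSymmetric_ofSymmetric [CharZero K] {p : ℕ} {F : List (List V) → V}
    (hF : KillsShuffles K F) (hF' : KoszulSymmetric K F) {ws : List (List V)} (hws : ∀ w ∈ ws, w ≠ [])
    (hp : ws.length = p) (hn : ws.flatten.length = n) :
    toSymmetric K p (ofSymmetric n p F) ws = F ws := by
  change (p.factorial : K)⁻¹ • evalWords _ (prodEulerian K ws) = _
  rw [map_prodEulerian _ hws, evalWords_ofSymmetric hF hF' hws hp hn, ← Nat.cast_smul_eq_nsmul K,
    smul_smul, inv_mul_cancel₀ (Nat.cast_ne_zero.2 (Nat.factorial_ne_zero p)), one_smul]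
  intro vs h1 h2
  exact evalWords_ofSymmetric_of_lt hF h1 (by omega)

lemma ofSymmetric_mem_poisBi [CharZero K] {p : ℕ} {F : List (List V) → V}
    (hF : KillsShuffles K F) (hF' : KoszulSymmetric K F) (hm : ofSymmetric n p F ∈ multilinear K V n) :
    ofSymmetric n p F ∈ poisBi K V p n := by
  refine ⟨hm, fun v => ?_⟩
  rw [evalWords_eulerian_single
    (fun ws h1 h2 => evalWords_ofSymmetric_of_lt hF h1 (by omega)), ofSymmetric_eq_cutSum]
  refine cutSum_congr fun ws h1 h2 h3 => ?_
  rw [evalWords_ofSymmetric hF hF' h3 h2 (by rw [h1, List.length_ofFn]),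
    ← Nat.cast_smul_eq_nsmul K,
    smul_smul, inv_mul_cancel₀ (Nat.cast_ne_zero.2 (Nat.factorial_ne_zero p)), one_smul]

lemma eulerian_one {K α : Type*} [Field K] :
    eulerian K 1 = (eulerian₁ K : Words K α →ₗ[K] Words K α) := by
  rw [eulerian]
  change _ • conv K _ (convUnit K) = _
  rw [conv_convUnit]
  simp

/-- A cochain fixed by `e⁽¹⁾` kills products of two words because `e⁽¹⁾` does; conversely `e⁽¹⁾`
differs from the identity by such products. -/
theorem poisBi_one_eq_harrison [CharZero K] (n : ℕ) :
    poisBi K V 1 (n + 1) = harrison K V (n + 1) := by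
  ext f
  constructor
  · intro hf
    refine ⟨hf.1, fun u v hu hv _ => ?_⟩
    have := evalWords_prodWords_of_lt hf (ws := [u, v]) (by simp [hu, hv]) (by simp)
    simpa using this
  · intro hf
    refine ⟨hf.1, fun v => ?_⟩
    rw [eulerian_one, ← sub_eq_zero, ← evalWords_ofFn (K := K) f v, ← map_sub]
    have hD := eulerian₁_sub_mem_decomposables (K := K) (w := List.ofFn v) (by simp)
    generalize eulerian₁ K (Finsupp.single (List.ofFn v) (1 : K)) - _ = d at hD
    induction hD using Submodule.span_induction with
    | mem x h =>
      obtain ⟨u, v, hu, hv, rfl⟩ := h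
      by_cases hl : u.length + v.length = n + 1
      · exact hf.2 u v hu hv hl
      · exact evalWords_of_ne f hl (shuffle_mem u v)
    | zero => simp
    | add x y _ _ hx hy => rw [map_add, hx, hy, add_zero]
    | smul c x _ hx => rw [map_smul, hx, smul_zero]

end PoissonSide

/-! ### Signed unshuffles of lists -/

section Unshuffle

variable {α W : Type*} [AddCommGroup W]

/-- The signed sum of `Q a b` over all ways to split a list into a subsequence `a` of length `m` and
the complementary subsequence `b`. -/
def unshuffleSum {α W : Type*} [AddCommGroup W] :
    ℕ → List α → (List α → List α → W) → W
  | 0, l, Q => Q [] l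
  | _ + 1, [], _ => 0
  | m + 1, x :: l, Q => unshuffleSum m l (fun a b => Q (x :: a) b) +
      (-1 : ℤ) ^ (m + 1) • unshuffleSum (m + 1) l (fun a b => Q a (x :: b))

@[simp] lemma unshuffleSum_zero (l : List α) (Q : List α → List α → W) :
    unshuffleSum 0 l Q = Q [] l := by
  cases l <;> rfl

lemma unshuffleSum_cons (m : ℕ) (x : α) (l : List α) (Q : List α → List α → W) :
    unshuffleSum (m + 1) (x :: l) Q = unshuffleSum m l (fun a b => Q (x :: a) b) +
      (-1 : ℤ) ^ (m + 1) • unshuffleSum (m + 1) l (fun a b => Q a (x :: b)) := rfl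

lemma unshuffleSum_congr {m : ℕ} {l : List α} {Q R : List α → List α → W}
    (h : ∀ a b : List α, (a ++ b).Perm l → a.length = m → Q a b = R a b) :
    unshuffleSum m l Q = unshuffleSum m l R := by
  induction l generalizing m Q R with
  | nil =>
    cases m
    · exact h [] [] (List.Perm.refl _) rfl
    · rfl
  | cons x l ih =>
    cases m with
    | zero => exact h [] (x :: l) (List.Perm.refl _) rfl
    | succ m =>
      rw [unshuffleSum_cons, unshuffleSum_cons]
      congr 1
      · exact ih fun a b hp hl => h _ _ (List.Perm.cons x hp) (by simp [hl])
      · congr 1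
        exact ih fun a b hp hl => h _ _ (List.perm_middle.trans (List.Perm.cons x hp)) hl

lemma unshuffleSum_add (m : ℕ) (l : List α) (Q R : List α → List α → W) :
    unshuffleSum m l (fun a b => Q a b + R a b) = unshuffleSum m l Q + unshuffleSum m l R := by
  induction l generalizing m Q R with
  | nil => cases m <;> simp [unshuffleSum]
  | cons x l ih =>
    cases m with
    | zero => rfl
    | succ m => simp only [unshuffleSum_cons, ih, smul_add]; abel

lemma unshuffleSum_zero_fun (m : ℕ) (l : List α) :
    unshuffleSum m l (fun _ _ => (0 : W)) = 0 := by
  induction l generalizing m with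
  | nil => cases m <;> simp [unshuffleSum]
  | cons x l ih => cases m <;> simp [unshuffleSum_cons, ih]

lemma map_unshuffleSum {W' : Type*} [AddCommGroup W'] (f : W →+ W') (m : ℕ) (l : List α)
    (Q : List α → List α → W) :
    f (unshuffleSum m l Q) = unshuffleSum m l (fun a b => f (Q a b)) := by
  induction l generalizing m Q with
  | nil => cases m <;> simp [unshuffleSum]
  | cons x l ih => cases m <;> simp [unshuffleSum_cons, ih]

lemma unshuffleSum_zsmul (m : ℕ) (l : List α) (c : ℤ) (Q : List α → List α → W) :
    unshuffleSum m l (fun a b => c • Q a b) = c • unshuffleSum m l Q :=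
  (map_unshuffleSum (zsmulAddGroupHom c) m l Q).symm

lemma unshuffleSum_neg (m : ℕ) (l : List α) (Q : List α → List α → W) :
    unshuffleSum m l (fun a b => -Q a b) = -unshuffleSum m l Q :=
  (map_unshuffleSum (negAddMonoidHom : W →+ W) m l Q).symm

lemma unshuffleSum_of_lt {m : ℕ} {l : List α} (h : l.length < m) (Q : List α → List α → W) :
    unshuffleSum m l Q = 0 := by
  rw [unshuffleSum_congr (R := fun _ _ => 0), unshuffleSum_zero_fun]
  intro a b hp hl
  have := hp.length_eq
  simp at this; omega

lemma unshuffleSum_map {β : Type*} (g : β → α) (m : ℕ) (l : List β) (Q : List α → List α → W) :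
    unshuffleSum m (l.map g) Q = unshuffleSum m l (fun a b => Q (a.map g) (b.map g)) := by
  induction l generalizing m Q with
  | nil => cases m <;> simp [unshuffleSum]
  | cons x l ih =>
    cases m with
    | zero => simp
    | succ m => simp only [List.map_cons, unshuffleSum_cons, ih]

/-- Coassociativity of the unshuffle coproduct. -/
lemma unshuffleSum_coassoc (m k : ℕ) (l : List α) (φ : List α → List α → List α → W) :
    unshuffleSum (m + k) l (fun a c => unshuffleSum m a (fun a₁ a₂ => φ a₁ a₂ c)) =
      unshuffleSum m l (fun a₁ r => unshuffleSum k r (fun a₂ c => φ a₁ a₂ c)) := by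
  induction l generalizing m k φ with
  | nil =>
    rcases m with _ | m
    · simp
    · rw [add_right_comm]; simp [unshuffleSum]
  | cons x l ih =>
    rcases m with _ | m
    · simp
    · rw [add_right_comm, unshuffleSum_cons, unshuffleSum_cons]
      simp only [unshuffleSum_cons, unshuffleSum_add, unshuffleSum_zsmul]
      rw [ih m k (fun a₁ a₂ c => φ (x :: a₁) a₂ c)]
      have e1 := ih (m + 1) k (fun a₁ a₂ c => φ a₁ a₂ (x :: c))
      rw [add_right_comm] at e1
      rw [e1]
      rcases k with _ | k
      -- For `k = 0` the extra term asks for `m + 1` letters out of `m`.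
      · have : unshuffleSum (m + 0) l (fun a b => unshuffleSum (m + 1) a
            (fun a_1 b_1 => φ a_1 (x :: b_1) b)) = 0 := by
          rw [unshuffleSum_congr (R := fun _ _ => 0), unshuffleSum_zero_fun]
          intro a b _ hl
          exact unshuffleSum_of_lt (by omega) _
        rw [this]
        simp
      · have e2 := ih (m + 1) k (fun a₁ a₂ c => φ a₁ (x :: a₂) c)
        rw [show m + 1 + k = m + (k + 1) by omega] at e2
        rw [e2]
        simp only [unshuffleSum_cons, unshuffleSum_add, unshuffleSum_zsmul, smul_add, smul_smul,
          ← pow_add]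
        rw [show m + (k + 1) + 1 = m + 1 + (k + 1) by omega]
        abel

/-- Cocommutativity of the unshuffle coproduct. -/
lemma unshuffleSum_cocomm {m k : ℕ} {l : List α} (h : l.length = m + k)
    (Q : List α → List α → W) :
    unshuffleSum m l Q = (-1 : ℤ) ^ (m * k) • unshuffleSum k l (fun a b => Q b a) := by
  induction l generalizing m k Q with
  | nil =>
    obtain ⟨rfl, rfl⟩ : m = 0 ∧ k = 0 := by simp at h; omega
    simp
  | cons x l ih =>
    simp only [List.length_cons] at h
    rcases m with _ | m
    · obtain rfl : k = l.length + 1 := by omega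
      have e := ih (m := 0) (k := l.length) (by simp) (fun a b => Q a (x :: b))
      rw [unshuffleSum_cons, unshuffleSum_of_lt (Nat.lt_succ_self _)]
      simp only [unshuffleSum_zero, zero_mul, pow_zero, one_smul, smul_zero, add_zero] at e ⊢
      exact e
    · rcases k with _ | k
      · obtain rfl : m = l.length := by omega
        rw [unshuffleSum_cons, unshuffleSum_of_lt (Nat.lt_succ_self _),
          ih (m := l.length) (k := 0) (by omega)]
        simp
      · rw [unshuffleSum_cons, unshuffleSum_cons, ih (m := m) (k := k + 1) (by omega),
          ih (m := m + 1) (k := k) (by omega)]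
        simp only [smul_add, smul_smul, ← pow_add]
        rw [add_comm]
        congr 2
        · refine neg_one_pow_congr ?_
          simp only [Nat.even_add, Nat.even_mul, Nat.even_add_one]; tauto
        · refine neg_one_pow_congr ?_
          simp only [Nat.even_add, Nat.even_mul, Nat.even_add_one]; tauto

/-- Antisymmetry under the exchange of two neighbours. -/
lemma unshuffleSum_swap {m : ℕ} {Q : List α → List α → W} {l₁ l₂ : List α} {x y : α}
    (h1 : ∀ p q b, (p ++ x :: y :: q ++ b).Perm (l₁ ++ x :: y :: l₂) →
      Q (p ++ x :: y :: q) b = -Q (p ++ y :: x :: q) b)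
    (h2 : ∀ a p q, (a ++ (p ++ x :: y :: q)).Perm (l₁ ++ x :: y :: l₂) →
      Q a (p ++ x :: y :: q) = -Q a (p ++ y :: x :: q)) :
    unshuffleSum m (l₁ ++ x :: y :: l₂) Q = -unshuffleSum m (l₁ ++ y :: x :: l₂) Q := by
  induction l₁ generalizing m Q with
  | nil =>
    simp only [List.nil_append] at h1 h2 ⊢
    rcases m with _ | _ | m
    · simpa using h2 [] [] l₂ (List.Perm.refl _)
    · simp only [unshuffleSum_cons, unshuffleSum_zero]
      have e : unshuffleSum (0 + 1) l₂ (fun a b => Q a (x :: y :: b)) =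
          -unshuffleSum (0 + 1) l₂ (fun a b => Q a (y :: x :: b)) := by
        rw [← unshuffleSum_neg]
        exact unshuffleSum_congr fun a b hp _ => h2 a [] b
          ((List.perm_append_comm_assoc a [x, y] b).trans (List.Perm.append_left [x, y] hp))
      rw [e]
      simp
      abel
    · simp only [unshuffleSum_cons]
      have e : unshuffleSum (m + 1 + 1) l₂ (fun a b => Q a (x :: y :: b)) =
          -unshuffleSum (m + 1 + 1) l₂ (fun a b => Q a (y :: x :: b)) := by
        rw [← unshuffleSum_neg]
        exact unshuffleSum_congr fun a b hp _ => h2 a [] b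
          ((List.perm_append_comm_assoc a [x, y] b).trans (List.Perm.append_left [x, y] hp))
      have e' : unshuffleSum m l₂ (fun a b => Q (x :: y :: a) b) =
          -unshuffleSum m l₂ (fun a b => Q (y :: x :: a) b) := by
        rw [← unshuffleSum_neg]
        exact unshuffleSum_congr fun a b hp _ => h1 [] a b
          (List.Perm.append_left [x, y] hp)
      rw [e, e']
      simp only [smul_add, smul_neg, neg_add, pow_succ]
      simp
      abel
  | cons z l ih =>
    rcases m with _ | m
    · simpa using h2 [] (z :: l) l₂ (List.Perm.refl _)
    · simp only [List.cons_append, unshuffleSum_cons]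
      rw [ih, ih, neg_add, smul_neg]
      · intro p q b hp
        exact h1 p q (z :: b) ((List.perm_middle).trans (List.Perm.cons z hp))
      · intro a p q hp
        exact h2 a (z :: p) q ((List.perm_middle).trans (List.Perm.cons z hp))
      · intro p q b hp
        exact h1 (z :: p) q b (List.Perm.cons z hp)
      · intro a p q hp
        exact h2 (z :: a) p q (List.Perm.cons z hp)

end Unshuffle

/-! ### Shuffle permutations as unshuffles of lists. -/

section ShufflePermutations

open Equiv

/-- The permutation that maps `j` to `0` and is given by `τ` elsewhere. -/
def insertZero {N : ℕ} (j : Fin (N + 1)) (τ : Perm (Fin N)) : Perm (Fin (N + 1)) :=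
  Perm.decomposeFin.symm (0, τ) * j.cycleRange

lemma insertZero_self {N : ℕ} (j : Fin (N + 1)) (τ : Perm (Fin N)) : insertZero j τ j = 0 := by
  simp [insertZero]

lemma insertZero_succAbove {N : ℕ} (j : Fin (N + 1)) (τ : Perm (Fin N)) (i : Fin N) :
    insertZero j τ (j.succAbove i) = (τ i).succ := by
  simp [insertZero, Fin.cycleRange_succAbove]

lemma sign_insertZero {N : ℕ} (j : Fin (N + 1)) (τ : Perm (Fin N)) :
    ((Perm.sign (insertZero j τ) : ℤˣ) : ℤ) = (-1) ^ (j : ℕ) * ((Perm.sign τ : ℤˣ) : ℤ) := by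
  simp [insertZero, Perm.decomposeFin.symm_sign, Fin.sign_cycleRange, mul_comm]

lemma insertZero_bijective (N : ℕ) :
    Function.Bijective (fun x : Fin (N + 1) × Perm (Fin N) => insertZero x.1 x.2) := by
  rw [Fintype.bijective_iff_injective_and_card]
  constructor
  · rintro ⟨j, τ⟩ ⟨j', τ'⟩ h
    simp only at h
    have hj : j = j' := by
      apply (insertZero j' τ').injective
      rw [insertZero_self, ← h, insertZero_self]
    subst hj
    congr 1
    ext i : 1
    have := insertZero_succAbove j τ i
    rw [h, insertZero_succAbove] at this
    exact (Fin.succ_injective _ this).symm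
  · simp [Fintype.card_perm, Nat.factorial_succ]

lemma isShuffle_insertZero_zero {N m : ℕ} (τ : Perm (Fin N)) :
    IsShuffle (m + 1) (insertZero 0 τ) ↔ IsShuffle m τ := by
  have hs : ∀ i : Fin N, insertZero 0 τ i.succ = (τ i).succ := fun i => by
    simpa using insertZero_succAbove 0 τ i
  constructor
  · intro h i j hij hc
    have := h i.succ j.succ (Fin.succ_lt_succ_iff.2 hij) (by simp; omega)
    rw [hs, hs, Fin.succ_lt_succ_iff] at this
    exact this
  · intro h i j hij hc
    induction j using Fin.cases with
    | zero => simp at hij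
    | succ j =>
      induction i using Fin.cases with
      | zero => rw [insertZero_self, hs]; exact Fin.succ_pos _
      | succ i =>
        rw [hs, hs, Fin.succ_lt_succ_iff]
        exact h i j (Fin.succ_lt_succ_iff.1 hij) (by simp at hc; omega)

lemma isShuffle_insertZero {N m : ℕ} (j : Fin (N + 1)) (hj : j.val = m) (τ : Perm (Fin N)) :
    IsShuffle m (insertZero j τ) ↔ IsShuffle m τ := by
  have key : ∀ i : Fin N, ((j.succAbove i : Fin (N + 1)).val = i.val ∧ i.val < m) ∨
      ((j.succAbove i : Fin (N + 1)).val = i.val + 1 ∧ m ≤ i.val) := by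
    intro i
    rcases lt_or_ge i.castSucc j with h | h
    · left
      rw [Fin.succAbove_of_castSucc_lt _ _ h]
      exact ⟨rfl, by rw [← hj]; exact h⟩
    · right
      rw [Fin.succAbove_of_le_castSucc _ _ h]
      exact ⟨rfl, by rw [← hj]; exact h⟩
  constructor
  · intro h i k hik hc
    have := h (j.succAbove i) (j.succAbove k) (Fin.succAbove_lt_succAbove_iff.2 hik)
      (by rcases key i with h1 | h1 <;> rcases key k with h2 | h2 <;> omega)
    rw [insertZero_succAbove, insertZero_succAbove, Fin.succ_lt_succ_iff] at this
    exact this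
  · intro h i k hik hc
    rcases Fin.eq_self_or_eq_succAbove j k with rfl | ⟨k, rfl⟩
    · rcases hc with hc | hc
      · omega
      · have : i.val < m := by rw [← hj]; exact hik
        omega
    · rcases Fin.eq_self_or_eq_succAbove j i with rfl | ⟨i, rfl⟩
      · rw [insertZero_self, insertZero_succAbove]; exact Fin.succ_pos _
      · rw [insertZero_succAbove, insertZero_succAbove, Fin.succ_lt_succ_iff]
        refine h i k (Fin.succAbove_lt_succAbove_iff.1 hik) ?_
        rcases key i with h1 | h1 <;> rcases key k with h2 | h2 <;> omega

/-- A shuffle takes its smallest value at the first index of one of its two increasing blocks. These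
are the two cases in the recursion for `unshuffleSum`. -/
lemma eq_zero_or_eq_of_isShuffle {N m : ℕ} (j : Fin (N + 1)) (τ : Perm (Fin N))
    (h : IsShuffle (m + 1) (insertZero j τ)) : j = 0 ∨ j.val = m + 1 := by
  by_contra! hc
  have hj : 0 < j := Fin.pos_of_ne_zero hc.1
  rcases lt_or_gt_of_ne hc.2 with h1 | h1
  · have := h 0 j hj (Or.inl h1)
    rw [insertZero_self] at this
    exact absurd this (Fin.not_lt_zero _)
  · have := h ⟨m + 1, by omega⟩ j h1 (Or.inr le_rfl)
    rw [insertZero_self] at this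
    exact absurd this (Fin.not_lt_zero _)

lemma ofFn_eq_take_cons_drop {α : Type*} {N : ℕ} (t : Fin (N + 1) → α) (j : Fin (N + 1)) :
    List.ofFn t = (List.ofFn fun i => t (j.succAbove i)).take j ++
      t j :: (List.ofFn fun i => t (j.succAbove i)).drop j := by
  refine List.ext_getElem (by simp; omega) fun k h1 h2 => ?_
  simp only [List.length_ofFn] at h1
  rw [List.getElem_ofFn]
  rcases lt_trichotomy k j with h | h | h
  · rw [List.getElem_append_left (by simp; omega), List.getElem_take, List.getElem_ofFn,
      Fin.succAbove_of_castSucc_lt _ _ (by simpa [Fin.lt_def] using h)]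
    rfl
  · rw [List.getElem_append_right (by simp; omega)]
    have : k - (List.take (↑j) (List.ofFn fun i => t (j.succAbove i))).length = 0 := by
      simp; omega
    simp only [this, List.getElem_cons_zero]
    congr 1
    exact Fin.ext h
  · rw [List.getElem_append_right (by simp; omega)]
    obtain ⟨i, hi⟩ : ∃ i, k - (List.take (↑j) (List.ofFn fun i => t (j.succAbove i))).length =
      i + 1 := ⟨k - j - 1, by simp; omega⟩
    simp only [hi, List.getElem_cons_succ, List.getElem_drop, List.getElem_ofFn]
    have hk : (j : ℕ) + i + 1 = k := by simp at hi; omega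
    rw [Fin.succAbove_of_le_castSucc _ _ (by simp [Fin.le_def])]
    congr 1
    exact Fin.ext hk.symm

open Classical in
/-- The sum over the shuffle permutations as a sum over the unshuffles of a list. -/
lemma sum_isShuffle_eq_unshuffleSum {α W : Type*} [AddCommGroup W] {N : ℕ} (m : ℕ) (hm : m ≤ N)
    (s : Fin N → α) (Q : List α → List α → W) :
    ∑ σ : Perm (Fin N) with IsShuffle m σ, ((Perm.sign σ : ℤˣ) : ℤ) •
      Q ((List.ofFn (s ∘ σ)).take m) ((List.ofFn (s ∘ σ)).drop m) =
    unshuffleSum m (List.ofFn s) Q := by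
  induction N generalizing m Q with
  | zero =>
    obtain rfl : m = 0 := by omega
    have h1 : IsShuffle 0 (1 : Perm (Fin 0)) := fun i => i.elim0
    rw [Finset.sum_filter, Fintype.sum_subsingleton _ 1, if_pos h1]
    simp
  | succ N ih =>
    rcases m with _ | m
    · have h1 : IsShuffle 0 (1 : Perm (Fin (N + 1))) := fun i j hij _ => hij
      rw [Finset.sum_eq_single 1]
      · simp
      · intro σ hσ hne
        exfalso
        have hmono : StrictMono σ := fun i j hij =>
          (Finset.mem_filter.1 hσ).2 i j hij (Or.inr (Nat.zero_le _))
        apply hne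
        have : hmono.orderIsoOfSurjective σ σ.surjective = OrderIso.refl _ := Subsingleton.elim _ _
        ext i
        exact congrArg Fin.val (DFunLike.congr_fun this i)
      · intro h; exact absurd (Finset.mem_filter.2 ⟨Finset.mem_univ _, h1⟩) h
    -- The permutations are sorted by the place `j` of the value zero. The case `j = 0` puts the
    -- first letter into the first block; `j = m + 1` puts it into the second one, with the sign of
    -- moving it past `m + 1` letters; other `j` give no shuffles.
    · rw [Finset.sum_filter, ← (insertZero_bijective N).sum_comp, Fintype.sum_prod_type]
      rw [List.ofFn_succ, unshuffleSum_cons, Fin.sum_univ_succ, ← ih m (by omega)]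
      congr 1
      · rw [Finset.sum_filter]
        refine Finset.sum_congr rfl fun τ _ => ?_
        simp only [isShuffle_insertZero_zero, sign_insertZero]
        have e : List.ofFn (s ∘ insertZero 0 τ) =
            s 0 :: List.ofFn ((fun i => s i.succ) ∘ τ) := by
          rw [List.ofFn_succ, Function.comp_apply, insertZero_self]
          refine congrArg _ (congrArg _ (funext fun i => ?_))
          have := insertZero_succAbove 0 τ i
          simp at this
          simp [this]
        rw [e]
        simp
      · by_cases hmN : m + 1 ≤ N
        · have hj : ((⟨m, by omega⟩ : Fin N).succ).val = m + 1 := rfl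
          rw [Finset.sum_eq_single (⟨m, by omega⟩ : Fin N), ← ih (m + 1) hmN, Finset.sum_filter,
            Finset.smul_sum]
          · refine Finset.sum_congr rfl fun τ _ => ?_
            simp only [isShuffle_insertZero _ hj, sign_insertZero]
            have e := ofFn_eq_take_cons_drop (s ∘ insertZero (⟨m, by omega⟩ : Fin N).succ τ)
              (⟨m, by omega⟩ : Fin N).succ
            simp only [Function.comp_apply, insertZero_self, insertZero_succAbove] at e
            have hlen : ((List.ofFn ((fun i => s i.succ) ∘ τ)).take (m + 1)).length = m + 1 := by
              simp; omega
            have e1 : List.ofFn (s ∘ insertZero (⟨m, by omega⟩ : Fin N).succ τ) =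
              (List.ofFn ((fun i => s i.succ) ∘ τ)).take (m + 1) ++
                s 0 :: (List.ofFn ((fun i => s i.succ) ∘ τ)).drop (m + 1) := e
            rw [e1, List.take_left' hlen, List.drop_left' hlen]
            split_ifs
            · rw [smul_smul]; rfl
            · simp
          · intro j _ hne
            refine Finset.sum_eq_zero fun τ _ => if_neg fun h => ?_
            rcases eq_zero_or_eq_of_isShuffle _ _ h with h | h
            · exact Fin.succ_ne_zero _ h
            · exact hne (Fin.ext (by simpa using h))
          · simp
        -- Here `m = N`: the second block is empty and only `j = 0` remains.
        · rw [unshuffleSum_of_lt (by simp; omega), smul_zero]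
          refine Finset.sum_eq_zero fun j _ => Finset.sum_eq_zero fun τ _ => if_neg fun h => ?_
          rcases eq_zero_or_eq_of_isShuffle _ _ h with h | h
          · exact Fin.succ_ne_zero _ h
          · have := j.2
            simp at h; omega

end ShufflePermutations

/-! ### Quivers on lists of letters

A letter is a set of base points together with a vector. A multiset of arrows between base points
induces a quiver on every list of letters; merging letters is taking unions, which turns the
compositions of the finite operad into substitutions. -/

section Letters

variable {M V : Type*}

open Classical in
/-- The quiver that arrows `E` between base points induce on the sets `S i`. -/
def quiverOn (E : Multiset (M × M)) {n : ℕ} (S : Fin n → Set M) : Quiv n :=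
  ⟨E.bind fun e => (Finset.univ.filter fun ij : Fin n × Fin n =>
      ij.1 ≠ ij.2 ∧ e.1 ∈ S ij.1 ∧ e.2 ∈ S ij.2).val, by
    intro a ha
    obtain ⟨e, -, he⟩ := Multiset.mem_bind.1 ha
    exact (Finset.mem_filter.1 he).2.1⟩

/-- The value of `f` on the quiver induced on a list of letters. -/
def evalList [Zero V] {n : ℕ} (f : QuivFun V n) (E : Multiset (M × M)) (l : List (Set M × V)) : V :=
  if h : l.length = n then
    f (quiverOn E fun i => (l.get (i.cast h.symm)).1) (fun i => (l.get (i.cast h.symm)).2)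
  else 0

lemma evalList_ofFn [Zero V] {n : ℕ} (f : QuivFun V n) (E : Multiset (M × M))
    (s : Fin n → Set M × V) :
    evalList f E (List.ofFn s) = f (quiverOn E fun i => (s i).1) (fun i => (s i).2) := by
  rw [evalList, dif_pos (List.length_ofFn)]
  simp

lemma evalList_of_ne [Zero V] {n : ℕ} (f : QuivFun V n) (E : Multiset (M × M))
    {l : List (Set M × V)} (h : l.length ≠ n) : evalList f E l = 0 := dif_neg h

lemma exists_eq_ofFn {α : Type*} {n : ℕ} {l : List α} (h : l.length = n) :
    ∃ s : Fin n → α, l = List.ofFn s := by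
  subst h
  exact ⟨l.get, (List.ofFn_get l).symm⟩

lemma quiverOn_singletons {n : ℕ} (Γ : Quiv n) : quiverOn Γ.1 (fun i => {i}) = Γ := by
  classical
  apply Subtype.ext
  simp only [quiverOn]
  have : ∀ e ∈ Γ.1, (Finset.univ.filter fun ij : Fin n × Fin n =>
      ij.1 ≠ ij.2 ∧ e.1 ∈ ({ij.1} : Set (Fin n)) ∧ e.2 ∈ ({ij.2} : Set (Fin n))).val = {e} := by
    intro e he
    have : (Finset.univ.filter fun ij : Fin n × Fin n =>
      ij.1 ≠ ij.2 ∧ e.1 ∈ ({ij.1} : Set (Fin n)) ∧ e.2 ∈ ({ij.2} : Set (Fin n))) = {e} := by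
      ext ⟨i, j⟩
      simp only [Finset.mem_filter, Finset.mem_univ, true_and, Set.mem_singleton_iff,
        Finset.mem_singleton, Prod.ext_iff]
      constructor
      · rintro ⟨-, h1, h2⟩; exact ⟨h1.symm, h2.symm⟩
      · rintro ⟨h1, h2⟩
        refine ⟨?_, h1.symm, h2.symm⟩
        rw [h1, h2]; exact Γ.2 e he
    rw [this]; rfl
  rw [Multiset.bind_congr this, Multiset.bind_singleton, Multiset.map_id']

lemma quiverOn_comp {n : ℕ} (E : Multiset (M × M)) (S : Fin n → Set M) (σ : Equiv.Perm (Fin n)) :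
    quiverOn E (fun i => S (σ i)) = (quiverOn E S).relabel σ⁻¹ := by
  classical
  apply Subtype.ext
  simp only [quiverOn, Quiv.relabel, Multiset.map_bind]
  refine Multiset.bind_congr fun e _ => ?_
  have : (Finset.univ.filter fun ij : Fin n × Fin n =>
      ij.1 ≠ ij.2 ∧ e.1 ∈ S (σ ij.1) ∧ e.2 ∈ S (σ ij.2)) =
      (Finset.univ.filter fun ij : Fin n × Fin n =>
      ij.1 ≠ ij.2 ∧ e.1 ∈ S ij.1 ∧ e.2 ∈ S ij.2).map
        ⟨fun e => (σ⁻¹ e.1, σ⁻¹ e.2), fun a b h => by simpa [Prod.ext_iff] using h⟩ := by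
    ext ⟨i, j⟩
    simp only [Finset.mem_filter, Finset.mem_univ, true_and, Finset.mem_map, Prod.exists]
    constructor
    · rintro ⟨h1, h2, h3⟩
      exact ⟨σ i, σ j, ⟨fun h => h1 (σ.injective h), h2, h3⟩, Prod.ext (by simp) (by simp)⟩
    · rintro ⟨i', j', ⟨h1, h2, h3⟩, h⟩
      obtain ⟨rfl, rfl⟩ := Prod.mk.inj h
      exact ⟨by simpa using h1, by simpa using h2, by simpa using h3⟩
  rw [this]; rfl

/-- Collapsing vertices amounts to taking unions of the sets of base points. -/
lemma map_quiverOn {n k : ℕ} (E : Multiset (M × M)) (S : Fin n → Set M)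
    (hS : ∀ i j, i ≠ j → Disjoint (S i) (S j)) (c : Fin n → Fin k) :
    ((quiverOn E S).1.map fun e => (c e.1, c e.2)).filter (fun e => e.1 ≠ e.2) =
      (quiverOn E fun i => {m | ∃ j, c j = i ∧ m ∈ S j}).1 := by
  classical
  -- By disjointness a base point lies in at most one set, so an arrow of `E` is not counted twice
  -- after the vertices are collapsed.
  have hinj : ∀ m i j, m ∈ S i → m ∈ S j → i = j := by
    intro m i j hi hj
    by_contra hne
    exact Set.disjoint_left.1 (hS i j hne) hi hj
  simp only [quiverOn, Multiset.map_bind]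
  rw [Multiset.filter_bind]
  refine Multiset.bind_congr fun e _ => ?_
  refine (Multiset.Nodup.ext ?_ (Finset.nodup _)).2 ?_
  · refine Multiset.Nodup.filter _ (Multiset.Nodup.map_on ?_ (Finset.nodup _))
    rintro ⟨i, j⟩ h ⟨i', j'⟩ h' -
    rw [Finset.mem_val, Finset.mem_filter] at h h'
    exact Prod.ext (hinj _ _ _ h.2.2.1 h'.2.2.1) (hinj _ _ _ h.2.2.2 h'.2.2.2)
  · rintro ⟨i, j⟩
    simp only [Multiset.mem_filter, Multiset.mem_map, Finset.mem_val, Finset.mem_filter,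
      Finset.mem_univ, true_and, Prod.exists, Prod.mk.injEq]
    constructor
    · rintro ⟨⟨i', j', ⟨h1, h2, h3⟩, rfl, rfl⟩, h4⟩
      exact ⟨h4, ⟨i', rfl, h2⟩, ⟨j', rfl, h3⟩⟩
    · rintro ⟨h4, ⟨i', rfl, h2⟩, ⟨j', rfl, h3⟩⟩
      refine ⟨⟨i', j', ⟨?_, h2, h3⟩, rfl, rfl⟩, h4⟩
      rintro rfl
      exact h4 rfl

lemma collapse_quiverOn {a b N : ℕ} (h : a + b = N) (E : Multiset (M × M)) (S : Fin (N + 1) → Set M)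
    (hS : ∀ i j, i ≠ j → Disjoint (S i) (S j)) :
    (quiverOn E S).collapse h = quiverOn E (fun i : Fin (a + 1) =>
      if i = 0 then {m | ∃ j : Fin (N + 1), j.val < b + 1 ∧ m ∈ S j}
        else S ⟨i.val + b, by omega⟩) := by
  apply Subtype.ext
  refine (map_quiverOn E S hS (fun i => (⟨i.val - b, by omega⟩ : Fin (a + 1)))).trans ?_
  congr 2
  funext i
  split_ifs with hi
  · subst hi
    ext m
    simp only [Set.mem_ofPred_eq, Fin.ext_iff, Fin.val_zero]
    exact exists_congr fun j => and_congr_left fun _ => by omega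
  · ext m
    have hi' : i.val ≠ 0 := fun h => hi (Fin.ext h)
    simp only [Set.mem_ofPred_eq, Fin.ext_iff]
    constructor
    · rintro ⟨j, h1, h2⟩
      have : j = ⟨i.val + b, by omega⟩ := Fin.ext (by simp; omega)
      rwa [this] at h2
    · intro h
      exact ⟨_, by simp, h⟩

lemma restrict_quiverOn {N b : ℕ} (hb : b ≤ N) (E : Multiset (M × M)) (S : Fin (N + 1) → Set M) :
    (quiverOn E S).restrict b = quiverOn E (fun i : Fin (b + 1) => S ⟨i.val, by omega⟩) := by
  classical
  apply Subtype.ext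
  simp only [quiverOn, Quiv.restrict, Multiset.filterMap_bind]
  refine Multiset.bind_congr fun e _ => ?_
  refine (Multiset.Nodup.ext (Multiset.Nodup.filterMap _ ?_ (Finset.nodup _))
    (Finset.nodup _)).2 ?_
  · rintro ⟨i, j⟩ ⟨i', j'⟩ c h h'
    simp only [Option.mem_def] at h h'
    split_ifs at h h'
    have h1 := Option.some.inj h
    have h2 := Option.some.inj h'
    rw [← h2] at h1
    simp only [Prod.mk.injEq, Fin.mk.injEq] at h1
    exact Prod.ext (Fin.ext h1.1) (Fin.ext h1.2)
  · rintro ⟨i, j⟩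
    simp only [Multiset.mem_filterMap, Finset.mem_val, Finset.mem_filter,
      Finset.mem_univ, true_and, Prod.exists]
    constructor
    · rintro ⟨i', j', ⟨h1, h2, h3⟩, h⟩
      split_ifs at h with hlt
      have h4 := Option.some.inj h
      simp only [Prod.mk.injEq] at h4
      obtain ⟨rfl, rfl⟩ := h4
      refine ⟨fun h => h1 (Fin.ext (Fin.mk.inj h)), h2, h3⟩
    · rintro ⟨h1, h2, h3⟩
      refine ⟨⟨i.val, by omega⟩, ⟨j.val, by omega⟩, ⟨?_, h2, h3⟩, ?_⟩
      · exact fun h => h1 (Fin.ext (Fin.mk.inj h))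
      · rw [dif_pos ⟨i.2, j.2⟩]

/-- The union of the base points of a list of letters. -/
def unionSet (l : List (Set M × V)) : Set M := {m | ∃ x ∈ l, m ∈ x.1}

/-- The base points of different letters are different. -/
def DisjointLetters (l : List (Set M × V)) : Prop := l.Pairwise fun x y => Disjoint x.1 y.1

lemma DisjointLetters.perm {l l' : List (Set M × V)} (h : DisjointLetters l) (hp : l.Perm l') :
    DisjointLetters l' :=
  (hp.pairwise_iff fun {_ _} h => h.symm).1 h

lemma DisjointLetters.merge {l₁ l₂ : List (Set M × V)} (h : DisjointLetters (l₁ ++ l₂)) (v : V) :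
    DisjointLetters ((unionSet l₁, v) :: l₂) := by
  rw [DisjointLetters, List.pairwise_append] at h
  refine List.Pairwise.cons (fun y hy => ?_) h.2.1
  rw [Set.disjoint_left]
  rintro m ⟨x, hx, hm⟩
  exact Set.disjoint_left.1 (h.2.2 x hx y hy) hm

/-- The value of the composition `f(g(l₁), l₂)`. -/
def evalComp [Zero V] {a b : ℕ} (f : QuivFun V a) (g : QuivFun V b) (E : Multiset (M × M))
    (l₁ l₂ : List (Set M × V)) : V :=
  evalList f E ((unionSet l₁, evalList g E l₁) :: l₂)

/-- This turns the composition of the operad into a substitution: the letters fed to `g` are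
replaced by one letter that carries the union of their base points and the value of `g`. The quiver
seen by `f` is then again induced by the same arrows `E`. -/
lemma circ_quiverOn [Zero V] {a b N : ℕ} (h : a + b = N) (f : QuivFun V (a + 1))
    (g : QuivFun V (b + 1)) (E : Multiset (M × M)) (s : Fin (N + 1) → Set M × V)
    (hs : ∀ i j, i ≠ j → Disjoint (s i).1 (s j).1) :
    circ h f g (quiverOn E fun i => (s i).1) (fun i => (s i).2) =
      evalComp f g E ((List.ofFn s).take (b + 1)) ((List.ofFn s).drop (b + 1)) := by
  have hb : b ≤ N := by omega
  have h1 : (List.ofFn s).take (b + 1) = List.ofFn (fun i : Fin (b + 1) => s ⟨i.val, by omega⟩) := by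
    refine List.ext_getElem (by rw [List.length_take, List.length_ofFn, List.length_ofFn]; omega)
      fun k h1 h2 => ?_
    rw [List.getElem_take, List.getElem_ofFn, List.getElem_ofFn]
  rw [evalComp, h1, evalList_ofFn]
  have h2 : ∀ x, x :: (List.ofFn s).drop (b + 1) =
      List.ofFn (fun i : Fin (a + 1) => if i = 0 then x else s ⟨i.val + b, by omega⟩) := by
    intro x
    refine List.ext_getElem (by
      rw [List.length_cons, List.length_drop, List.length_ofFn, List.length_ofFn]; omega)
      fun k h1 h2 => ?_
    rcases k with _ | k
    · rw [List.getElem_cons_zero, List.getElem_ofFn]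
      exact (if_pos rfl).symm
    · rw [List.getElem_cons_succ, List.getElem_drop, List.getElem_ofFn, List.getElem_ofFn,
        if_neg (by simp [Fin.ext_iff])]
      congr 1
      exact Fin.ext (by simp; omega)
  rw [h2, evalList_ofFn, circ, collapse_quiverOn h E _ hs, restrict_quiverOn hb]
  have h3 : unionSet (List.ofFn (fun i : Fin (b + 1) => s ⟨i.val, by omega⟩)) =
      {m | ∃ j : Fin (N + 1), j.val < b + 1 ∧ m ∈ (s j).1} := by
    ext m
    simp only [unionSet, Set.mem_ofPred_eq, List.mem_ofFn]
    constructor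
    · rintro ⟨x, ⟨i, rfl⟩, hm⟩
      exact ⟨_, i.2, hm⟩
    · rintro ⟨j, hj, hm⟩
      exact ⟨_, ⟨⟨j.val, hj⟩, rfl⟩, hm⟩
  rw [h3]
  congr 1
  · congr 1
    funext i
    split_ifs <;> rfl
  · funext i
    split_ifs <;> rfl

lemma act_inv_quiverOn {n : ℕ} (f : QuivFun V n) (E : Multiset (M × M)) (s : Fin n → Set M × V)
    (σ : Equiv.Perm (Fin n)) :
    act σ⁻¹ f (quiverOn E fun i => (s i).1) (fun i => (s i).2) =
      f (quiverOn E fun i => (s (σ i)).1) (fun i => (s (σ i)).2) := by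
  rw [quiverOn_comp E (fun i => (s i).1) σ, act, inv_inv]

/-- The operation `□` evaluated on a list of letters. -/
lemma evalList_box [AddCommGroup V] {a b N : ℕ} (h : a + b = N) (f : QuivFun V (a + 1))
    (g : QuivFun V (b + 1)) (E : Multiset (M × M)) {l : List (Set M × V)} (hl : DisjointLetters l) :
    evalList (box h f g) E l = unshuffleSum (b + 1) l (evalComp f g E) := by
  classical
  by_cases hN : l.length = N + 1
  · obtain ⟨s, rfl⟩ := exists_eq_ofFn hN
    have hs : ∀ i j, i ≠ j → Disjoint (s i).1 (s j).1 := by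
      rw [DisjointLetters, List.pairwise_ofFn] at hl
      intro i j hij
      rcases lt_or_gt_of_ne hij with h | h
      · exact hl h
      · exact (hl h).symm
    rw [evalList_ofFn, ← sum_isShuffle_eq_unshuffleSum (b + 1) (by omega)]
    simp only [box, Finset.sum_apply, Pi.smul_apply]
    refine (Finset.sum_congr (by ext; simp) fun σ _ => ?_)
    rw [act_inv_quiverOn]
    exact congrArg _ (circ_quiverOn h f g E (s ∘ σ)
      fun i j hij => hs _ _ (fun e => hij (σ.injective e)))
  -- For a list of the wrong length both sides are the default value zero.
  · rw [evalList_of_ne _ _ hN, unshuffleSum_congr (R := fun _ _ => 0), unshuffleSum_zero_fun]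
    intro p q hp hlen
    refine evalList_of_ne _ _ ?_
    have := hp.length_eq
    simp only [List.length_append, List.length_cons] at this ⊢
    omega

/-- Every quiver is induced by its own arrows on the letters `({i}, v i)`, whose base points are its
vertices. -/
lemma ext_evalList [Zero V] {n : ℕ} {f g : QuivFun V n}
    (h : ∀ (E : Multiset (Fin n × Fin n)) (l : List (Set (Fin n) × V)), DisjointLetters l →
      evalList f E l = evalList g E l) : f = g := by
  funext Γ v
  have := h Γ.1 (List.ofFn fun i => ({i}, v i)) ?_
  · rw [evalList_ofFn, evalList_ofFn] at this
    simpa only [quiverOn_singletons] using this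
  · rw [DisjointLetters, List.pairwise_ofFn]
    intro i j hij
    simpa using hij.ne

end Letters

/-! ### Antisymmetry and multilinearity on lists of letters -/

section Skew

variable {K M V : Type*} [Field K] [AddCommGroup V] [Module K V]

/-- Invariance under the action of permutations twisted by the signature. -/
def IsSkew {n : ℕ} (f : QuivFun V n) : Prop :=
  ∀ σ : Equiv.Perm (Fin n), act σ f = ((Equiv.Perm.sign σ : ℤˣ) : ℤ) • f

lemma act_mul {V : Type*} {n : ℕ} (σ τ : Equiv.Perm (Fin n)) (f : QuivFun V n) :
    act (σ * τ) f = act τ (act σ f) := by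
  funext Γ v
  simp only [act, Quiv.relabel, Multiset.map_map, mul_inv_rev]
  rfl

lemma act_one {V : Type*} {n : ℕ} (f : QuivFun V n) : act 1 f = f := by
  funext Γ v
  simp only [act, Quiv.relabel]
  congr 1
  exact Subtype.ext (Multiset.map_id' _)

lemma act_smul {n : ℕ} (σ : Equiv.Perm (Fin n)) (c : ℤ) (f : QuivFun V n) :
    act σ (c • f) = c • act σ f := rfl

lemma append_swap_eq_ofFn {α : Type*} {n : ℕ} {l₁ l₂ : List α} {x y : α} {s : Fin n → α}
    (h : l₁ ++ x :: y :: l₂ = List.ofFn s) {i j : Fin n} (hi : i.val = l₁.length)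
    (hj : j.val = l₁.length + 1) : l₁ ++ y :: x :: l₂ = List.ofFn (s ∘ Equiv.swap i j) := by
  have hs : ∀ k : Fin n, (l₁ ++ x :: y :: l₂)[k.val]? = some (s k) := by
    intro k; rw [h]; simp
  have hlen : l₁.length + l₂.length + 2 = n := by
    have := congrArg List.length h; simp at this; omega
  refine List.ext_getElem? fun k => ?_
  by_cases hk : k < n
  · rw [List.getElem?_eq_getElem (by simp; omega), List.getElem?_eq_getElem (by simpa using hk),
      List.getElem_ofFn, ← List.getElem?_eq_getElem, Function.comp_apply, ← hs]
    rcases lt_trichotomy k l₁.length with h1 | h1 | h1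
    · rw [Equiv.swap_apply_of_ne_of_ne (by intro e; have := congrArg Fin.val e; simp at this; omega)
        (by intro e; have := congrArg Fin.val e; simp at this; omega),
        List.getElem?_append_left h1, List.getElem?_append_left (by exact h1)]
    · have : (⟨k, hk⟩ : Fin n) = i := Fin.ext (by simp; omega)
      rw [this, Equiv.swap_apply_left, List.getElem?_append_right (by omega),
        List.getElem?_append_right (by omega), hj, h1]
      simp
    · rcases Nat.lt_or_ge (l₁.length + 1) k with h2 | h2
      · rw [Equiv.swap_apply_of_ne_of_ne (by intro e; have := congrArg Fin.val e; simp at this; omega)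
          (by intro e; have := congrArg Fin.val e; simp at this; omega),
          List.getElem?_append_right (by omega), List.getElem?_append_right (by simp; omega)]
        obtain ⟨m, hm⟩ : ∃ m, k - l₁.length = m + 2 := ⟨k - l₁.length - 2, by omega⟩
        simp [hm]
      · have hk1 : k = l₁.length + 1 := by omega
        have : (⟨k, hk⟩ : Fin n) = j := Fin.ext (by simp; omega)
        rw [this, Equiv.swap_apply_right, List.getElem?_append_right (by omega),
          List.getElem?_append_right (by omega), hi, hk1]
        simp
  · rw [List.getElem?_eq_none (by simp; omega), List.getElem?_eq_none (by simp; omega)]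

lemma IsSkew.evalList_swap {n : ℕ} {f : QuivFun V n} (hf : IsSkew f) (E : Multiset (M × M))
    (l₁ : List (Set M × V)) (x y : Set M × V) (l₂ : List (Set M × V)) :
    evalList f E (l₁ ++ x :: y :: l₂) = -evalList f E (l₁ ++ y :: x :: l₂) := by
  by_cases hn : (l₁ ++ x :: y :: l₂).length = n
  · obtain ⟨s, hs⟩ := exists_eq_ofFn hn
    simp only [List.length_append, List.length_cons] at hn
    have hne : (⟨l₁.length, by omega⟩ : Fin n) ≠ ⟨l₁.length + 1, by omega⟩ := by
      simp [Fin.ext_iff]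
    rw [append_swap_eq_ofFn (i := ⟨l₁.length, by omega⟩) (j := ⟨l₁.length + 1, by omega⟩) hs rfl rfl,
      hs, evalList_ofFn, evalList_ofFn]
    have := act_inv_quiverOn f E s (Equiv.swap ⟨l₁.length, by omega⟩ ⟨l₁.length + 1, by omega⟩)
    rw [hf, Equiv.Perm.sign_inv, Equiv.Perm.sign_swap hne] at this
    simp only [Function.comp_apply]
    rw [← this]
    simp
  · rw [evalList_of_ne _ _ hn, evalList_of_ne _ _ (by simpa using hn), neg_zero]

/-- Adjacent transpositions generate the symmetric group, and both sides are multiplicative in the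
permutation. -/
lemma isSkew_of_act_swap {n : ℕ} {f : QuivFun V (n + 1)}
    (key : ∀ i : Fin n, act (Equiv.swap i.castSucc i.succ) f = -f) : IsSkew f := by
  intro σ
  have hσ : σ ∈ Submonoid.closure
      (Set.range fun i : Fin n => Equiv.swap i.castSucc i.succ) := by
    rw [Equiv.Perm.mclosure_swap_castSucc_succ]; trivial
  induction hσ using Submonoid.closure_induction with
  | mem σ h =>
    obtain ⟨i, rfl⟩ := h
    rw [key i]
    dsimp only
    rw [Equiv.Perm.sign_swap (Fin.castSucc_lt_succ).ne]
    simp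
  | one => rw [act_one]; simp
  | mul σ τ _ _ h1 h2 =>
    rw [act_mul, h1, act_smul, h2, smul_smul]
    simp

lemma isSkew_of_evalList_swap {n : ℕ} {f : QuivFun V (n + 1)}
    (h : ∀ (E : Multiset (Fin (n + 1) × Fin (n + 1))) (l₁ : List (Set (Fin (n + 1)) × V))
      (x y : Set (Fin (n + 1)) × V) (l₂ : List (Set (Fin (n + 1)) × V)),
      DisjointLetters (l₁ ++ x :: y :: l₂) →
      evalList f E (l₁ ++ x :: y :: l₂) = -evalList f E (l₁ ++ y :: x :: l₂)) : IsSkew f := by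
  refine isSkew_of_act_swap fun i => ?_
  funext Γ v
  set s : Fin (n + 1) → Set (Fin (n + 1)) × V := fun i => ({i}, v i)
  have hd : DisjointLetters (List.ofFn s) := by
    rw [DisjointLetters, List.pairwise_ofFn]
    intro i j hij
    simpa [s] using hij.ne
  have e : (List.ofFn s).take i ++ s i.castSucc :: s i.succ :: (List.ofFn s).drop (i + 2) =
      List.ofFn s := by
    have h1 : (List.ofFn s).drop i =
        s i.castSucc :: s i.succ :: (List.ofFn s).drop (i + 2) := by
      rw [List.drop_eq_getElem_cons (by simp),
        List.drop_eq_getElem_cons (i := i + 1) (by simp)]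
      rw [List.getElem_ofFn, List.getElem_ofFn]
      rfl
    rw [← h1, List.take_append_drop]
  have h2 := h Γ.1 _ (s i.castSucc) (s i.succ) _ (by rw [e]; exact hd)
  rw [append_swap_eq_ofFn e (i := i.castSucc) (j := i.succ) (by simp; omega) (by simp; omega), e,
    evalList_ofFn, evalList_ofFn] at h2
  have h3 := act_inv_quiverOn f Γ.1 s (Equiv.swap i.castSucc i.succ)
  rw [Equiv.swap_inv] at h3
  simp only [Function.comp_apply] at h2
  rw [← h3] at h2
  simp only [s, quiverOn_singletons] at h2
  rw [Pi.neg_apply, Pi.neg_apply, h2, neg_neg]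

/-- Multilinearity in one letter, as the existence of a linear map. In this form sums and signs can
be pulled out of the letter that arises by merging. -/
lemma exists_linear_evalList {n : ℕ} {f : QuivFun V n} (hf : ∀ Γ, f Γ ∈ multilinear K V n)
    (E : Multiset (M × M)) (l₁ : List (Set M × V)) (S : Set M) (l₂ : List (Set M × V)) :
    ∃ g : V →ₗ[K] V, ∀ v, evalList f E (l₁ ++ (S, v) :: l₂) = g v := by
  by_cases hn : l₁.length + l₂.length + 1 = n
  · have key : ∃ (Γ : Quiv n) (t : Fin n → V) (i : Fin n), ∀ v,
        evalList f E (l₁ ++ (S, v) :: l₂) = f Γ (Function.update t i v) := by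
      obtain ⟨s, hs⟩ := exists_eq_ofFn (n := n) (l := l₁ ++ (S, (0 : V)) :: l₂) (by simp; omega)
      have hs' : ∀ k : Fin n, (l₁ ++ (S, (0 : V)) :: l₂)[k.val]? = some (s k) := by
        intro k; rw [hs]; simp
      refine ⟨quiverOn E fun i => (s i).1, fun i => (s i).2, ⟨l₁.length, by omega⟩, fun v => ?_⟩
      have e : l₁ ++ (S, v) :: l₂ =
          List.ofFn (Function.update s ⟨l₁.length, by omega⟩ (S, v)) := by
        refine List.ext_getElem? fun k => ?_
        by_cases hk : k < n
        · rw [List.getElem?_eq_getElem (by simp; omega), List.getElem?_eq_getElem (by simpa using hk),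
            List.getElem_ofFn, ← List.getElem?_eq_getElem]
          rcases lt_trichotomy k l₁.length with h1 | h1 | h1
          · rw [Function.update_of_ne (by simp [Fin.ext_iff]; omega), ← hs',
              List.getElem?_append_left h1, List.getElem?_append_left (by exact h1)]
          · subst h1; simp
          · rw [Function.update_of_ne (by simp [Fin.ext_iff]; omega), ← hs',
              List.getElem?_append_right (by omega), List.getElem?_append_right (by simp; omega)]
            obtain ⟨m, hm⟩ : ∃ m, k - l₁.length = m + 1 := ⟨k - l₁.length - 1, by omega⟩
            simp [hm]
        · rw [List.getElem?_eq_none (by simp; omega), List.getElem?_eq_none (by simp; omega)]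
      have hS : (s ⟨l₁.length, by omega⟩).1 = S := by
        have := hs' ⟨l₁.length, by omega⟩
        simp at this
        rw [← this]
      rw [e, evalList_ofFn]
      congr 1
      · congr 1
        funext i
        rcases eq_or_ne i ⟨l₁.length, by omega⟩ with rfl | hi
        · simp [hS]
        · rw [Function.update_of_ne hi]
      · funext i
        rcases eq_or_ne i ⟨l₁.length, by omega⟩ with rfl | hi
        · simp
        · rw [Function.update_of_ne hi, Function.update_of_ne hi]
    obtain ⟨Γ, t, i, h⟩ := key
    obtain ⟨g, hg⟩ := hf Γ
    exact ⟨g.toLinearMap t i, fun v => by rw [h, ← hg]; rfl⟩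
  · exact ⟨0, fun v => evalList_of_ne _ _ (by simp; omega)⟩

lemma mem_multilinear_iff {n : ℕ} {f : (Fin n → V) → V} : f ∈ multilinear K V n ↔
    (∀ (v : Fin n → V) (i : Fin n) (x y : V), f (Function.update v i (x + y)) =
      f (Function.update v i x) + f (Function.update v i y)) ∧
    ∀ (v : Fin n → V) (i : Fin n) (c : K) (x : V), f (Function.update v i (c • x)) =
      c • f (Function.update v i x) := by
  constructor
  · rintro ⟨g, rfl⟩
    exact ⟨fun v i x y => g.map_update_add v i x y, fun v i c x => g.map_update_smul v i c x⟩
  · rintro ⟨h1, h2⟩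
    refine ⟨⟨f, ?_, ?_⟩, rfl⟩
    · intro _ v i x y
      convert h1 v i x y
    · intro _ v i c x
      convert h2 v i c x

lemma act_mem_multilinear {n : ℕ} {f : QuivFun V n} (hf : ∀ Γ, f Γ ∈ multilinear K V n)
    (σ : Equiv.Perm (Fin n)) (Γ : Quiv n) : act σ f Γ ∈ multilinear K V n := by
  obtain ⟨g, hg⟩ := hf (Γ.relabel σ)
  refine ⟨g.domDomCongr σ⁻¹, ?_⟩
  funext v
  simp only [act, ← hg]
  rfl

lemma circ_mem_multilinear {a b N : ℕ} (h : a + b = N) {f : QuivFun V (a + 1)}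
    {g : QuivFun V (b + 1)} (hf : ∀ Γ, f Γ ∈ multilinear K V (a + 1))
    (hg : ∀ Γ, g Γ ∈ multilinear K V (b + 1)) (Γ : Quiv (N + 1)) :
    circ h f g Γ ∈ multilinear K V (N + 1) := by
  have key : ∀ (v : Fin (N + 1) → V) (i : Fin (N + 1)), ∃ L : V →ₗ[K] V, ∀ x,
      circ h f g Γ (Function.update v i x) = L x := by
    intro v i
    obtain ⟨F, hF⟩ := hf (Γ.collapse h)
    obtain ⟨G, hG⟩ := hg (Γ.restrict b)
    set w : V → Fin (a + 1) → V := fun x k =>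
      if k = 0 then g (Γ.restrict b) (fun j => Function.update v i x ⟨j.val, by omega⟩)
        else Function.update v i x ⟨k.val + b, by omega⟩ with hw
    have hc : ∀ x, circ h f g Γ (Function.update v i x) = F (w x) := by
      intro x; rw [hF]; rfl
    -- The variable is either an argument of `g`, and the dependence is a composition of two linear
    -- maps, or a direct argument of `f`.
    by_cases hi : i.val < b + 1
    · refine ⟨(F.toLinearMap (w 0) 0).comp
        (G.toLinearMap (fun j => v ⟨j.val, by omega⟩) ⟨i.val, hi⟩), fun x => ?_⟩
      rw [hc]
      simp only [LinearMap.comp_apply, MultilinearMap.toLinearMap_apply]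
      congr 1
      funext k
      by_cases hk : k = 0
      · subst hk
        simp only [hw, if_true, Function.update_self, hG]
        congr 1
        funext j
        by_cases hj : j = ⟨i.val, hi⟩
        · subst hj; simp
        · rw [Function.update_of_ne hj, Function.update_of_ne]
          intro e; apply hj; apply Fin.ext; exact congrArg (fun x : Fin (N + 1) => x.val) e
      · have hk' : k.val ≠ 0 := fun e => hk (Fin.ext e)
        have hne : (⟨k.val + b, by omega⟩ : Fin (N + 1)) ≠ i := by
          intro e; have := congrArg Fin.val e; simp at this; omega
        rw [Function.update_of_ne hk]
        simp only [hw, if_neg hk, Function.update_of_ne hne]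
    · refine ⟨F.toLinearMap (w 0) ⟨i.val - b, by omega⟩, fun x => ?_⟩
      rw [hc, MultilinearMap.toLinearMap_apply]
      congr 1
      funext k
      by_cases hk : k = 0
      · subst hk
        rw [Function.update_of_ne (by intro e; have := congrArg Fin.val e; simp at this; omega)]
        simp only [hw, if_true]
        congr 1
        funext j
        have hne : (⟨j.val, by omega⟩ : Fin (N + 1)) ≠ i := by
          intro e; have := congrArg Fin.val e; simp at this; omega
        rw [Function.update_of_ne hne, Function.update_of_ne hne]
      · have hk' : k.val ≠ 0 := fun e => hk (Fin.ext e)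
        by_cases hki : k = ⟨i.val - b, by omega⟩
        · subst hki
          have : (⟨i.val - b + b, by omega⟩ : Fin (N + 1)) = i := Fin.ext (by simp; omega)
          simp only [hw, if_neg hk, this, Function.update_self]
        · have hne : (⟨k.val + b, by omega⟩ : Fin (N + 1)) ≠ i := by
            intro e; apply hki; apply Fin.ext; have := congrArg Fin.val e; simp at this ⊢; omega
          rw [Function.update_of_ne hki]
          simp only [hw, if_neg hk, Function.update_of_ne hne]
  rw [mem_multilinear_iff]
  constructor
  · intro v i x y
    obtain ⟨L, hL⟩ := key v i
    rw [hL, hL, hL, map_add]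
  · intro v i c x
    obtain ⟨L, hL⟩ := key v i
    rw [hL, hL, map_smul]

end Skew

/-! ### The pre-Lie identity -/

section PreLie

variable {K M V : Type*} [Field K] [AddCommGroup V] [Module K V]

lemma unionSet_perm {M V : Type*} {l l' : List (Set M × V)} (h : l.Perm l') : unionSet l = unionSet l' := by
  ext m
  simp only [unionSet, Set.mem_ofPred_eq, h.mem_iff]

lemma unionSet_append {M V : Type*} (l l' : List (Set M × V)) :
    unionSet (l ++ l') = unionSet l ∪ unionSet l' := by
  ext m
  simp only [unionSet, Set.mem_ofPred_eq, List.mem_append, Set.mem_union, or_and_right,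
    exists_or]

lemma unionSet_cons {M V : Type*} (x : Set M × V) (l : List (Set M × V)) :
    unionSet (x :: l) = x.1 ∪ unionSet l := by
  ext m
  simp [unionSet]

lemma unionSet_nil {M V : Type*} : unionSet ([] : List (Set M × V)) = ∅ := by
  ext m
  simp [unionSet]

lemma exists_linear_head {n : ℕ} {f : QuivFun V n} (hf : ∀ Γ, f Γ ∈ multilinear K V n)
    (E : Multiset (M × M)) (S : Set M) (l : List (Set M × V)) :
    ∃ g : V →ₗ[K] V, ∀ v, evalList f E ((S, v) :: l) = g v :=
  exists_linear_evalList hf E [] S l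

/-- If two neighbours are fed to the same operation, the skewness of `f` or `g` applies; if they are
separated, the exchange is a property of signed unshuffles (`unshuffleSum_swap`). -/
lemma box_isSkew {a b N : ℕ} (h : a + b = N) {f : QuivFun V (a + 1)} {g : QuivFun V (b + 1)}
    (hfm : ∀ Γ, f Γ ∈ multilinear K V (a + 1)) (hf : IsSkew f) (hg : IsSkew g) :
    IsSkew (box h f g) := by
  refine isSkew_of_evalList_swap fun E l₁ x y l₂ hd => ?_
  have hp : (l₁ ++ x :: y :: l₂).Perm (l₁ ++ y :: x :: l₂) :=
    List.Perm.append_left _ (List.Perm.swap _ _ _)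
  rw [evalList_box h f g E hd, evalList_box h f g E (hd.perm hp)]
  refine unshuffleSum_swap (fun p q b _ => ?_) (fun a p q _ => ?_)
  · rw [evalComp, evalComp, hg.evalList_swap, unionSet_perm (List.Perm.append_left p
      (List.Perm.swap y x q))]
    obtain ⟨L, hL⟩ := exists_linear_head hfm E (unionSet (p ++ y :: x :: q)) b
    rw [hL, hL, map_neg]
  · exact hf.evalList_swap E (_ :: p) x y q

/-- The terms of `(f □ g) □ h` in which `g` and `h` have different inputs. -/
def braceSum {a b c : ℕ} (f : QuivFun V a) (g : QuivFun V (b + 1)) (h : QuivFun V (c + 1))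
    (E : Multiset (M × M)) (l : List (Set M × V)) : V :=
  unshuffleSum (c + 1) l fun l₁ l₂ => (-1 : ℤ) ^ (b + 1) • unshuffleSum (b + 1) l₂ fun m₁ m₂ =>
    evalList f E ((unionSet m₁, evalList g E m₁) :: (unionSet l₁, evalList h E l₁) :: m₂)

/-- In `(f □ g) □ h` the letter produced by `h` is either fed to `g` or remains an argument of `f`.
The first kind of terms is `f □ (g □ h)` by coassociativity of unshuffling, the second kind is
`braceSum`. -/
lemma evalList_box_box {a b c k m N : ℕ} (hab : a + b = k) (hkc : k + c = N) (hbc : b + c = m)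
    (ham : a + m = N) {f : QuivFun V (a + 1)} (hf : ∀ Γ, f Γ ∈ multilinear K V (a + 1))
    (g : QuivFun V (b + 1)) (h : QuivFun V (c + 1)) (E : Multiset (M × M))
    {l : List (Set M × V)} (hl : DisjointLetters l) :
    evalList (box hkc (box hab f g) h) E l =
      evalList (box ham f (box hbc g h)) E l + braceSum f g h E l := by
  subst hbc
  rw [evalList_box _ _ _ _ hl, evalList_box _ _ _ _ hl, braceSum]
  have e1 : unshuffleSum (c + 1) l (evalComp (box hab f g) h E) =
      unshuffleSum (c + 1) l (fun l₁ l₂ => unshuffleSum b l₂ (fun m₁ m₂ =>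
        evalList f E ((unionSet l₁ ∪ unionSet m₁,
          evalList g E ((unionSet l₁, evalList h E l₁) :: m₁)) :: m₂))) +
      unshuffleSum (c + 1) l fun l₁ l₂ => (-1 : ℤ) ^ (b + 1) • unshuffleSum (b + 1) l₂
        fun m₁ m₂ =>
        evalList f E ((unionSet m₁, evalList g E m₁) :: (unionSet l₁, evalList h E l₁) :: m₂) := by
    rw [← unshuffleSum_add]
    refine unshuffleSum_congr fun l₁ l₂ hp _ => ?_
    rw [evalComp, evalList_box _ _ _ _ ((hl.perm hp.symm).merge _), unshuffleSum_cons]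
    simp only [evalComp, unionSet_cons]
  have e2 : unshuffleSum (b + c + 1) l (evalComp f (box rfl g h) E) =
      unshuffleSum (c + 1 + b) l (fun k₁ k₂ => unshuffleSum (c + 1) k₁ (fun l₁ m₁ =>
        evalList f E ((unionSet l₁ ∪ unionSet m₁,
          evalList g E ((unionSet l₁, evalList h E l₁) :: m₁)) :: k₂))) := by
    rw [show c + 1 + b = b + c + 1 by omega]
    refine unshuffleSum_congr fun k₁ k₂ hp _ => ?_
    have hk : DisjointLetters k₁ := (List.pairwise_append.1 (hl.perm hp.symm)).1
    rw [evalComp, evalList_box _ _ _ _ hk]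
    obtain ⟨L, hL⟩ := exists_linear_head hf E (unionSet k₁) k₂
    rw [hL]
    refine (map_unshuffleSum L.toAddMonoidHom _ _ _).trans ?_
    refine unshuffleSum_congr fun l₁ m₁ hq _ => ?_
    rw [← unionSet_append, unionSet_perm hq, hL]
    rfl
  rw [e1, e2, unshuffleSum_coassoc]

/-- Coassociativity collects the inputs of `g` and `h`, cocommutativity exchanges them, and the
skewness of `f` exchanges its first two arguments. With `evalList_box_box` this is the graded
pre-Lie identity. -/
lemma braceSum_comm {a b c : ℕ} {f : QuivFun V a} (hf : IsSkew f) (g : QuivFun V (b + 1))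
    (h : QuivFun V (c + 1)) (E : Multiset (M × M)) (l : List (Set M × V)) :
    braceSum f g h E l = (-1 : ℤ) ^ (b * c) • braceSum f h g E l := by
  have e1 : ∀ {b c : ℕ} (g : QuivFun V (b + 1)) (h : QuivFun V (c + 1)), braceSum f g h E l =
      (-1 : ℤ) ^ (b + 1) • unshuffleSum (b + c + 2) l fun k m₂ => unshuffleSum (c + 1) k
        fun l₁ m₁ => evalList f E
          ((unionSet m₁, evalList g E m₁) :: (unionSet l₁, evalList h E l₁) :: m₂) := by
    intro b c g h
    rw [braceSum, unshuffleSum_zsmul, show b + c + 2 = (c + 1) + (b + 1) by omega,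
      unshuffleSum_coassoc]
  rw [e1 g h, e1 h g, smul_smul, show c + b + 2 = b + c + 2 by omega]
  have e2 : (unshuffleSum (b + c + 2) l fun k m₂ => unshuffleSum (c + 1) k
        fun l₁ m₁ => evalList f E
          ((unionSet m₁, evalList g E m₁) :: (unionSet l₁, evalList h E l₁) :: m₂)) =
      (-1 : ℤ) ^ ((c + 1) * (b + 1) + 1) • (unshuffleSum (b + c + 2) l fun k m₂ =>
        unshuffleSum (b + 1) k fun l₁ m₁ => evalList f E
          ((unionSet m₁, evalList h E m₁) :: (unionSet l₁, evalList g E l₁) :: m₂)) := by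
    rw [← unshuffleSum_zsmul]
    refine unshuffleSum_congr fun k m₂ _ hk => ?_
    rw [unshuffleSum_cocomm (m := c + 1) (k := b + 1) (by omega), pow_succ, mul_smul]
    congr 1
    rw [neg_one_smul, ← unshuffleSum_neg]
    refine unshuffleSum_congr fun l₁ m₁ _ _ => ?_
    exact hf.evalList_swap E [] _ _ _
  rw [e2, smul_smul, ← pow_add, ← pow_add]
  congr 1
  refine neg_one_pow_congr ?_
  simp only [Nat.even_add, Nat.even_mul, Nat.even_add_one]
  tauto

lemma evalList_add {n : ℕ} (f g : QuivFun V n) (E : Multiset (M × M)) (l : List (Set M × V)) :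
    evalList (f + g) E l = evalList f E l + evalList g E l := by
  by_cases h : l.length = n
  · simp [evalList, h]
  · simp [evalList_of_ne _ _ h]

lemma evalList_zsmul {n : ℕ} (c : ℤ) (f : QuivFun V n) (E : Multiset (M × M))
    (l : List (Set M × V)) : evalList (c • f) E l = c • evalList f E l := by
  by_cases h : l.length = n
  · simp [evalList, h]
  · simp [evalList_of_ne _ _ h]

lemma evalList_smul {n : ℕ} (c : K) (f : QuivFun V n) (E : Multiset (M × M))
    (l : List (Set M × V)) : evalList (c • f) E l = c • evalList f E l := by
  by_cases h : l.length = n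
  · simp [evalList, h]
  · simp [evalList_of_ne _ _ h]

lemma evalList_zero {n : ℕ} (E : Multiset (M × M)) (l : List (Set M × V)) :
    evalList (0 : QuivFun V n) E l = 0 := by
  by_cases h : l.length = n
  · simp [evalList, h]
  · simp [evalList_of_ne _ _ h]

lemma evalList_sub {n : ℕ} (f g : QuivFun V n) (E : Multiset (M × M)) (l : List (Set M × V)) :
    evalList (f - g) E l = evalList f E l - evalList g E l := by
  by_cases h : l.length = n
  · simp [evalList, h]
  · simp [evalList_of_ne _ _ h]

lemma box_add_left {a b N : ℕ} (h : a + b = N) (f f' : QuivFun V (a + 1)) (g : QuivFun V (b + 1)) :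
    box h (f + f') g = box h f g + box h f' g := by
  simp only [box, ← Finset.sum_add_distrib, ← smul_add]
  rfl

lemma box_smul_left {a b N : ℕ} (h : a + b = N) (c : K) (f : QuivFun V (a + 1))
    (g : QuivFun V (b + 1)) : box h (c • f) g = c • box h f g := by
  simp only [box, Finset.smul_sum]
  refine Finset.sum_congr rfl fun σ _ => ?_
  rw [smul_comm]
  rfl

lemma exists_linear_circ {a b N : ℕ} (h : a + b = N) {f : QuivFun V (a + 1)}
    (hf : ∀ Γ, f Γ ∈ multilinear K V (a + 1)) (Γ : Quiv (N + 1)) (v : Fin (N + 1) → V) :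
    ∃ L : V →ₗ[K] V, ∀ g : QuivFun V (b + 1),
      circ h f g Γ v = L (g (Γ.restrict b) (fun j => v ⟨j.val, by omega⟩)) := by
  obtain ⟨F, hF⟩ := hf (Γ.collapse h)
  refine ⟨F.toLinearMap (fun i => v ⟨i.val + b, by omega⟩) 0, fun g => ?_⟩
  rw [circ, ← hF, MultilinearMap.toLinearMap_apply]
  congr 1
  funext i
  split_ifs with hi
  · subst hi; simp
  · rw [Function.update_of_ne hi]

lemma box_add_right {a b N : ℕ} (h : a + b = N) {f : QuivFun V (a + 1)}
    (hf : ∀ Γ, f Γ ∈ multilinear K V (a + 1)) (g g' : QuivFun V (b + 1)) :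
    box h f (g + g') = box h f g + box h f g' := by
  have key : circ h f (g + g') = circ h f g + circ h f g' := by
    funext Γ v
    obtain ⟨L, hL⟩ := exists_linear_circ (b := b) h hf Γ v
    rw [Pi.add_apply, Pi.add_apply, hL, hL, hL]
    exact map_add L _ _
  simp only [box, ← Finset.sum_add_distrib, ← smul_add, key]
  rfl

lemma box_smul_right {a b N : ℕ} (h : a + b = N) {f : QuivFun V (a + 1)}
    (hf : ∀ Γ, f Γ ∈ multilinear K V (a + 1)) (c : K) (g : QuivFun V (b + 1)) :
    box h f (c • g) = c • box h f g := by
  have key : circ h f (c • g) = c • circ h f g := by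
    funext Γ v
    obtain ⟨L, hL⟩ := exists_linear_circ (b := b) h hf Γ v
    rw [Pi.smul_apply, Pi.smul_apply, hL, hL]
    exact map_smul L _ _
  simp only [box, Finset.smul_sum, key]
  refine Finset.sum_congr rfl fun σ _ => ?_
  rw [smul_comm]
  rfl

lemma box_zero_right {a b N : ℕ} (h : a + b = N) {f : QuivFun V (a + 1)}
    (hf : ∀ Γ, f Γ ∈ multilinear K V (a + 1)) : box h f (0 : QuivFun V (b + 1)) = 0 := by
  have := box_smul_right h hf (0 : K) (0 : QuivFun V (b + 1))
  simpa using this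

lemma box_zsmul_right {a b N : ℕ} (h : a + b = N) {f : QuivFun V (a + 1)}
    (hf : ∀ Γ, f Γ ∈ multilinear K V (a + 1)) (c : ℤ) (g : QuivFun V (b + 1)) :
    box h f (c • g) = c • box h f g := by
  have := box_smul_right h hf (c : K) g
  simpa only [Int.cast_smul_eq_zsmul] using this

/-- The operators `[P, -]` and `[Q, -]` of degree one anticommute if `P □ Q + Q □ P = 0`. -/
lemma lieBracket_anticomm {P Q : QuivFun V 2} (hP : ∀ Γ, P Γ ∈ multilinear K V 2)
    (hQ : ∀ Γ, Q Γ ∈ multilinear K V 2) (hPs : IsSkew P) (hQs : IsSkew Q)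
    (hPQ : box (a := 1) (b := 1) (N := 2) rfl P Q + box (a := 1) (b := 1) (N := 2) rfl Q P = 0)
    {n : ℕ} {Y : QuivFun V (n + 1)} (hY : ∀ Γ, Y Γ ∈ multilinear K V (n + 1)) (hYs : IsSkew Y) :
    lieBracket (a := 1) (b := n + 1) (Nat.add_comm 1 (n + 1)) P
        (lieBracket (a := 1) (b := n) (Nat.add_comm 1 n) Q Y) +
      lieBracket (a := 1) (b := n + 1) (Nat.add_comm 1 (n + 1)) Q
        (lieBracket (a := 1) (b := n) (Nat.add_comm 1 n) P Y) = 0 := by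
  -- The left-nested terms `(Q □ Y) □ P` and `(Y □ Q) □ P` are rewritten so that only right-nested
  -- terms and braces remain.
  have expand : ∀ {P Q : QuivFun V 2}, (∀ Γ, P Γ ∈ multilinear K V 2) →
      (∀ Γ, Q Γ ∈ multilinear K V 2) → IsSkew Q →
      ∀ (E : Multiset (Fin (n + 1 + 1 + 1) × Fin (n + 1 + 1 + 1)))
        (l : List (Set (Fin (n + 1 + 1 + 1)) × V)), DisjointLetters l →
      evalList (lieBracket (a := 1) (b := n + 1) (Nat.add_comm 1 (n + 1)) P
        (lieBracket (a := 1) (b := n) (Nat.add_comm 1 n) Q Y)) E l =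
      evalList (box (Nat.add_comm 1 (n + 1)) P (box (Nat.add_comm 1 n) Q Y)) E l
      - (-1 : ℤ) ^ n • evalList (box (a := 1) (b := n + 1) (Nat.add_comm 1 (n + 1)) P
          (box (a := n) (b := 1) rfl Y Q)) E l
      + (-1 : ℤ) ^ n • (evalList (box (a := 1) (b := n + 1) (Nat.add_comm 1 (n + 1)) Q
          (box (a := n) (b := 1) rfl Y P)) E l + braceSum Q Y P E l)
      - (evalList (box (a := n) (b := 2) rfl Y (box (a := 1) (b := 1) rfl Q P)) E l +
          braceSum Y Q P E l) := by
    intro P Q hP hQ hQs E l hl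
    have e1 : box (a := 1) (b := n + 1) (Nat.add_comm 1 (n + 1)) P
        (lieBracket (a := 1) (b := n) (Nat.add_comm 1 n) Q Y) =
        box (Nat.add_comm 1 (n + 1)) P (box (Nat.add_comm 1 n) Q Y) +
        ((-1 : ℤ) * (-1) ^ n) • box (a := 1) (b := n + 1) (Nat.add_comm 1 (n + 1)) P
          (box (a := n) (b := 1) rfl Y Q) := by
      rw [lieBracket, sub_eq_add_neg, box_add_right _ hP, ← neg_one_zsmul, smul_smul,
        box_zsmul_right _ hP, one_mul]
    have e2 : ∀ (R S : QuivFun V (n + 1 + 1)) (c : ℤ),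
        box (a := n + 1) (b := 1) rfl (R - c • S) P =
          box (a := n + 1) (b := 1) rfl R P - c • box (a := n + 1) (b := 1) rfl S P := by
      intro R S c
      rw [sub_eq_add_neg, box_add_left, ← neg_smul, ← Int.cast_smul_eq_zsmul K (-c) S,
        box_smul_left, Int.cast_smul_eq_zsmul, neg_smul, sub_eq_add_neg]
    rw [lieBracket, evalList_sub, e1, evalList_add, evalList_zsmul, evalList_zsmul, one_mul,
      lieBracket, e2, evalList_sub, evalList_zsmul,
      evalList_box_box (a := 1) (b := n) (c := 1) (m := n + 1) _ _ rfl (Nat.add_comm 1 (n + 1)) hQ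
        Y P E hl,
      evalList_box_box (a := n) (b := 1) (c := 1) (m := 2) _ _ rfl rfl hY Q P E hl]
    rw [one_mul, pow_succ]
    have hs : ((-1 : ℤ) ^ n) * (-1) ^ n = 1 := by rw [← mul_pow]; simp
    simp only [smul_sub, smul_add, smul_smul]
    rw [show (-1 : ℤ) ^ n * -1 * (-1) ^ n = -((-1) ^ n * (-1) ^ n) by ring, hs]
    simp only [mul_neg, mul_one, neg_smul, one_smul, neg_mul, one_mul]
    abel
  refine ext_evalList fun E l hl => ?_
  rw [evalList_add, expand hP hQ hQs E l hl, expand hQ hP hPs E l hl, evalList_zero]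
  -- In the sum of the two expansions the terms `P □ (Y □ Q)` and `Q □ (Y □ P)` cancel, and so do
  -- the braces of `Y`. The braces of `P` and `Q` complete the other terms to `(P □ Q + Q □ P) □ Y`
  -- and `Y □ (Q □ P + P □ Q)`, which vanish by hypothesis.
  have b1 := braceSum_comm hQs Y P E l
  have b2 := braceSum_comm hPs Y Q E l
  have b3 := braceSum_comm hYs Q P E l
  have p1 := evalList_box_box (a := 1) (b := 1) (c := n) (k := 2) (m := n + 1) (N := n + 2) rfl
    (by omega) (by omega) (by omega) hP Q Y E hl
  have p2 := evalList_box_box (a := 1) (b := 1) (c := n) (k := 2) (m := n + 1) (N := n + 2) rfl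
    (by omega) (by omega) (by omega) hQ P Y E hl
  have hz : evalList (box (a := 2) (b := n) (N := n + 2) (by omega)
      (box (a := 1) (b := 1) (N := 2) rfl P Q) Y) E l +
      evalList (box (a := 2) (b := n) (N := n + 2) (by omega)
      (box (a := 1) (b := 1) (N := 2) rfl Q P) Y) E l = 0 := by
    rw [← evalList_add, ← box_add_left, hPQ, ← evalList_zero (n := n + 2 + 1) E l]
    congr 1
    have := box_smul_left (a := 2) (b := n) (N := n + 2) (by omega) (0 : K) 0 Y
    simpa using this
  have hz' : evalList (box (a := n) (b := 2) rfl Y (box (a := 1) (b := 1) rfl Q P)) E l +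
      evalList (box (a := n) (b := 2) rfl Y (box (a := 1) (b := 1) rfl P Q)) E l = 0 := by
    rw [← evalList_add, ← box_add_right _ hY, (add_comm _ _).trans hPQ, box_zero_right _ hY,
      evalList_zero]
  rw [p1, p2] at hz
  have hs : ((-1 : ℤ) ^ n) * (-1) ^ n = 1 := by rw [← mul_pow]; simp
  rw [mul_one] at b1 b2 b3
  rw [pow_one, neg_one_zsmul] at b3
  rw [b1, b2, b3]
  simp only [smul_add, smul_smul, hs, one_smul]
  have : ∀ A B C D F G H I H' : V, A + B + (C + D) = 0 → H + H' = 0 →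
      A - F + (G + D) - (H + -I) + (C - G + (F + B) - (H' + I)) = 0 := by
    intro A B C D F G H I H' h1 h2
    have : A - F + (G + D) - (H + -I) + (C - G + (F + B) - (H' + I)) =
      (A + B + (C + D)) - (H + H') := by abel
    rw [this, h1, h2, sub_zero]
  exact this _ _ _ _ _ _ _ _ _ hz hz'

end PreLie

/-! ### Cycles of multigraphs -/

section Cycles

variable {M : Type*}

/-- Two points are connected by arrows of `E` (in any direction). -/
def Conn (E : Multiset (M × M)) : M → M → Prop :=
  Relation.ReflTransGen fun x y => (x, y) ∈ E ∨ (y, x) ∈ E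

lemma Conn.refl (E : Multiset (M × M)) (a : M) : Conn E a a := Relation.ReflTransGen.refl

lemma Conn.trans {E : Multiset (M × M)} {a b c : M} (h : Conn E a b) (h' : Conn E b c) :
    Conn E a c := Relation.ReflTransGen.trans h h'

lemma Conn.symm {E : Multiset (M × M)} {a b : M} (h : Conn E a b) : Conn E b a := by
  induction h with
  | refl => exact Conn.refl _ _
  | tail _ h ih => exact Relation.ReflTransGen.head h.symm ih

lemma Conn.of_mem {E : Multiset (M × M)} {a b : M} (h : (a, b) ∈ E) : Conn E a b :=
  Relation.ReflTransGen.single (Or.inl h)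

lemma Conn.mono {E E' : Multiset (M × M)} (hE : E ≤ E') {a b : M} (h : Conn E a b) :
    Conn E' a b := by
  induction h with
  | refl => exact Conn.refl _ _
  | tail _ h ih =>
    exact Relation.ReflTransGen.tail ih
      (h.imp (Multiset.mem_of_le hE) (Multiset.mem_of_le hE))

lemma Conn.lift {N : Type*} {E : Multiset (M × M)} {E' : Multiset (N × N)} (π : M → N)
    (hE : ∀ e ∈ E, Conn E' (π e.1) (π e.2)) {a b : M} (h : Conn E a b) : Conn E' (π a) (π b) := by
  induction h with
  | refl => exact Conn.refl _ _
  | tail _ h ih => exact ih.trans (h.elim (fun h => hE _ h) fun h => (hE _ h).symm)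

lemma Conn.of_cons {E : Multiset (M × M)} {a b c d : M} (h : Conn ((a, b) ::ₘ E) c d) :
    Conn E c d ∨ (Conn E c a ∧ Conn E b d) ∨ (Conn E c b ∧ Conn E a d) := by
  induction h with
  | refl => exact Or.inl (Conn.refl _ _)
  | @tail x y _ h ih =>
    have step : (Conn E x y) ∨ (x = a ∧ y = b) ∨ (x = b ∧ y = a) := by
      rcases h with h | h
      · rcases Multiset.mem_cons.1 h with h | h
        · exact Or.inr (Or.inl (Prod.mk.inj h))
        · exact Or.inl (Conn.of_mem h)
      · rcases Multiset.mem_cons.1 h with h | h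
        · exact Or.inr (Or.inr (Prod.mk.inj h).symm)
        · exact Or.inl (Conn.of_mem h).symm
    rcases step with h | ⟨rfl, rfl⟩ | ⟨rfl, rfl⟩
    · exact ih.imp (·.trans h) (Or.imp (fun k => ⟨k.1, k.2.trans h⟩) fun k => ⟨k.1, k.2.trans h⟩)
    · rcases ih with h | ⟨h, h'⟩ | ⟨h, -⟩
      · exact Or.inr (Or.inl ⟨h, Conn.refl _ _⟩)
      · exact Or.inr (Or.inl ⟨h, Conn.refl _ _⟩)
      · exact Or.inl h
    · rcases ih with h | ⟨h, -⟩ | ⟨h, h'⟩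
      · exact Or.inr (Or.inr ⟨h, Conn.refl _ _⟩)
      · exact Or.inl h
      · exact Or.inr (Or.inr ⟨h, Conn.refl _ _⟩)

/-- Some arrow joins points that are connected by the other arrows. -/
def Cyclic (E : Multiset (M × M)) : Prop :=
  ∃ a b E', E = (a, b) ::ₘ E' ∧ Conn E' a b

lemma Cyclic.mono {E E' : Multiset (M × M)} (hE : E ≤ E') (h : Cyclic E) : Cyclic E' := by
  obtain ⟨a, b, F, rfl, h⟩ := h
  obtain ⟨G, rfl⟩ := Multiset.le_iff_exists_add.1 hE
  exact ⟨a, b, F + G, by rw [Multiset.cons_add], h.mono (Multiset.le_add_right _ _)⟩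

/-- Either the new arrow is itself the one that closes the cycle, or the cycle is closed by another
arrow. In the latter case the path avoids the new arrow, or it passes through it and then connects
its ends by the remaining arrows. -/
lemma Cyclic.of_cons {E : Multiset (M × M)} {a b : M} (h : Cyclic ((a, b) ::ₘ E)) :
    Cyclic E ∨ Conn E a b := by
  classical
  obtain ⟨c, d, F, hF, h⟩ := h
  rcases (Multiset.cons_eq_cons).1 hF with ⟨h1, rfl⟩ | ⟨-, G, rfl, rfl⟩
  · obtain ⟨rfl, rfl⟩ := Prod.mk.inj h1
    exact Or.inr h
  · have hle : G ≤ (c, d) ::ₘ G := Multiset.le_cons_self _ _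
    have hcd : Conn ((c, d) ::ₘ G) c d := Conn.of_mem (Multiset.mem_cons_self _ _)
    rcases h.of_cons with h | ⟨h1, h2⟩ | ⟨h1, h2⟩
    · exact Or.inl ⟨c, d, G, rfl, h⟩
    · exact Or.inr (((h1.mono hle).symm.trans hcd).trans (h2.mono hle).symm)
    · exact Or.inr (((h2.mono hle).trans hcd.symm).trans (h1.mono hle))

/-- A cycle of `I + X` is a cycle of `I` or becomes one of `X` when the components of `I` are
contracted. -/
lemma Cyclic.of_add {N : Type*} (π : M → N) {I X : Multiset (M × M)}
    (hI : ∀ e ∈ I, π e.1 = π e.2) (h : Cyclic (I + X)) :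
    Cyclic I ∨ Cyclic (X.map fun e => (π e.1, π e.2)) := by
  induction X using Multiset.induction_on with
  | empty => exact Or.inl (by simpa using h)
  | cons e X ih =>
    rw [Multiset.add_cons] at h
    rcases Cyclic.of_cons (a := e.1) (b := e.2) h with h | h
    · refine (ih h).imp_right fun h => h.mono ?_
      rw [Multiset.map_cons]
      exact Multiset.le_cons_self _ _
    · refine Or.inr ⟨π e.1, π e.2, _, Multiset.map_cons _ _ _, h.lift π fun x hx => ?_⟩
      rcases Multiset.mem_add.1 hx with hx | hx
      · rw [hI x hx]; exact Conn.refl _ _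
      · exact Conn.of_mem (Multiset.mem_map_of_mem (fun e => (π e.1, π e.2)) hx)

lemma Conn.exists_path {E : Multiset (M × M)} {a b : M} (h : Conn E a b) :
    ∃ l : List M, (a :: l).Nodup ∧ (a :: l).getLast (List.cons_ne_nil _ _) = b ∧
      List.IsChain (fun x y => (x, y) ∈ E ∨ (y, x) ∈ E) (a :: l) := by
  induction h using Relation.ReflTransGen.head_induction_on with
  | refl => exact ⟨[], by simp, rfl, by simp⟩
  | @head a c hac _ ih =>
    obtain ⟨l, h1, h2, h3⟩ := ih
    by_cases ha : a ∈ c :: l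
    -- If the new vertex already lies on the simple path, the part before it is dropped.
    · obtain ⟨s, t, hst⟩ := List.append_of_mem ha
      refine ⟨t, ?_, ?_, ?_⟩
      · rw [hst] at h1; exact h1.of_append_right
      · rw [← h2]
        simp only [hst]
        rw [List.getLast_append_of_ne_nil _ (List.cons_ne_nil _ _)]
      · rw [hst] at h3; exact h3.right_of_append
    · exact ⟨c :: l, List.nodup_cons.2 ⟨ha, h1⟩, by rw [List.getLast_cons (List.cons_ne_nil _ _), h2],
        List.IsChain.cons_cons hac h3⟩

end Cycles

/-! ### Cycles with distinct vertices and connectedness. -/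

section HasCycle

variable {n : ℕ}

lemma fin_val_add_one {k : ℕ} (i : Fin (k + 1)) :
    (i + 1 : Fin (k + 1)).val = if i.val = k then 0 else i.val + 1 := by
  rw [Fin.val_add_one]
  simp [Fin.ext_iff]

/-- The last edge of a cycle joins the ends of the path formed by the other edges. -/
lemma Quiv.HasCycle.cyclic {Γ : Quiv n} (h : Γ.HasCycle) : Cyclic Γ.1 := by
  obtain ⟨k, v, o, hv, hle⟩ := h
  refine Cyclic.mono hle ?_
  rw [Fin.univ_castSuccEmb, Finset.cons_val, Multiset.map_cons]
  set F : Multiset (Fin n × Fin n) := Multiset.map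
    (fun i => if o i then (v i, v (i + 1)) else (v (i + 1), v i))
    (Finset.map Fin.castSuccEmb Finset.univ).val
  have hc : ∀ j (hj : j < k + 1), Conn F (v 0) (v ⟨j, hj⟩) := by
    intro j
    induction j with
    | zero => intro _; exact Conn.refl _ _
    | succ j ih =>
      intro hj
      refine (ih (by omega)).trans ?_
      have hmem : (if o ⟨j, by omega⟩ then (v ⟨j, by omega⟩, v (⟨j, by omega⟩ + 1))
          else (v (⟨j, by omega⟩ + 1), v ⟨j, by omega⟩)) ∈ F := by
        refine Multiset.mem_map_of_mem
          (fun i : Fin (k + 1) => if o i then (v i, v (i + 1)) else (v (i + 1), v i)) ?_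
        rw [Finset.mem_val, Finset.mem_map]
        exact ⟨⟨j, by omega⟩, Finset.mem_univ _, rfl⟩
      have e : (⟨j, by omega⟩ + 1 : Fin (k + 1)) = ⟨j + 1, hj⟩ := by
        apply Fin.ext
        rw [fin_val_add_one, if_neg (by simp; omega)]
      rw [e] at hmem
      split_ifs at hmem
      · exact Conn.of_mem hmem
      · exact (Conn.of_mem hmem).symm
  have e : Fin.last k + 1 = 0 := by simp
  have h0 := hc k (by omega)
  split_ifs
  · refine ⟨_, _, F, rfl, ?_⟩
    rw [e]
    exact h0.symm
  · refine ⟨_, _, F, rfl, ?_⟩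
    rw [e]
    exact h0

lemma Quiv.hasCycle_of_cyclic {Γ : Quiv n} (h : Cyclic Γ.1) : Γ.HasCycle := by
  classical
  obtain ⟨a, b, E, hE, h⟩ := h
  have hab : a ≠ b := Γ.2 (a, b) (by rw [hE]; exact Multiset.mem_cons_self _ _)
  obtain ⟨l, h1, h2, h3⟩ := h.exists_path
  set k := l.length
  set v : Fin (k + 1) → Fin n := (a :: l).get
  have hv : Function.Injective v := List.nodup_iff_injective_get.1 h1
  have hlast : v (Fin.last k) = b := by
    rw [← h2, List.getLast_eq_getElem]
    rfl
  -- The path runs from `a` to `b`, so the closing arrow `(a, b)` is traversed backwards and the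
  -- last orientation is `false`. Elsewhere the orientation follows an arrow of `E` that is present;
  -- the edges of a simple path are different, which gives the inequality of multisets.
  set o : Fin (k + 1) → Bool := fun i => decide (i ≠ Fin.last k ∧ (v i, v (i + 1)) ∈ E)
  refine ⟨k, v, o, hv, ?_⟩
  rw [hE, Fin.univ_castSuccEmb, Finset.cons_val, Multiset.map_cons]
  have e : Fin.last k + 1 = 0 := by simp
  have h4 : (if o (Fin.last k) then (v (Fin.last k), v (Fin.last k + 1))
      else (v (Fin.last k + 1), v (Fin.last k))) = (a, b) := by
    simp only [o, ne_eq, not_true_eq_false, false_and, decide_false, Bool.false_eq_true, if_false]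
    rw [e, hlast]
    rfl
  rw [h4]
  refine Multiset.cons_le_cons _ ((Multiset.le_iff_subset (Multiset.Nodup.map_on ?_
    (Finset.nodup _))).2 ?_)
  · intro i hi j hj hij
    rw [Finset.mem_val, Finset.mem_map] at hi hj
    obtain ⟨i, -, rfl⟩ := hi
    obtain ⟨j, -, rfl⟩ := hj
    have hs : ∀ i : Fin k, (Fin.castSuccEmb i + 1 : Fin (k + 1)).val = i.val + 1 := by
      intro i
      rw [fin_val_add_one, if_neg (by simp; omega)]
      rfl
    apply Fin.ext
    have hi := hs i
    have hj := hs j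
    split_ifs at hij <;> simp only [Prod.mk.injEq, hv.eq_iff, Fin.ext_iff, hi, hj] at hij <;>
      simp only [Fin.castSuccEmb_apply, Fin.val_castSucc] at hij ⊢ <;> omega
  · intro x hx
    obtain ⟨i, hi, rfl⟩ := Multiset.mem_map.1 hx
    rw [Finset.mem_val, Finset.mem_map] at hi
    obtain ⟨i, -, rfl⟩ := hi
    have hne : Fin.castSuccEmb i ≠ Fin.last k := (Fin.castSucc_lt_last i).ne
    have hs : (Fin.castSuccEmb i + 1 : Fin (k + 1)) = i.succ := by
      apply Fin.ext
      rw [fin_val_add_one, if_neg (by simp; omega)]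
      rfl
    have h5 := List.isChain_iff_getElem.1 h3 i.val (by simp; omega)
    have h6 : (v (Fin.castSuccEmb i), v (Fin.castSuccEmb i + 1)) ∈ E ∨
        (v (Fin.castSuccEmb i + 1), v (Fin.castSuccEmb i)) ∈ E := by
      rw [hs]; exact h5
    simp only [o, hne, ne_eq, not_false_eq_true, true_and, decide_eq_true_eq]
    split_ifs with h7
    · exact h7
    · exact h6.resolve_left h7

end HasCycle

/-! ### The relations of the finite operad -/

section FinOp

variable {K V W : Type*} [Field K] [AddCommGroup V] [Module K V] [AddCommGroup W]

/-- The quiver with the arrows of `E` that are not loops. -/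
def ofArrows {n : ℕ} (E : Multiset (Fin n × Fin n)) : Quiv n :=
  ⟨E.filter fun e => e.1 ≠ e.2, fun _ h => (Multiset.mem_filter.1 h).2⟩

lemma ofArrows_val {n : ℕ} (Γ : Quiv n) : ofArrows Γ.1 = Γ :=
  Subtype.ext (Multiset.filter_eq_self.2 Γ.2)

lemma ofArrows_cons_self {n : ℕ} (a : Fin n) (E : Multiset (Fin n × Fin n)) :
    ofArrows ((a, a) ::ₘ E) = ofArrows E :=
  Subtype.ext (Multiset.filter_cons_of_neg _ (by simp))

lemma ofArrows_cons {n : ℕ} {a b : Fin n} (h : a ≠ b) (E : Multiset (Fin n × Fin n)) :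
    (ofArrows ((a, b) ::ₘ E)).1 = (a, b) ::ₘ (ofArrows E).1 :=
  Multiset.filter_cons_of_pos _ h

lemma ofArrows_cons_val {n : ℕ} (e : Fin n × Fin n) (E : Multiset (Fin n × Fin n)) :
    ofArrows (e ::ₘ (ofArrows E).1) = ofArrows (e ::ₘ E) := by
  apply Subtype.ext
  simp only [ofArrows, Multiset.filter_cons, Multiset.filter_filter, and_self]

lemma ofArrows_erase {n : ℕ} (Γ : Quiv n) (e : Fin n × Fin n) :
    Γ.erase e = ofArrows (Γ.1.erase e) := (ofArrows_val (Γ.erase e)).symm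

lemma relabel_ofArrows {n : ℕ} (σ : Equiv.Perm (Fin n)) (E : Multiset (Fin n × Fin n)) :
    (ofArrows E).relabel σ = ofArrows (E.map fun e => (σ e.1, σ e.2)) := by
  apply Subtype.ext
  simp only [Quiv.relabel, ofArrows, Multiset.filter_map]
  congr 2
  funext e
  simp

lemma conn_ofArrows {n : ℕ} {E : Multiset (Fin n × Fin n)} {a b : Fin n} (h : Conn E a b) :
    Conn (ofArrows E).1 a b := by
  refine h.lift id fun e he => ?_
  by_cases hl : e.1 = e.2
  · rw [hl]; exact Conn.refl _ _
  · exact Conn.of_mem (Multiset.mem_filter.2 ⟨he, hl⟩)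

/-- The sum of the values of `f` on `E + (l \ x)` over the members `x` of `l`. -/
def eraseSum {α : Type*} (f : Multiset α → W) : List α → Multiset α → W
  | [], _ => 0
  | x :: l, E => f (E + (l : Multiset α)) + eraseSum f l (x ::ₘ E)

lemma eraseSum_eq_sum {α : Type*} [DecidableEq α] (f : Multiset α → W) (l : List α)
    (E : Multiset α) :
    eraseSum f l E = (l.map fun x => f ((E + (l : Multiset α)).erase x)).sum := by
  induction l generalizing E with
  | nil => rfl
  | cons x l ih =>
    rw [eraseSum, ih, List.map_cons, List.sum_cons, ← Multiset.cons_coe, Multiset.add_cons,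
      Multiset.erase_cons_head, Multiset.cons_add]

lemma eraseSum_add {α : Type*} {f : Multiset α → W} {X Y Z : Multiset α}
    (h : ∀ E, f (X + E) = f (Y + E) + f (Z + E)) (l : List α) (E : Multiset α) :
    eraseSum f l (X + E) = eraseSum f l (Y + E) + eraseSum f l (Z + E) := by
  induction l generalizing E with
  | nil => simp [eraseSum]
  | cons x l ih =>
    simp only [eraseSum]
    rw [add_assoc, h, ← add_assoc, ← add_assoc, ← Multiset.add_cons, ih, ← Multiset.add_cons,
      ← Multiset.add_cons]
    abel

/-- The arrows of the closed walk `r → l → r` except for the first one. -/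
def walkArrows {α : Type*} : α → List α → α → List (α × α)
  | a, [], r => [(a, r)]
  | a, b :: l, r => (a, b) :: walkArrows b l r

/-- Induction on the length of the cycle, from the reversal rule for two arrows. The triangle rule
replaces the path `r → a → b` by the arrow `r → b` accompanied by `a → b` or by `r → a`. The
relations of the two shortened cycles, with the additional arrow `a → b` or `r → a`, then cancel the
two terms in which `r → a` or `a → b` is erased. -/
lemma eraseSum_walkArrows {α : Type*} {f : Multiset (α × α) → W}
    (hrev : ∀ E a b, a ≠ b → f ((a, b) ::ₘ E) = -f ((b, a) ::ₘ E))
    (htri : ∀ E a b c, a ≠ b → a ≠ c → b ≠ c → f ((c, a) ::ₘ (a, b) ::ₘ E) +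
      f ((c, b) ::ₘ (b, a) ::ₘ E) = f ((c, a) ::ₘ (c, b) ::ₘ E))
    (l : List α) (a r : α) (h : (r :: a :: l).Nodup) (E : Multiset (α × α)) :
    eraseSum f ((r, a) :: walkArrows a l r) E = 0 := by
  induction l generalizing a E with
  | nil =>
    have hra : a ≠ r := by
      rintro rfl; simp at h
    simp only [walkArrows, eraseSum, add_zero, Multiset.coe_nil]
    rw [add_comm, Multiset.add_comm E, ← Multiset.cons_coe, Multiset.coe_nil, Multiset.cons_add,
      zero_add, hrev _ _ _ hra.symm, neg_add_cancel]
  | cons b l ih =>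
    have hn : (r :: b :: l).Nodup := h.sublist (List.Sublist.cons_cons _ (List.sublist_cons_self _ _))
    simp only [List.nodup_cons, List.mem_cons, not_or] at h
    simp only [walkArrows]
    set C := walkArrows b l r
    have h1 := ih b hn ((a, b) ::ₘ E)
    have h2 := ih b hn ((r, a) ::ₘ E)
    have h3 := eraseSum_add (f := f) (X := {(r, a), (a, b)}) (Y := {(r, b), (a, b)})
      (Z := {(r, b), (r, a)}) (by
        intro E
        simp only [Multiset.insert_eq_cons, Multiset.cons_add, Multiset.singleton_add]
        have := htri E a b r h.2.1.1 (Ne.symm h.1.1) (Ne.symm h.1.2.1)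
        rw [Multiset.cons_swap (r, b) (b, a), hrev _ b a (Ne.symm h.2.1.1),
          Multiset.cons_swap (a, b)] at this
        rw [Multiset.cons_swap (r, b) (r, a), ← this]
        abel) C E
    simp only [Multiset.insert_eq_cons, Multiset.cons_add, Multiset.singleton_add] at h3
    rw [eraseSum] at h1 h2
    rw [eraseSum, eraseSum, Multiset.cons_swap, h3, ← Multiset.cons_coe, Multiset.add_cons,
      ← Multiset.cons_add, eq_neg_of_add_eq_zero_left h1, eq_neg_of_add_eq_zero_left h2]
    abel

lemma walkArrows_eq_zip {α : Type*} (a : α) (l : List α) (r : α) :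
    walkArrows a l r = (a :: l).zip (l ++ [r]) := by
  induction l generalizing a with
  | nil => rfl
  | cons b l ih => simp [walkArrows, ih]

lemma ofFn_cycle_eq_walkArrows {α : Type*} {k : ℕ} (v : Fin (k + 1) → α) :
    List.ofFn (fun i => (v i, v (i + 1))) = walkArrows (v 0) (List.ofFn fun i => v i.succ) (v 0) := by
  rw [walkArrows_eq_zip, ← List.ofFn_succ]
  refine List.ext_getElem (by simp) fun i h1 h2 => ?_
  rw [List.getElem_ofFn, List.getElem_zip, List.getElem_ofFn]
  simp only [List.length_ofFn] at h1
  congr 1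
  rcases Nat.lt_or_ge i k with h | h
  · rw [List.getElem_append_left (by simpa using h), List.getElem_ofFn]
    congr 1
    apply Fin.ext
    rw [fin_val_add_one, if_neg (by simp; omega)]
    rfl
  · obtain rfl : i = k := by omega
    rw [List.getElem_append_right (by simp)]
    simp only [List.length_ofFn, Nat.sub_self, List.getElem_cons_zero]
    congr 1
    apply Fin.ext
    rw [fin_val_add_one, if_pos rfl]
    rfl

/-- The finite operad in terms of cycles, reversals of arrows, and triangles. -/
lemma mem_finOp_iff {n : ℕ} {f : QuivFun V n} : f ∈ finOp K V n ↔
    (∀ Γ, f Γ ∈ multilinear K V n) ∧ (∀ E, Cyclic (ofArrows E).1 → f (ofArrows E) = 0) ∧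
    (∀ E a b, a ≠ b → f (ofArrows ((a, b) ::ₘ E)) = -f (ofArrows ((b, a) ::ₘ E))) ∧
    ∀ E a b c, a ≠ b → a ≠ c → b ≠ c → f (ofArrows ((c, a) ::ₘ (a, b) ::ₘ E)) +
      f (ofArrows ((c, b) ::ₘ (b, a) ::ₘ E)) = f (ofArrows ((c, a) ::ₘ (c, b) ::ₘ E)) := by
  constructor
  · rintro ⟨h1, h2, h3⟩
    have hrev : ∀ E a b, a ≠ b →
        f (ofArrows ((a, b) ::ₘ E)) = -f (ofArrows ((b, a) ::ₘ E)) := by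
      intro E a b hab
      -- The reversal rule is the relation of the cycle `a → b → a`.
      have := h3 (ofArrows ((a, b) ::ₘ (b, a) ::ₘ E)) 1 ![a, b] ⟨?_, ?_⟩
      · change ∑ i : Fin 2, f ((ofArrows _).erase (![a, b] i, ![a, b] (i + 1))) = 0 at this
        rw [Fin.sum_univ_two] at this
        change f (Quiv.erase _ (a, b)) + f (Quiv.erase _ (b, a)) = 0 at this
        rw [ofArrows_erase, ofArrows_erase, ofArrows_cons hab, ofArrows_cons hab.symm,
          Multiset.erase_cons_head, Multiset.cons_swap, Multiset.erase_cons_head,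
          ← ofArrows_cons hab,
          ← ofArrows_cons hab.symm, ofArrows_val, ofArrows_val] at this
        exact eq_neg_of_add_eq_zero_right this
      · intro i j h
        fin_cases i <;> fin_cases j <;> simp_all
      · rw [ofArrows_cons hab, ofArrows_cons hab.symm]
        have : (Finset.univ : Finset (Fin 2)).val.map
            (fun i => ((![a, b] : Fin 2 → Fin n) i, (![a, b] : Fin 2 → Fin n) (i + 1))) =
            (a, b) ::ₘ (b, a) ::ₘ 0 := rfl
        rw [this]
        exact Multiset.cons_le_cons _ (Multiset.cons_le_cons _ (Multiset.zero_le _))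
    refine ⟨h1, fun E h => h2 _ (Quiv.hasCycle_of_cyclic h), hrev, ?_⟩
    intro E a b c hab hac hbc
    -- The triangle rule is the relation of the cycle `c → a → b → c` after reversing arrows.
    have := h3 (ofArrows ((c, a) ::ₘ (a, b) ::ₘ (b, c) ::ₘ E)) 2 ![c, a, b] ⟨?_, ?_⟩
    · change ∑ i : Fin 3, f ((ofArrows _).erase (![c, a, b] i, ![c, a, b] (i + 1))) = 0 at this
      rw [Fin.sum_univ_three] at this
      change f (Quiv.erase _ (c, a)) + f (Quiv.erase _ (a, b)) + f (Quiv.erase _ (b, c)) = 0 at this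
      have e1 : ∀ F : Multiset (Fin n × Fin n), ((c, a) ::ₘ (a, b) ::ₘ (b, c) ::ₘ F).erase (a, b) =
          (c, a) ::ₘ (b, c) ::ₘ F := fun F => by
        rw [Multiset.cons_swap, Multiset.erase_cons_head]
      have e2 : ∀ F : Multiset (Fin n × Fin n), ((c, a) ::ₘ (a, b) ::ₘ (b, c) ::ₘ F).erase (b, c) =
          (c, a) ::ₘ (a, b) ::ₘ F := fun F => by
        rw [Multiset.cons_swap (a, b), Multiset.cons_swap (c, a), Multiset.erase_cons_head]
      rw [ofArrows_erase, ofArrows_erase, ofArrows_erase, ofArrows_cons hac.symm, ofArrows_cons hab,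
        ofArrows_cons hbc, Multiset.erase_cons_head, e1, e2, ← ofArrows_cons hbc,
        ← ofArrows_cons hab, ofArrows_val, ofArrows_cons_val, ← ofArrows_cons hab, ofArrows_cons_val,
        Multiset.cons_swap (a, b) (b, c), Multiset.cons_swap (c, a) (b, c),
        hrev _ b c hbc, hrev _ b c hbc, Multiset.cons_swap (c, b) (a, b), hrev _ a b hab,
        neg_neg] at this
      rw [Multiset.cons_swap (c, b) (b, a), Multiset.cons_swap (c, a) (c, b)]
      have h := eq_neg_of_add_eq_zero_right this
      rw [h]
      abel
    · intro i j h
      fin_cases i <;> fin_cases j <;> simp_all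
    · rw [ofArrows_cons hac.symm, ofArrows_cons hab, ofArrows_cons hbc]
      have : (Finset.univ : Finset (Fin 3)).val.map
          (fun i => ((![c, a, b] : Fin 3 → Fin n) i, (![c, a, b] : Fin 3 → Fin n) (i + 1))) =
          (c, a) ::ₘ (a, b) ::ₘ (b, c) ::ₘ 0 := rfl
      rw [this]
      exact Multiset.cons_le_cons _ (Multiset.cons_le_cons _ (Multiset.cons_le_cons _
        (Multiset.zero_le _)))
  · rintro ⟨h1, h2, hrev, htri⟩
    refine ⟨h1, fun Γ h => ?_, fun Γ k v h => ?_⟩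
    · have := h2 Γ.1
      rw [ofArrows_val] at this
      exact this h.cyclic
    · obtain ⟨hv, hle⟩ := h
      simp only [ofArrows_erase]
      set l := List.ofFn fun i => (v i, v (i + 1)) with hl
      have hcoe : (Finset.univ : Finset (Fin (k + 1))).val.map (fun i => (v i, v (i + 1))) =
          (l : Multiset (Fin n × Fin n)) := by
        rw [hl, Fin.univ_val_map]
      rw [hcoe] at hle
      obtain ⟨F, hF⟩ := Multiset.le_iff_exists_add.1 hle
      have e1 : ∑ i, f (ofArrows (Γ.1.erase (v i, v (i + 1)))) =
          eraseSum (fun E => f (ofArrows E)) l F := by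
        rw [eraseSum_eq_sum, hl, List.map_ofFn, List.sum_ofFn, hF, Multiset.add_comm, hl]
        rfl
      rw [e1, hl, ofFn_cycle_eq_walkArrows]
      -- A directed cycle with one vertex would be a loop, which a quiver does not have.
      rcases k with _ | k
      · exfalso
        have : (v 0, v (0 + 1)) ∈ Γ.1 := by
          refine Multiset.mem_of_le hle ?_
          simp [hl]
        exact Γ.2 _ this (congrArg v (Subsingleton.elim (α := Fin 1) _ _))
      · rw [List.ofFn_succ, walkArrows]
        refine eraseSum_walkArrows hrev htri _ _ _ ?_ F
        have : (v 0 :: v (Fin.succ 0) :: List.ofFn fun i : Fin k => v i.succ.succ) =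
            List.ofFn v := by
          rw [List.ofFn_succ, List.ofFn_succ]
        rw [this]
        exact List.nodup_ofFn.2 hv

section Relations

variable {n : ℕ} {f : QuivFun V n} (hf : f ∈ finOp K V n)

lemma finOp_rev {n : ℕ} {f : QuivFun V n} (hf : f ∈ finOp K V n) (E : Multiset (Fin n × Fin n))
    {a b : Fin n} (h : a ≠ b) :
    f (ofArrows ((a, b) ::ₘ E)) = -f (ofArrows ((b, a) ::ₘ E)) := (mem_finOp_iff.1 hf).2.2.1 E a b h

lemma finOp_tri {n : ℕ} {f : QuivFun V n} (hf : f ∈ finOp K V n) (E : Multiset (Fin n × Fin n))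
    {a b c : Fin n} (hab : a ≠ b) (hac : a ≠ c) (hbc : b ≠ c) :
    f (ofArrows ((c, a) ::ₘ (a, b) ::ₘ E)) + f (ofArrows ((c, b) ::ₘ (b, a) ::ₘ E)) =
      f (ofArrows ((c, a) ::ₘ (c, b) ::ₘ E)) := (mem_finOp_iff.1 hf).2.2.2 E a b c hab hac hbc

lemma finOp_cyclic {n : ℕ} {f : QuivFun V n} (hf : f ∈ finOp K V n) {E : Multiset (Fin n × Fin n)}
    (h : Cyclic (ofArrows E).1) : f (ofArrows E) = 0 := (mem_finOp_iff.1 hf).2.1 E h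

lemma finOp_conn {n : ℕ} {f : QuivFun V n} (hf : f ∈ finOp K V n) {E : Multiset (Fin n × Fin n)}
    {a b : Fin n} (h : a ≠ b) (hc : Conn E a b) : f (ofArrows ((a, b) ::ₘ E)) = 0 :=
  finOp_cyclic hf ⟨a, b, _, ofArrows_cons h E, conn_ofArrows hc⟩

end Relations

lemma act_mem_finOp {n : ℕ} {f : QuivFun V n} (hf : f ∈ finOp K V n) (σ : Equiv.Perm (Fin n)) :
    act σ f ∈ finOp K V n := by
  rw [mem_finOp_iff]
  refine ⟨act_mem_multilinear hf.1 σ, fun E h => ?_, fun E a b h => ?_,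
    fun E a b c hab hac hbc => ?_⟩
  · funext v
    rw [act, relabel_ofArrows, finOp_cyclic hf]
    · rfl
    · rw [← relabel_ofArrows]
      obtain ⟨a, b, F, hF, hc⟩ := h
      refine ⟨σ a, σ b, F.map fun e => (σ e.1, σ e.2), ?_, hc.lift σ fun e he => ?_⟩
      · simp only [Quiv.relabel]
        rw [hF, Multiset.map_cons]
      · exact Conn.of_mem (Multiset.mem_map_of_mem (fun e => (σ e.1, σ e.2)) he)
  · funext v
    simp only [act, relabel_ofArrows, Multiset.map_cons, Pi.neg_apply]
    rw [finOp_rev hf _ (σ.injective.ne h)]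
    rfl
  · funext v
    simp only [act, relabel_ofArrows, Multiset.map_cons, Pi.add_apply]
    rw [← finOp_tri hf _ (σ.injective.ne hab) (σ.injective.ne hac) (σ.injective.ne hbc)]
    rfl

lemma collapse_ofArrows {a b N : ℕ} (h : a + b = N) (E : Multiset (Fin (N + 1) × Fin (N + 1))) :
    (ofArrows E).collapse h = ofArrows (E.map fun e => ((⟨e.1.val - b, by omega⟩ : Fin (a + 1)),
      (⟨e.2.val - b, by omega⟩ : Fin (a + 1)))) := by
  induction E using Multiset.induction_on with
  | empty => rfl
  | cons e E ih =>
    obtain ⟨x, y⟩ := e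
    by_cases hxy : x = y
    · subst hxy
      rw [ofArrows_cons_self, ih, Multiset.map_cons, ofArrows_cons_self]
    · apply Subtype.ext
      have := congrArg Subtype.val ih
      simp only [Quiv.collapse, ofArrows] at this ⊢
      rw [Multiset.filter_cons_of_pos (p := fun e : Fin (N + 1) × Fin (N + 1) => e.1 ≠ e.2) _ hxy,
        Multiset.map_cons, Multiset.map_cons]
      rw [← Multiset.singleton_add, ← Multiset.singleton_add, Multiset.filter_add,
        Multiset.filter_add]
      exact congrArg _ this

lemma restrict_ofArrows_cons {N b : ℕ} {x y : Fin (N + 1)} (E : Multiset (Fin (N + 1) × Fin (N + 1))) :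
    (ofArrows ((x, y) ::ₘ E)).restrict b = if h : x.val < b + 1 ∧ y.val < b + 1 then
      ofArrows ((⟨x.val, h.1⟩, ⟨y.val, h.2⟩) ::ₘ ((ofArrows E).restrict b).1)
      else (ofArrows E).restrict b := by
  by_cases hxy : x = y
  · subst hxy
    rw [ofArrows_cons_self]
    split_ifs
    · rw [ofArrows_cons_self, ofArrows_val]
    · rfl
  · apply Subtype.ext
    by_cases h : x.val < b + 1 ∧ y.val < b + 1
    · rw [dif_pos h, ofArrows_cons (by simpa [Fin.ext_iff] using hxy), ofArrows_val]
      simp only [Quiv.restrict]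
      rw [ofArrows_cons hxy]
      exact Multiset.filterMap_cons_some _ _ _ (by rw [dif_pos h])
    · rw [dif_neg h]
      simp only [Quiv.restrict]
      rw [ofArrows_cons hxy]
      exact Multiset.filterMap_cons_none _ _ (by rw [dif_neg h])

/-- The arrows are divided into those inside the collapsed block and the others; `Cyclic.of_add`
says that a cycle lies inside the block or survives its contraction. -/
lemma cyclic_collapse_or_restrict {a b N : ℕ} (h : a + b = N) {Γ : Quiv (N + 1)}
    (hc : Cyclic Γ.1) : Cyclic (Γ.collapse h).1 ∨ Cyclic (Γ.restrict b).1 := by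
  classical
  set p : Fin (N + 1) × Fin (N + 1) → Prop := fun e => e.1.val < b + 1 ∧ e.2.val < b + 1 with hp
  set π : Fin (N + 1) → Fin (a + 1) := fun i => ⟨i.val - b, by omega⟩ with hπ
  rw [← Multiset.filter_add_not p Γ.1] at hc
  have hI : ∀ e ∈ Γ.1.filter p, π e.1 = π e.2 := by
    intro e he
    have h1 := (Multiset.mem_filter.1 he).2
    simp only [hp] at h1
    exact Fin.ext (by simp only [hπ]; omega)
  rcases hc.of_add π hI with h1 | h1
  · right
    have key : ∀ E : Multiset (Fin (N + 1) × Fin (N + 1)), (∀ e ∈ E, p e) → Cyclic E →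
        Cyclic (E.filterMap (fun e => if h : e.1.val < b + 1 ∧ e.2.val < b + 1 then
          some ((⟨e.1.val, h.1⟩ : Fin (b + 1)), (⟨e.2.val, h.2⟩ : Fin (b + 1))) else none)) := by
      rintro E hE ⟨x, y, F, rfl, hF⟩
      have hxy := hE (x, y) (Multiset.mem_cons_self _ _)
      -- A total function that is the identity on the vertices of the block; its values elsewhere
      -- play no role.
      set c : Fin (N + 1) → Fin (b + 1) := fun i => ⟨min i.val b, by omega⟩
      refine ⟨c x, c y, _, Multiset.filterMap_cons_some _ _ _ ?_, hF.lift c fun e he => ?_⟩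
      · rw [dif_pos hxy]
        have h1 := hxy.1
        have h2 := hxy.2
        simp only at h1 h2
        simp only [c, Option.some.injEq, Prod.mk.injEq, Fin.mk.injEq]
        omega
      · have he' := hE e (Multiset.mem_cons_of_mem he)
        refine Conn.of_mem ((Multiset.mem_filterMap _ _).2 ⟨e, he, ?_⟩)
        rw [dif_pos he']
        have h1 := he'.1
        have h2 := he'.2
        simp only [c, Option.some.injEq, Prod.mk.injEq, Fin.mk.injEq]
        omega
    refine (key _ (fun e he => (Multiset.mem_filter.1 he).2) h1).mono ?_
    exact Multiset.filterMap_le_filterMap _ (Multiset.filter_le _ _)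
  · left
    refine h1.mono ?_
    refine Multiset.le_filter.2 ⟨Multiset.map_le_map (Multiset.filter_le _ _), fun e he => ?_⟩
    obtain ⟨x, hx, rfl⟩ := Multiset.mem_map.1 he
    obtain ⟨hx1, hx2⟩ := Multiset.mem_filter.1 hx
    have := Γ.2 x hx1
    simp only [hp, hπ, ne_eq, Fin.ext_iff] at hx2 this ⊢
    omega

/-- The rules of `mem_finOp_iff` are checked by the position of their vertices relative to the block
fed to `g`. A rule whose arrows lie in the block is one of `g`; a rule whose vertices stay different
after the collapse is one of `f`; the mixed triangles are the remaining case. -/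
lemma circ_mem_finOp {a b N : ℕ} (h : a + b = N) {f : QuivFun V (a + 1)} {g : QuivFun V (b + 1)}
    (hf : f ∈ finOp K V (a + 1)) (hg : g ∈ finOp K V (b + 1)) :
    circ h f g ∈ finOp K V (N + 1) := by
  have hlin : ∀ (F : Quiv (a + 1)) (v : Fin (N + 1) → V),
      ∃ L : V →ₗ[K] V, ∀ x, f F (fun i : Fin (a + 1) => if i = 0 then x else
        v ⟨i.val + b, by omega⟩) = L x := by
    intro F v
    obtain ⟨G, hG⟩ := hf.1 F
    refine ⟨G.toLinearMap (fun i => v ⟨i.val + b, by omega⟩) 0, fun x => ?_⟩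
    rw [← hG, MultilinearMap.toLinearMap_apply]
    congr 1
    funext i
    split_ifs with hi
    · subst hi; simp
    · rw [Function.update_of_ne hi]
  rw [mem_finOp_iff]
  refine ⟨circ_mem_multilinear h hf.1 hg.1, fun E hE => ?_, fun E x y hxy => ?_,
    fun E x y z hxy hxz hyz => ?_⟩
  · funext v
    rcases cyclic_collapse_or_restrict h hE with hc | hc
    · rw [← ofArrows_val (Quiv.collapse h _)] at hc
      rw [circ, ← ofArrows_val (Quiv.collapse h _), finOp_cyclic hf hc]
      rfl
    · obtain ⟨L, hL⟩ := hlin ((ofArrows E).collapse h) v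
      rw [← ofArrows_val (Quiv.restrict b _)] at hc
      rw [circ, hL, ← ofArrows_val (Quiv.restrict b _), finOp_cyclic hg hc]
      simp
  · funext v
    simp only [circ, Pi.neg_apply]
    by_cases hin : x.val < b + 1 ∧ y.val < b + 1
    · obtain ⟨L, hL⟩ := hlin ((ofArrows E).collapse h) v
      have hl : ∀ x y : Fin (N + 1), x.val < b + 1 ∧ y.val < b + 1 →
          (ofArrows ((x, y) ::ₘ E)).collapse h = (ofArrows E).collapse h := by
        intro x y hxy
        rw [collapse_ofArrows, collapse_ofArrows, Multiset.map_cons]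
        have : (⟨x.val - b, by omega⟩ : Fin (a + 1)) = ⟨y.val - b, by omega⟩ := by
          apply Fin.ext; simp only; omega
        simp only [this]
        rw [ofArrows_cons_self]
      rw [hl x y hin, hl y x hin.symm, restrict_ofArrows_cons, restrict_ofArrows_cons, dif_pos hin,
        dif_pos hin.symm, hL, hL, finOp_rev hg _ (by simpa [Fin.ext_iff] using hxy)]
      simp
    · rw [restrict_ofArrows_cons, restrict_ofArrows_cons, dif_neg hin,
        dif_neg (fun h => hin h.symm), collapse_ofArrows, collapse_ofArrows, Multiset.map_cons,
        Multiset.map_cons, finOp_rev hf]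
      · rfl
      · simp only [Fin.ext_iff, ne_eq] at hxy ⊢
        omega
  · funext v
    set π : Fin (N + 1) → Fin (a + 1) := fun i => ⟨i.val - b, by omega⟩ with hπ
    have hcol : ∀ E, (ofArrows E).collapse h = ofArrows (E.map fun e => (π e.1, π e.2)) :=
      fun E => collapse_ofArrows h E
    have hπeq : ∀ x y : Fin (N + 1), x.val < b + 1 → y.val < b + 1 → π x = π y := by
      intro x y hx hy
      simp only [hπ, Fin.mk.injEq]
      omega
    have hπne : ∀ x y : Fin (N + 1), x ≠ y → ¬(x.val < b + 1 ∧ y.val < b + 1) → π x ≠ π y := by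
      intro x y hxy hn
      simp only [hπ, ne_eq, Fin.ext_iff] at hxy ⊢
      omega
    have hvne : ∀ {x y : Fin (N + 1)} (_ : x ≠ y) (hx : x.val < b + 1) (hy : y.val < b + 1),
        (⟨x.val, hx⟩ : Fin (b + 1)) ≠ ⟨y.val, hy⟩ := by
      intro x y hxy _ _ e
      exact hxy (Fin.ext (Fin.mk.inj e))
    have hdouble : ∀ {x y : Fin (a + 1)} (_ : x ≠ y) (P : Multiset (Fin (a + 1) × Fin (a + 1))),
        f (ofArrows ((x, y) ::ₘ (x, y) ::ₘ P)) = 0 := fun hxy P =>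
      finOp_conn hf hxy (Conn.of_mem (Multiset.mem_cons_self _ _))
    have hdouble' : ∀ {x y : Fin (a + 1)} (_ : x ≠ y) (P : Multiset (Fin (a + 1) × Fin (a + 1))),
        f (ofArrows ((x, y) ::ₘ (y, x) ::ₘ P)) = 0 := fun hxy P =>
      finOp_conn hf hxy (Conn.of_mem (Multiset.mem_cons_self _ _)).symm
    simp only [circ, Pi.add_apply, hcol, Multiset.map_cons]
    simp only [restrict_ofArrows_cons]
    set ρ := ((ofArrows E).restrict b).1 with hρ
    set P := E.map fun e => (π e.1, π e.2) with hP
    -- With exactly two of the three vertices in the block, one summand acquires two parallel or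
    -- opposite arrows and vanishes; the other two agree or cancel by the reversal rule for `g`.
    by_cases hx : x.val < b + 1 <;> by_cases hy : y.val < b + 1 <;> by_cases hz : z.val < b + 1
    · obtain ⟨L, hL⟩ := hlin (ofArrows P) v
      simp only [hπeq x y hx hy, hπeq z y hz hy,
        ofArrows_cons_self, hx, hy, hz, and_self, dite_true, ofArrows_cons_val]
      rw [hL, hL, hL, ← map_add]
      congr 1
      exact congrFun (finOp_tri hg ρ (hvne hxy hx hy) (hvne hxz hx hz) (hvne hyz hy hz)) _
    · obtain ⟨L, hL⟩ := hlin (ofArrows ((π z, π y) ::ₘ P)) v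
      simp only [hπeq x y hx hy, ofArrows_cons_self, Multiset.cons_swap (π z, π y) (π y, π y),
        hx, hy, hz, and_self, false_and, dite_true, dite_false, ofArrows_cons_val]
      rw [hdouble (hπne z y (Ne.symm hyz) (by omega)), hL, hL, finOp_rev hg _ (hvne hxy hx hy),
        Pi.neg_apply, map_neg, neg_add_cancel]
      rfl
    · simp only [hπeq z x hz hx, ofArrows_cons_self,
        hx, hy, hz, and_self, and_false, false_and, dite_true, dite_false]
      rw [hdouble' (hπne x y hxy (by omega))]
      exact add_zero _
    · simp only [hx, hy, hz, and_self, and_false, false_and, dite_false]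
      rw [← finOp_tri hf P (hπne x y hxy (by omega)) (hπne x z hxz (by omega))
        (hπne y z hyz (by omega))]
      rfl
    · simp only [hπeq z y hz hy, ofArrows_cons_self, Multiset.cons_swap (π y, π x) (π y, π y),
        hx, hy, hz, and_self, and_false, false_and, dite_true, dite_false, ofArrows_cons_val]
      rw [hdouble' (hπne y x (Ne.symm hxy) (by omega))]
      exact zero_add _
    · simp only [hx, hy, hz, and_self, and_false, false_and, dite_false]
      rw [← finOp_tri hf P (hπne x y hxy (by omega)) (hπne x z hxz (by omega))
        (hπne y z hyz (by omega))]
      rfl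
    · simp only [hx, hy, hz, and_self, and_false, dite_false]
      rw [← finOp_tri hf P (hπne x y hxy (by omega)) (hπne x z hxz (by omega))
        (hπne y z hyz (by omega))]
      rfl
    · simp only [hx, hy, hz, and_self, dite_false]
      rw [← finOp_tri hf P (hπne x y hxy (by omega)) (hπne x z hxz (by omega))
        (hπne y z hyz (by omega))]
      rfl

end FinOp

/-! ### The Maurer-Cartan element -/

section Arrows

variable {M : Type*}

open Classical in
/-- The number of arrows from `S` to `T`. -/
def arrowCount (E : Multiset (M × M)) (S T : Set M) : ℕ :=
  E.countP fun e => e.1 ∈ S ∧ e.2 ∈ T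

lemma arrowCount_union_left (E : Multiset (M × M)) {S S' : Set M} (h : Disjoint S S') (T : Set M) :
    arrowCount E (S ∪ S') T = arrowCount E S T + arrowCount E S' T := by
  classical
  induction E using Multiset.induction_on with
  | empty => rfl
  | cons e E ih =>
    simp only [arrowCount, Multiset.countP_cons] at ih ⊢
    rw [ih]
    have : e.1 ∈ S → e.1 ∉ S' := fun k => Set.disjoint_left.1 h k
    by_cases h1 : e.1 ∈ S <;> by_cases h2 : e.1 ∈ S' <;> by_cases h3 : e.2 ∈ T <;>
      simp [h1, h2, h3] at this ⊢ <;> omega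

lemma arrowCount_union_right (E : Multiset (M × M)) (S : Set M) {T T' : Set M} (h : Disjoint T T') :
    arrowCount E S (T ∪ T') = arrowCount E S T + arrowCount E S T' := by
  classical
  induction E using Multiset.induction_on with
  | empty => rfl
  | cons e E ih =>
    simp only [arrowCount, Multiset.countP_cons] at ih ⊢
    rw [ih]
    have : e.2 ∈ T → e.2 ∉ T' := fun k => Set.disjoint_left.1 h k
    by_cases h1 : e.2 ∈ T <;> by_cases h2 : e.2 ∈ T' <;> by_cases h3 : e.1 ∈ S <;>
      simp [h1, h2, h3] at this ⊢ <;> omega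

lemma count_quiverOn {n : ℕ} (E : Multiset (M × M)) (S : Fin n → Set M) {i j : Fin n}
    (hij : i ≠ j) : (quiverOn E S).1.count (i, j) = arrowCount E (S i) (S j) := by
  classical
  induction E using Multiset.induction_on with
  | empty => rfl
  | cons e E ih =>
    simp only [arrowCount, Multiset.countP_cons, quiverOn, Multiset.cons_bind,
      Multiset.count_add] at ih ⊢
    rw [ih, add_comm]
    congr 1
    by_cases h : e.1 ∈ S i ∧ e.2 ∈ S j
    · rw [if_pos h, Multiset.count_eq_one_of_mem (Finset.nodup _)]
      exact Finset.mem_filter.2 ⟨Finset.mem_univ _, hij, h⟩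
    · rw [if_neg h, Multiset.count_eq_zero_of_notMem]
      intro h'
      exact h (Finset.mem_filter.1 h').2.2

lemma eq_iff_count_fin_two {E F : Multiset (Fin 2 × Fin 2)} (hE : ∀ e ∈ E, e.1 ≠ e.2)
    (hF : ∀ e ∈ F, e.1 ≠ e.2) : E = F ↔
      E.count (0, 1) = F.count (0, 1) ∧ E.count (1, 0) = F.count (1, 0) := by
  constructor
  · rintro rfl; exact ⟨rfl, rfl⟩
  · rintro ⟨h1, h2⟩
    ext ⟨i, j⟩
    by_cases h : i = j
    · subst h
      rw [Multiset.count_eq_zero_of_notMem fun h => hE _ h rfl,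
        Multiset.count_eq_zero_of_notMem fun h => hF _ h rfl]
    · fin_cases i <;> fin_cases j <;> first | exact absurd rfl h | assumption

/-- The coefficient of the bracket in the Maurer-Cartan element. -/
def bracketCoeff (i j : ℕ) : ℤ := if i = 0 ∧ j = 0 then 1 else 0

/-- The coefficient of the product in the Maurer-Cartan element. -/
def mulCoeff (i j : ℕ) : ℤ := if i = 1 ∧ j = 0 then 1 else if i = 0 ∧ j = 1 then -1 else 0

end Arrows

namespace PoissonAlgebra

variable {K V M : Type*} [Field K] [AddCommGroup V] [Module K V] (A : PoissonAlgebra K V)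

lemma X_eq : A.X = A.Xh + A.Xv := by
  funext Γ v
  simp only [X, Xh, Xv, Pi.add_apply]
  by_cases h : Γ.1 = 0
  · have h1 : ¬ Γ.1 = {((0 : Fin 2), (1 : Fin 2))} := by rw [h]; exact (Multiset.singleton_ne_zero _).symm
    have h2 : ¬ Γ.1 = {((1 : Fin 2), (0 : Fin 2))} := by rw [h]; exact (Multiset.singleton_ne_zero _).symm
    rw [if_pos h, if_pos h, if_neg h1, if_neg h2, add_zero]
  · rw [if_neg h, if_neg h, zero_add]

lemma evalList_pair {V : Type*} [Zero V] (f : QuivFun V 2) (E : Multiset (M × M))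
    (x y : Set M × V) :
    evalList f E [x, y] = f (quiverOn E fun i => (![x, y] i).1) (fun i => (![x, y] i).2) := by
  exact evalList_ofFn f E ![x, y]

lemma evalList_Xh (E : Multiset (M × M)) (x y : Set M × V) :
    evalList A.Xh E [x, y] =
      bracketCoeff (arrowCount E x.1 y.1) (arrowCount E y.1 x.1) • A.bracket x.2 y.2 := by
  have key : (quiverOn E fun i => (![x, y] i).1).1 = 0 ↔
      arrowCount E x.1 y.1 = 0 ∧ arrowCount E y.1 x.1 = 0 := by
    rw [eq_iff_count_fin_two (quiverOn E _).2 (by simp), count_quiverOn _ _ (by decide),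
      count_quiverOn _ _ (by decide)]
    rfl
  rw [evalList_pair, Xh, bracketCoeff]
  simp only [key]
  split_ifs
  · simp
  · simp

lemma evalList_Xv (E : Multiset (M × M)) (x y : Set M × V) :
    evalList A.Xv E [x, y] =
      mulCoeff (arrowCount E x.1 y.1) (arrowCount E y.1 x.1) • A.mul x.2 y.2 := by
  have key : (quiverOn E fun i => (![x, y] i).1).1 = {(0, 1)} ↔
      arrowCount E x.1 y.1 = 1 ∧ arrowCount E y.1 x.1 = 0 := by
    rw [eq_iff_count_fin_two (quiverOn E _).2 (by simp), count_quiverOn _ _ (by decide),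
      count_quiverOn _ _ (by decide)]
    rfl
  have key' : (quiverOn E fun i => (![x, y] i).1).1 = {(1, 0)} ↔
      arrowCount E x.1 y.1 = 0 ∧ arrowCount E y.1 x.1 = 1 := by
    rw [eq_iff_count_fin_two (quiverOn E _).2 (by simp), count_quiverOn _ _ (by decide),
      count_quiverOn _ _ (by decide)]
    rfl
  rw [evalList_pair, Xv, mulCoeff]
  simp only [key, key']
  split_ifs <;> simp

lemma bracketCoeff_comm (i j : ℕ) : bracketCoeff i j = bracketCoeff j i := by
  simp only [bracketCoeff, and_comm]

lemma mulCoeff_comm (i j : ℕ) : mulCoeff i j = -mulCoeff j i := by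
  simp only [mulCoeff]
  split_ifs <;> first | rfl | omega

lemma length_eq_two_of_swap {α : Type*} {l₁ l₂ : List α} {x y : α}
    (h : (l₁ ++ x :: y :: l₂).length = 2) : l₁ = [] ∧ l₂ = [] := by
  simp only [List.length_append, List.length_cons] at h
  exact ⟨List.eq_nil_of_length_eq_zero (by omega), List.eq_nil_of_length_eq_zero (by omega)⟩

lemma isSkew_two {f : QuivFun V 2} (h : ∀ (E : Multiset (Fin 2 × Fin 2)) (x y : Set (Fin 2) × V),
    evalList f E [x, y] = -evalList f E [y, x]) : IsSkew f := by
  refine isSkew_of_evalList_swap fun E l₁ x y l₂ _ => ?_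
  by_cases hl : (l₁ ++ x :: y :: l₂).length = 2
  · obtain ⟨rfl, rfl⟩ := length_eq_two_of_swap hl
    exact h E x y
  · rw [evalList_of_ne _ _ hl, evalList_of_ne _ _ (by simpa using hl), neg_zero]

lemma Xh_isSkew : IsSkew A.Xh := isSkew_two fun E x y => by
  rw [evalList_Xh, evalList_Xh, A.antisymm, bracketCoeff_comm, smul_neg]

lemma Xv_isSkew : IsSkew A.Xv := isSkew_two fun E x y => by
  rw [evalList_Xv, evalList_Xv, A.mul_comm, mulCoeff_comm, neg_smul]

lemma mem_multilinear_two {f : (Fin 2 → V) → V} {B : V →ₗ[K] V →ₗ[K] V}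
    (h : ∀ v, f v = B (v 0) (v 1)) : f ∈ multilinear K V 2 := by
  rw [mem_multilinear_iff]
  constructor
  · intro v i x y
    fin_cases i <;> simp [h]
  · intro v i x y
    fin_cases i <;> simp [h]

lemma Xh_multilinear (Γ : Quiv 2) : A.Xh Γ ∈ multilinear K V 2 := by
  by_cases h : Γ.1 = 0
  · exact mem_multilinear_two (B := A.bracket) fun v => if_pos h
  · exact mem_multilinear_two (B := 0) fun v => if_neg h

lemma Xv_multilinear (Γ : Quiv 2) : A.Xv Γ ∈ multilinear K V 2 := by
  by_cases h : Γ.1 = {(0, 1)}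
  · exact mem_multilinear_two (B := A.mul) fun v => if_pos h
  · by_cases h' : Γ.1 = {(1, 0)}
    · exact mem_multilinear_two (B := -A.mul) fun v => (if_neg h).trans (if_pos h')
    · exact mem_multilinear_two (B := 0) fun v => (if_neg h).trans (if_neg h')

lemma one_lt_card_of_cyclic {n : ℕ} {Γ : Quiv n} (h : Cyclic Γ.1) : 1 < Multiset.card Γ.1 := by
  obtain ⟨a, b, E, hE, hc⟩ := h
  have hab : a ≠ b := Γ.2 (a, b) (by rw [hE]; exact Multiset.mem_cons_self _ _)
  have : E ≠ 0 := by
    rintro rfl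
    rcases Relation.ReflTransGen.cases_head hc with h | ⟨c, h, -⟩
    · exact hab h
    · simp at h
  rw [hE, Multiset.card_cons]
  have := Multiset.card_pos.2 this
  omega

lemma Xh_mem_finCx : A.Xh ∈ finCx K V 1 := by
  refine ⟨mem_finOp_iff.2 ⟨A.Xh_multilinear, fun E h => ?_, fun E a b h => ?_,
    fun E a b c hab hac hbc => by omega⟩, A.Xh_isSkew⟩
  · have := one_lt_card_of_cyclic h
    funext v
    refine if_neg fun h => ?_
    rw [h] at this
    simp at this
  · funext v
    rw [Pi.neg_apply, Xh, if_neg, Xh, if_neg, neg_zero]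
    · rw [ofArrows_cons h.symm]; exact Multiset.cons_ne_zero
    · rw [ofArrows_cons h]; exact Multiset.cons_ne_zero

lemma Xv_mem_finCx : A.Xv ∈ finCx K V 1 := by
  refine ⟨mem_finOp_iff.2 ⟨A.Xv_multilinear, fun E h => ?_, fun E a b h => ?_,
    fun E a b c hab hac hbc => by omega⟩, A.Xv_isSkew⟩
  · have := one_lt_card_of_cyclic h
    funext v
    refine (if_neg fun h => ?_).trans (if_neg fun h => ?_)
    · rw [h] at this
      simp at this
    · rw [h] at this
      simp at this
  · have key : ∀ E : Multiset (Fin 2 × Fin 2), A.Xv (ofArrows ((0, 1) ::ₘ E)) =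
        -A.Xv (ofArrows ((1, 0) ::ₘ E)) := by
      intro E
      funext v
      simp only [Pi.neg_apply, Xv, ofArrows_cons (show (0 : Fin 2) ≠ 1 by decide),
        ofArrows_cons (show (1 : Fin 2) ≠ 0 by decide)]
      by_cases hE : (ofArrows E).1 = 0
      · rw [hE]
        simp
      · have : ∀ x y : Fin 2 × Fin 2, ¬ x ::ₘ (ofArrows E).1 = {y} := by
          intro x y h
          apply hE
          have := congrArg Multiset.card h
          rw [Multiset.card_cons, Multiset.card_singleton] at this
          exact Multiset.card_eq_zero.1 (by omega)
        simp only [this, if_false, neg_zero]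
    have hab : (a = 0 ∧ b = 1) ∨ (a = 1 ∧ b = 0) := by revert a b; decide
    rcases hab with ⟨rfl, rfl⟩ | ⟨rfl, rfl⟩
    · exact key E
    · rw [key E, neg_neg]

lemma X_mem_finCx : A.X ∈ finCx K V 1 := by
  rw [X_eq]
  exact add_mem A.Xh_mem_finCx A.Xv_mem_finCx

/-- The value of a composition of two operations of arity two on three letters. -/
lemma evalList_box_three {P Q : QuivFun V 2} (E : Multiset (M × M)) {x y z : Set M × V}
    (h : DisjointLetters [x, y, z]) :
    evalList (box (a := 1) (b := 1) (N := 2) rfl P Q) E [x, y, z] =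
      evalList P E [(x.1 ∪ y.1, evalList Q E [x, y]), z] -
      evalList P E [(x.1 ∪ z.1, evalList Q E [x, z]), y] +
      evalList P E [(y.1 ∪ z.1, evalList Q E [y, z]), x] := by
  rw [evalList_box _ _ _ _ h]
  simp only [unshuffleSum_cons, unshuffleSum_zero, evalComp, unionSet_cons, unionSet_nil,
    Set.union_empty, unshuffleSum_of_lt (show ([] : List (Set M × V)).length < 1 by simp),
    unshuffleSum_of_lt (show ([] : List (Set M × V)).length < 1 + 1 by simp)]
  simp
  abel

lemma eq_zero_of_three {f : QuivFun V 3} (h : ∀ (E : Multiset (Fin 3 × Fin 3))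
    (x y z : Set (Fin 3) × V), DisjointLetters [x, y, z] → evalList f E [x, y, z] = 0) : f = 0 := by
  refine ext_evalList fun E l hl => ?_
  rw [evalList_zero]
  by_cases hn : l.length = 3
  · obtain ⟨x, y, z, rfl⟩ := List.length_eq_three.1 hn
    exact h E x y z hl
  · exact evalList_of_ne _ _ hn

lemma smul_eq_zero_of_coeff {c : ℤ} (h : c = 0) (v : V) : c • v = 0 := by rw [h, zero_smul]

/-- Without any arrow this is the Jacobi identity; an arrow between two of the three letters makes a
coefficient of each summand zero. -/
lemma box_Xh_Xh : box (a := 1) (b := 1) (N := 2) rfl A.Xh A.Xh = 0 := by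
  refine eq_zero_of_three fun E x y z hd => ?_
  rw [evalList_box_three E hd]
  simp only [DisjointLetters, List.pairwise_cons, List.mem_cons, List.not_mem_nil, or_false,
    forall_eq_or_imp, forall_eq] at hd
  obtain ⟨⟨hxy, hxz⟩, hyz, -⟩ := hd
  simp only [evalList_Xh, arrowCount_union_left E hxy, arrowCount_union_left E hxz,
    arrowCount_union_left E hyz, arrowCount_union_right E _ hxy, arrowCount_union_right E _ hxz,
    arrowCount_union_right E _ hyz]
  generalize arrowCount E x.1 y.1 = a
  generalize arrowCount E y.1 x.1 = a'
  generalize arrowCount E x.1 z.1 = b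
  generalize arrowCount E z.1 x.1 = b'
  generalize arrowCount E y.1 z.1 = c
  generalize arrowCount E z.1 y.1 = c'
  simp only [bracketCoeff]
  by_cases h : a = 0 ∧ a' = 0 ∧ b = 0 ∧ b' = 0 ∧ c = 0 ∧ c' = 0
  · obtain ⟨rfl, rfl, rfl, rfl, rfl, rfl⟩ := h
    simp only [and_self, if_true, one_smul, add_zero]
    have := A.jacobi x.2 y.2 z.2
    rw [A.antisymm x.2 (A.bracket y.2 z.2), A.antisymm y.2 (A.bracket x.2 z.2)] at this
    rw [← sub_eq_zero] at this
    rw [← neg_zero, ← this]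
    abel
  · split_ifs <;> first | omega | simp

/-- By commutativity and associativity the three double products coincide, and an identity between
integer coefficients in the six numbers of arrows remains. -/
lemma box_Xv_Xv : box (a := 1) (b := 1) (N := 2) rfl A.Xv A.Xv = 0 := by
  refine eq_zero_of_three fun E x y z hd => ?_
  rw [evalList_box_three E hd]
  simp only [DisjointLetters, List.pairwise_cons, List.mem_cons, List.not_mem_nil, or_false,
    forall_eq_or_imp, forall_eq] at hd
  obtain ⟨⟨hxy, hxz⟩, hyz, -⟩ := hd
  simp only [evalList_Xv, arrowCount_union_left E hxy, arrowCount_union_left E hxz,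
    arrowCount_union_left E hyz, arrowCount_union_right E _ hxy, arrowCount_union_right E _ hxz,
    arrowCount_union_right E _ hyz]
  generalize arrowCount E x.1 y.1 = a
  generalize arrowCount E y.1 x.1 = a'
  generalize arrowCount E x.1 z.1 = b
  generalize arrowCount E z.1 x.1 = b'
  generalize arrowCount E y.1 z.1 = c
  generalize arrowCount E z.1 y.1 = c'
  have e1 : A.mul (A.mul x.2 z.2) y.2 = A.mul (A.mul x.2 y.2) z.2 := by
    rw [A.mul_assoc, A.mul_comm z.2, A.mul_assoc]
  have e2 : A.mul (A.mul y.2 z.2) x.2 = A.mul (A.mul x.2 y.2) z.2 := by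
    rw [A.mul_comm, A.mul_assoc]
  simp only [map_zsmul, LinearMap.smul_apply, e1, e2, smul_smul, ← sub_smul, ← add_smul]
  refine smul_eq_zero_of_coeff ?_ _
  -- Two products use up exactly two arrows. For two arrows in total the identity is a finite check;
  -- otherwise every coefficient vanishes.
  by_cases h : a + a' + b + b' + c + c' = 2
  · have key : ∀ a a' b b' c c' : Fin 3, (mulCoeff (b + c) (b' + c') * mulCoeff a a' -
      mulCoeff (a + c') (a' + c) * mulCoeff b b' + mulCoeff (a' + b') (a + b) * mulCoeff c c') = 0 ∨
      (a : ℕ) + a' + b + b' + c + c' ≠ 2 := by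
      unfold mulCoeff
      decide
    exact (key ⟨a, by omega⟩ ⟨a', by omega⟩ ⟨b, by omega⟩ ⟨b', by omega⟩ ⟨c, by omega⟩
      ⟨c', by omega⟩).resolve_right (fun h' => h' h)
  · have key : ∀ i j k l : ℕ, i + j + k + l ≠ 2 → mulCoeff i j * mulCoeff k l = 0 := by
      intro i j k l h
      unfold mulCoeff
      split_ifs <;> omega
    rw [key _ _ _ _ (by omega), key _ _ _ _ (by omega), key _ _ _ _ (by omega)]
    rfl

/-- Only one arrow in total contributes, and its six positions give instances of the Leibniz rule.
-/
lemma box_Xh_Xv : box (a := 1) (b := 1) (N := 2) rfl A.Xh A.Xv +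
    box (a := 1) (b := 1) (N := 2) rfl A.Xv A.Xh = 0 := by
  refine eq_zero_of_three fun E x y z hd => ?_
  rw [evalList_add, evalList_box_three E hd, evalList_box_three E hd]
  simp only [DisjointLetters, List.pairwise_cons, List.mem_cons, List.not_mem_nil, or_false,
    forall_eq_or_imp, forall_eq] at hd
  obtain ⟨⟨hxy, hxz⟩, hyz, -⟩ := hd
  simp only [evalList_Xv, evalList_Xh, arrowCount_union_left E hxy, arrowCount_union_left E hxz,
    arrowCount_union_left E hyz, arrowCount_union_right E _ hxy, arrowCount_union_right E _ hxz,
    arrowCount_union_right E _ hyz]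
  generalize arrowCount E x.1 y.1 = a
  generalize arrowCount E y.1 x.1 = a'
  generalize arrowCount E x.1 z.1 = b
  generalize arrowCount E z.1 x.1 = b'
  generalize arrowCount E y.1 z.1 = c
  generalize arrowCount E z.1 y.1 = c'
  simp only [map_zsmul, LinearMap.smul_apply, smul_smul]
  generalize x.2 = x, y.2 = y, z.2 = z
  have leib : ∀ x y z, A.bracket (A.mul x y) z =
      A.mul (A.bracket x z) y + A.mul (A.bracket y z) x := by
    intro x y z
    rw [A.antisymm, A.leibniz, A.antisymm z x, A.antisymm z y, map_neg, map_neg,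
      LinearMap.neg_apply, neg_add, neg_neg, neg_neg, A.mul_comm x]
  rw [leib x y z, leib x z y, leib y z x, A.antisymm z y, A.antisymm z x, A.antisymm y x]
  simp only [map_neg, LinearMap.neg_apply]
  by_cases h : a + a' + b + b' + c + c' = 1
  · have : (a = 1 ∧ a' = 0 ∧ b = 0 ∧ b' = 0 ∧ c = 0 ∧ c' = 0) ∨
        (a = 0 ∧ a' = 1 ∧ b = 0 ∧ b' = 0 ∧ c = 0 ∧ c' = 0) ∨
        (a = 0 ∧ a' = 0 ∧ b = 1 ∧ b' = 0 ∧ c = 0 ∧ c' = 0) ∨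
        (a = 0 ∧ a' = 0 ∧ b = 0 ∧ b' = 1 ∧ c = 0 ∧ c' = 0) ∨
        (a = 0 ∧ a' = 0 ∧ b = 0 ∧ b' = 0 ∧ c = 1 ∧ c' = 0) ∨
        (a = 0 ∧ a' = 0 ∧ b = 0 ∧ b' = 0 ∧ c = 0 ∧ c' = 1) := by omega
    rcases this with ⟨rfl, rfl, rfl, rfl, rfl, rfl⟩ | ⟨rfl, rfl, rfl, rfl, rfl, rfl⟩ |
      ⟨rfl, rfl, rfl, rfl, rfl, rfl⟩ | ⟨rfl, rfl, rfl, rfl, rfl, rfl⟩ |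
      ⟨rfl, rfl, rfl, rfl, rfl, rfl⟩ | ⟨rfl, rfl, rfl, rfl, rfl, rfl⟩ <;>
    · simp [bracketCoeff, mulCoeff]
      try abel
  · have key : ∀ i j k l : ℕ, i + j + k + l ≠ 1 → bracketCoeff i j * mulCoeff k l = 0 := by
      intro i j k l h
      unfold mulCoeff bracketCoeff
      split_ifs <;> omega
    have key' : ∀ i j k l : ℕ, i + j + k + l ≠ 1 → mulCoeff i j * bracketCoeff k l = 0 := by
      intro i j k l h
      rw [_root_.mul_comm]
      exact key _ _ _ _ (by omega)
    rw [key _ _ _ _ (by omega), key _ _ _ _ (by omega), key _ _ _ _ (by omega),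
      key' _ _ _ _ (by omega), key' _ _ _ _ (by omega), key' _ _ _ _ (by omega)]
    simp

end PoissonAlgebra

/-! ### Closure of the complex under the bracket. -/

section FinCx

variable {K V : Type*} [Field K] [AddCommGroup V] [Module K V]

lemma box_mem_finCx {a b N : ℕ} (h : a + b = N) {f : QuivFun V (a + 1)} {g : QuivFun V (b + 1)}
    (hf : f ∈ finCx K V a) (hg : g ∈ finCx K V b) : box h f g ∈ finCx K V N := by
  refine ⟨?_, box_isSkew h hf.1.1 hf.2 hg.2⟩
  rw [box]
  exact Submodule.sum_mem _ fun σ _ => zsmul_mem (act_mem_finOp (circ_mem_finOp h hf.1 hg.1) _) _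

lemma lieBracket_mem_finCx {a b N : ℕ} (h : a + b = N) {f : QuivFun V (a + 1)}
    {g : QuivFun V (b + 1)} (hf : f ∈ finCx K V a) (hg : g ∈ finCx K V b) :
    lieBracket h f g ∈ finCx K V N :=
  sub_mem (box_mem_finCx h hf hg) (zsmul_mem (box_mem_finCx _ hg hf) _)

end FinCx

namespace PoissonAlgebra

variable {K V M : Type*} [Field K] [AddCommGroup V] [Module K V] (A : PoissonAlgebra K V)

lemma dX_eq {n : ℕ} {Y : QuivFun V (n + 1)} (hY : Y ∈ finCx K V n) :
    A.dX n Y = A.dh n Y + A.dv n Y := by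
  rw [dX, dh, dv, lieBracket, lieBracket, lieBracket, X_eq, box_add_left,
    box_add_right _ hY.1.1, smul_add]
  abel

/-- `lieBracket_anticomm` for two equal operations gives twice the square, and two is invertible. -/
lemma dh_dh {n : ℕ} [CharZero K] {Y : QuivFun V (n + 1)} (hY : Y ∈ finCx K V n) :
    A.dh (n + 1) (A.dh n Y) = 0 := by
  have := lieBracket_anticomm A.Xh_multilinear A.Xh_multilinear A.Xh_isSkew A.Xh_isSkew
    (by rw [A.box_Xh_Xh, add_zero]) hY.1.1 hY.2
  rw [← two_smul K] at this
  exact (smul_eq_zero.1 this).resolve_left two_ne_zero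

lemma dv_dv {n : ℕ} [CharZero K] {Y : QuivFun V (n + 1)} (hY : Y ∈ finCx K V n) :
    A.dv (n + 1) (A.dv n Y) = 0 := by
  have := lieBracket_anticomm A.Xv_multilinear A.Xv_multilinear A.Xv_isSkew A.Xv_isSkew
    (by rw [A.box_Xv_Xv, add_zero]) hY.1.1 hY.2
  rw [← two_smul K] at this
  exact (smul_eq_zero.1 this).resolve_left two_ne_zero

lemma dh_dv_add {n : ℕ} {Y : QuivFun V (n + 1)} (hY : Y ∈ finCx K V n) :
    A.dh (n + 1) (A.dv n Y) + A.dv (n + 1) (A.dh n Y) = 0 :=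
  lieBracket_anticomm A.Xh_multilinear A.Xv_multilinear A.Xh_isSkew A.Xv_isSkew
    A.box_Xh_Xv hY.1.1 hY.2

lemma dh_mem_finCx {n : ℕ} {Y : QuivFun V (n + 1)} (hY : Y ∈ finCx K V n) :
    A.dh n Y ∈ finCx K V (n + 1) := lieBracket_mem_finCx _ A.Xh_mem_finCx hY

lemma dv_mem_finCx {n : ℕ} {Y : QuivFun V (n + 1)} (hY : Y ∈ finCx K V n) :
    A.dv n Y ∈ finCx K V (n + 1) := lieBracket_mem_finCx _ A.Xv_mem_finCx hY

lemma dX_mem_finCx {n : ℕ} {Y : QuivFun V (n + 1)} (hY : Y ∈ finCx K V n) :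
    A.dX n Y ∈ finCx K V (n + 1) := lieBracket_mem_finCx _ A.X_mem_finCx hY

lemma dh_add {n : ℕ} {Y Z : QuivFun V (n + 1)} : A.dh n (Y + Z) = A.dh n Y + A.dh n Z := by
  rw [dh, dh, dh, lieBracket, lieBracket, lieBracket, box_add_right _ A.Xh_multilinear,
    box_add_left, smul_add]
  abel

lemma dv_add {n : ℕ} {Y Z : QuivFun V (n + 1)} : A.dv n (Y + Z) = A.dv n Y + A.dv n Z := by
  rw [dv, dv, dv, lieBracket, lieBracket, lieBracket, box_add_right _ A.Xv_multilinear,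
    box_add_left, smul_add]
  abel

lemma dh_smul {n : ℕ} (c : K) {Y : QuivFun V (n + 1)} : A.dh n (c • Y) = c • A.dh n Y := by
  rw [dh, dh, lieBracket, lieBracket, box_smul_right _ A.Xh_multilinear, box_smul_left, smul_sub,
    smul_comm c]

lemma dv_smul {n : ℕ} (c : K) {Y : QuivFun V (n + 1)} : A.dv n (c • Y) = c • A.dv n Y := by
  rw [dv, dv, lieBracket, lieBracket, box_smul_right _ A.Xv_multilinear, box_smul_left, smul_sub,
    smul_comm c]

lemma X_multilinear (Γ : Quiv 2) : A.X Γ ∈ multilinear K V 2 := A.X_mem_finCx.1.1 Γ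

lemma dX_add {n : ℕ} {Y Z : QuivFun V (n + 1)} : A.dX n (Y + Z) = A.dX n Y + A.dX n Z := by
  rw [dX, dX, dX, lieBracket, lieBracket, lieBracket, box_add_right _ A.X_multilinear,
    box_add_left, smul_add]
  abel

lemma dX_smul {n : ℕ} (c : K) {Y : QuivFun V (n + 1)} : A.dX n (c • Y) = c • A.dX n Y := by
  rw [dX, dX, lieBracket, lieBracket, box_smul_right _ A.X_multilinear, box_smul_left, smul_sub,
    smul_comm c]

lemma dX_dX {n : ℕ} [CharZero K] {Y : QuivFun V (n + 1)} (hY : Y ∈ finCx K V n) :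
    A.dX (n + 1) (A.dX n Y) = 0 := by
  rw [A.dX_eq hY, dX_add, A.dX_eq (A.dh_mem_finCx hY), A.dX_eq (A.dv_mem_finCx hY), A.dh_dh hY,
    A.dv_dv hY, zero_add, add_zero]
  exact (add_comm _ _).trans (A.dh_dv_add hY)

lemma lieBracket_X_X : lieBracket (a := 1) (b := 1) (N := 2) rfl A.X A.X = 0 := by
  have : box (a := 1) (b := 1) (N := 2) rfl A.X A.X = 0 := by
    rw [X_eq, box_add_left, box_add_right _ A.Xh_multilinear, box_add_right _ A.Xv_multilinear,
      A.box_Xh_Xh, A.box_Xv_Xv, zero_add, add_zero]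
    exact A.box_Xh_Xv
  rw [lieBracket, this, smul_zero, sub_zero]

end PoissonAlgebra

/-! ### Evaluation on labelled letters -/

section Points

variable {K M V : Type*} [Field K] [AddCommGroup V] [Module K V] {n : ℕ}

/-- The value of `f` on the quiver that `E` induces on the labels of a list of labelled
vectors. -/
def evalPts (f : QuivFun V n) (E : Multiset (M × M)) (l : List (M × V)) : V :=
  evalList f E (l.map fun p => ({p.1}, p.2))

lemma evalPts_ofFn (f : QuivFun V n) (E : Multiset (M × M)) (s : Fin n → M × V) :
    evalPts f E (List.ofFn s) = f (quiverOn E fun i => {(s i).1}) (fun i => (s i).2) := by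
  rw [evalPts, List.map_ofFn, evalList_ofFn]
  rfl

lemma evalPts_of_ne (f : QuivFun V n) (E : Multiset (M × M)) {l : List (M × V)}
    (h : l.length ≠ n) : evalPts f E l = 0 := evalList_of_ne _ _ (by simpa using h)

lemma quiverOn_map {M' : Type*} (π : M → M') (E : Multiset (M × M)) (S : Fin n → Set M') :
    quiverOn (E.map fun e => (π e.1, π e.2)) S = quiverOn E fun i => π ⁻¹' S i := by
  apply Subtype.ext
  simp only [quiverOn, Multiset.bind_map]
  rfl

/-- Contraction of base points. -/
lemma evalPts_map {M' : Type*} (π : M → M') (f : QuivFun V n) (E : Multiset (M × M))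
    (l : List (M' × V)) : evalPts f (E.map fun e => (π e.1, π e.2)) l =
      evalList f E (l.map fun p => (π ⁻¹' {p.1}, p.2)) := by
  by_cases h : l.length = n
  · obtain ⟨s, rfl⟩ := exists_eq_ofFn h
    rw [evalPts_ofFn, quiverOn_map, List.map_ofFn, evalList_ofFn]
    rfl
  · rw [evalPts_of_ne _ _ h, evalList_of_ne _ _ (by simpa using h)]

lemma quiverOn_congr (E : Multiset (M × M)) {S S' : Fin n → Set M}
    (h : ∀ e ∈ E, ∀ i, (e.1 ∈ S i ↔ e.1 ∈ S' i) ∧ (e.2 ∈ S i ↔ e.2 ∈ S' i)) :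
    quiverOn E S = quiverOn E S' := by
  classical
  apply Subtype.ext
  simp only [quiverOn]
  refine Multiset.bind_congr fun e he => ?_
  have : ∀ ij : Fin n × Fin n, (ij.1 ≠ ij.2 ∧ e.1 ∈ S ij.1 ∧ e.2 ∈ S ij.2) ↔
      (ij.1 ≠ ij.2 ∧ e.1 ∈ S' ij.1 ∧ e.2 ∈ S' ij.2) := fun ij => by
    rw [(h e he ij.1).1, (h e he ij.2).2]
  simp only [this]

/-- Relabelling. -/
lemma evalPts_relabel {M' : Type*} (π : M → M') (f : QuivFun V n) (E : Multiset (M × M))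
    (l : List (M × V)) (hE : ∀ e ∈ E, e.1 ∈ l.map Prod.fst ∧ e.2 ∈ l.map Prod.fst)
    (hπ : Set.InjOn π {m | m ∈ l.map Prod.fst}) :
    evalPts f (E.map fun e => (π e.1, π e.2)) (l.map fun p => (π p.1, p.2)) = evalPts f E l := by
  by_cases h : l.length = n
  · obtain ⟨s, rfl⟩ := exists_eq_ofFn h
    rw [List.map_ofFn, evalPts_ofFn, evalPts_ofFn, quiverOn_map]
    have hs : ∀ i, (s i).1 ∈ (List.ofFn s).map Prod.fst := fun i =>
      List.mem_map_of_mem (List.mem_ofFn.2 ⟨i, rfl⟩)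
    rw [quiverOn_congr E (S' := fun i => {(s i).1})]
    · rfl
    · intro e he i
      simp only [Function.comp_apply, Set.mem_preimage, Set.mem_singleton_iff]
      exact ⟨hπ.eq_iff (hE e he).1 (hs i), hπ.eq_iff (hE e he).2 (hs i)⟩
  · rw [evalPts_of_ne _ _ h, evalPts_of_ne _ _ (by simpa using h)]

/-- Arrows at other points than the labels do not matter. -/
lemma evalPts_add_of_forall (f : QuivFun V n) (E F : Multiset (M × M)) (l : List (M × V))
    (h : ∀ e ∈ F, e.1 ∉ l.map Prod.fst ∨ e.2 ∉ l.map Prod.fst) :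
    evalPts f (E + F) l = evalPts f E l := by
  classical
  by_cases hn : l.length = n
  · obtain ⟨s, rfl⟩ := exists_eq_ofFn hn
    rw [evalPts_ofFn, evalPts_ofFn]
    refine congrArg (fun Γ => f Γ _) (Subtype.ext ?_)
    have hs : ∀ i, (s i).1 ∈ (List.ofFn s).map Prod.fst := fun i =>
      List.mem_map_of_mem (List.mem_ofFn.2 ⟨i, rfl⟩)
    simp only [quiverOn, Multiset.add_bind]
    have h0 : (F.bind fun e => (Finset.univ.filter fun ij : Fin n × Fin n =>
        ij.1 ≠ ij.2 ∧ e.1 ∈ ({(s ij.1).1} : Set M) ∧ e.2 ∈ ({(s ij.2).1} : Set M)).val) =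
        F.bind fun _ => 0 := by
      refine Multiset.bind_congr fun e he => ?_
      rw [Finset.filter_false_of_mem]
      · rfl
      · rintro ij - ⟨-, h1, h2⟩
        rw [Set.mem_singleton_iff] at h1 h2
        rcases h e he with h | h
        · exact h (h1 ▸ hs _)
        · exact h (h2 ▸ hs _)
    rw [h0, Multiset.bind_zero, add_zero]
  · rw [evalPts_of_ne _ _ hn, evalPts_of_ne _ _ hn]

lemma evalPts_swap {f : QuivFun V n} (hf : IsSkew f) (E : Multiset (M × M)) (l₁ : List (M × V))
    (x y : M × V) (l₂ : List (M × V)) :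
    evalPts f E (l₁ ++ x :: y :: l₂) = -evalPts f E (l₁ ++ y :: x :: l₂) := by
  simp only [evalPts, List.map_append, List.map_cons]
  exact hf.evalList_swap _ _ _ _ _

lemma evalPts_move {f : QuivFun V n} (hf : IsSkew f) (E : Multiset (M × M)) (l₁ : List (M × V))
    (x : M × V) (u l₂ : List (M × V)) :
    evalPts f E (l₁ ++ x :: (u ++ l₂)) = (-1 : K) ^ u.length • evalPts f E (l₁ ++ u ++ x :: l₂) := by
  induction u generalizing l₁ with
  | nil => simp
  | cons y u ih =>
    rw [List.cons_append, evalPts_swap hf]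
    have := ih (l₁ ++ [y])
    simp only [List.append_assoc, List.cons_append, List.nil_append] at this ⊢
    rw [this, List.length_cons, pow_succ, mul_neg_one, neg_smul]

lemma evalPts_swap_blocks {f : QuivFun V n} (hf : IsSkew f) (E : Multiset (M × M))
    (l₁ u v l₂ : List (M × V)) :
    evalPts f E (l₁ ++ u ++ v ++ l₂) =
      (-1 : K) ^ (u.length * v.length) • evalPts f E (l₁ ++ v ++ u ++ l₂) := by
  induction u generalizing l₁ l₂ with
  | nil => simp
  | cons x u ih =>
    have h1 := ih (l₁ ++ [x]) l₂
    have h2 := evalPts_move (K := K) hf E l₁ x v (u ++ l₂)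
    simp only [List.append_assoc, List.cons_append, List.nil_append] at h1 h2 ⊢
    rw [h1, h2, smul_smul, ← pow_add, List.length_cons, Nat.succ_mul]

/-- Since the labels are different, an arrow between labels is one arrow between positions. This
transports the rules of the operad from quivers to arrows between labels. -/
lemma quiverOn_cons_pts {s : Fin n → M} (hs : Function.Injective s) (E : Multiset (M × M))
    (i j : Fin n) : quiverOn ((s i, s j) ::ₘ E) (fun i => {s i}) =
      ofArrows ((i, j) ::ₘ (quiverOn E fun i => {s i}).1) := by
  classical
  apply Subtype.ext
  by_cases hij : i = j
  · subst hij
    rw [ofArrows_cons_self, ofArrows_val]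
    simp only [quiverOn, Multiset.cons_bind]
    rw [Finset.filter_false_of_mem]
    · exact zero_add _
    · rintro ij - ⟨h, h1, h2⟩
      rw [Set.mem_singleton_iff, hs.eq_iff] at h1 h2
      exact h (h1.symm.trans h2)
  · rw [ofArrows_cons hij, ofArrows_val]
    simp only [quiverOn, Multiset.cons_bind]
    rw [← Multiset.singleton_add]
    congr 1
    have : (Finset.univ.filter fun ij : Fin n × Fin n =>
      ij.1 ≠ ij.2 ∧ s i ∈ ({s ij.1} : Set M) ∧ s j ∈ ({s ij.2} : Set M)) = {(i, j)} := by
      ext ⟨k, l⟩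
      simp only [Finset.mem_filter, Finset.mem_univ, true_and, Set.mem_singleton_iff,
        Finset.mem_singleton, Prod.mk.injEq, hs.eq_iff]
      constructor
      · rintro ⟨-, rfl, rfl⟩; exact ⟨rfl, rfl⟩
      · rintro ⟨rfl, rfl⟩; exact ⟨hij, rfl, rfl⟩
    rw [this]
    rfl

lemma exists_index {M V : Type*} {n : ℕ} {s : Fin n → M × V} {a : M} (ha : a ∈ (List.ofFn s).map Prod.fst) :
    ∃ i, (s i).1 = a := by
  obtain ⟨p, hp, rfl⟩ := List.mem_map.1 ha
  obtain ⟨i, rfl⟩ := List.mem_ofFn.1 hp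
  exact ⟨i, rfl⟩

lemma injective_of_nodup {M V : Type*} {n : ℕ} {s : Fin n → M × V} (h : ((List.ofFn s).map Prod.fst).Nodup) :
    Function.Injective fun i => (s i).1 := by
  rw [List.map_ofFn] at h
  exact List.nodup_ofFn.1 h

lemma evalPts_rev {f : QuivFun V n} (hf : f ∈ finOp K V n) (E : Multiset (M × M))
    {l : List (M × V)} (hl : (l.map Prod.fst).Nodup) {a b : M} (hab : a ≠ b)
    (ha : a ∈ l.map Prod.fst) (hb : b ∈ l.map Prod.fst) :
    evalPts f ((a, b) ::ₘ E) l = -evalPts f ((b, a) ::ₘ E) l := by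
  by_cases h : l.length = n
  · obtain ⟨s, rfl⟩ := exists_eq_ofFn h
    obtain ⟨i, rfl⟩ := exists_index ha
    obtain ⟨j, rfl⟩ := exists_index hb
    have hij : i ≠ j := fun e => hab (by rw [e])
    have hinj := injective_of_nodup hl
    rw [evalPts_ofFn, evalPts_ofFn, quiverOn_cons_pts (s := fun i => (s i).1) hinj,
      quiverOn_cons_pts (s := fun i => (s i).1) hinj, finOp_rev hf _ hij]
    rfl
  · rw [evalPts_of_ne _ _ h, evalPts_of_ne _ _ h, neg_zero]

lemma evalPts_tri {f : QuivFun V n} (hf : f ∈ finOp K V n) (E : Multiset (M × M))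
    {l : List (M × V)} (hl : (l.map Prod.fst).Nodup) {a b c : M} (hab : a ≠ b) (hac : a ≠ c)
    (hbc : b ≠ c) (ha : a ∈ l.map Prod.fst) (hb : b ∈ l.map Prod.fst) (hc : c ∈ l.map Prod.fst) :
    evalPts f ((c, a) ::ₘ (c, b) ::ₘ E) l = evalPts f ((c, a) ::ₘ (a, b) ::ₘ E) l +
      evalPts f ((c, b) ::ₘ (b, a) ::ₘ E) l := by
  by_cases h : l.length = n
  · obtain ⟨s, rfl⟩ := exists_eq_ofFn h
    obtain ⟨i, rfl⟩ := exists_index ha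
    obtain ⟨j, rfl⟩ := exists_index hb
    obtain ⟨k, rfl⟩ := exists_index hc
    have hinj := injective_of_nodup hl
    simp only [evalPts_ofFn, quiverOn_cons_pts (s := fun i => (s i).1) hinj, ofArrows_cons_val]
    rw [← finOp_tri hf _ (fun e => hab (by rw [e])) (fun e => hac (by rw [e]))
      (fun e => hbc (by rw [e]))]
    rfl
  · rw [evalPts_of_ne _ _ h, evalPts_of_ne _ _ h, evalPts_of_ne _ _ h, zero_add]

/-- Reversing both arrows in each term of `evalPts_tri` does not change the signs. -/
lemma evalPts_tri_in {f : QuivFun V n} (hf : f ∈ finOp K V n) (E : Multiset (M × M))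
    {l : List (M × V)} (hl : (l.map Prod.fst).Nodup) {a b c : M} (hab : a ≠ b) (hac : a ≠ c)
    (hbc : b ≠ c) (ha : a ∈ l.map Prod.fst) (hb : b ∈ l.map Prod.fst) (hc : c ∈ l.map Prod.fst) :
    evalPts f ((a, c) ::ₘ (b, c) ::ₘ E) l = evalPts f ((b, c) ::ₘ (a, b) ::ₘ E) l +
      evalPts f ((a, c) ::ₘ (b, a) ::ₘ E) l := by
  have := evalPts_tri hf E hl hab hac hbc ha hb hc
  rw [evalPts_rev hf _ hl hac ha hc, Multiset.cons_swap, evalPts_rev hf _ hl hbc hb hc, neg_neg,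
    Multiset.cons_swap, this, evalPts_rev hf _ hl hac ha hc, evalPts_rev hf _ hl hbc hb hc,
    Multiset.cons_swap (c, a) (b, a), evalPts_rev hf _ hl hab.symm hb ha,
    Multiset.cons_swap (c, b) (a, b), evalPts_rev hf _ hl hab ha hb, neg_neg, neg_neg,
    Multiset.cons_swap (a, b), Multiset.cons_swap (b, a), add_comm]

lemma evalPts_conn {f : QuivFun V n} (hf : f ∈ finOp K V n) {E E' : Multiset (M × M)}
    {l : List (M × V)} (hl : (l.map Prod.fst).Nodup) {a b : M} (hab : a ≠ b)
    (ha : a ∈ l.map Prod.fst) (hb : b ∈ l.map Prod.fst) (hle : E' ≤ E)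
    (hE : ∀ e ∈ E', e.1 ∈ l.map Prod.fst ∧ e.2 ∈ l.map Prod.fst) (hc : Conn E' a b) :
    evalPts f ((a, b) ::ₘ E) l = 0 := by
  by_cases h : l.length = n
  · obtain ⟨s, rfl⟩ := exists_eq_ofFn h
    obtain ⟨i, rfl⟩ := exists_index ha
    obtain ⟨j, rfl⟩ := exists_index hb
    have hinj := injective_of_nodup hl
    have : Nonempty (Fin n) := ⟨i⟩
    rw [evalPts_ofFn, quiverOn_cons_pts (s := fun i => (s i).1) hinj, finOp_conn hf]
    · rfl
    · exact fun e => hab (by rw [e])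
    · have hleft : ∀ k, Function.invFun (fun i => (s i).1) (s k).1 = k :=
        Function.leftInverse_invFun hinj
      have h1 := Conn.lift (E' := (quiverOn E fun i => {(s i).1}).1)
        (Function.invFun fun i => (s i).1) (fun e he => ?_) hc
      · rwa [hleft i, hleft j] at h1
      · obtain ⟨k, hk⟩ := exists_index (hE e he).1
        obtain ⟨m, hm⟩ := exists_index (hE e he).2
        rw [← hk, ← hm, hleft k, hleft m]
        by_cases hkm : k = m
        · rw [hkm]; exact Conn.refl _ _
        · refine Conn.of_mem ?_
          classical
          rw [← Multiset.count_pos, count_quiverOn _ _ hkm, arrowCount, Multiset.countP_pos]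
          exact ⟨e, Multiset.mem_of_le hle he, hk.symm, hm.symm⟩
  · exact evalPts_of_ne _ _ h

end Points

/-! ### Lines -/

section ShuffleEnds

variable {K α N : Type*} [Field K] [AddCommGroup N] [Module K N]

lemma linearCombination_consWord (φ : List α → N) (a : α) (x : Words K α) :
    Finsupp.linearCombination K φ (consWord K a x) =
      Finsupp.linearCombination K (fun w => φ (a :: w)) x := by
  induction x using words_induction with
  | h0 => simp
  | hadd x x' hx hx' => simp only [map_add, hx, hx']
  | hsmul c x hx => simp only [map_smul, hx]
  | h1 w => simp

/-- Appending a letter to words. -/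
def wordConcat (K : Type*) [Field K] {α : Type*} (a : α) : Words K α →ₗ[K] Words K α :=
  Finsupp.linearCombination K fun w => Finsupp.single (w ++ [a]) 1

@[simp] lemma wordConcat_single (a : α) (w : List α) :
    wordConcat K a (Finsupp.single w 1) = Finsupp.single (w ++ [a]) 1 := by
  simp [wordConcat]

lemma linearCombination_wordConcat (φ : List α → N) (a : α) (x : Words K α) :
    Finsupp.linearCombination K φ (wordConcat K a x) =
      Finsupp.linearCombination K (fun w => φ (w ++ [a])) x := by
  induction x using words_induction with
  | h0 => simp
  | hadd x x' hx hx' => simp only [map_add, hx, hx']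
  | hsmul c x hx => simp only [map_smul, hx]
  | h1 w => simp

lemma wordConcat_consWord (a b : α) (x : Words K α) :
    wordConcat K b (consWord K a x) = consWord K a (wordConcat K b x) := by
  induction x using words_induction with
  | h0 => simp
  | hadd x x' hx hx' => simp only [map_add, hx, hx']
  | hsmul c x hx => simp only [map_smul, hx]
  | h1 w => simp

/-- The recursion for the shuffle product by the last letters. -/
lemma shuffle_concat_concat (a b : α) (u v : List α) : shuffle K (u ++ [a]) (v ++ [b]) =
    wordConcat K b (shuffle K (u ++ [a]) v) +
      (-1 : K) ^ (v.length + 1) • wordConcat K a (shuffle K u (v ++ [b])) := by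
  induction hk : u.length + v.length using Nat.strong_induction_on generalizing u v with
  | _ k ih =>
  subst hk
  rcases u with _ | ⟨x, u⟩
  · induction v with
    | nil =>
      simp [shuffle_nil_right, shuffle_nil_left, shuffle_cons_cons]
    | cons y v ihv =>
      have h1 := ihv (fun m hm u' v' h => ih m (by simp at hm ⊢; omega) u' v' h)
      simp only [List.nil_append, List.cons_append, shuffle_cons_cons, shuffle_nil_left,
        List.length_nil, zero_add, pow_one, map_add, map_smul, consWord_single, wordConcat_single,
        List.length_cons] at h1 ⊢
      rw [h1]
      simp only [map_add, map_smul, wordConcat_consWord, smul_add, smul_smul, consWord_single]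
      rw [show v.length + 1 + 1 = (v.length + 1) + 1 from rfl, pow_succ (-1 : K) (v.length + 1)]
      simp only [neg_smul, one_smul, mul_neg, neg_mul, one_mul, mul_one]
      abel
  · rcases v with _ | ⟨y, v⟩
    · have h1 := ih (u.length + 0) (by simp) u [] rfl
      simp only [List.nil_append, List.cons_append, shuffle_cons_cons, shuffle_nil_right,
        List.length_nil, zero_add, pow_one, map_add, map_smul, consWord_single, wordConcat_single,
        List.length_append, List.length_cons] at h1 ⊢
      rw [h1]
      simp only [map_add, map_smul, wordConcat_consWord, smul_add, smul_smul, consWord_single]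
      rw [pow_succ (-1 : K) (u.length + 1)]
      simp only [neg_smul, one_smul, mul_neg, neg_mul, one_mul, mul_one]
      abel
    · have h1 := ih (u.length + (y :: v).length) (by simp) u (y :: v) rfl
      have h2 := ih ((x :: u).length + v.length) (by simp) (x :: u) v rfl
      simp only [List.cons_append, shuffle_cons_cons, List.length_append, List.length_cons,
        List.length_nil, zero_add] at h1 h2 ⊢
      rw [h1, h2]
      simp only [map_add, map_smul, wordConcat_consWord, smul_add, smul_smul]
      rw [pow_succ (-1 : K) (u.length + 1), pow_succ (-1 : K) (v.length + 1)]
      simp only [neg_smul, mul_neg, neg_mul, mul_one]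
      rw [mul_comm ((-1 : K) ^ (u.length + 1))]
      abel

end ShuffleEnds

/-! ### Chains of arrows and their shuffles. -/

section Lines

variable {K M V : Type*} [Field K] [AddCommGroup V] [Module K V] {n : ℕ}

/-- The arrows from each member of a list to the next one. -/
def chain (w : List M) : Multiset (M × M) := (w.zip w.tail : List (M × M))

@[simp] lemma chain_nil : chain ([] : List M) = 0 := rfl

@[simp] lemma chain_singleton (a : M) : chain [a] = 0 := rfl

@[simp] lemma chain_cons_cons (a b : M) (w : List M) :
    chain (a :: b :: w) = (a, b) ::ₘ chain (b :: w) := rfl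

lemma chain_append (u : List M) (a : M) (v : List M) :
    chain (u ++ a :: v) = chain (u ++ [a]) + chain (a :: v) := by
  induction u with
  | nil => simp
  | cons b u ih =>
    cases u with
    | nil => simp
    | cons c u =>
      simp only [List.cons_append, chain_cons_cons, Multiset.cons_add] at ih ⊢
      rw [ih]

lemma chain_concat (u : List M) (a b : M) :
    chain (u ++ [a, b]) = (a, b) ::ₘ chain (u ++ [a]) := by
  rw [chain_append, chain_cons_cons, chain_singleton, add_comm]
  rfl

lemma mem_of_mem_chain {w : List M} {e : M × M} (h : e ∈ chain w) : e.1 ∈ w ∧ e.2 ∈ w := by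
  have h' : (e.1, e.2) ∈ w.zip w.tail := h
  exact ⟨(List.of_mem_zip h').1, List.mem_of_mem_tail (List.of_mem_zip h').2⟩

lemma conn_chain {a b : M} {w : List M} (ha : a ∈ w) (hb : b ∈ w) : Conn (chain w) a b := by
  have key : ∀ (w : List M) (a c : M), c ∈ a :: w → Conn (chain (a :: w)) a c := by
    intro w
    induction w with
    | nil =>
      intro a c hc
      rw [List.mem_singleton] at hc
      rw [hc]; exact Conn.refl _ _
    | cons b w ih =>
      intro a c hc
      rcases List.mem_cons.1 hc with rfl | hc
      · exact Conn.refl _ _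
      · rw [chain_cons_cons]
        exact (Conn.of_mem (Multiset.mem_cons_self _ _)).trans
          ((ih b c hc).mono (Multiset.le_cons_self _ _))
  cases w with
  | nil => simp at ha
  | cons c w => exact (key w c a ha).symm.trans (key w c b hb)

/-- Two lines that start at the same point combine to lines along the shuffles. -/
lemma evalPts_shuffle_out {f : QuivFun V n} (hf : f ∈ finOp K V n) (hs : IsSkew f) (c : M)
    (u v l₁ l₂ : List (M × V)) (E : Multiset (M × M))
    (hl : ((l₁ ++ u ++ v ++ l₂).map Prod.fst).Nodup) (hc : c ∈ (l₁ ++ l₂).map Prod.fst) :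
    evalPts f (chain (c :: u.map Prod.fst) + chain (c :: v.map Prod.fst) + E)
      (l₁ ++ u ++ v ++ l₂) =
    Finsupp.linearCombination K (fun w : List (M × V) =>
      evalPts f (chain (c :: w.map Prod.fst) + E) (l₁ ++ w ++ l₂)) (shuffle K u v) := by
  induction hk : u.length + v.length using Nat.strong_induction_on generalizing c u v l₁ E with
  | _ k ih =>
  subst hk
  rcases u with _ | ⟨a, u⟩
  · simp [shuffle_nil_left]
  rcases v with _ | ⟨b, v⟩
  · simp [shuffle_nil_right]
  have hp : ∀ x, x ∈ (l₁ ++ l₂).map Prod.fst → x ≠ a.1 ∧ x ≠ b.1 := by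
    intro x hx
    have hperm : (l₁ ++ (a :: u) ++ (b :: v) ++ l₂).Perm
        (a :: b :: ((l₁ ++ l₂) ++ (u ++ v))) := by
      classical
      rw [List.perm_iff_count]
      intro x
      simp only [List.count_append, List.count_cons]
      omega
    have h2 := (hperm.map Prod.fst).nodup_iff.1 hl
    simp only [List.map_cons, List.map_append, List.nodup_cons, List.mem_cons, List.mem_append,
      not_or] at h2 hx
    refine ⟨?_, ?_⟩
    · rintro rfl; tauto
    · rintro rfl; tauto
  have hab : a.1 ≠ b.1 := by
    rw [List.append_assoc, List.append_assoc, List.map_append] at hl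
    have h2 := hl.of_append_right
    simp only [List.cons_append, List.map_cons, List.map_append, List.nodup_cons, List.mem_append,
      List.mem_cons, not_or] at h2
    exact h2.1.2.1
  obtain ⟨hca, hcb⟩ := hp c hc
  have hmem : ∀ x ∈ (l₁ ++ l₂).map Prod.fst,
      x ∈ (l₁ ++ (a :: u) ++ (b :: v) ++ l₂).map Prod.fst := by
    intro x hx
    simp only [List.map_append, List.mem_append] at hx ⊢
    tauto
  have ha : a.1 ∈ (l₁ ++ (a :: u) ++ (b :: v) ++ l₂).map Prod.fst := by simp
  have hb : b.1 ∈ (l₁ ++ (a :: u) ++ (b :: v) ++ l₂).map Prod.fst := by simp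
  rw [shuffle_cons_cons, map_add, map_smul]
  simp only [List.map_cons, chain_cons_cons, Multiset.cons_add, Multiset.add_cons]
  -- The triangle rule decides which of the first letters `a`, `b` follows `c`. In the first term
  -- the lines branch at `a`, in the second one at `b`, and there the induction applies.
  rw [Multiset.cons_swap, evalPts_tri hf _ hl hab hca.symm hcb.symm ha hb (hmem c hc)]
  congr 1
  · have h1 := ih (u.length + (b :: v).length) (by simp) a.1 u (b :: v) (l₁ ++ [a])
      ((c, a.1) ::ₘ E) (by simpa using hl) (by simp) rfl
    simp only [List.append_assoc, List.cons_append, List.nil_append, List.map_cons,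
      chain_cons_cons, Multiset.add_cons, Multiset.cons_add] at h1 ⊢
    rw [h1, linearCombination_consWord]
    simp only [List.map_cons, chain_cons_cons, List.cons_append, Multiset.cons_add]
  · have h1 := ih ((a :: u).length + v.length) (by simp) b.1 (a :: u) v (l₁ ++ [b])
      ((c, b.1) ::ₘ E) (by
        refine ((List.Perm.map Prod.fst ?_).nodup_iff).1 hl
        classical
        rw [List.perm_iff_count]
        intro x
        simp only [List.count_append, List.count_cons, List.count_nil]
        omega) (by simp) rfl
    -- Moving `b` in front of `a :: u` produces the sign of the shuffle recursion.
    have h2 := evalPts_move (K := K) hs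
      ((c, b.1) ::ₘ (b.1, a.1) ::ₘ (chain (a.1 :: u.map Prod.fst) +
        (chain (b.1 :: v.map Prod.fst) + E))) l₁ b (a :: u) (v ++ l₂)
    simp only [List.append_assoc, List.cons_append, List.nil_append, List.map_cons,
      chain_cons_cons, Multiset.add_cons, Multiset.cons_add, List.length_cons, add_assoc] at h1 h2 ⊢
    rw [linearCombination_consWord]
    simp only [List.map_cons, chain_cons_cons, List.cons_append, Multiset.cons_add]
    rw [← h1, h2, smul_smul, neg_one_pow_mul_self, one_smul]

/-- Two lines that end at the same point combine to lines along the shuffles. -/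
lemma evalPts_shuffle_in {f : QuivFun V n} (hf : f ∈ finOp K V n) (hs : IsSkew f) (c : M)
    (u v l₁ l₂ : List (M × V)) (E : Multiset (M × M))
    (hl : ((l₁ ++ u ++ v ++ l₂).map Prod.fst).Nodup) (hc : c ∈ (l₁ ++ l₂).map Prod.fst) :
    evalPts f (chain (u.map Prod.fst ++ [c]) + chain (v.map Prod.fst ++ [c]) + E)
      (l₁ ++ u ++ v ++ l₂) =
    Finsupp.linearCombination K (fun w : List (M × V) =>
      evalPts f (chain (w.map Prod.fst ++ [c]) + E) (l₁ ++ w ++ l₂)) (shuffle K u v) := by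
  induction hk : u.length + v.length using Nat.strong_induction_on generalizing c u v l₂ E with
  | _ k ih =>
  subst hk
  rcases List.eq_nil_or_concat u with rfl | ⟨u, a, rfl⟩
  · simp [shuffle_nil_left]
  rcases List.eq_nil_or_concat v with rfl | ⟨v, b, rfl⟩
  · simp [shuffle_nil_right]
  simp only [List.concat_eq_append] at ih hl ⊢
  have hp : ∀ x, x ∈ (l₁ ++ l₂).map Prod.fst → x ≠ a.1 ∧ x ≠ b.1 := by
    intro x hx
    have hperm : (l₁ ++ (u ++ [a]) ++ (v ++ [b]) ++ l₂).Perm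
        (a :: b :: ((l₁ ++ l₂) ++ (u ++ v))) := by
      classical
      rw [List.perm_iff_count]
      intro x
      simp only [List.count_append, List.count_cons, List.count_nil]
      omega
    have h2 := (hperm.map Prod.fst).nodup_iff.1 hl
    simp only [List.map_cons, List.map_append, List.nodup_cons, List.mem_cons, List.mem_append,
      not_or] at h2 hx
    refine ⟨?_, ?_⟩
    · rintro rfl; tauto
    · rintro rfl; tauto
  have hab : a.1 ≠ b.1 := by
    have hperm : (l₁ ++ (u ++ [a]) ++ (v ++ [b]) ++ l₂).Perm
        (a :: b :: ((l₁ ++ l₂) ++ (u ++ v))) := by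
      classical
      rw [List.perm_iff_count]
      intro x
      simp only [List.count_append, List.count_cons, List.count_nil]
      omega
    have h2 := (hperm.map Prod.fst).nodup_iff.1 hl
    simp only [List.map_cons, List.nodup_cons, List.mem_cons, not_or] at h2
    exact h2.1.1
  obtain ⟨hca, hcb⟩ := hp c hc
  have hmem : ∀ x ∈ (l₁ ++ l₂).map Prod.fst,
      x ∈ (l₁ ++ (u ++ [a]) ++ (v ++ [b]) ++ l₂).map Prod.fst := by
    intro x hx
    simp only [List.map_append, List.mem_append] at hx ⊢
    tauto
  have ha : a.1 ∈ (l₁ ++ (u ++ [a]) ++ (v ++ [b]) ++ l₂).map Prod.fst := by simp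
  have hb : b.1 ∈ (l₁ ++ (u ++ [a]) ++ (v ++ [b]) ++ l₂).map Prod.fst := by simp
  rw [shuffle_concat_concat, map_add, map_smul, linearCombination_wordConcat,
    linearCombination_wordConcat]
  have hsplit : ∀ (u : List (M × V)) (a : M × V) (c : M),
      chain ((u ++ [a]).map Prod.fst ++ [c]) =
        (a.1, c) ::ₘ chain (u.map Prod.fst ++ [a.1]) := by
    intro u a c
    simp only [List.map_append, List.map_cons, List.map_nil, List.append_assoc, List.cons_append,
      List.nil_append]
    exact chain_concat _ _ _
  have h1 := ih ((u ++ [a]).length + v.length) (by simp) b.1 (u ++ [a]) v (b :: l₂)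
      ((b.1, c) ::ₘ E) (by simpa using hl) (by simp) rfl
  have h2 := ih (u.length + (v ++ [b]).length) (by simp) a.1 u (v ++ [b]) (a :: l₂)
      ((a.1, c) ::ₘ E) (by
        refine ((List.Perm.map Prod.fst ?_).nodup_iff).1 hl
        classical
        rw [List.perm_iff_count]
        intro x
        simp only [List.count_append, List.count_cons, List.count_nil]
        omega) (by simp) rfl
  have h3 := evalPts_move (K := K) hs
      ((a.1, c) ::ₘ (b.1, a.1) ::ₘ (chain (u.map Prod.fst ++ [a.1]) +
        (chain (v.map Prod.fst ++ [b.1]) + E))) (l₁ ++ u) a (v ++ [b]) l₂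
  simp only [hsplit, Multiset.cons_add, Multiset.add_cons] at h1 h2 h3 ⊢
  -- The triangle rule decides which of the last letters `a`, `b` stands directly before `c`.
  rw [Multiset.cons_swap, evalPts_tri_in hf _ hl hab hca.symm hcb.symm ha hb (hmem c hc)]
  simp only [List.append_assoc, List.cons_append, List.nil_append, List.length_append,
    List.length_cons, List.length_nil, add_assoc, zero_add] at h1 h2 h3 ⊢
  rw [h3, ← h1, ← h2]

end Lines

/-! ### Values on unions of lines -/

section LineValues

variable {K M V : Type*} [Field K] [AddCommGroup V] [Module K V] {n : ℕ}

/-- The arrows of the lines along some lists of labelled letters. -/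
def linesArrows {M V : Type*} (ws : List (List (M × V))) : Multiset (M × M) :=
  (ws.map fun w => chain (w.map Prod.fst)).sum

@[simp] lemma linesArrows_nil {M V : Type*} : linesArrows ([] : List (List (M × V))) = 0 := rfl

@[simp] lemma linesArrows_cons {M V : Type*} (w : List (M × V)) (ws : List (List (M × V))) :
    linesArrows (w :: ws) = chain (w.map Prod.fst) + linesArrows ws := rfl

@[simp] lemma linesArrows_append {M V : Type*} (ws ws' : List (List (M × V))) :
    linesArrows (ws ++ ws') = linesArrows ws + linesArrows ws' := by
  simp [linesArrows]

/-- The value of `f` on the union of the lines along some lists of labelled letters. -/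
def evalLines (f : QuivFun V n) (ws : List (List (M × V))) : V :=
  evalPts f (linesArrows ws) ws.flatten

/-- The letters of a word, labelled by consecutive numbers. -/
def labelWord {V : Type*} : ℕ → List V → List (ℕ × V)
  | _, [] => []
  | k, v :: w => (k, v) :: labelWord (k + 1) w

/-- The letters of a list of words, labelled by consecutive numbers. -/
def labelWords {V : Type*} : ℕ → List (List V) → List (List (ℕ × V))
  | _, [] => []
  | k, w :: ws => labelWord k w :: labelWords (k + w.length) ws

/-- The value of `f` on the union of the lines along a list of words. -/
def lineValue (f : QuivFun V n) (ws : List (List V)) : V :=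
  evalLines f (labelWords 0 ws)

section Labels

variable {M V : Type*}

lemma labelWord_append (k : ℕ) (u v : List V) :
    labelWord k (u ++ v) = labelWord k u ++ labelWord (k + u.length) v := by
  induction u generalizing k with
  | nil => rfl
  | cons a u ih =>
    simp only [List.cons_append, labelWord, ih, List.length_cons]
    rw [add_right_comm, add_assoc]

lemma flatten_labelWords (k : ℕ) (ws : List (List V)) :
    (labelWords k ws).flatten = labelWord k ws.flatten := by
  induction ws generalizing k with
  | nil => rfl
  | cons w ws ih => rw [labelWords, List.flatten_cons, ih, List.flatten_cons, labelWord_append]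

lemma map_fst_labelWord (k : ℕ) (w : List V) :
    (labelWord k w).map Prod.fst = List.range' k w.length := by
  induction w generalizing k with
  | nil => rfl
  | cons a w ih => simp [labelWord, ih, List.range'_succ]

lemma map_snd_labelWord (k : ℕ) (w : List V) : (labelWord k w).map Prod.snd = w := by
  induction w generalizing k with
  | nil => rfl
  | cons a w ih => simp [labelWord, ih]

lemma map_snd_labelWords (k : ℕ) (ws : List (List V)) :
    (labelWords k ws).map (List.map Prod.snd) = ws := by
  induction ws generalizing k with
  | nil => rfl
  | cons w ws ih => simp [labelWords, ih, map_snd_labelWord]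

lemma nodup_labelWords (k : ℕ) (ws : List (List V)) :
    ((labelWords k ws).flatten.map Prod.fst).Nodup := by
  rw [flatten_labelWords, map_fst_labelWord]
  exact List.nodup_range'

lemma linesArrows_labelWords_congr (k : ℕ) {ws ws' : List (List V)}
    (h : ws.map List.length = ws'.map List.length) :
    linesArrows (labelWords k ws) = linesArrows (labelWords k ws') := by
  induction ws generalizing k ws' with
  | nil =>
    cases ws' with
    | nil => rfl
    | cons w ws' => simp at h
  | cons w ws ih =>
    cases ws' with
    | nil => simp at h
    | cons w' ws' =>
      simp only [List.map_cons, List.cons.injEq] at h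
      simp only [labelWords, linesArrows_cons, map_fst_labelWord]
      rw [h.1, ih _ h.2]

lemma labelWord_ofFn {n : ℕ} (v : Fin n → V) :
    labelWord 0 (List.ofFn v) = List.ofFn fun i => (i.val, v i) := by
  have key : ∀ (n : ℕ) (v : Fin n → V) (k : ℕ),
      labelWord k (List.ofFn v) = List.ofFn fun i => (k + i.val, v i) := by
    intro n
    induction n with
    | zero => intro v k; simp [labelWord]
    | succ n ih =>
      intro v k
      rw [List.ofFn_succ, labelWord, ih, List.ofFn_succ]
      simp only [Fin.val_zero, Fin.val_succ, Nat.add_zero]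
      congr 2
      funext i
      congr 1
      omega
  simpa using key n v 0

lemma linesArrows_relabel {M' : Type*} (π : M → M') (ws : List (List (M × V))) :
    linesArrows (ws.map (List.map fun p => (π p.1, p.2))) =
      (linesArrows ws).map fun e => (π e.1, π e.2) := by
  have h : ∀ w : List M, chain (w.map π) = (chain w).map fun e => (π e.1, π e.2) := by
    intro w
    simp only [chain, Multiset.map_coe, ← List.map_tail]
    rw [List.zip_map]
    rfl
  induction ws with
  | nil => rfl
  | cons w ws ih =>
    rw [List.map_cons, linesArrows_cons, linesArrows_cons, ih, Multiset.map_add, ← h]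
    simp only [List.map_map]
    rfl

lemma mem_of_mem_linesArrows {ws : List (List (M × V))} {e : M × M} (h : e ∈ linesArrows ws) :
    e.1 ∈ ws.flatten.map Prod.fst ∧ e.2 ∈ ws.flatten.map Prod.fst := by
  induction ws with
  | nil => simp at h
  | cons w ws ih =>
    rw [linesArrows_cons, Multiset.mem_add] at h
    simp only [List.flatten_cons, List.map_append, List.mem_append]
    rcases h with h | h
    · exact ⟨Or.inl (mem_of_mem_chain h).1, Or.inl (mem_of_mem_chain h).2⟩
    · exact ⟨Or.inr (ih h).1, Or.inr (ih h).2⟩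

lemma relabel_eq_labelWord (π : M → ℕ) (k : ℕ) (w : List (M × V))
    (h : ∀ (i : ℕ) (hi : i < w.length), π (w[i]).1 = k + i) :
    w.map (fun p => (π p.1, p.2)) = labelWord k (w.map Prod.snd) := by
  induction w generalizing k with
  | nil => rfl
  | cons x w ih =>
    rw [List.map_cons, List.map_cons, labelWord, ih (k + 1)]
    · have := h 0 (by simp)
      simp at this
      rw [this]
    · intro i hi
      have := h (i + 1) (by simpa using hi)
      simp at this
      rw [this]; omega

lemma relabel_eq_labelWords (π : M → ℕ) (k : ℕ) (ws : List (List (M × V)))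
    (h : ∀ (i : ℕ) (hi : i < ws.flatten.length), π (ws.flatten[i]).1 = k + i) :
    ws.map (List.map fun p => (π p.1, p.2)) = labelWords k (ws.map (List.map Prod.snd)) := by
  induction ws generalizing k with
  | nil => rfl
  | cons w ws ih =>
    simp only [List.flatten_cons] at h
    rw [List.map_cons, List.map_cons, labelWords, relabel_eq_labelWord π k w, List.length_map,
      ih (k + w.length)]
    · intro i hi
      have := h (w.length + i) (by simp; simpa using hi)
      rw [List.getElem_append_right (by omega)] at this
      simp only [Nat.add_sub_cancel_left] at this
      rw [this]; omega
    · intro i hi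
      have := h i (by simp; omega)
      rwa [List.getElem_append_left hi] at this

end Labels

/-- The value on a union of lines does not depend on the labels. -/
lemma evalLines_eq_lineValue (f : QuivFun V n) (ws : List (List (M × V)))
    (h : (ws.flatten.map Prod.fst).Nodup) :
    evalLines f ws = lineValue f (ws.map (List.map Prod.snd)) := by
  classical
  set π : M → ℕ := fun m => (ws.flatten.map Prod.fst).idxOf m
  have hπ : ∀ (i : ℕ) (hi : i < ws.flatten.length), π (ws.flatten[i]).1 = 0 + i := by
    intro i hi
    have := h.idxOf_getElem i (by rw [List.length_map]; exact hi)
    rw [List.getElem_map] at this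
    rw [zero_add]
    exact this
  rw [lineValue, ← relabel_eq_labelWords π 0 ws hπ, evalLines, evalLines, linesArrows_relabel,
    ← List.map_flatten]
  refine (evalPts_relabel π f _ _ (fun e he => mem_of_mem_linesArrows he) ?_).symm
  intro a ha b hb hab
  have ha' := List.getElem_idxOf (List.idxOf_lt_length_of_mem ha)
  have hb' := List.getElem_idxOf (List.idxOf_lt_length_of_mem hb)
  rw [← ha', ← hb']
  congr 1

lemma lineValue_eq_evalPts (f : QuivFun V n) (ws : List (List V)) (v : Fin n → V)
    (h : ws.flatten = List.ofFn v) : lineValue f ws =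
      f (quiverOn (linesArrows (labelWords 0 ws)) fun i : Fin n => {i.val}) v := by
  rw [lineValue, evalLines, flatten_labelWords, h, labelWord_ofFn, evalPts_ofFn]

lemma lineValue_add (f g : QuivFun V n) (ws : List (List V)) :
    lineValue (f + g) ws = lineValue f ws + lineValue g ws := evalList_add _ _ _ _

lemma lineValue_smul (c : K) (f : QuivFun V n) (ws : List (List V)) :
    lineValue (c • f) ws = c • lineValue f ws := evalList_smul _ _ _ _

lemma linearCombination_shuffle_congr {α N : Type*} [AddCommGroup N] [Module K N]
    {φ ψ : List α → N} {u v : List α} (h : ∀ w : List α, w.Perm (u ++ v) → φ w = ψ w) :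
    Finsupp.linearCombination K φ (shuffle K u v) =
      Finsupp.linearCombination K ψ (shuffle K u v) := by
  induction u generalizing φ ψ v with
  | nil => simp [shuffle_nil_left, h v (List.Perm.refl _)]
  | cons a u ih =>
    induction v generalizing φ ψ with
    | nil => simp [shuffle_nil_right, h (a :: u) (by simp)]
    | cons b v ihv =>
      rw [shuffle_cons_cons]
      simp only [map_add, map_smul, linearCombination_consWord]
      rw [ih fun w hw => h (a :: w) (List.Perm.cons a hw)]
      congr 2
      exact ihv fun w hw => h (b :: w) ((List.Perm.cons b hw).trans List.perm_middle.symm)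

lemma linearCombination_shuffle_map {α β N : Type*} [AddCommGroup N] [Module K N]
    (g : α → β) (φ : List β → N) (u v : List α) :
    Finsupp.linearCombination K φ (shuffle K (u.map g) (v.map g)) =
      Finsupp.linearCombination K (fun w => φ (w.map g)) (shuffle K u v) := by
  induction u generalizing φ v with
  | nil => simp [shuffle_nil_left]
  | cons a u ih =>
    induction v generalizing φ with
    | nil => simp [shuffle_nil_right]
    | cons b v ihv =>
      simp only [List.map_cons] at ih ihv ⊢
      rw [shuffle_cons_cons, shuffle_cons_cons]
      simp only [map_add, map_smul, linearCombination_consWord, List.map_cons, List.length_map]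
      rw [← List.map_cons, ih, ihv]

lemma exists_labels {V : Type*} (ws : List (List V)) : ∃ ws' : List (List (ℕ × V)),
    ws = ws'.map (List.map Prod.snd) ∧ (ws'.flatten.map Prod.fst).Nodup :=
  ⟨labelWords 0 ws, (map_snd_labelWords 0 ws).symm, nodup_labelWords 0 ws⟩

/-- The arrows of a union of lines do not depend on the order of the lines; only the arguments are
permuted, in blocks. -/
lemma lineValue_koszulSymmetric {f : QuivFun V n} (hs : IsSkew f) :
    KoszulSymmetric K (lineValue f) := by
  intro A B u v
  obtain ⟨ws, h1, h2⟩ := exists_labels (A ++ u :: v :: B)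
  obtain ⟨A, ws, rfl, rfl, h3⟩ := List.append_eq_map_iff.1 h1
  obtain ⟨u, ws, rfl, rfl, h4⟩ := List.map_eq_cons_iff.1 h3
  obtain ⟨v, B, rfl, rfl, rfl⟩ := List.map_eq_cons_iff.1 h4
  have e1 := evalLines_eq_lineValue f _ h2
  have hp : (A ++ v :: u :: B).flatten.Perm (A ++ u :: v :: B).flatten :=
    List.Perm.flatten (List.Perm.append_left _ (List.Perm.swap _ _ _))
  have e2 := evalLines_eq_lineValue f (A ++ v :: u :: B) ((hp.map _).nodup_iff.2 h2)
  simp only [List.map_append, List.map_cons, List.length_map] at e1 e2 ⊢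
  rw [← e1, ← e2, evalLines, evalLines]
  simp only [linesArrows_append, linesArrows_cons, List.flatten_append, List.flatten_cons]
  have := evalPts_swap_blocks (K := K) hs (linesArrows A + (chain (v.map Prod.fst) +
    (chain (u.map Prod.fst) + linesArrows B))) A.flatten u v B.flatten
  simp only [List.append_assoc] at this ⊢
  rw [← this, add_left_comm (chain (v.map Prod.fst))]

/-- Let `a` and `b` be the first letters of the two words. The shuffles that begin with `a` sum up
to the two lines joined by the arrow `a → b`, those that begin with `b` to the same lines joined by
`b → a`. The two sums cancel by the reversal rule. -/
lemma lineValue_killsShuffles {f : QuivFun V n} (hf : f ∈ finOp K V n) (hs : IsSkew f) :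
    KillsShuffles K (lineValue f) := by
  intro A B u v hu hv
  obtain ⟨ws, h1, h2⟩ := exists_labels (A ++ u :: v :: B)
  obtain ⟨A, ws, rfl, rfl, h3⟩ := List.append_eq_map_iff.1 h1
  obtain ⟨u, ws, rfl, rfl, h4⟩ := List.map_eq_cons_iff.1 h3
  obtain ⟨v, B, rfl, rfl, rfl⟩ := List.map_eq_cons_iff.1 h4
  rw [linearCombination_shuffle_map]
  have h2' : ((A.flatten ++ u ++ v ++ B.flatten).map Prod.fst).Nodup := by simpa using h2
  rw [linearCombination_shuffle_congr (ψ := fun w : List (ℕ × V) =>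
    evalPts f (chain (w.map Prod.fst) + (linesArrows A + linesArrows B))
      (A.flatten ++ w ++ B.flatten))]
  · rcases u with _ | ⟨a, u⟩
    · simp at hu
    rcases v with _ | ⟨b, v⟩
    · simp at hv
    set E := linesArrows A + linesArrows B
    rw [shuffle_cons_cons, map_add, map_smul, linearCombination_consWord,
      linearCombination_consWord]
    have e1 := evalPts_shuffle_out hf hs a.1 u (b :: v) (A.flatten ++ [a]) B.flatten E
      (by simpa using h2') (by simp)
    have e2 := evalPts_shuffle_out hf hs b.1 (a :: u) v (A.flatten ++ [b]) B.flatten E (by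
      refine ((List.Perm.map Prod.fst ?_).nodup_iff).1 h2'
      classical
      rw [List.perm_iff_count]
      intro x
      simp only [List.count_append, List.count_cons, List.count_nil]
      omega) (by simp)
    have e3 := evalPts_move (K := K) hs
      (chain (b.1 :: a.1 :: u.map Prod.fst) + chain (b.1 :: v.map Prod.fst) + E) A.flatten b
      (a :: u) (v ++ B.flatten)
    have e4 := evalPts_rev hf
      (chain (a.1 :: u.map Prod.fst) + (chain (b.1 :: v.map Prod.fst) + E)) h2' (a := a.1)
      (b := b.1) (by
        rintro e
        simp only [List.append_assoc, List.map_append, List.cons_append, List.map_cons] at h2'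
        have h3 := h2'.of_append_right
        simp [e] at h3) (by simp) (by simp)
    simp only [List.map_cons, chain_cons_cons, List.append_assoc, List.cons_append,
      List.nil_append, List.length_cons, Multiset.cons_add, Multiset.add_cons] at e1 e2 e3 e4 ⊢
    simp only [add_assoc] at e1 e2 e3 e4 ⊢
    rw [← e1, ← e2, e3, smul_smul, neg_one_pow_mul_self, one_smul, e4, neg_add_cancel]
  · intro w hw
    have e1 := evalLines_eq_lineValue f (A ++ w :: B) (by
      refine ((List.Perm.map Prod.fst ?_).nodup_iff).1 h2'
      simp only [List.flatten_append, List.flatten_cons, List.append_assoc]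
      refine List.Perm.append_left _ ?_
      rw [← List.append_assoc]
      exact List.Perm.append_right _ hw.symm)
    simp only [List.map_append, List.map_cons] at e1
    rw [← e1, evalLines]
    simp only [linesArrows_append, linesArrows_cons, List.flatten_append, List.flatten_cons,
      List.append_assoc]
    rw [add_left_comm (linesArrows A)]

/-- The arrows depend only on the lengths of the words, so each composition contributes the value of
`f` on a fixed quiver. -/
lemma ofSymmetric_lineValue_multilinear {f : QuivFun V n} (hf : ∀ Γ, f Γ ∈ multilinear K V n)
    (p : ℕ) : ofSymmetric n p (lineValue f) ∈ multilinear K V n := by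
  have : ofSymmetric n p (lineValue f) = ∑ c : Composition n, if c.length = p then
      f (quiverOn (linesArrows (labelWords 0
        ((List.ofFn (0 : Fin n → V)).splitWrtComposition c))) fun i : Fin n => {i.val}) else 0 := by
    funext v
    rw [Finset.sum_apply, ofSymmetric]
    refine Finset.sum_congr rfl fun c _ => ?_
    split_ifs
    · have hlen : ∀ v : Fin n → V, ((List.ofFn v).splitWrtComposition c).map List.length =
          c.blocks := fun v => List.map_length_splitWrtCompositionAux (ns := c.blocks) (by rw [c.blocks_sum, List.length_ofFn])
      rw [lineValue_eq_evalPts f ((List.ofFn v).splitWrtComposition c) v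
          (List.flatten_splitWrtCompositionAux (ns := c.blocks)
            (by rw [c.blocks_sum, List.length_ofFn])),
        linesArrows_labelWords_congr 0 ((hlen v).trans (hlen 0).symm)]
    · rfl
  rw [this]
  refine Submodule.sum_mem _ fun c _ => ?_
  split_ifs
  · exact hf _
  · exact zero_mem _

end LineValues

/-! ### Unions of lines span the quivers modulo the cycle relations -/

section Spanning

variable {K V : Type*} [Field K] [AddCommGroup V] [Module K V] {n : ℕ}

lemma lineArrows_eq_sum (L : List (List (Fin n))) :
    Quiv.lineArrows L = (L.map chain).sum := by
  induction L with
  | nil => rfl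
  | cons l L ih =>
    rw [List.map_cons, List.sum_cons, ← ih]
    rfl

lemma card_chain {M : Type*} (w : List M) : Multiset.card (chain w) = w.length - 1 := by
  simp [chain]

lemma ne_of_mem_chain {M : Type*} {w : List M} (hw : w.Nodup) {e : M × M} (he : e ∈ chain w) :
    e.1 ≠ e.2 := by
  induction w with
  | nil => simp at he
  | cons a w ih =>
    rcases w with _ | ⟨b, w⟩
    · simp at he
    rw [chain_cons_cons, Multiset.mem_cons] at he
    rcases he with rfl | he
    · intro h
      exact (List.nodup_cons.1 hw).1 (List.mem_cons.2 (Or.inl h))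
    · exact ih hw.of_cons he

lemma mem_sum_chain {M : Type*} {L : List (List M)} {e : M × M} (he : e ∈ (L.map chain).sum) :
    ∃ w ∈ L, e ∈ chain w := by
  induction L with
  | nil => simp at he
  | cons l L ih =>
    rw [List.map_cons, List.sum_cons, Multiset.mem_add] at he
    rcases he with he | he
    · exact ⟨l, List.mem_cons_self, he⟩
    · obtain ⟨w, hw, he⟩ := ih he
      exact ⟨w, List.mem_cons_of_mem _ hw, he⟩

lemma card_sum_chain {M : Type*} (L : List (List M)) (h : ∀ l ∈ L, l ≠ []) :
    Multiset.card (L.map chain).sum + L.length = L.flatten.length := by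
  induction L with
  | nil => rfl
  | cons l L ih =>
    have h1 := ih fun l hl => h l (List.mem_cons_of_mem _ hl)
    have h2 := List.length_pos_iff.2 (h l List.mem_cons_self)
    simp only [List.map_cons, List.sum_cons, Multiset.card_add, card_chain, List.length_cons,
      List.flatten_cons, List.length_append]
    omega

lemma Quiv.IsLinePartition.card_add {L : List (List (Fin n))} (h : Quiv.IsLinePartition L) :
    Multiset.card (Quiv.lineArrows L) + L.length = n := by
  rw [lineArrows_eq_sum, card_sum_chain L h.1, h.2.1.length_eq, List.length_finRange]

/-- The reason is the one of `evalPts_shuffle_out`. For the spanning argument it suffices to keep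
track of vanishing, so neither signs nor skewness of `f` are needed. -/
lemma finOp_shuffle_eq_zero {f : QuivFun V n} (hf : f ∈ finOp K V n) (c : Fin n)
    (u v : List (Fin n)) (hn : (c :: (u ++ v)).Nodup) (E : Multiset (Fin n × Fin n))
    (h : ∀ w : List (Fin n), w.Perm (u ++ v) → f (ofArrows (chain (c :: w) + E)) = 0) :
    f (ofArrows (chain (c :: u) + chain (c :: v) + E)) = 0 := by
  induction hk : u.length + v.length using Nat.strong_induction_on generalizing c u v E with
  | _ k ih =>
    rcases u with _ | ⟨a, u⟩
    · simpa using h v (by simp)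
    rcases v with _ | ⟨b, v⟩
    · simpa using h (a :: u) (by simp)
    simp only [List.length_cons] at hk
    simp only [List.cons_append, List.nodup_cons, List.mem_cons, List.mem_append, not_or] at hn
    have key := finOp_tri hf (chain (a :: u) + chain (b :: v) + E) (a := a) (b := b) (c := c)
      (by tauto) (Ne.symm (by tauto)) (Ne.symm (by tauto))
    have e1 := ih _ (by simp; omega) a u (b :: v) (by simp; tauto) ((c, a) ::ₘ E)
      (fun w hw => by
        rw [← h (a :: w) (List.Perm.cons a hw), chain_cons_cons, Multiset.cons_add,
          Multiset.add_cons]) rfl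
    have e2 := ih _ (by simp; omega) b (a :: u) v (by
        have : (b :: a :: (u ++ v)).Nodup := by
          have h2 := hn.2.2
          have h3 := (List.nodup_middle.1 h2)
          have h4 := hn.2.1
          simp only [List.nodup_cons, List.mem_cons, List.mem_append, not_or] at h3 ⊢
          refine ⟨⟨Ne.symm h4.2.1, h3.1⟩, ⟨h4.1, h4.2.2⟩, h3.2⟩
        simpa using this) ((c, b) ::ₘ E)
      (fun w hw => by
        rw [← h (b :: w) ((List.Perm.cons b hw).trans List.perm_middle.symm), chain_cons_cons,
          Multiset.cons_add, Multiset.add_cons]) rfl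
    simp only [chain_cons_cons, Multiset.cons_add, Multiset.add_cons, add_assoc] at e1 e2 key ⊢
    rw [Multiset.cons_swap, ← key, e1, e2, add_zero]

/-- Reversing the arrows one by one changes only the sign. -/
lemma finOp_reverse_eq_zero {f : QuivFun V n} (hf : f ∈ finOp K V n) (l : List (Fin n))
    (hn : l.Nodup) (E : Multiset (Fin n × Fin n))
    (h : f (ofArrows (chain l.reverse + E)) = 0) : f (ofArrows (chain l + E)) = 0 := by
  induction l generalizing E with
  | nil => exact h
  | cons a l ih =>
    rcases l with _ | ⟨b, l⟩
    · exact h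
    simp only [List.nodup_cons, List.mem_cons, not_or] at hn
    rw [chain_cons_cons, Multiset.cons_add, finOp_rev hf _ hn.1.1, ← Multiset.add_cons,
      ih (by simp; tauto) ((b, a) ::ₘ E), neg_zero]
    rw [← h]
    congr 2
    simp only [List.reverse_cons, List.append_assoc, List.cons_append, List.nil_append]
    rw [chain_concat]
    simp

/-- Two lines joined by an arrow are a combination of single lines. -/
lemma finOp_join_eq_zero {f : QuivFun V n} (hf : f ∈ finOp K V n) (a b : Fin n)
    (p₁ p₂ q₁ q₂ : List (Fin n)) (hn : ((p₁ ++ a :: p₂) ++ (q₁ ++ b :: q₂)).Nodup)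
    (E : Multiset (Fin n × Fin n))
    (h : ∀ w : List (Fin n), w.Perm (p₂ ++ (q₁ ++ b :: q₂)) →
      f (ofArrows (chain (p₁ ++ a :: w) + E)) = 0) :
    f (ofArrows ((a, b) ::ₘ (chain (p₁ ++ a :: p₂) + chain (q₁ ++ b :: q₂) + E))) = 0 := by
  have hq : (b :: (q₁.reverse ++ q₂)).Nodup := by
    have := hn.of_append_right
    refine ((List.Perm.nodup_iff ?_).1 this)
    exact List.perm_middle.trans (List.Perm.cons b (List.Perm.append_right _
      (List.reverse_perm _).symm))
  have hp : ∀ w : List (Fin n), w.Perm (q₁ ++ q₂) → (a :: (p₂ ++ b :: w)).Nodup := by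
    intro w hw
    have h2 : (a :: p₂ ++ (q₁ ++ b :: q₂)).Nodup := by
      have : (p₁ ++ (a :: p₂ ++ (q₁ ++ b :: q₂))).Nodup := by simpa using hn
      exact this.of_append_right
    refine (List.Perm.nodup_iff ?_).1 h2
    refine List.Perm.cons a (List.Perm.append_left _ ?_)
    exact List.perm_middle.trans (List.Perm.cons b hw.symm)
  rw [chain_append p₁, chain_append q₁]
  -- The part of the second line that leads to `b` is reversed, so that both of its parts start at
  -- `b` and can be shuffled to one line. The arrow `a → b` makes it a line that starts at `a`,
  -- which is shuffled with `p₂`.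
  have := finOp_reverse_eq_zero hf (q₁ ++ [b]) (by
      have := hn.of_append_right
      rw [show q₁ ++ b :: q₂ = (q₁ ++ [b]) ++ q₂ by simp] at this
      exact this.of_append_left)
    ((a, b) ::ₘ (chain (b :: q₂) + (chain (p₁ ++ [a]) + chain (a :: p₂) + E))) ?_
  · rw [← this]
    congr 2
    simp only [Multiset.add_cons]
    congr 1
    abel
  have := finOp_shuffle_eq_zero hf b q₁.reverse q₂ hq
    ((a, b) ::ₘ (chain (p₁ ++ [a]) + chain (a :: p₂) + E)) ?_
  · rw [← this]
    congr 2
    simp only [Multiset.add_cons, List.reverse_append, List.reverse_singleton, List.singleton_append]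
    congr 1
    abel
  intro w hw
  have hw' : w.Perm (q₁ ++ q₂) := hw.trans (List.Perm.append_right _ (List.reverse_perm _))
  have := finOp_shuffle_eq_zero hf a p₂ (b :: w) (hp w hw') (chain (p₁ ++ [a]) + E) ?_
  · rw [← this]
    congr 2
    simp only [chain_cons_cons, Multiset.add_cons, Multiset.cons_add]
    congr 1
    abel
  intro x hx
  have := h x (hx.trans (List.Perm.append_left _
    ((List.Perm.cons b hw').trans List.perm_middle.symm)))
  rw [chain_append] at this
  rw [← this]
  congr 2
  abel

/-- Lists of lines on all vertices. -/
def IsLineList (L : List (List (Fin n))) : Prop :=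
  (∀ l ∈ L, l ≠ []) ∧ L.flatten.Perm (List.finRange n)

lemma IsLineList.perm {L L' : List (List (Fin n))} (h : IsLineList L) (hp : L.Perm L') :
    IsLineList L' :=
  ⟨fun l hl => h.1 l (hp.mem_iff.2 hl), hp.symm.flatten.trans h.2⟩

lemma IsLineList.of_head {l l' : List (Fin n)} {L : List (List (Fin n))} (h : IsLineList (l :: L))
    (hp : l'.Perm l) : IsLineList (l' :: L) := by
  refine ⟨fun x hx => ?_, (List.Perm.append_right _ hp).trans h.2⟩
  rcases List.mem_cons.1 hx with rfl | hx
  · rintro rfl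
    exact h.1 l List.mem_cons_self (List.nil_perm.1 hp)
  · exact h.1 x (List.mem_cons_of_mem _ hx)

lemma sum_chain_perm {L L' : List (List (Fin n))} (hp : L.Perm L') :
    (L.map chain).sum = (L'.map chain).sum := (hp.map chain).sum_eq

/-- Arrows are absorbed into a union of lines one at a time. A loop is ignored, an arrow between
points of one line closes a cycle, and an arrow between two lines joins them to combinations of
single lines by `finOp_join_eq_zero`. -/
lemma finOp_eq_zero_of_lines {f : QuivFun V n} (hf : f ∈ finOp K V n)
    (h : ∀ L, IsLineList L → f (ofArrows (L.map chain).sum) = 0) (E : Multiset (Fin n × Fin n))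
    (L : List (List (Fin n))) (hL : IsLineList L) : f (ofArrows (E + (L.map chain).sum)) = 0 := by
  induction E using Multiset.induction generalizing L with
  | empty => simpa using h L hL
  | cons e E ih =>
    obtain ⟨a, b⟩ := e
    rw [Multiset.cons_add]
    by_cases hab : a = b
    · subst hab
      rw [ofArrows_cons_self]
      exact ih L hL
    have hmem : ∀ x, ∃ l ∈ L, x ∈ l := fun x =>
      List.mem_flatten.1 (hL.2.mem_iff.2 (List.mem_finRange x))
    obtain ⟨l, hl, ha⟩ := hmem a
    obtain ⟨l', hl', hb⟩ := hmem b
    have hL₁ := List.perm_cons_erase hl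
    set L₁ := L.erase l
    by_cases hbl : b ∈ l
    · refine finOp_conn hf hab ?_
      refine (conn_chain ha hbl).mono ?_
      rw [sum_chain_perm hL₁, List.map_cons, List.sum_cons]
      exact (Multiset.le_add_right _ _).trans (Multiset.le_add_left _ _)
    · have hl'' : l' ∈ L₁ := by
        rcases List.mem_cons.1 (hL₁.mem_iff.1 hl') with rfl | h
        · exact absurd hb hbl
        · exact h
      have hL₂ := List.perm_cons_erase hl''
      set L₂ := L₁.erase l'
      have hP := hL₁.trans (List.Perm.cons l hL₂)
      have hL' := hL.perm hP
      obtain ⟨p₁, p₂, rfl⟩ := List.append_of_mem ha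
      obtain ⟨q₁, q₂, rfl⟩ := List.append_of_mem hb
      rw [sum_chain_perm hP, List.map_cons, List.map_cons, List.sum_cons, List.sum_cons]
      have := finOp_join_eq_zero hf a b p₁ p₂ q₁ q₂ (by
          have := hL'.2.nodup_iff.2 (List.nodup_finRange n)
          simp only [List.flatten_cons] at this
          rw [← List.append_assoc] at this
          exact this.of_append_left) (E + (L₂.map chain).sum) ?_
      · rw [← this]
        congr 3
        abel
      intro w hw
      rw [← ih ((p₁ ++ a :: w) :: L₂) ?_]
      · congr 2
        rw [List.map_cons, List.sum_cons]
        abel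
      · refine ⟨?_, ?_⟩
        · intro x hx
          rcases List.mem_cons.1 hx with rfl | hx
          · simp
          · exact hL'.1 x (List.mem_cons_of_mem _ (List.mem_cons_of_mem _ hx))
        · refine List.Perm.trans ?_ hL'.2
          simp only [List.flatten_cons, List.append_assoc, List.cons_append]
          refine List.Perm.append_left _ (List.Perm.cons a ?_)
          simpa using List.Perm.append_right L₂.flatten hw

/-- Every line starts with its smallest vertex. -/
def MinHeaded (l : List (Fin n)) : Prop := ∀ x ∈ l.head?, ∀ y ∈ l, x ≤ y

lemma exists_min_split (l : List (Fin n)) (hl : l ≠ []) :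
    ∃ u m v, l = u ++ m :: v ∧ ∀ y ∈ l, m ≤ y := by
  obtain ⟨m, hm, h⟩ := l.toFinset.exists_min_image id (by simpa using hl)
  simp only [List.mem_toFinset, id] at hm h
  obtain ⟨u, v, rfl⟩ := List.append_of_mem hm
  exact ⟨u, m, v, rfl, h⟩

/-- Each line of `L₂` is split at its smallest vertex, its first part is reversed, and the two parts
are shuffled; the resulting lines start with their minimum and go to `L₁`. At the end only the order
of the lines has to be arranged. -/
lemma finOp_lines_eq_zero {f : QuivFun V n} (hf : f ∈ finOp K V n)
    (h : ∀ L, Quiv.IsLinePartition L → f (ofArrows (Quiv.lineArrows L)) = 0)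
    (L₁ L₂ : List (List (Fin n))) (h₁ : ∀ l ∈ L₁, MinHeaded l) (hL : IsLineList (L₂ ++ L₁)) :
    f (ofArrows ((L₂ ++ L₁).map chain).sum) = 0 := by
  induction L₂ generalizing L₁ with
  | nil =>
    rw [List.nil_append] at hL ⊢
    -- Lines are sorted by their first vertices. The default value concerns empty lists, which do
    -- not occur.
    set le : List (Fin n) → List (Fin n) → Bool := fun l l' =>
      decide ((l.head?.map Fin.val).getD 0 ≤ (l'.head?.map Fin.val).getD 0) with hle
    have hp := List.mergeSort_perm L₁ le
    have hs := List.pairwise_mergeSort (le := le) (by simp only [hle, decide_eq_true_eq]; omega)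
      (by simp only [hle, Bool.or_eq_true, decide_eq_true_eq]; omega) L₁
    set L := L₁.mergeSort le
    have hL' := hL.perm hp.symm
    rw [← sum_chain_perm hp, ← lineArrows_eq_sum]
    refine h L ⟨hL'.1, hL'.2, fun l hl => h₁ l (hp.mem_iff.1 hl), ?_⟩
    have hd := (List.nodup_flatten.1 (hL'.2.nodup_iff.2 (List.nodup_finRange n))).2
    refine (hs.and hd).imp ?_
    rintro l l' ⟨h1, h2⟩ x hx y hy
    have hx' := List.mem_of_mem_head? hx
    have hy' := List.mem_of_mem_head? hy
    rw [Option.mem_def] at hx hy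
    simp only [hle, hx, hy, Option.map_some, Option.getD_some, decide_eq_true_eq] at h1
    refine lt_of_le_of_ne h1 ?_
    rintro rfl
    exact h2 hx' hy'
  | cons l L₂ ih =>
    obtain ⟨u, m, v, rfl, hm⟩ := exists_min_split l (hL.1 l (by simp))
    have hn := hL.2.nodup_iff.2 (List.nodup_finRange n)
    simp only [List.cons_append, List.flatten_cons] at hn
    have hn' := hn.of_append_left
    simp only [List.cons_append, List.map_cons, List.sum_cons]
    rw [chain_append, add_assoc]
    refine finOp_reverse_eq_zero hf _ (by
      rw [show u ++ m :: v = (u ++ [m]) ++ v by simp] at hn'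
      exact hn'.of_append_left) _ ?_
    rw [List.reverse_append, List.reverse_singleton, List.singleton_append, ← add_assoc]
    refine finOp_shuffle_eq_zero hf m _ _ ((List.Perm.nodup_iff ?_).1 hn') _ ?_
    · exact List.perm_middle.trans (List.Perm.cons m (List.Perm.append_right _
        (List.reverse_perm _).symm))
    intro w hw
    have hw' : (m :: w).Perm (u ++ m :: v) :=
      (List.Perm.cons m (hw.trans (List.Perm.append_right _ (List.reverse_perm _)))).trans
        List.perm_middle.symm
    rw [← ih ((m :: w) :: L₁) ?_ ?_]
    · congr 2
      rw [sum_chain_perm List.perm_middle, List.map_cons, List.sum_cons]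
    · intro l hl
      rcases List.mem_cons.1 hl with rfl | hl
      · intro x hx y hy
        obtain rfl := Option.some.inj hx
        exact hm y (hw'.mem_iff.1 hy)
      · exact h₁ l hl
    · exact (IsLineList.of_head hL hw').perm List.perm_middle.symm

/-- An element of the finite operad is determined by its values on the unions of lines. -/
lemma finOp_ext_lines {f : QuivFun V n} (hf : f ∈ finOp K V n)
    (h : ∀ (L : List (List (Fin n))) (Γ : Quiv n), Quiv.IsLinePartition L →
      Γ.1 = Quiv.lineArrows L → f Γ = 0) : f = 0 := by
  have h1 : ∀ L, Quiv.IsLinePartition L → f (ofArrows (Quiv.lineArrows L)) = 0 := by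
    intro L hL
    refine h L _ hL ?_
    rw [ofArrows, Multiset.filter_eq_self]
    intro e he
    rw [lineArrows_eq_sum] at he
    have hd := (List.nodup_flatten.1 (hL.2.1.nodup_iff.2 (List.nodup_finRange n))).1
    obtain ⟨w, hw, he⟩ := mem_sum_chain he
    exact ne_of_mem_chain (hd w hw) he
  funext Γ
  -- The start is the union of the lines with one vertex, which carry no arrows; all arrows of `Γ`
  -- are then added.
  have := finOp_eq_zero_of_lines hf (fun L hL => by
    have := finOp_lines_eq_zero hf h1 [] L (by simp) (by rwa [List.append_nil])
    rwa [List.append_nil] at this) Γ.1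
    ((List.finRange n).map fun i => [i]) ⟨by simp, by
      rw [← List.flatMap_def, List.flatMap_singleton']⟩
  have h0 : (((List.finRange n).map fun i => [i]).map chain).sum = 0 := by
    rw [List.map_map, show (chain ∘ fun i : Fin n => [i]) = fun _ => 0 from rfl]
    simp
  rw [h0, add_zero, ofArrows_val] at this
  exact this

end Spanning

/-! ### The bigrading -/

section Bigrading

variable {K V : Type*} [Field K] [AddCommGroup V] [Module K V] {n : ℕ}

/-- `f` vanishes on the quivers whose number of arrows does not satisfy `P`. -/
def SupportedOn (P : ℕ → Prop) (f : QuivFun V n) : Prop :=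
  ∀ Γ : Quiv n, ¬P (Multiset.card Γ.1) → f Γ = 0

/-- An arrow lies inside the collapsed block or survives the collapse. Hence numbers of arrows add
up under composition, which is the source of the bigrading. -/
lemma card_collapse_add_card_restrict {a b N : ℕ} (h : a + b = N) (Γ : Quiv (N + 1)) :
    Multiset.card (Γ.collapse h).1 + Multiset.card (Γ.restrict b).1 = Multiset.card Γ.1 := by
  obtain ⟨E, hE⟩ := Γ
  simp only [Quiv.collapse, Quiv.restrict]
  induction E using Multiset.induction_on with
  | empty => rfl
  | cons e E ih =>
    have ih' := ih fun x hx => hE x (Multiset.mem_cons_of_mem hx)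
    obtain ⟨x, y⟩ := e
    have hxy : x.val ≠ y.val := fun h => hE _ (Multiset.mem_cons_self _ _) (Fin.ext h)
    rw [Multiset.map_cons, Multiset.filterMap_cons, Multiset.filter_cons, Multiset.card_cons, ← ih']
    by_cases hin : x.val < b + 1 ∧ y.val < b + 1
    · rw [dif_pos hin, if_neg (by simp only [ne_eq, Fin.mk.injEq, not_not]; omega)]
      simp
      omega
    · rw [dif_neg hin, if_pos (by simp only [ne_eq, Fin.mk.injEq]; omega)]
      simp
      omega

lemma SupportedOn.act {P : ℕ → Prop} {f : QuivFun V n} (hf : SupportedOn P f)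
    (σ : Equiv.Perm (Fin n)) : SupportedOn P (PoissonFinite.act σ f) := by
  intro Γ h
  funext v
  rw [PoissonFinite.act, hf _ (by rwa [Quiv.relabel, Multiset.card_map])]
  rfl

lemma SupportedOn.circ {P Q : ℕ → Prop} {a b N : ℕ} (h : a + b = N) {f : QuivFun V (a + 1)}
    {g : QuivFun V (b + 1)} (hf' : ∀ Γ, f Γ ∈ multilinear K V (a + 1)) (hf : SupportedOn P f)
    (hg : SupportedOn Q g) :
    SupportedOn (fun k => ∃ i j, P i ∧ Q j ∧ k = i + j) (PoissonFinite.circ h f g) := by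
  intro Γ hΓ
  funext v
  rw [PoissonFinite.circ]
  by_cases h1 : P (Multiset.card (Γ.collapse h).1)
  · have h2 : ¬Q (Multiset.card (Γ.restrict b).1) := fun h2 =>
      hΓ ⟨_, _, h1, h2, (card_collapse_add_card_restrict h Γ).symm⟩
    rw [hg _ h2]
    obtain ⟨G, hG⟩ := hf' (Γ.collapse h)
    rw [← hG]
    exact G.map_coord_zero 0 (by simp)
  · rw [hf _ h1]
    rfl

lemma SupportedOn.add {P : ℕ → Prop} {f g : QuivFun V n} (hf : SupportedOn P f)
    (hg : SupportedOn P g) : SupportedOn P (f + g) := fun Γ h => by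
  rw [Pi.add_apply, hf Γ h, hg Γ h, add_zero]

lemma SupportedOn.zsmul {P : ℕ → Prop} {f : QuivFun V n} (hf : SupportedOn P f) (c : ℤ) :
    SupportedOn P (c • f) := fun Γ h => by
  rw [Pi.smul_apply, hf Γ h, smul_zero]

lemma SupportedOn.mono {P Q : ℕ → Prop} {f : QuivFun V n} (hf : SupportedOn P f)
    (h : ∀ k, P k → Q k) : SupportedOn Q f := fun Γ hΓ => hf Γ fun h' => hΓ (h _ h')

lemma SupportedOn.lieBracket {P Q : ℕ → Prop} {a b N : ℕ} (h : a + b = N) {f : QuivFun V (a + 1)}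
    {g : QuivFun V (b + 1)} (hf' : ∀ Γ, f Γ ∈ multilinear K V (a + 1))
    (hg' : ∀ Γ, g Γ ∈ multilinear K V (b + 1)) (hf : SupportedOn P f) (hg : SupportedOn Q g) :
    SupportedOn (fun k => ∃ i j, P i ∧ Q j ∧ k = i + j) (PoissonFinite.lieBracket h f g) := by
  have key : ∀ {P Q : ℕ → Prop} {a b N : ℕ} (h : a + b = N) {f : QuivFun V (a + 1)}
      {g : QuivFun V (b + 1)}, (∀ Γ, f Γ ∈ multilinear K V (a + 1)) → SupportedOn P f →
      SupportedOn Q g → SupportedOn (fun k => ∃ i j, P i ∧ Q j ∧ k = i + j) (box h f g) := by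
    intro P Q a b N h f g hf' hf hg Γ hΓ
    rw [box, Finset.sum_apply]
    refine Finset.sum_eq_zero fun σ _ => ?_
    exact ((SupportedOn.circ h hf' hf hg).act σ⁻¹).zsmul _ Γ hΓ
  rw [PoissonFinite.lieBracket, sub_eq_add_neg, ← neg_smul]
  refine (key h hf' hf hg).add ((key _ hg' hg hf).zsmul _ |>.mono ?_)
  rintro k ⟨i, j, hi, hj, rfl⟩
  exact ⟨j, i, hj, hi, add_comm _ _⟩

/-- The part of `f` on the quivers with `k` arrows, `k + p = n`. -/
def gradedPart (p : ℕ) (f : QuivFun V n) : QuivFun V n :=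
  fun Γ => if Multiset.card Γ.1 + p = n then f Γ else 0

/-- The cycle relations and the action of permutations are homogeneous in the number of arrows. -/
lemma gradedPart_mem_finCx {Y : QuivFun V (n + 1)} (hY : Y ∈ finCx K V n) (p : ℕ) :
    gradedPart p Y ∈ finCx K V n := by
  refine ⟨⟨fun Γ => ?_, fun Γ h => ?_, fun Γ k v h => ?_⟩, fun σ => ?_⟩
  · rw [gradedPart]
    split_ifs
    · exact hY.1.1 Γ
    · exact zero_mem _
  · rw [gradedPart, hY.1.2.1 Γ h, ite_self]
  · have hc : ∀ i, Multiset.card (Γ.erase (v i, v (i + 1))).1 = Multiset.card Γ.1 - 1 := by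
      intro i
      refine Multiset.card_erase_of_mem (Multiset.mem_of_le h.2 ?_)
      exact Multiset.mem_map_of_mem (fun i => (v i, v (i + 1))) (Finset.mem_univ i)
    simp only [gradedPart, hc]
    split_ifs
    · exact hY.1.2.2 Γ k v h
    · simp
  · funext Γ v
    have := congrFun (congrFun (hY.2 σ) Γ) v
    have hc : Multiset.card (Γ.relabel σ).1 = Multiset.card Γ.1 := Multiset.card_map _ _
    simp only [act, gradedPart, Pi.smul_apply, hc] at this ⊢
    split_ifs
    · exact this
    · exact (smul_zero _).symm

lemma gradedPart_mem_finBi {Y : QuivFun V (n + 1)} (hY : Y ∈ finCx K V n) (p : ℕ) :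
    gradedPart p Y ∈ finBi K V p n := by
  refine ⟨gradedPart_mem_finCx hY p, fun L Γ hL hΓ hp => ?_⟩
  have := hL.card_add
  rw [gradedPart, if_neg]
  rw [hΓ]
  omega

lemma finCx_ext_lines {Y : QuivFun V (n + 1)} (hY : Y ∈ finCx K V n)
    (h : ∀ (L : List (List (Fin (n + 1)))) (Γ : Quiv (n + 1)), Quiv.IsLinePartition L →
      Γ.1 = Quiv.lineArrows L → Y Γ = 0) : Y = 0 := finOp_ext_lines hY.1 h

/-- It suffices to compare values on unions of lines, and `n + 1` vertices form at most `n + 1`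
lines. -/
lemma sum_gradedPart {Y : QuivFun V (n + 1)} (hY : Y ∈ finCx K V n) :
    ∑ p ∈ Finset.range (n + 2), gradedPart p Y = Y := by
  symm
  rw [← sub_eq_zero]
  refine finCx_ext_lines (sub_mem hY (Submodule.sum_mem _ fun p _ => gradedPart_mem_finCx hY p))
    fun L Γ hL hΓ => ?_
  have hc := hL.card_add
  rw [← hΓ] at hc
  rw [Pi.sub_apply, Finset.sum_apply, Finset.sum_eq_single L.length, gradedPart, if_pos hc, sub_self]
  · intro p _ hp
    rw [gradedPart, if_neg (by omega)]
  · intro h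
    rw [Finset.mem_range] at h
    omega

/-- A union of `p` lines on `n + 1` vertices has `n + 1 - p` arrows, and unions of lines determine
the graded parts. The condition on supports, unlike the one on lines, is visibly compatible with
composition. -/
lemma mem_finBi_iff {Y : QuivFun V (n + 1)} {p : ℕ} : Y ∈ finBi K V p n ↔
    Y ∈ finCx K V n ∧ SupportedOn (fun k => k + p = n + 1) Y := by
  constructor
  · rintro ⟨h, h'⟩
    refine ⟨h, fun Γ hΓ => ?_⟩
    rw [← sum_gradedPart h, Finset.sum_apply]
    refine Finset.sum_eq_zero fun q _ => ?_
    rw [gradedPart]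
    split_ifs with hq
    · have : gradedPart q Y = 0 := by
        refine finCx_ext_lines (gradedPart_mem_finCx h _) fun L Δ hL hΔ => ?_
        have hc := hL.card_add
        rw [← hΔ] at hc
        rw [gradedPart]
        split_ifs
        · exact h' L Δ hL hΔ (by omega)
        · rfl
      have := congrFun this Γ
      rwa [gradedPart, if_pos hq] at this
    · rfl
  · rintro ⟨h, h'⟩
    refine ⟨h, fun L Γ hL hΓ hp => h' Γ ?_⟩
    have := hL.card_add
    rw [← hΓ] at this
    omega

lemma finBi_eq_bot {p : ℕ} (h : p = 0 ∨ n + 1 < p) : finBi K V p n = ⊥ := by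
  rw [eq_bot_iff]
  rintro Y ⟨hY, hY'⟩
  rw [Submodule.mem_bot]
  refine finCx_ext_lines hY fun L Γ hL hΓ => hY' L Γ hL hΓ ?_
  have := hL.card_add
  rintro rfl
  rcases h with h | h
  · rw [List.length_eq_zero_iff] at h
    subst h
    have := hL.2.1.length_eq
    simp at this
  · omega

lemma iSupIndep_finBi : iSupIndep fun p => finBi K V p n := by
  rw [iSupIndep_def]
  intro p
  rw [Submodule.disjoint_def]
  intro Y hY hY'
  -- The functions that vanish on the quivers with `n + 1 - p` arrows; they contain all other
  -- components.
  let Z : Submodule K (QuivFun V (n + 1)) :=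
    { carrier := {f | SupportedOn (fun k => k + p ≠ n + 1) f}
      add_mem' := fun hf hg => by
        rw [Set.mem_ofPred_eq] at *
        exact hf.add hg
      zero_mem' := fun _ _ => rfl
      smul_mem' := fun c f hf Γ h => by
        rw [Set.mem_ofPred_eq] at hf
        rw [Pi.smul_apply, hf Γ h, smul_zero] }
  have hZ : (⨆ j, ⨆ (_ : j ≠ p), finBi K V j n) ≤ Z := by
    refine iSup₂_le fun j hj f hf => ?_
    have : SupportedOn (fun k => k + p ≠ n + 1) f :=
      (mem_finBi_iff.1 hf).2.mono fun k hk h => hj (by omega)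
    exact this
  funext Γ
  by_cases h : Multiset.card Γ.1 + p = n + 1
  · exact hZ hY' Γ (by simpa using h)
  · exact (mem_finBi_iff.1 hY).2 Γ h

lemma iSup_finBi : ⨆ p, finBi K V p n = finCx K V n := by
  refine le_antisymm (iSup_le fun p f hf => hf.1) fun Y hY => ?_
  rw [← sum_gradedPart hY]
  exact Submodule.sum_mem _ fun p _ => Submodule.mem_iSup_of_mem p (gradedPart_mem_finBi hY p)

namespace PoissonAlgebra

variable (A : PoissonAlgebra K V)

lemma Xh_supportedOn : SupportedOn (fun k => k = 0) A.Xh := fun Γ h => by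
  funext v
  rw [Xh, if_neg]
  · rfl
  · intro h'
    rw [h'] at h
    exact h rfl

lemma Xv_supportedOn : SupportedOn (fun k => k = 1) A.Xv := fun Γ h => by
  funext v
  rw [Xv, if_neg, if_neg]
  · rfl
  all_goals
    intro h'
    rw [h'] at h
    exact h rfl

lemma dh_mem_finBi {p : ℕ} {Y : QuivFun V (n + 1)} (hY : Y ∈ finBi K V p n) :
    A.dh n Y ∈ finBi K V (p + 1) (n + 1) := by
  refine mem_finBi_iff.2 ⟨A.dh_mem_finCx hY.1, ?_⟩
  refine (SupportedOn.lieBracket (K := K) _ A.Xh_multilinear hY.1.1.1 A.Xh_supportedOn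
    (mem_finBi_iff.1 hY).2).mono ?_
  rintro k ⟨i, j, hi, hj, rfl⟩
  omega

lemma dv_mem_finBi {p : ℕ} {Y : QuivFun V (n + 1)} (hY : Y ∈ finBi K V p n) :
    A.dv n Y ∈ finBi K V p (n + 1) := by
  refine mem_finBi_iff.2 ⟨A.dv_mem_finCx hY.1, ?_⟩
  refine (SupportedOn.lieBracket (K := K) _ A.Xv_multilinear hY.1.1.1 A.Xv_supportedOn
    (mem_finBi_iff.1 hY).2).mono ?_
  rintro k ⟨i, j, hi, hj, rfl⟩
  omega

end PoissonAlgebra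

end Bigrading

/-! ### Products of letters and the words that respect given arrows -/

section Respecting

variable {K : Type*} [Field K] {M : Type*} [DecidableEq M]

lemma supported_induction {α : Type*} {s : Set (List α)} {p : Words K α → Prop} {x : Words K α}
    (hx : x ∈ Finsupp.supported K K s) (h0 : p 0)
    (hadd : ∀ x y, p x → p y → p (x + y)) (hsmul : ∀ (c : K) x, p x → p (c • x))
    (h1 : ∀ w ∈ s, p (Finsupp.single w 1)) : p x := by
  rw [Finsupp.supported_eq_span_single] at hx
  induction hx using Submodule.span_induction with
  | mem x h => obtain ⟨w, hw, rfl⟩ := h; exact h1 w hw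
  | zero => exact h0
  | add x y _ _ hx hy => exact hadd x y hx hy
  | smul c x _ hx => exact hsmul c x hx

lemma map_consWord_supported {α : Type*} {s t : Set (List α)} {a : α} (h : ∀ w ∈ s, a :: w ∈ t)
    {x : Words K α} (hx : x ∈ Finsupp.supported K K s) :
    consWord K a x ∈ Finsupp.supported K K t := by
  refine supported_induction (p := fun x => consWord K a x ∈ Finsupp.supported K K t) hx
    ?_ ?_ ?_ ?_
  · rw [map_zero]; exact zero_mem _
  · intro x y hx hy; rw [map_add]; exact add_mem hx hy
  · intro c x hx; rw [map_smul]; exact Submodule.smul_mem _ _ hx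
  · intro w hw
    rw [consWord_single]
    exact Finsupp.single_mem_supported _ _ (h w hw)

/-- Shuffles contain their factors as subwords. -/
lemma shuffle_supported {α : Type*} (u v : List α) : shuffle K u v ∈ Finsupp.supported K K
    {w | w.Perm (u ++ v) ∧ u.Sublist w ∧ v.Sublist w} := by
  induction u generalizing v with
  | nil =>
    rw [shuffle_nil_left]
    exact Finsupp.single_mem_supported _ _ ⟨List.Perm.refl _, List.nil_sublist _, List.Sublist.refl _⟩
  | cons a u ih =>
    induction v with
    | nil =>
      rw [shuffle_nil_right]
      exact Finsupp.single_mem_supported _ _ ⟨by simp, List.Sublist.refl _, List.nil_sublist _⟩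
    | cons b v ihv =>
      rw [shuffle_cons_cons]
      refine add_mem (map_consWord_supported ?_ (ih (b :: v)))
        (Submodule.smul_mem _ _ (map_consWord_supported ?_ ihv))
      · rintro w ⟨h1, h2, h3⟩
        exact ⟨List.Perm.cons a h1, h2.cons_cons a, h3.cons a⟩
      · rintro w ⟨h1, h2, h3⟩
        exact ⟨(List.Perm.cons b h1).trans List.perm_middle.symm, h2.cons b, h3.cons_cons b⟩

/-- In the word `w` the source of every arrow of `E` stands before its target. -/
def Respects (E : Multiset (M × M)) (w : List M) : Prop :=
  ∀ e ∈ E, e.1 ∈ w → e.2 ∈ w → w.idxOf e.1 < w.idxOf e.2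

open Classical in
/-- The projection to the words that respect the arrows of `E`. -/
def respecting (K : Type*) [Field K] (E : Multiset (M × M)) : Words K M →ₗ[K] Words K M :=
  Finsupp.linearCombination K fun w => if Respects E w then Finsupp.single w 1 else 0

open Classical in
lemma respecting_single (E : Multiset (M × M)) (w : List M) :
    respecting K E (Finsupp.single w 1) = if Respects E w then Finsupp.single w 1 else 0 := by
  simp [respecting]

lemma respecting_nil (E : Multiset (M × M)) :
    respecting K E (Finsupp.single [] 1) = Finsupp.single [] 1 := by
  rw [respecting_single, if_pos]
  intro e _ h
  exact absurd h List.not_mem_nil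

lemma respecting_supported (E : Multiset (M × M)) {s : Set (List M)} {x : Words K M}
    (hx : x ∈ Finsupp.supported K K s) : respecting K E x ∈ Finsupp.supported K K s := by
  refine supported_induction (p := fun x => respecting K E x ∈ Finsupp.supported K K s) hx
    ?_ ?_ ?_ ?_
  · rw [map_zero]; exact zero_mem _
  · intro x y hx hy; rw [map_add]; exact add_mem hx hy
  · intro c x hx; rw [map_smul]; exact Submodule.smul_mem _ _ hx
  · intro w hw
    rw [respecting_single]
    split_ifs
    · exact Finsupp.single_mem_supported _ _ hw
    · exact zero_mem _

lemma respecting_congr {E F : Multiset (M × M)} {s : Set (List M)} {x : Words K M}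
    (hx : x ∈ Finsupp.supported K K s) (h : ∀ w ∈ s, Respects E w ↔ Respects F w) :
    respecting K E x = respecting K F x := by
  refine supported_induction (p := fun x => respecting K E x = respecting K F x) hx
    ?_ ?_ ?_ ?_
  · simp
  · intro x y hx hy; rw [map_add, map_add, hx, hy]
  · intro c x hx; rw [map_smul, map_smul, hx]
  · intro w hw
    classical
    rw [respecting_single, respecting_single, if_congr (h w hw) rfl rfl]

lemma idxOf_lt_iff_of_sublist {u w : List M} (h : u.Sublist w) (hw : w.Nodup) {a b : M}
    (ha : a ∈ u) (hb : b ∈ u) : u.idxOf a < u.idxOf b ↔ w.idxOf a < w.idxOf b := by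
  induction h with
  | slnil => simp at ha
  | cons x h ih =>
    rw [List.nodup_cons] at hw
    have hxa : x ≠ a := by rintro rfl; exact hw.1 (h.subset ha)
    have hxb : x ≠ b := by rintro rfl; exact hw.1 (h.subset hb)
    rw [List.idxOf_cons_ne _ hxa, List.idxOf_cons_ne _ hxb, ih hw.2 ha hb]
    omega
  | cons_cons x h ih =>
    rw [List.nodup_cons] at hw
    by_cases hxa : x = a
    · subst hxa
      rw [List.idxOf_cons_self, List.idxOf_cons_self]
      by_cases hxb : x = b
      · subst hxb
        rw [List.idxOf_cons_self, List.idxOf_cons_self]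
      · rw [List.idxOf_cons_ne _ hxb, List.idxOf_cons_ne _ hxb]
        omega
    · by_cases hxb : x = b
      · subst hxb
        rw [List.idxOf_cons_self, List.idxOf_cons_self]
        simp
      · rw [List.idxOf_cons_ne _ hxb, List.idxOf_cons_ne _ hxb, List.idxOf_cons_ne _ hxa,
          List.idxOf_cons_ne _ hxa]
        have := ih hw.2 ((List.mem_cons.1 ha).resolve_left (Ne.symm hxa))
          ((List.mem_cons.1 hb).resolve_left (Ne.symm hxb))
        omega

/-- No arrow of `E` joins a letter of `u` and a letter of `v`. -/
def Separates (E : Multiset (M × M)) (u v : List M) : Prop :=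
  ∀ e ∈ E, ¬(e.1 ∈ u ∧ e.2 ∈ v) ∧ ¬(e.1 ∈ v ∧ e.2 ∈ u)

/-- A shuffle keeps the relative order of the letters of each factor, and no arrow compares letters
of different factors. -/
lemma respects_shuffle {E : Multiset (M × M)} {u v w : List M} (hn : (u ++ v).Nodup)
    (hE : Separates E u v) (h : w.Perm (u ++ v) ∧ u.Sublist w ∧ v.Sublist w) :
    Respects E w ↔ Respects E u ∧ Respects E v := by
  obtain ⟨h1, h2, h3⟩ := h
  have hw := h1.nodup_iff.2 hn
  constructor
  · intro H
    exact ⟨fun e he ha hb => (idxOf_lt_iff_of_sublist h2 hw ha hb).2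
        (H e he (h2.subset ha) (h2.subset hb)),
      fun e he ha hb => (idxOf_lt_iff_of_sublist h3 hw ha hb).2
        (H e he (h3.subset ha) (h3.subset hb))⟩
  · rintro ⟨H1, H2⟩ e he ha hb
    obtain ⟨E1, E2⟩ := hE e he
    rw [h1.mem_iff, List.mem_append] at ha hb
    rcases ha with ha | ha <;> rcases hb with hb | hb
    · exact (idxOf_lt_iff_of_sublist h2 hw ha hb).1 (H1 e he ha hb)
    · exact absurd ⟨ha, hb⟩ E1
    · exact absurd ⟨ha, hb⟩ E2
    · exact (idxOf_lt_iff_of_sublist h3 hw ha hb).1 (H2 e he ha hb)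

lemma respecting_shuffle {E : Multiset (M × M)} {u v : List M} (hn : (u ++ v).Nodup)
    (hE : Separates E u v) : respecting K E (shuffle K u v) =
      shuffleProd K (respecting K E (Finsupp.single u 1)) (respecting K E (Finsupp.single v 1)) := by
  classical
  have : respecting K E (shuffle K u v) =
      if Respects E u ∧ Respects E v then shuffle K u v else 0 := by
    refine supported_induction (p := fun x => respecting K E x =
      if Respects E u ∧ Respects E v then x else 0) (shuffle_supported u v) ?_ ?_ ?_ ?_
    · simp
    · intro x y hx hy; rw [map_add, hx, hy]; split_ifs <;> simp
    · intro c x hx; rw [map_smul, hx]; split_ifs <;> simp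
    · intro w hw
      rw [respecting_single]
      rw [if_congr (respects_shuffle hn hE hw) rfl rfl]
  rw [this, respecting_single, respecting_single]
  by_cases h1 : Respects E u <;> by_cases h2 : Respects E v <;> simp [h1, h2]

lemma respecting_shuffleProd {E : Multiset (M × M)} {u v : List M} (hn : (u ++ v).Nodup)
    (hE : Separates E u v) {x y : Words K M} (hx : x ∈ Finsupp.supported K K {w | w.Perm u})
    (hy : y ∈ Finsupp.supported K K {w | w.Perm v}) :
    respecting K E (shuffleProd K x y) =
      shuffleProd K (respecting K E x) (respecting K E y) := by
  refine supported_induction (p := fun x => respecting K E (shuffleProd K x y) =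
      shuffleProd K (respecting K E x) (respecting K E y)) hx ?_ ?_ ?_ ?_
  · simp
  · intro x y hx hy; simp only [map_add, LinearMap.add_apply, hx, hy]
  · intro c x hx; simp only [map_smul, LinearMap.smul_apply, hx]
  intro u' hu
  refine supported_induction (p := fun y => respecting K E (shuffleProd K (Finsupp.single u' 1) y) =
      shuffleProd K (respecting K E (Finsupp.single u' 1)) (respecting K E y)) hy ?_ ?_ ?_ ?_
  · simp
  · intro x y hx hy; simp only [map_add, hx, hy]
  · intro c x hx; simp only [map_smul, hx]
  intro v' hv
  rw [Set.mem_ofPred_eq] at hu hv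
  rw [shuffleProd_single, respecting_shuffle]
  · exact (hu.append hv).nodup_iff.2 hn
  · intro e he
    rw [hu.mem_iff, hv.mem_iff, hu.mem_iff, hv.mem_iff]
    exact hE e he

/-- The shuffle product of letters. -/
def letterProd (K : Type*) [Field K] {M : Type*} (l : List M) : Words K M :=
  prodWords K (l.map fun a => [a])

lemma letterProd_cons {M : Type*} (a : M) (l : List M) :
    letterProd K (a :: l) = shuffleProd K (Finsupp.single [a] 1) (letterProd K l) := rfl

lemma letterProd_append {M : Type*} (l l' : List M) :
    letterProd K (l ++ l') = shuffleProd K (letterProd K l) (letterProd K l') := by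
  rw [letterProd, List.map_append, prodWords_append]
  rfl

lemma letterProd_cons_cons {M : Type*} (a b : M) (l : List M) :
    letterProd K (a :: b :: l) = -letterProd K (b :: a :: l) := by
  rw [letterProd_cons, letterProd_cons, letterProd_cons, letterProd_cons, ← shuffleProd_assoc,
    ← shuffleProd_assoc, shuffleProd_single, shuffleProd_single, shuffle_comm]
  simp

lemma letterProd_swap {M : Type*} (A : List M) (a b : M) (B : List M) :
    letterProd K (A ++ a :: b :: B) = -letterProd K (A ++ b :: a :: B) := by
  rw [letterProd_append, letterProd_append, letterProd_cons_cons, map_neg]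

lemma letterProd_perm {M : Type*} {l l' : List M} (h : l.Perm l') :
    ∃ c : K, letterProd K l = c • letterProd K l' := by
  induction h with
  | nil => exact ⟨1, by simp⟩
  | cons a h ih =>
    obtain ⟨c, hc⟩ := ih
    exact ⟨c, by rw [letterProd_cons, hc, map_smul, letterProd_cons]⟩
  | swap a b l => exact ⟨-1, by rw [letterProd_cons_cons]; simp⟩
  | trans h1 h2 ih1 ih2 =>
    obtain ⟨c, hc⟩ := ih1
    obtain ⟨d, hd⟩ := ih2
    exact ⟨c * d, by rw [hc, hd, smul_smul]⟩

lemma letterProd_supported {M : Type*} (l : List M) :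
    letterProd K l ∈ Finsupp.supported K K {w | w.Perm l} := by
  induction l with
  | nil => exact Finsupp.single_mem_supported _ _ (List.Perm.refl _)
  | cons a l ih =>
    rw [letterProd_cons]
    refine supported_induction (p := fun x => shuffleProd K (Finsupp.single [a] 1) x ∈
      Finsupp.supported K K {w | w.Perm (a :: l)}) ih ?_ ?_ ?_ ?_
    · rw [map_zero]; exact zero_mem _
    · intro x y hx hy; rw [map_add]; exact add_mem hx hy
    · intro c x hx; rw [map_smul]; exact Submodule.smul_mem _ _ hx
    · intro w hw
      rw [shuffleProd_single]
      refine Finsupp.supported_mono ?_ (shuffle_supported [a] w)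
      rintro x ⟨hx, -⟩
      exact hx.trans (List.Perm.cons a hw)

/-- The span of the products of `k` nonempty words. -/
def wordPowers (K : Type*) [Field K] (M : Type*) (k : ℕ) : Submodule K (Words K M) :=
  Submodule.span K {x | ∃ ws : List (List M), (∀ w ∈ ws, w ≠ []) ∧ ws.length = k ∧
    x = prodWords K ws}

lemma shuffleProd_mem_wordPowers {M : Type*} {j k : ℕ} {x y : Words K M}
    (hx : x ∈ wordPowers K M j) (hy : y ∈ wordPowers K M k) :
    shuffleProd K x y ∈ wordPowers K M (j + k) := by
  induction hx using Submodule.span_induction with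
  | zero => rw [map_zero]; exact zero_mem _
  | add x x' _ _ hx hx' => rw [map_add, LinearMap.add_apply]; exact add_mem hx hx'
  | smul c x _ hx => rw [map_smul, LinearMap.smul_apply]; exact Submodule.smul_mem _ _ hx
  | mem x hx =>
    obtain ⟨ws, h1, rfl, rfl⟩ := hx
    induction hy using Submodule.span_induction with
    | zero => rw [map_zero]; exact zero_mem _
    | add x x' _ _ hx hx' => rw [map_add]; exact add_mem hx hx'
    | smul c x _ hx => rw [map_smul]; exact Submodule.smul_mem _ _ hx
    | mem y hy =>
      obtain ⟨ws', h2, rfl, rfl⟩ := hy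
      rw [← prodWords_append]
      refine Submodule.subset_span ⟨ws ++ ws', ?_, List.length_append, rfl⟩
      intro w hw
      rcases List.mem_append.1 hw with hw | hw
      · exact h1 w hw
      · exact h2 w hw

lemma mem_wordPowers_one {M : Type*} {l : List M} (hl : l ≠ []) {x : Words K M}
    (hx : x ∈ Finsupp.supported K K {w | w.Perm l}) : x ∈ wordPowers K M 1 := by
  refine supported_induction hx (zero_mem _) (fun _ _ => add_mem)
    (fun c _ => Submodule.smul_mem _ c) ?_
  intro w hw
  rw [Set.mem_ofPred_eq] at hw
  refine Submodule.subset_span ⟨[w], ?_, rfl, ?_⟩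
  · rintro v hv rfl
    rw [List.mem_singleton] at hv
    subst hv
    exact hl (List.nil_perm.1 hw)
  · simp

/-- The words that respect some arrows form a combination of products of as many words as there
are classes of letters. -/
lemma respecting_letterProd_mem {N : Type*} [DecidableEq N] (E : Multiset (M × M)) (c : M → N)
    (hc : ∀ e ∈ E, c e.1 = c e.2) (l : List M) (hl : l.Nodup) :
    respecting K E (letterProd K l) ∈ wordPowers K M (l.map c).toFinset.card := by
  classical
  induction hk : l.length using Nat.strong_induction_on generalizing l with
  | _ k ih =>
    rcases l with _ | ⟨a, l⟩
    · change respecting K E (Finsupp.single [] 1) ∈ _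
      rw [respecting_nil]
      exact Submodule.subset_span ⟨[], by simp, rfl, rfl⟩
    -- The class of the first letter is split off. No arrow leaves it, so `respecting` acts on the
    -- two factors separately: the letters of the class give a combination of nonempty words, and
    -- the rest has one class less. The sign of the reordering is irrelevant for membership.
    set l₁ := (a :: l).filter (fun x => decide (c x = c a))
    set l₂ := (a :: l).filter (fun x => !decide (c x = c a))
    have hp : (l₁ ++ l₂).Perm (a :: l) := List.filter_append_perm _ _
    have hn := hp.nodup_iff.2 hl
    have ha : a ∈ l₁ := List.mem_filter.2 ⟨List.mem_cons_self, by simp⟩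
    have hlt : l₂.length < k := by
      have h1 := hp.length_eq
      have h2 := List.length_pos_of_mem ha
      rw [List.length_append] at h1
      omega
    obtain ⟨r, hr⟩ := letterProd_perm (K := K) hp.symm
    have hcard : ((a :: l).map c).toFinset.card = 1 + (l₂.map c).toFinset.card := by
      have : ((a :: l).map c).toFinset = insert (c a) (l₂.map c).toFinset := by
        ext x
        simp only [List.mem_toFinset, List.mem_map, Finset.mem_insert]
        constructor
        · rintro ⟨y, hy, rfl⟩
          by_cases h : c y = c a
          · exact Or.inl h
          · exact Or.inr ⟨y, List.mem_filter.2 ⟨hy, by simpa using h⟩, rfl⟩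
        · rintro (rfl | ⟨y, hy, rfl⟩)
          · exact ⟨a, List.mem_cons_self, rfl⟩
          · exact ⟨y, (List.mem_filter.1 hy).1, rfl⟩
      rw [this, Finset.card_insert_of_notMem, add_comm]
      simp only [List.mem_toFinset, List.mem_map, not_exists, not_and]
      intro y hy h
      have := (List.mem_filter.1 hy).2
      simp [h] at this
    rw [hr, map_smul, letterProd_append, hcard]
    refine Submodule.smul_mem _ _ ?_
    rw [respecting_shuffleProd hn ?_ (letterProd_supported l₁) (letterProd_supported l₂)]
    · refine shuffleProd_mem_wordPowers (mem_wordPowers_one (l := l₁) ?_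
        (respecting_supported E (letterProd_supported l₁))) (ih _ hlt l₂ hn.of_append_right rfl)
      rintro h
      rw [h] at ha
      simp at ha
    · intro e he
      have := hc e he
      constructor
      · rintro ⟨h1, h2⟩
        have h1 := (List.mem_filter.1 h1).2
        have h2 := (List.mem_filter.1 h2).2
        simp at h1 h2
        exact h2 (this.symm.trans h1)
      · rintro ⟨h1, h2⟩
        have h1 := (List.mem_filter.1 h1).2
        have h2 := (List.mem_filter.1 h2).2
        simp at h1 h2
        exact h1 (this.trans h2)

/-- Adding an arrow identifies at most two classes. -/
lemma exists_classes [Fintype M] (E : Multiset (M × M)) : ∃ c : M → M,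
    (∀ e ∈ E, c e.1 = c e.2) ∧
    Fintype.card M ≤ (Finset.univ.image c).card + Multiset.card E := by
  induction E using Multiset.induction with
  | empty => exact ⟨id, by simp, by simp⟩
  | cons e E ih =>
    obtain ⟨c, h1, h2⟩ := ih
    refine ⟨fun x => if c x = c e.2 then c e.1 else c x, fun e' he => ?_, ?_⟩
    · rcases Multiset.mem_cons.1 he with rfl | he
      · simp
      · simp only [h1 e' he]
    · have : Finset.univ.image c ⊆
          insert (c e.2) (Finset.univ.image fun x => if c x = c e.2 then c e.1 else c x) := by
        intro y hy
        obtain ⟨x, -, rfl⟩ := Finset.mem_image.1 hy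
        rw [Finset.mem_insert]
        by_cases h : c x = c e.2
        · exact Or.inl h
        · exact Or.inr (Finset.mem_image.2 ⟨x, Finset.mem_univ x, by rw [if_neg h]⟩)
      have := (Finset.card_le_card this).trans (Finset.card_insert_le _ _)
      rw [Multiset.card_cons]
      omega

lemma eq_of_conn {M N : Type*} {E : Multiset (M × M)} {c : M → N} (hc : ∀ e ∈ E, c e.1 = c e.2)
    {a b : M} (h : Conn E a b) : c a = c b := by
  induction h with
  | refl => rfl
  | tail _ h ih =>
    rcases h with h | h
    · exact ih.trans (hc _ h)
    · exact ih.trans (hc _ h).symm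

/-- The arrow that closes a cycle joins points that are already in one class, which saves one class
compared with `exists_classes`. -/
lemma exists_classes_of_cyclic [Fintype M] {E : Multiset (M × M)} (hE : Cyclic E) : ∃ c : M → M,
    (∀ e ∈ E, c e.1 = c e.2) ∧
    Fintype.card M + 1 ≤ (Finset.univ.image c).card + Multiset.card E := by
  obtain ⟨a, b, E', rfl, h⟩ := hE
  obtain ⟨c, h1, h2⟩ := exists_classes E'
  refine ⟨c, fun e he => ?_, by rw [Multiset.card_cons]; omega⟩
  rcases Multiset.mem_cons.1 he with rfl | he
  · exact eq_of_conn h1 h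
  · exact h1 e he

lemma respects_add_of_forall {E F : Multiset (M × M)} {w : List M}
    (h : ∀ e ∈ F, ¬(e.1 ∈ w ∧ e.2 ∈ w)) : Respects (F + E) w ↔ Respects E w := by
  constructor
  · exact fun H e he => H e (Multiset.mem_add.2 (Or.inr he))
  · intro H e he h1 h2
    rcases Multiset.mem_add.1 he with he | he
    · exact absurd ⟨h1, h2⟩ (h e he)
    · exact H e he h1 h2

lemma respecting_add (E F : Multiset (M × M)) (x : Words K M) :
    respecting K (E + F) x = respecting K E (respecting K F x) := by
  induction x using words_induction with
  | h0 => simp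
  | hadd x y hx hy => simp only [map_add, hx, hy]
  | hsmul c x hx => simp only [map_smul, hx]
  | h1 w =>
    classical
    have : Respects (E + F) w ↔ Respects E w ∧ Respects F w := by
      constructor
      · exact fun H => ⟨fun e he => H e (Multiset.mem_add.2 (Or.inl he)),
          fun e he => H e (Multiset.mem_add.2 (Or.inr he))⟩
      · rintro ⟨H1, H2⟩ e he
        rcases Multiset.mem_add.1 he with he | he
        · exact H1 e he
        · exact H2 e he
    rw [respecting_single, respecting_single]
    by_cases h1 : Respects E w <;> by_cases h2 : Respects F w <;>
      simp [this, h1, h2, respecting_single]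

/-- Only one order of the letters respects all arrows of a line. -/
lemma respecting_chain (w : List M) (hw : w.Nodup) :
    respecting K (chain w) (letterProd K w) = Finsupp.single w 1 := by
  classical
  induction w with
  | nil =>
    change respecting K _ (Finsupp.single [] 1) = _
    rw [respecting_nil]
  | cons a w ih =>
    rcases w with _ | ⟨b, w⟩
    · change respecting K _ (shuffleProd K (Finsupp.single [a] 1) (Finsupp.single [] 1)) = _
      rw [shuffleProd_nil_right, respecting_single, if_pos]
      exact fun e he => absurd he (by simp)
    have hn := List.nodup_cons.1 hw
    rw [chain_cons_cons, ← Multiset.singleton_add, respecting_add, letterProd_cons,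
      respecting_shuffleProd (u := [a]) (v := b :: w) hw ?_
        (Finsupp.single_mem_supported _ _ (List.Perm.refl _)) (letterProd_supported _), ih hn.2,
      respecting_single, if_pos, shuffleProd_single, shuffle_cons_cons]
    · rw [shuffle_nil_left, map_add, map_smul, consWord_single, respecting_single, if_pos]
      · rw [add_eq_left, smul_eq_zero]
        right
        refine supported_induction (p := fun x => respecting K {(a, b)} (consWord K b x) = 0)
          (shuffle_supported [a] w) ?_ ?_ ?_ ?_
        · simp
        · intro x y hx hy; rw [map_add, map_add, hx, hy, add_zero]
        · intro c x hx; rw [map_smul, map_smul, hx, smul_zero]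
        · rintro x ⟨hx, -⟩
          rw [consWord_single, respecting_single, if_neg]
          intro H
          have := H (a, b) (Multiset.mem_singleton_self _)
            (List.mem_cons_of_mem _ (hx.mem_iff.2 (by simp))) List.mem_cons_self
          simp at this
      · intro e he _ _
        rw [Multiset.mem_singleton] at he
        subst he
        rw [List.idxOf_cons_self, List.idxOf_cons_ne _ (by rintro rfl; simp at hn)]
        omega
    · intro e he h1 h2
      rw [List.mem_singleton] at h1
      exact absurd (h1 ▸ (mem_of_mem_chain he).1) hn.1
    · intro e he
      have h3 := mem_of_mem_chain he
      simp only [List.mem_singleton]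
      exact ⟨fun h => hn.1 (h.1 ▸ h3.1), fun h => hn.1 (h.2 ▸ h3.2)⟩

/-- No arrow joins different lines, so `respecting` is multiplicative here, and each line admits
only its own order. This identity makes `ofCochain` a preimage under `cochainOf`, up to sign. -/
lemma respecting_lines (L : List (List M)) (hL : L.flatten.Nodup) :
    respecting K (L.map chain).sum (letterProd K L.flatten) = prodWords K L := by
  have hmem : ∀ {L : List (List M)} {e : M × M}, e ∈ (L.map chain).sum →
      e.1 ∈ L.flatten ∧ e.2 ∈ L.flatten := by
    intro L e he
    obtain ⟨w, hw, he⟩ := mem_sum_chain he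
    exact ⟨List.mem_flatten.2 ⟨w, hw, (mem_of_mem_chain he).1⟩,
      List.mem_flatten.2 ⟨w, hw, (mem_of_mem_chain he).2⟩⟩
  induction L with
  | nil =>
    classical
    change respecting K _ (Finsupp.single [] 1) = _
    rw [respecting_nil]
    rfl
  | cons l L ih =>
    rw [List.flatten_cons] at hL
    have hd := List.disjoint_of_nodup_append hL
    rw [List.map_cons, List.sum_cons, List.flatten_cons, letterProd_append,
      respecting_shuffleProd hL ?_ (letterProd_supported _) (letterProd_supported _), prodWords_cons,
      ← ih hL.of_append_right, ← respecting_chain l hL.of_append_left]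
    · congr 1
      · rw [add_comm]
        refine congrArg _ (respecting_congr (letterProd_supported l) fun w hw => ?_)
        refine respects_add_of_forall fun e he h => ?_
        exact hd (hw.mem_iff.1 h.1) (hmem he).1
      · refine respecting_congr (letterProd_supported _) fun w hw => ?_
        refine respects_add_of_forall fun e he h => ?_
        exact hd (mem_of_mem_chain he).1 (hw.mem_iff.1 h.1)
    · intro e he
      rcases Multiset.mem_add.1 he with he | he
      · have := mem_of_mem_chain he
        exact ⟨fun h => hd this.2 h.2, fun h => hd this.1 h.1⟩
      · have := hmem he
        exact ⟨fun h => hd h.1 this.1, fun h => hd h.2 this.2⟩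

end Respecting

/-! ### The isomorphism with the Eulerian components -/

section Isomorphism

variable {K V : Type*} [Field K] [AddCommGroup V] [Module K V]

/-- The effect on words of a map of letters. -/
def mapWords (K : Type*) [Field K] {α β : Type*} (g : α → β) : Words K α →ₗ[K] Words K β :=
  Finsupp.lmapDomain K K (List.map g)

@[simp] lemma mapWords_single {α β : Type*} (g : α → β) (w : List α) (c : K) :
    mapWords K g (Finsupp.single w c) = Finsupp.single (w.map g) c := by
  simp [mapWords, Finsupp.lmapDomain_apply, Finsupp.mapDomain_single]

lemma mapWords_shuffle {α β : Type*} (g : α → β) (u v : List α) :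
    mapWords K g (shuffle K u v) = shuffle K (u.map g) (v.map g) := by
  have h := linearCombination_shuffle_map (K := K) g (fun w => (Finsupp.single w (1 : K))) u v
  have h1 : ∀ x : Words K β, Finsupp.linearCombination K
      (fun w : List β => (Finsupp.single w (1 : K))) x = x := by
    intro x
    have : Finsupp.linearCombination K (fun w : List β => (Finsupp.single w (1 : K))) =
        LinearMap.id := words_hom_ext fun w => by simp
    rw [this]
    rfl
  have h2 : Finsupp.linearCombination K (fun w : List α => (Finsupp.single (w.map g) (1 : K))) =
        mapWords K g := words_hom_ext fun w => by simp
  rw [h1, h2] at h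
  exact h.symm

lemma mapWords_shuffleProd {α β : Type*} (g : α → β) (x y : Words K α) :
    mapWords K g (shuffleProd K x y) = shuffleProd K (mapWords K g x) (mapWords K g y) := by
  induction x using words_induction with
  | h0 => simp
  | hadd x x' hx hx' => simp only [map_add, LinearMap.add_apply, hx, hx']
  | hsmul c x hx => simp only [map_smul, LinearMap.smul_apply, hx]
  | h1 u =>
    induction y using words_induction with
    | h0 => simp
    | hadd x x' hx hx' => simp only [map_add, hx, hx']
    | hsmul c x hx => simp only [map_smul, hx]
    | h1 v =>
      rw [shuffleProd_single, mapWords_single, mapWords_single, shuffleProd_single, mapWords_shuffle]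

lemma mapWords_prodWords {α β : Type*} (g : α → β) (ws : List (List α)) :
    mapWords K g (prodWords K ws) = prodWords K (ws.map (List.map g)) := by
  induction ws with
  | nil => simp
  | cons w ws ih => rw [List.map_cons, prodWords_cons, prodWords_cons, mapWords_shuffleProd, ih,
      mapWords_single]

lemma mapWords_mapWords {α β γ : Type*} (g : α → β) (h : β → γ) (x : Words K α) :
    mapWords K h (mapWords K g x) = mapWords K (h ∘ g) x := by
  induction x using words_induction with
  | h0 => simp
  | hadd x x' hx hx' => simp only [map_add, hx, hx']
  | hsmul c x hx => simp only [map_smul, hx]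
  | h1 u => simp

lemma mapWords_letterProd {α β : Type*} (g : α → β) (l : List α) :
    mapWords K g (letterProd K l) = letterProd K (l.map g) := by
  rw [letterProd, mapWords_prodWords, letterProd, List.map_map, List.map_map]
  rfl

lemma mapWords_respecting {M N : Type*} [DecidableEq M] [DecidableEq N] (g : M → N)
    (hg : Function.Injective g) (E : Multiset (M × M)) (x : Words K M) :
    mapWords K g (respecting K E x) =
      respecting K (E.map fun e => (g e.1, g e.2)) (mapWords K g x) := by
  induction x using words_induction with
  | h0 => simp
  | hadd x x' hx hx' => simp only [map_add, hx, hx']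
  | hsmul c x hx => simp only [map_smul, hx]
  | h1 w =>
    classical
    have : Respects (E.map fun e => (g e.1, g e.2)) (w.map g) ↔ Respects E w := by
      have hi : ∀ a, (w.map g).idxOf (g a) = w.idxOf a := by
        intro a
        induction w with
        | nil => rfl
        | cons b w ih =>
          rw [List.map_cons]
          by_cases h : b = a
          · rw [h, List.idxOf_cons_self, List.idxOf_cons_self]
          · rw [List.idxOf_cons_ne _ h, List.idxOf_cons_ne _ fun h' => h (hg h'), ih]
      simp only [Respects, Multiset.mem_map, forall_exists_index, and_imp,
        forall_apply_eq_imp_iff₂, List.mem_map_of_injective hg, hi]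
    rw [mapWords_single, respecting_single, respecting_single]
    by_cases h : Respects E w
    · rw [if_pos h, if_pos (this.2 h), mapWords_single]
    · rw [if_neg h, if_neg (fun h' => h (this.1 h')), map_zero]

/-- The element of the finite operad whose value on unions of `p` lines is the value of a cochain
on the products of the corresponding words. -/
def ofCochain (K : Type*) {V : Type*} [Field K] [AddCommGroup V] [Module K V] {n : ℕ} (p : ℕ)
    (f : (Fin n → V) → V) : QuivFun V n := fun Γ v =>
  if Multiset.card Γ.1 + p = n then (p.factorial : K)⁻¹ •
    evalWords f (mapWords K v (respecting K Γ.1 (letterProd K (List.finRange n)))) else 0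

lemma evalWords_mapWords_eq_zero [CharZero K] {n p k : ℕ} {f : (Fin n → V) → V}
    (hf : f ∈ poisBi K V p n) (hk : p < k) {α : Type*} (v : α → V) {x : Words K α}
    (hx : x ∈ wordPowers K α k) : evalWords f (mapWords K v x) = 0 := by
  induction hx using Submodule.span_induction with
  | zero => simp
  | add x y _ _ hx hy => rw [map_add, map_add, hx, hy, add_zero]
  | smul c x _ hx => rw [map_smul, map_smul, hx, smul_zero]
  | mem x hx =>
    obtain ⟨ws, h1, rfl, rfl⟩ := hx
    rw [mapWords_prodWords]
    refine evalWords_prodWords_of_lt hf ?_ (by rwa [List.length_map])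
    intro w hw
    obtain ⟨u, hu, rfl⟩ := List.mem_map.1 hw
    simpa using h1 u hu

/-- The orderings that respect the arrows form a combination of products of as many words as there
are classes, and a cochain of the `p`-th component kills products of more than `p` words. -/
lemma evalWords_respecting_eq_zero [CharZero K] {n p : ℕ} {f : (Fin n → V) → V}
    (hf : f ∈ poisBi K V p n) (v : Fin n → V) {E : Multiset (Fin n × Fin n)} {c : Fin n → Fin n}
    (hc : ∀ e ∈ E, c e.1 = c e.2) (hp : p < (Finset.univ.image c).card) :
    evalWords f (mapWords K v (respecting K E (letterProd K (List.finRange n)))) = 0 := by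
  refine evalWords_mapWords_eq_zero hf hp v ?_
  have := respecting_letterProd_mem (K := K) E c hc _ (List.nodup_finRange n)
  convert this using 2
  congr 1
-- A word that contains every vertex once contributes `f` with permuted variables.
lemma mapWords_mem_multilinear {n : ℕ} {f : (Fin n → V) → V} (hf : f ∈ multilinear K V n)
    {x : Words K (Fin n)} (hx : x ∈ Finsupp.supported K K {w | w.Perm (List.finRange n)}) :
    (fun v => evalWords f (mapWords K v x)) ∈ multilinear K V n := by
  refine supported_induction (p := fun x => (fun v => evalWords f (mapWords K v x)) ∈
    multilinear K V n) hx ?_ ?_ ?_ ?_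
  · simp only [map_zero]; exact (multilinear K V n).zero_mem
  · intro x y hx hy; simp only [map_add]; exact (multilinear K V n).add_mem hx hy
  · intro c x hx; simp only [map_smul]; exact Submodule.smul_mem _ c hx
  · intro w hw
    rw [Set.mem_ofPred_eq] at hw
    obtain ⟨s, rfl⟩ := exists_eq_ofFn (hw.length_eq.trans (List.length_finRange))
    have hs : Function.Injective s := List.nodup_ofFn.1 (hw.nodup_iff.2 (List.nodup_finRange n))
    obtain ⟨g, rfl⟩ := hf
    refine ⟨g.domDomCongr (Equiv.ofBijective s (Finite.injective_iff_bijective.1 hs)), ?_⟩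
    funext v
    rw [mapWords_single, List.map_ofFn, evalWords_ofFn, MultilinearMap.domDomCongr_apply]
    rfl

lemma card_ofArrows_cons {n : ℕ} {a b : Fin n} (h : a ≠ b) (E : Multiset (Fin n × Fin n)) :
    Multiset.card (ofArrows ((a, b) ::ₘ E)).1 = Multiset.card (ofArrows E).1 + 1 := by
  rw [ofArrows_cons h, Multiset.card_cons]

lemma respects_cons {M : Type*} [DecidableEq M] (e : M × M) (E : Multiset (M × M)) (w : List M) :
    Respects (e ::ₘ E) w ↔
      (e.1 ∈ w → e.2 ∈ w → w.idxOf e.1 < w.idxOf e.2) ∧ Respects E w := by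
  simp only [Respects, Multiset.mem_cons, forall_eq_or_imp]

/-- In every ordering exactly one of `a`, `b` comes first. -/
lemma respecting_rev {M : Type*} [DecidableEq M] {l : List M} {x : Words K M}
    (hx : x ∈ Finsupp.supported K K {w | w.Perm l}) {a b : M} (hab : a ≠ b) (ha : a ∈ l)
    (hb : b ∈ l) (E : Multiset (M × M)) :
    respecting K ((a, b) ::ₘ E) x + respecting K ((b, a) ::ₘ E) x = respecting K E x := by
  classical
  refine supported_induction (p := fun x => respecting K ((a, b) ::ₘ E) x +
    respecting K ((b, a) ::ₘ E) x = respecting K E x) hx ?_ ?_ ?_ ?_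
  · simp
  · intro x y hx hy; simp only [map_add]; rw [← hx, ← hy]; abel
  · intro c x hx; simp only [map_smul]; rw [← hx, smul_add]
  · intro w hw
    rw [Set.mem_ofPred_eq] at hw
    have hne : w.idxOf a ≠ w.idxOf b := fun h =>
      hab ((List.idxOf_inj (hw.mem_iff.2 ha)).1 h)
    simp only [respecting_single, respects_cons, hw.mem_iff, ha, hb, forall_const]
    by_cases h : Respects E w
    · rcases lt_or_gt_of_ne hne with h1 | h1
      · simp [h, h1, h1.not_gt]
      · simp [h, h1, h1.not_gt]
    · simp [h]

/-- Holds for each ordering separately: if `c` precedes both `a` and `b`, exactly one of `a`, `b`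
comes next among them; otherwise all terms vanish. -/
lemma respecting_tri {M : Type*} [DecidableEq M] {l : List M} {x : Words K M}
    (hx : x ∈ Finsupp.supported K K {w | w.Perm l}) {a b c : M} (hab : a ≠ b) (ha : a ∈ l)
    (hb : b ∈ l) (hc : c ∈ l) (E : Multiset (M × M)) :
    respecting K ((c, a) ::ₘ (a, b) ::ₘ E) x + respecting K ((c, b) ::ₘ (b, a) ::ₘ E) x =
      respecting K ((c, a) ::ₘ (c, b) ::ₘ E) x := by
  classical
  refine supported_induction (p := fun x => respecting K ((c, a) ::ₘ (a, b) ::ₘ E) x +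
    respecting K ((c, b) ::ₘ (b, a) ::ₘ E) x = respecting K ((c, a) ::ₘ (c, b) ::ₘ E) x) hx ?_ ?_ ?_ ?_
  · simp
  · intro x y hx hy; simp only [map_add]; rw [← hx, ← hy]; abel
  · intro c x hx; simp only [map_smul]; rw [← hx, smul_add]
  · intro w hw
    rw [Set.mem_ofPred_eq] at hw
    have hne : w.idxOf a ≠ w.idxOf b := fun h =>
      hab ((List.idxOf_inj (hw.mem_iff.2 ha)).1 h)
    simp only [respecting_single, respects_cons, hw.mem_iff, ha, hb, hc, forall_const]
    by_cases h : Respects E w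
    · simp only [h, and_true]
      by_cases h1 : w.idxOf c < w.idxOf a <;> by_cases h2 : w.idxOf c < w.idxOf b <;>
        rcases lt_or_gt_of_ne hne with h3 | h3 <;>
        simp [h1, h2, h3, h3.not_gt] <;> omega
    · simp only [h, and_false, if_false, add_zero]

/-- A cyclic quiver with `n - p` arrows leaves more than `p` classes of vertices, and so does an
acyclic or cyclic one with one arrow less, which is what the sum over both directions of an arrow
amounts to. In both cases `f` vanishes. The triangle rule holds before `f` is applied. -/
lemma ofCochain_mem_finOp [CharZero K] {n p : ℕ} {f : (Fin n → V) → V}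
    (hf : f ∈ poisBi K V p n) : ofCochain K p f ∈ finOp K V n := by
  have hx := letterProd_supported (K := K) (List.finRange n)
  rw [mem_finOp_iff]
  refine ⟨fun Γ => ?_, fun E hE => ?_, fun E a b hab => ?_, fun E a b c hab hac hbc => ?_⟩
  · by_cases h : Multiset.card Γ.1 + p = n
    · have := Submodule.smul_mem _ ((p.factorial : K)⁻¹)
        (mapWords_mem_multilinear hf.1 (respecting_supported Γ.1 hx))
      convert this using 1
      funext v
      rw [ofCochain, if_pos h]
      rfl
    · convert zero_mem (multilinear K V n) using 1
      funext v
      rw [ofCochain, if_neg h]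
      rfl
  · funext v
    rw [ofCochain]
    split_ifs with h
    · obtain ⟨c, h1, h2⟩ := exists_classes_of_cyclic hE
      rw [Fintype.card_fin] at h2
      rw [evalWords_respecting_eq_zero hf v h1 (by omega), smul_zero]
      rfl
    · rfl
  · funext v
    rw [Pi.neg_apply, eq_neg_iff_add_eq_zero]
    simp only [ofCochain, card_ofArrows_cons hab, card_ofArrows_cons hab.symm]
    split_ifs with h
    · obtain ⟨c, h1, h2⟩ := exists_classes (ofArrows E).1
      rw [Fintype.card_fin] at h2
      rw [ofArrows_cons hab, ofArrows_cons hab.symm, ← smul_add, ← map_add, ← map_add,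
        respecting_rev hx hab (List.mem_finRange a) (List.mem_finRange b),
        evalWords_respecting_eq_zero hf v h1 (by omega), smul_zero]
    · exact add_zero 0
  · funext v
    simp only [Pi.add_apply, ofCochain, card_ofArrows_cons hab, card_ofArrows_cons hab.symm,
      card_ofArrows_cons hac.symm, card_ofArrows_cons hbc.symm]
    split_ifs with h
    · rw [ofArrows_cons hac.symm, ofArrows_cons hab, ofArrows_cons hbc.symm, ofArrows_cons hab.symm,
        ofArrows_cons hac.symm, ofArrows_cons hbc.symm, ← smul_add, ← map_add, ← map_add,
        respecting_tri hx hab (List.mem_finRange a) (List.mem_finRange b) (List.mem_finRange c)]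
    · simp

/-- Letters anticommute in the signed shuffle algebra, so relabelling by an adjacent transposition
changes the sign of the product of all vertices. -/
lemma ofCochain_isSkew {n p : ℕ} (f : (Fin (n + 1) → V) → V) :
    IsSkew (ofCochain K p f) := by
  refine isSkew_of_act_swap fun i => ?_
  set τ := Equiv.swap i.castSucc i.succ with hτ
  funext Γ v
  have hc : Multiset.card (Γ.relabel τ).1 = Multiset.card Γ.1 := Multiset.card_map _ _
  simp only [act, Pi.neg_apply, ofCochain, hc]
  split_ifs with h
  · have e1 : letterProd K (List.finRange (n + 1)) =
        -letterProd K ((List.finRange (n + 1)).map τ) := by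
      have e : (List.finRange (n + 1)).take i ++ i.castSucc :: i.succ ::
          (List.finRange (n + 1)).drop (i + 2) = List.ofFn id := by
        have h1 : (List.finRange (n + 1)).drop i =
            i.castSucc :: i.succ :: (List.finRange (n + 1)).drop (i + 2) := by
          rw [List.drop_eq_getElem_cons (by simp),
            List.drop_eq_getElem_cons (i := i + 1) (by simp)]
          simp only [List.getElem_finRange]
          rfl
        rw [← h1, List.take_append_drop, List.ofFn_id]
      have e2 := append_swap_eq_ofFn e (i := i.castSucc) (j := i.succ) (by simp; omega)
        (by simp; omega)
      rw [← List.ofFn_id, List.map_ofFn, ← e, letterProd_swap, e2]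
      rfl
    have e2 : respecting K (Γ.relabel τ).1 (letterProd K (List.finRange (n + 1))) =
        -mapWords K τ (respecting K Γ.1 (letterProd K (List.finRange (n + 1)))) := by
      rw [mapWords_respecting _ τ.injective, mapWords_letterProd, e1, map_neg]
      rfl
    rw [e2, map_neg, map_neg, smul_neg, mapWords_mapWords]
    congr 4
    congr 1
    funext j
    simp
  · simp

lemma ofCochain_mem_finBi [CharZero K] {n p : ℕ} {f : (Fin (n + 1) → V) → V}
    (hf : f ∈ poisBi K V p (n + 1)) : ofCochain K p f ∈ finBi K V p n := by
  refine mem_finBi_iff.2 ⟨⟨ofCochain_mem_finOp hf, ofCochain_isSkew f⟩, fun Γ h => ?_⟩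
  funext v
  rw [ofCochain, if_neg h]
  rfl

lemma exists_flatten_eq_map {α β : Type*} (g : α → β) (ws : List (List β)) (l : List α)
    (h : ws.flatten = l.map g) : ∃ L : List (List α), L.flatten = l ∧ ws = L.map (List.map g) := by
  induction ws generalizing l with
  | nil => exact ⟨[], by simpa [eq_comm] using h, rfl⟩
  | cons w ws ih =>
    rw [List.flatten_cons] at h
    obtain ⟨l₁, l₂, rfl, rfl, h2⟩ := List.map_eq_append_iff.1 h.symm
    obtain ⟨L, rfl, rfl⟩ := ih l₂ h2.symm
    exact ⟨l₁ :: L, rfl, rfl⟩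

/-- The value on the union of some lines on all vertices. -/
lemma lineValue_map_eq {n : ℕ} (f : QuivFun V n) (L : List (List (Fin n)))
    (hL : L.flatten = List.finRange n) (v : Fin n → V) :
    lineValue f (L.map (List.map v)) = f (ofArrows (L.map chain).sum) v := by
  have h := evalLines_eq_lineValue f (L.map (List.map fun i => (i, v i)))
    (by rw [← List.map_flatten, hL, List.map_map]; simpa [Function.comp_def] using List.nodup_finRange n)
  have h1 : linesArrows (L.map (List.map fun i => (i, v i))) = (L.map chain).sum := by
    rw [linesArrows, List.map_map]
    congr 1
    refine List.map_congr_left fun w _ => ?_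
    simp [Function.comp_def]
  rw [List.map_map, evalLines, h1, ← List.map_flatten, hL, ← List.ofFn_id, List.map_ofFn, evalPts_ofFn]
    at h
  have h2 : (List.map Prod.snd ∘ List.map fun i => (i, v i)) = List.map v := by
    funext w
    simp [Function.comp_def]
  rw [h2] at h
  rw [← h]
  have h3 : (L.map chain).sum = (ofArrows (L.map chain).sum).1 := by
    refine (Multiset.filter_eq_self.2 fun e he => ?_).symm
    obtain ⟨w, hw, he⟩ := mem_sum_chain he
    refine ne_of_mem_chain ?_ he
    exact (List.nodup_flatten.1 (hL ▸ List.nodup_finRange n)).1 w hw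
  conv_rhs => rw [← quiverOn_singletons (ofArrows _), ← h3]
  rfl

lemma lineValue_ofCochain {n p : ℕ} (f : (Fin n → V) → V) {ws : List (List V)}
    (hws : ∀ w ∈ ws, w ≠ []) (hp : ws.length = p) (hn : ws.flatten.length = n) :
    lineValue (ofCochain K p f) ws = (p.factorial : K)⁻¹ • evalWords f (prodWords K ws) := by
  obtain ⟨v, hv⟩ := exists_eq_ofFn hn
  obtain ⟨L, hL, rfl⟩ := exists_flatten_eq_map v ws (List.finRange n)
    (by rw [hv, ← List.ofFn_id, List.map_ofFn]; rfl)
  have h3 : (L.map chain).sum = (ofArrows (L.map chain).sum).1 := by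
    refine (Multiset.filter_eq_self.2 fun e he => ?_).symm
    obtain ⟨w, hw, he⟩ := mem_sum_chain he
    refine ne_of_mem_chain ?_ he
    exact (List.nodup_flatten.1 (hL ▸ List.nodup_finRange n)).1 w hw
  have hc := card_sum_chain L (fun l hl h => hws _ (List.mem_map_of_mem hl) (by rw [h]; rfl))
  rw [hL, List.length_finRange] at hc
  rw [List.length_map] at hp
  rw [lineValue_map_eq _ L hL, ofCochain, ← h3, if_pos (by omega), ← hL, respecting_lines L
    (hL ▸ List.nodup_finRange n), mapWords_prodWords]

end Isomorphism

/-! ### The linear isomorphism onto the Eulerian components. -/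

section Equivalence

variable {K V : Type*} [Field K] [AddCommGroup V] [Module K V]

/-- The cochain of an element of the finite cohomology complex, up to sign: the sum of the values
on the unions of `p` consecutive lines. -/
def cochainOf (K : Type*) {V : Type*} [Field K] [AddCommGroup V] [Module K V] (p n : ℕ) :
    QuivFun V (n + 1) →ₗ[K] ((Fin (n + 1) → V) → V) where
  toFun Y := (-1 : K) ^ n.choose 2 • ofSymmetric (n + 1) p (lineValue Y)
  map_add' Y Z := by
    rw [← smul_add]
    congr 1
    funext v
    rw [Pi.add_apply, ofSymmetric_eq_cutSum, ofSymmetric_eq_cutSum, ofSymmetric_eq_cutSum,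
      ← cutSum_add]
    exact cutSum_congr fun ws _ _ _ => lineValue_add Y Z ws
  map_smul' c Y := by
    rw [RingHom.id_apply, smul_comm c]
    congr 1
    funext v
    rw [Pi.smul_apply, ofSymmetric_eq_cutSum, ofSymmetric_eq_cutSum, ← cutSum_smul]
    exact cutSum_congr fun ws _ _ _ => lineValue_smul c Y ws

lemma cochainOf_apply (p n : ℕ) (Y : QuivFun V (n + 1)) (v : Fin (n + 1) → V) :
    cochainOf K p n Y v = (-1 : K) ^ n.choose 2 • cutSum p (lineValue Y) (List.ofFn v) := by
  change (-1 : K) ^ n.choose 2 • ofSymmetric (n + 1) p (lineValue Y) v = _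
  rw [ofSymmetric_eq_cutSum]

lemma cochainOf_mem [CharZero K] {p n : ℕ} {Y : QuivFun V (n + 1)} (hY : Y ∈ finCx K V n) :
    cochainOf K p n Y ∈ poisBi K V p (n + 1) :=
  Submodule.smul_mem _ _ (ofSymmetric_mem_poisBi (lineValue_killsShuffles hY.1 hY.2)
    (lineValue_koszulSymmetric hY.2) (ofSymmetric_lineValue_multilinear hY.1.1 p))

/-- The vertices have to be brought into the order in which the lines run through them, at the cost
of a sign. For injectivity its value does not matter. -/
lemma exists_sign_evalLines {n : ℕ} {f : QuivFun V n} (hs : IsSkew f) (L : List (List (Fin n)))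
    (hL : L.flatten.Perm (List.finRange n)) (Γ : Quiv n) (hΓ : Γ.1 = (L.map chain).sum)
    (v : Fin n → V) : ∃ c : ℤ, f Γ v = c • lineValue f (L.map (List.map v)) := by
  have h := evalLines_eq_lineValue f (L.map (List.map fun i => (i, v i)))
    (by
      rw [← List.map_flatten, List.map_map]
      simpa [Function.comp_def] using hL.nodup_iff.2 (List.nodup_finRange n))
  have h1 : linesArrows (L.map (List.map fun i => (i, v i))) = Γ.1 := by
    rw [linesArrows, List.map_map, hΓ]
    congr 1
    refine List.map_congr_left fun w _ => ?_
    simp [Function.comp_def]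
  have h2 : (List.map Prod.snd ∘ List.map fun i => (i, v i)) = List.map v := by
    funext w
    simp [Function.comp_def]
  obtain ⟨s, hs'⟩ := exists_eq_ofFn (hL.length_eq.trans (List.length_finRange))
  have hinj : Function.Injective s := List.nodup_ofFn.1 (by
    rw [← hs']
    exact hL.nodup_iff.2 (List.nodup_finRange n))
  set σ := Equiv.ofBijective s (Finite.injective_iff_bijective.1 hinj)
  rw [List.map_map, evalLines, h1, ← List.map_flatten, hs', List.map_ofFn, evalPts_ofFn, h2] at h
  refine ⟨((Equiv.Perm.sign σ : ℤˣ) : ℤ), ?_⟩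
  rw [← h]
  have h3 := quiverOn_comp Γ.1 (fun i => ({i} : Set (Fin n))) σ
  rw [quiverOn_singletons] at h3
  have h4 := congrFun (congrFun (hs σ⁻¹) Γ) v
  have h5 : f (quiverOn Γ.1 fun i => {(((fun i => (i, v i)) ∘ s) i).1})
      (fun i => (((fun i => (i, v i)) ∘ s) i).2) = act σ⁻¹ f Γ v := by
    rw [act, inv_inv]
    exact congrArg (fun G => f G fun i => v (σ i)) h3
  rw [h5, h4, Equiv.Perm.sign_inv, Pi.smul_apply, Pi.smul_apply, smul_smul, ← Units.val_mul,
    Int.units_mul_self]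
  simp

/-- By `toSymmetric_ofSymmetric` the cochain determines `lineValue Y` on `p` nonempty words, hence
`Y` on unions of `p` lines; on other unions of lines `Y` vanishes by the definition of the
component. -/
lemma cochainOf_injective [CharZero K] {p n : ℕ} {Y : QuivFun V (n + 1)} (hY : Y ∈ finBi K V p n)
    (h : cochainOf K p n Y = 0) : Y = 0 := by
  refine finCx_ext_lines hY.1 fun L Γ hL hΓ => ?_
  by_cases hp : L.length = p
  · funext v
    rw [lineArrows_eq_sum] at hΓ
    obtain ⟨c, hc⟩ := exists_sign_evalLines hY.1.2 L hL.2.1 Γ hΓ v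
    have h0 : ofSymmetric (n + 1) p (lineValue Y) = 0 :=
      (smul_eq_zero.1 h).resolve_left (pow_ne_zero _ (neg_ne_zero.2 one_ne_zero))
    have h1 := toSymmetric_ofSymmetric (n := n + 1) (p := p) (lineValue_killsShuffles hY.1.1 hY.1.2)
      (lineValue_koszulSymmetric hY.1.2) (ws := L.map (List.map v))
      (by
        intro w hw
        obtain ⟨u, hu, rfl⟩ := List.mem_map.1 hw
        simpa using hL.1 u hu)
      (by rw [List.length_map, hp]) (by
        rw [← List.map_flatten, List.length_map, hL.2.1.length_eq, List.length_finRange])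
    rw [hc, ← h1, h0]
    have h2 : (evalWords (0 : (Fin (n + 1) → V) → V) : Words K V →ₗ[K] V) = 0 :=
      words_hom_ext fun w => by simp [evalWords]
    rw [toSymmetric, h2]
    simp
  · exact hY.2 L Γ hL hΓ hp

/-- The preimage is `ofCochain`, corrected by the sign in `cochainOf`: the values of both sides on a
word are the same sum over its cuts. -/
lemma cochainOf_surjective [CharZero K] {p n : ℕ} {f : (Fin (n + 1) → V) → V}
    (hf : f ∈ poisBi K V p (n + 1)) : ∃ Y ∈ finBi K V p n, cochainOf K p n Y = f := by
  refine ⟨(-1 : K) ^ n.choose 2 • ofCochain K p f,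
    Submodule.smul_mem _ _ (ofCochain_mem_finBi hf), ?_⟩
  funext v
  rw [map_smul, Pi.smul_apply, cochainOf_apply, smul_smul, neg_one_pow_mul_self, one_smul,
    eq_cutSum_of_mem_poisBi hf v]
  exact cutSum_congr fun ws h1 h2 h3 => lineValue_ofCochain f h3 h2 (by rw [h1, List.length_ofFn])

/-- The isomorphism between the components of the finite cohomology complex and the Eulerian
components of the Hochschild complex. -/
def cochainEquiv (K V : Type*) [Field K] [CharZero K] [AddCommGroup V] [Module K V] (p n : ℕ) :
    finBi K V p n ≃ₗ[K] poisBi K V p (n + 1) :=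
  LinearEquiv.ofBijective
    (((cochainOf K p n).comp (finBi K V p n).subtype).codRestrict (poisBi K V p (n + 1))
      fun Y => cochainOf_mem Y.2.1)
    ⟨by
      rw [← LinearMap.ker_eq_bot, LinearMap.ker_eq_bot']
      intro Y hY
      exact Subtype.ext (cochainOf_injective Y.2 (congrArg Subtype.val hY)),
    fun f => by
      obtain ⟨Y, hY, h⟩ := cochainOf_surjective f.2
      exact ⟨⟨Y, hY⟩, Subtype.ext h⟩⟩

lemma chain_finRange (n : ℕ) : chain (List.finRange (n + 1)) = (Quiv.line n).1 := by
  change _ = (Finset.univ : Finset (Fin n)).val.map (fun i => (i.castSucc, i.succ))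
  rw [chain, Fin.univ_val_map]
  congr 1
  refine List.ext_getElem (by simp) fun i h1 h2 => ?_
  simp [List.getElem_zip]

lemma deconcSum_right_nil {α M : Type*} [AddCommGroup M] (Z : List α → M) (w : List α) :
    deconcSum (fun x y => if y = [] then Z x else 0) w = Z w := by
  induction w generalizing Z with
  | nil => simp [deconcSum]
  | cons a w ih => rw [deconcSum, if_neg (by simp), zero_add, ih fun x => Z (a :: x)]

lemma cutSum_one {α M : Type*} [AddCommGroup M] (G : List (List α) → M) {w : List α} (hw : w ≠ []) :
    cutSum 1 G w = G [w] := by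
  rw [← deconcSum_right_nil (fun x => G [x]) w, cutSum]
  refine deconcSum_congr fun x y h => ?_
  rw [cutSum]
  by_cases hx : x = []
  · subst hx
    rw [List.nil_append] at h
    rw [if_pos rfl, if_neg (h ▸ hw)]
  · rw [if_neg hx]

lemma cochainOf_one (n : ℕ) (Y : QuivFun V (n + 1)) : cochainOf K 1 n Y = lineMap n Y := by
  funext v
  have h := lineValue_map_eq Y [List.finRange (n + 1)] (by simp) v
  have h1 : ofArrows (chain (List.finRange (n + 1))) = Quiv.line n := by
    rw [chain_finRange, ofArrows_val]
  rw [cochainOf_apply, cutSum_one _ (by simp), lineMap]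
  simp only [List.map_cons, List.map_nil, List.sum_cons, List.sum_nil, add_zero, h1] at h
  rw [← List.ofFn_id, List.map_ofFn] at h
  change lineValue Y [List.ofFn v] = _ at h
  rw [h, Pi.smul_apply, ← Int.cast_smul_eq_zsmul K]
  push_cast
  rfl

end Equivalence

/-! ### The Hochschild coboundary on lists -/

section HochschildList

variable {K V : Type*} [Field K] [AddCommGroup V] [Module K V]

/-- The Hochschild coboundary of a function on words, with symmetric coefficients. -/
def hochList (m : V →ₗ[K] V →ₗ[K] V) : (List V → V) → List V → V
  | _, [] => 0
  | _, [_] => 0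
  | g, a :: b :: l =>
      m a (g (b :: l)) - g (m a b :: l) + m b (g (a :: l)) - hochList m (fun w => g (a :: w)) (b :: l)

variable (m : V →ₗ[K] V →ₗ[K] V)

lemma hochList_congr {g h : List V → V} {l : List V}
    (H : ∀ w : List V, w.length + 1 = l.length → g w = h w) : hochList m g l = hochList m h l := by
  induction l generalizing g h with
  | nil => rfl
  | cons a l ih =>
    rcases l with _ | ⟨b, l⟩
    · rfl
    · rw [hochList, hochList, H _ (by simp), H _ (by simp), H _ (by simp),
        ih fun w hw => H (a :: w) (by simpa using hw)]

lemma hochList_add (g h : List V → V) (l : List V) :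
    hochList m (fun w => g w + h w) l = hochList m g l + hochList m h l := by
  induction l generalizing g h with
  | nil => simp [hochList]
  | cons a l ih =>
    rcases l with _ | ⟨b, l⟩
    · simp [hochList]
    · rw [hochList, hochList, hochList, ih]
      simp only [map_add]
      abel

lemma hochList_smul (c : K) (g : List V → V) (l : List V) :
    hochList m (fun w => c • g w) l = c • hochList m g l := by
  induction l generalizing g with
  | nil => simp [hochList]
  | cons a l ih =>
    rcases l with _ | ⟨b, l⟩
    · simp [hochList]
    · rw [hochList, hochList, ih]
      simp only [map_smul, smul_sub, smul_add]

lemma hochList_zero (l : List V) : hochList m (fun _ => 0) l = 0 := by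
  have := hochList_smul m 0 (fun _ => 0) l
  simpa using this

lemma hochList_deconcSum_fun (G : List V → List V → List V → V) (x y : List V) :
    hochList m (fun w => deconcSum (fun p q => G p q w) y) x =
      deconcSum (fun p q => hochList m (G p q) x) y := by
  induction y generalizing G with
  | nil => rfl
  | cons a y ih =>
    simp only [deconcSum]
    rw [hochList_add, ih fun p q => G (a :: p) q]

/-- The Hochschild coboundary is a coderivation of the deconcatenation. -/
lemma hochList_deconcSum (B : List V → List V → V) (l : List V) :
    hochList m (deconcSum B) l = deconcSum (fun x y => hochList m (fun w => B w y) x +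
      (-1 : K) ^ x.length • hochList m (B x) y) l := by
  induction l generalizing B with
  | nil => simp [hochList, deconcSum]
  | cons a l ih =>
    rcases l with _ | ⟨b, l⟩
    · simp [hochList, deconcSum]
    have e1 : deconcSum (fun x y => hochList m (fun w => B w y) (a :: x) +
        hochList m (fun w => B (a :: w) y) x) (b :: l) =
        m a (deconcSum (fun x => B (b :: x)) l) - deconcSum (fun x => B (m a b :: x)) l +
          m b (deconcSum (fun x => B (a :: x)) l) := by
      rw [deconcSum, map_deconcSum, map_deconcSum]
      simp only [hochList, zero_add]
      simp only [deconcSum_eq_sum, ← Finset.sum_add_distrib, ← Finset.sum_sub_distrib]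
      refine Finset.sum_congr rfl fun i _ => ?_
      abel
    rw [hochList]
    have e2 : hochList m (fun w => deconcSum B (a :: w)) (b :: l) =
        hochList m (fun w => B [] (a :: w)) (b :: l) +
          hochList m (deconcSum fun x => B (a :: x)) (b :: l) := by
      rw [← hochList_add]
      rfl
    rw [e2, ih]
    have e3 : deconcSum (fun x y => hochList m (fun w => B w y) (a :: x) +
        (-1 : K) ^ (a :: x).length • hochList m (B (a :: x)) y) (b :: l) =
        deconcSum (fun x y => hochList m (fun w => B w y) (a :: x) +
          hochList m (fun w => B (a :: w) y) x) (b :: l) -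
        deconcSum (fun x y => hochList m (fun w => B (a :: w) y) x +
          (-1 : K) ^ x.length • hochList m (B (a :: x)) y) (b :: l) := by
      rw [deconcSum_eq_sum, deconcSum_eq_sum, deconcSum_eq_sum, ← Finset.sum_sub_distrib]
      refine Finset.sum_congr rfl fun i _ => ?_
      rw [List.length_cons, pow_succ]
      simp only [mul_neg, mul_one, neg_smul]
      abel
    conv_rhs => rw [deconcSum]
    rw [e3, e1]
    simp only [deconcSum, hochList, List.length_nil, pow_zero, one_smul, zero_add, map_add]
    abel

/-- The extension of the Hochschild coboundary to functions of lists of words. -/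
def hochWords (m : V →ₗ[K] V →ₗ[K] V) : (List (List V) → V) → List (List V) → V
  | _, [] => 0
  | G, w :: ws => hochList m (fun w' => G (w' :: ws)) w +
      (-1 : K) ^ w.length • hochWords m (fun ws' => G (w :: ws')) ws

lemma hochList_cutSum_fun (p : ℕ) (G : List (List V) → List V → V) (x y : List V) :
    hochList m (fun w => cutSum p (fun ws => G ws w) y) x =
      cutSum p (fun ws => hochList m (G ws) x) y := by
  induction p generalizing G y with
  | zero =>
    simp only [cutSum]
    split_ifs
    · rfl
    · exact hochList_zero m x
  | succ p ih =>
    simp only [cutSum]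
    rw [hochList_deconcSum_fun m (fun a b w => if a = [] then 0 else
      cutSum p (fun ws => G (a :: ws) w) b) x y]
    refine deconcSum_congr fun a b _ => ?_
    split_ifs
    · exact hochList_zero m x
    · exact ih _ _

/-- The Hochschild coboundary commutes with the sum over the cuts of a word. -/
lemma hochList_cutSum (p : ℕ) (G : List (List V) → V) (l : List V) :
    hochList m (cutSum p G) l = cutSum p (hochWords m G) l := by
  induction p generalizing G l with
  | zero =>
    rcases l with _ | ⟨a, _ | ⟨b, l⟩⟩
    · rfl
    · rfl
    · rw [hochList_congr m (h := fun _ => 0), hochList_zero]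
      · simp [cutSum]
      · intro w hw
        rw [cutSum, if_neg]
        rintro rfl
        simp at hw
  | succ p ih =>
    have : hochList m (cutSum (p + 1) G) l = _ := hochList_deconcSum m
      (fun x y => if x = [] then 0 else cutSum p (fun ws => G (x :: ws)) y) l
    rw [this, cutSum]
    refine deconcSum_congr fun x y _ => ?_
    rcases x with _ | ⟨a, x⟩
    · simp only [if_true]
      rw [hochList_zero]
      simp [hochList]
    · rw [if_neg (by simp)]
      have e : hochList m (fun w => if w = [] then 0 else cutSum p (fun ws => G (w :: ws)) y)
          (a :: x) = cutSum p (fun ws => hochList m (fun w => G (w :: ws)) (a :: x)) y := by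
        rw [← hochList_cutSum_fun]
        rcases x with _ | ⟨b, x⟩
        · rfl
        · refine hochList_congr m fun w hw => ?_
          rw [if_neg]
          rintro rfl
          simp at hw
      rw [e]
      simp only [hochWords, if_neg (List.cons_ne_nil a x)]
      rw [cutSum_add, cutSum_smul, ih]

/-- In the recursion of `hochList` the term `m b (g (a :: l))` compensates the left action with
which the recursive call begins; when `l` is empty there is none to compensate, and the term is the
action of the last letter. Commutativity lets this action be written on the left. -/
lemma sum_hoch_eq_hochList (hm : ∀ x y, m x y = m y x) (n : ℕ) (φ : List V → V)
    (v : Fin (n + 1) → V) :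
    m (v 0) (φ (List.ofFn fun i => v i.succ)) + ∑ i : Fin n, (-1 : K) ^ (i.val + 1) •
      φ (List.ofFn (Fin.contractNth i.castSucc (fun x y => m x y) v)) +
      (-1 : K) ^ (n + 1) • m (φ (List.ofFn fun i => v i.castSucc)) (v (Fin.last n)) =
    hochList m φ (List.ofFn v) := by
  induction n generalizing φ with
  | zero =>
    simp [hochList, hm (v 0)]
  | succ n ih =>
    have h := ih (fun w => φ (v 0 :: w)) (fun i => v i.succ)
    have e0 : List.ofFn v = v 0 :: v (Fin.succ 0) :: List.ofFn fun i : Fin n => v i.succ.succ := by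
      rw [List.ofFn_succ, List.ofFn_succ]
    rw [show (List.ofFn fun i : Fin (n + 1) => v i.succ) =
      v (Fin.succ 0) :: List.ofFn fun i : Fin n => v i.succ.succ from List.ofFn_succ ..] at h ⊢
    rw [e0, hochList, ← h, Fin.sum_univ_succ]
    have e1 : List.ofFn (Fin.contractNth (0 : Fin (n + 1)).castSucc (fun x y => m x y) v) =
        m (v 0) (v (Fin.succ 0)) :: List.ofFn fun i : Fin n => v i.succ.succ := by
      rw [List.ofFn_succ]
      congr 1
    have e2 : ∀ i : Fin n, List.ofFn (Fin.contractNth i.succ.castSucc (fun x y => m x y) v) =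
        v 0 :: List.ofFn (Fin.contractNth i.castSucc (fun x y => m x y) fun i => v i.succ) := by
      intro i
      rw [List.ofFn_succ]
      congr 1
      congr 1
      funext j
      simp only [Fin.contractNth, Fin.val_succ, Fin.val_castSucc]
      by_cases h1 : j.val < i.val
      · rw [if_pos (by omega), if_pos h1]
        rfl
      · rw [if_neg (by omega), if_neg h1]
        by_cases h2 : j.val = i.val
        · rw [if_pos (by omega), if_pos h2]
          rfl
        · rw [if_neg (by omega), if_neg h2]
    have e3 : (List.ofFn fun i : Fin (n + 1) => v i.castSucc) =
        v 0 :: List.ofFn fun i : Fin n => v i.castSucc.succ := by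
      rw [List.ofFn_succ]
      rfl
    simp only [e2, e3]
    rw [e1]
    simp only [Fin.val_zero, Fin.val_succ, zero_add, pow_one, neg_smul, one_smul, pow_succ _ (_ + 1),
      mul_neg, mul_one, Finset.sum_neg_distrib, Fin.succ_last]
    abel

lemma PoissonAlgebra.hochschild_eq_hochList (A : PoissonAlgebra K V) {n : ℕ} (φ : List V → V)
    {f : (Fin n → V) → V} (hf : ∀ v, f v = φ (List.ofFn v)) (v : Fin (n + 1) → V) :
    A.hochschild f v = hochList A.mul φ (List.ofFn v) := by
  rw [← sum_hoch_eq_hochList A.mul A.mul_comm, PoissonAlgebra.hochschild]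
  simp only [hf]

lemma PoissonAlgebra.hochschild_cochainOf (A : PoissonAlgebra K V) (p n : ℕ)
    (Y : QuivFun V (n + 1)) (v : Fin (n + 2) → V) : A.hochschild (cochainOf K p n Y) v =
      (-1 : K) ^ n.choose 2 • cutSum p (hochWords A.mul (lineValue Y)) (List.ofFn v) := by
  rw [A.hochschild_eq_hochList (fun w => (-1 : K) ^ n.choose 2 • cutSum p (lineValue Y) w)
    (cochainOf_apply p n Y), hochList_smul, hochList_cutSum]

/-- The value on the word obtained by multiplying a letter with the next one. -/
def mergeNext {V : Type*} [Zero V] (m : V → V → V) (g : List V → V) (u : List V) (x : V) :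
    List V → V
  | [] => 0
  | y :: v => g (u ++ m x y :: v)

lemma splitSum_neg {β M : Type*} [AddCommGroup M] (φ : List β → β → List β → M) (l : List β) :
    splitSum (fun A x B => -φ A x B) l = -splitSum φ l := by
  induction l generalizing φ with
  | nil => simp [splitSum]
  | cons x l ih => rw [splitSum, splitSum, ih fun A y B => φ (x :: A) y B, neg_add]

/-- The Hochschild coboundary as a sum over the letters of a word. -/
lemma hochList_eq_splitSum (g : List V → V) (l : List V) :
    hochList m g l = splitSum (fun u x v => (-1 : K) ^ u.length •
      (((if u = [] then 1 else 0) - (if v = [] then 1 else 0) : ℤ) • m x (g (u ++ v)) -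
        mergeNext (fun x y => m x y) g u x v)) l := by
  induction l generalizing g with
  | nil => rfl
  | cons a l ih =>
    rcases l with _ | ⟨b, l⟩
    · simp [splitSum, hochList, mergeNext]
    · rw [hochList, ih]
      have e : ∀ u x v, (-1 : K) ^ (a :: b :: u).length •
          (((if a :: b :: u = [] then 1 else 0) - (if v = [] then 1 else 0) : ℤ) •
            m x (g (a :: b :: u ++ v)) - mergeNext (fun x y => m x y) g (a :: b :: u) x v) =
          -((-1 : K) ^ (b :: u).length •
          (((if b :: u = [] then 1 else 0) - (if v = [] then 1 else 0) : ℤ) •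
            m x (g (a :: (b :: u ++ v))) -
              mergeNext (fun x y => m x y) (fun w => g (a :: w)) (b :: u) x v)) := by
        intro u x v
        have : mergeNext (fun x y => m x y) g (a :: b :: u) x v =
            mergeNext (fun x y => m x y) (fun w => g (a :: w)) (b :: u) x v := by
          cases v <;> rfl
        rw [this, ← neg_smul, List.length_cons, pow_succ _ (b :: u).length]
        simp
      simp only [splitSum, e]
      rw [splitSum_neg]
      simp [mergeNext, sub_smul]
      abel

end HochschildList

/-! ### Sums over the letters of a list -/

section SplitSums

variable {β W : Type*} [AddCommGroup W]

lemma splitSum_add (φ ψ : List β → β → List β → W) (l : List β) :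
    splitSum (fun A x B => φ A x B + ψ A x B) l = splitSum φ l + splitSum ψ l := by
  induction l generalizing φ ψ with
  | nil => simp [splitSum]
  | cons x l ih =>
    simp only [splitSum]
    rw [ih (fun A y B => φ (x :: A) y B)]
    abel

lemma splitSum_zero (l : List β) : splitSum (fun _ _ _ => (0 : W)) l = 0 := by
  rw [splitSum_const, smul_zero]

lemma map_splitSum {W' F : Type*} [AddCommGroup W'] [FunLike F W W'] [AddMonoidHomClass F W W']
    (f : F) (φ : List β → β → List β → W) (l : List β) :
    f (splitSum φ l) = splitSum (fun A x B => f (φ A x B)) l := by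
  induction l generalizing φ with
  | nil => simp [splitSum]
  | cons x l ih =>
    simp only [splitSum]
    rw [map_add, ih]

lemma smul_splitSum {R : Type*} [Ring R] [Module R W] (c : R) (φ : List β → β → List β → W)
    (l : List β) : c • splitSum φ l = splitSum (fun A x B => c • φ A x B) l :=
  map_splitSum (DistribSMul.toAddMonoidHom W c) φ l

lemma splitSum_append (φ : List β → β → List β → W) (l l' : List β) :
    splitSum φ (l ++ l') = splitSum (fun A x B => φ A x (B ++ l')) l +
      splitSum (fun A x B => φ (l ++ A) x B) l' := by
  induction l generalizing φ with
  | nil => simp [splitSum]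
  | cons x l ih =>
    simp only [splitSum, List.cons_append]
    rw [ih, add_assoc]

lemma splitSum_flatten (φ : List β → β → List β → W) (ws : List (List β)) :
    splitSum φ ws.flatten = splitSum (fun A w B => splitSum (fun u x v =>
      φ (A.flatten ++ u) x (v ++ B.flatten)) w) ws := by
  induction ws generalizing φ with
  | nil => rfl
  | cons w ws ih =>
    simp only [List.flatten_cons, splitSum, splitSum_append, ih, List.flatten_nil, List.nil_append,
      List.append_assoc]

lemma splitSum_map {γ : Type*} (g : γ → β) (φ : List β → β → List β → W) (l : List γ) :
    splitSum φ (l.map g) = splitSum (fun A x B => φ (A.map g) (g x) (B.map g)) l := by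
  induction l generalizing φ with
  | nil => rfl
  | cons x l ih => simp only [splitSum, List.map_cons, ih, List.map_nil]

lemma splitSum_comm {γ : Type*} (φ : List β → β → List β → List γ → γ → List γ → W) (l : List β)
    (l' : List γ) : splitSum (fun A x B => splitSum (φ A x B) l') l =
      splitSum (fun A' x' B' => splitSum (fun A x B => φ A x B A' x' B') l) l' := by
  induction l generalizing φ with
  | nil => exact (splitSum_zero l').symm
  | cons x l ih =>
    simp only [splitSum]
    rw [splitSum_add, ih]

lemma sum_fin_eq_splitSum (φ : List β → β → List β → W) (l : List β) :
    ∑ i : Fin l.length, φ (l.take i) (l.get i) (l.drop (i + 1)) = splitSum φ l := by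
  induction l generalizing φ with
  | nil => rfl
  | cons x l ih =>
    rw [splitSum, ← ih]
    exact Fin.sum_univ_succ (n := l.length) _

/-- The sum of `φ A x B y C` over all ways to write a list as `A ++ x :: (B ++ y :: C)`. -/
def pairSum (φ : List β → β → List β → β → List β → W) (l : List β) : W :=
  splitSum (fun A x R => splitSum (φ A x) R) l

lemma pairSum_congr {φ ψ : List β → β → List β → β → List β → W} {l : List β}
    (h : ∀ A x B y C, l = A ++ x :: (B ++ y :: C) → φ A x B y C = ψ A x B y C) :
    pairSum φ l = pairSum ψ l :=
  splitSum_congr fun _ _ _ h1 => splitSum_congr fun _ _ _ h2 => h _ _ _ _ _ (by rw [h1, h2])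

lemma pairSum_map {γ : Type*} (g : γ → β) (φ : List β → β → List β → β → List β → W) (l : List γ) :
    pairSum φ (l.map g) =
      pairSum (fun A x B y C => φ (A.map g) (g x) (B.map g) (g y) (C.map g)) l := by
  simp only [pairSum, splitSum_map]

/-- Pairs of letters of a list of words lie in one word or in two different words. -/
lemma pairSum_flatten (φ : List β → β → List β → β → List β → W) (ws : List (List β)) :
    pairSum φ ws.flatten =
      splitSum (fun A w B => pairSum (fun u x c y v =>
        φ (A.flatten ++ u) x c y (v ++ B.flatten)) w) ws +
      pairSum (fun A w C w' D => splitSum (fun u x v => splitSum (fun u' y v' =>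
        φ (A.flatten ++ u) x (v ++ (C.flatten ++ u')) y (v' ++ D.flatten)) w') w) ws := by
  rw [pairSum, splitSum_flatten]
  simp only [pairSum]
  rw [← splitSum_add]
  refine splitSum_congr fun A w B _ => ?_
  rw [← splitSum_comm, ← splitSum_add]
  refine splitSum_congr fun u x v _ => ?_
  rw [splitSum_append, splitSum_flatten]

lemma sum_lt_eq_pairSum (φ : List β → β → List β → β → List β → W) (l : List β) :
    ∑ i : Fin l.length, ∑ j : Fin l.length, (if i < j then
      φ (l.take i) (l.get i) ((l.drop (i + 1)).take (j - (i + 1))) (l.get j) (l.drop (j + 1)) else 0) =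
    pairSum φ l := by
  induction l generalizing φ with
  | nil => rfl
  | cons x l ih =>
    rw [pairSum, splitSum]
    refine (Fin.sum_univ_succ (n := l.length) _).trans ?_
    congr 1
    · rw [← sum_fin_eq_splitSum]
      refine (Fin.sum_univ_succ (n := l.length) _).trans ?_
      simp
    · refine Eq.trans (Finset.sum_congr rfl fun i _ => ?_)
        (ih fun A y B z C => φ (x :: A) y B z C)
      refine (Fin.sum_univ_succ (n := l.length) _).trans ?_
      simp

lemma unshuffleSum_one (l : List β) (Q : List β → List β → W) : unshuffleSum 1 l Q =
    splitSum (fun A x B => (-1 : ℤ) ^ A.length • Q [x] (A ++ B)) l := by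
  induction l generalizing Q with
  | nil => rfl
  | cons x l ih =>
    rw [unshuffleSum_cons, ih, unshuffleSum_zero, smul_splitSum, splitSum]
    simp [smul_smul, pow_succ]

lemma unshuffleSum_two (l : List β) (Q : List β → List β → W) : unshuffleSum 2 l Q =
    pairSum (fun A x B y C => (-1 : ℤ) ^ B.length • Q [x, y] (A ++ (B ++ C))) l := by
  induction l generalizing Q with
  | nil => rfl
  | cons x l ih =>
    rw [unshuffleSum_cons, ih, unshuffleSum_one]
    simp [pairSum, splitSum]

end SplitSums

/-! ### The differential on labelled points -/

section PointDifferential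

variable {K M V : Type*} [Field K] [AddCommGroup V] [Module K V] {n : ℕ}

lemma unionSet_points {M V : Type*} (l : List (M × V)) :
    unionSet (l.map fun p => (({p.1} : Set M), p.2)) = {m | m ∈ l.map Prod.fst} := by
  ext m
  simp [unionSet, eq_comm]

lemma disjointLetters_points {M V : Type*} {l : List (M × V)} (h : (l.map Prod.fst).Nodup) :
    DisjointLetters (l.map fun p => (({p.1} : Set M), p.2)) := by
  rw [DisjointLetters, List.pairwise_map]
  rw [List.Nodup, List.pairwise_map] at h
  exact h.imp fun h => Set.disjoint_singleton.2 h

/-- The bracket with an operation `X` of two variables whose values only depend on the numbers of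
arrows. -/
lemma evalPts_lieBracket {X : QuivFun V 2} {κ : ℕ → ℕ → ℤ} {b : V → V → V}
    (hX : ∀ (E : Multiset (M × M)) (x y : Set M × V),
      evalList X E [x, y] = κ (arrowCount E x.1 y.1) (arrowCount E y.1 x.1) • b x.2 y.2)
    (Y : QuivFun V (n + 1)) (E : Multiset (M × M)) {l : List (M × V)} (hl : l.length = n + 2)
    (hd : (l.map Prod.fst).Nodup) :
    evalPts (lieBracket (a := 1) (b := n) (Nat.add_comm 1 n) X Y) E l =
      -((-1 : ℤ) ^ n • (splitSum (fun P x S => (-1 : ℤ) ^ P.length •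
        κ (arrowCount E {m | m ∈ (P ++ S).map Prod.fst} {x.1})
          (arrowCount E {x.1} {m | m ∈ (P ++ S).map Prod.fst}) •
          b (evalPts Y E (P ++ S)) x.2) l +
      pairSum (fun P x Q y S => (-1 : ℤ) ^ Q.length •
        evalList Y E (({x.1} ∪ {y.1}, κ (arrowCount E {x.1} {y.1}) (arrowCount E {y.1} {x.1}) •
          b x.2 y.2) :: (P ++ (Q ++ S)).map fun p => ({p.1}, p.2))) l)) := by
  -- In `X □ Y` all letters but one are fed to `Y`; cocommutativity makes this a sum over the
  -- remaining letter. In `Y □ X` the sum is over the pairs of letters that are fed to `X`.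
  rw [evalPts, lieBracket, evalList_sub, evalList_zsmul, evalList_box _ _ _ _
    (disjointLetters_points hd), evalList_box _ _ _ _ (disjointLetters_points hd),
    unshuffleSum_cocomm (m := n + 1) (k := 1) (by rw [List.length_map, hl]), unshuffleSum_map,
    unshuffleSum_map, unshuffleSum_one, unshuffleSum_two, smul_add, neg_add, ← sub_eq_add_neg,
    mul_one, one_mul, pow_succ, mul_neg_one, neg_smul]
  refine congrArg₂ _ (congrArg _ (congrArg _ ?_)) (congrArg _ ?_)
  · refine splitSum_congr fun P x S _ => ?_
    rw [evalComp, List.map_cons, List.map_nil, hX, unionSet_points]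
    rfl
  · refine pairSum_congr fun P x Q y S _ => ?_
    rw [evalComp, List.map_cons, List.map_cons, List.map_nil, hX, unionSet_cons, unionSet_cons,
      unionSet_nil, Set.union_empty]

open Classical in
/-- The identification of `b` with `a`. -/
def mergeMap {M : Type*} (a b m : M) : M := if m = b then a else m

@[simp] lemma mergeMap_self {M : Type*} (a b : M) : mergeMap a b b = a := if_pos rfl

lemma mergeMap_of_ne {M : Type*} {a b m : M} (h : m ≠ b) : mergeMap a b m = m := if_neg h

lemma map_mergeMap {M V : Type*} {a b : M} {l : List (M × V)} (h : b ∉ l.map Prod.fst) :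
    l.map (fun p => (mergeMap a b p.1, p.2)) = l := by
  refine (List.map_congr_left fun p hp => ?_).trans (List.map_id l)
  rw [mergeMap_of_ne]
  · rfl
  · rintro rfl
    exact h (List.mem_map_of_mem hp)

lemma map_map_mergeMap {M V : Type*} {a b : M} {ws : List (List (M × V))}
    (h : b ∉ ws.flatten.map Prod.fst) :
    ws.map (List.map fun p => (mergeMap a b p.1, p.2)) = ws := by
  refine (List.map_congr_left fun w hw => ?_).trans (List.map_id ws)
  rw [map_mergeMap]
  · rfl
  · intro h'
    obtain ⟨p, hp, rfl⟩ := List.mem_map.1 h'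
    exact h (List.mem_map_of_mem (List.mem_flatten_of_mem hw hp))

/-- A letter with two base points amounts to identifying these points in all arrows, so the value is
again one on labelled points. -/
lemma evalList_merge (Y : QuivFun V n) (E : Multiset (M × M)) {a b : M} (c : V)
    {l : List (M × V)} (ha : a ∉ l.map Prod.fst) (hb : b ∉ l.map Prod.fst) :
    evalList Y E (({a} ∪ {b}, c) :: l.map fun p => ({p.1}, p.2)) =
      evalPts Y (E.map fun e => (mergeMap a b e.1, mergeMap a b e.2)) ((a, c) :: l) := by
  rw [evalPts_map, List.map_cons]
  congr 2
  · congr 1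
    ext m
    by_cases h : m = b <;> simp [mergeMap, h]
  · refine List.map_congr_left fun p hp => ?_
    congr 1
    have h1 : p.1 ≠ a := by rintro rfl; exact ha (List.mem_map_of_mem hp)
    have h2 : p.1 ≠ b := by rintro rfl; exact hb (List.mem_map_of_mem hp)
    ext m
    by_cases h : m = b
    · simp [mergeMap, h, h1.symm, h2.symm]
    · simp [mergeMap, h]

lemma evalPts_cons_self (Y : QuivFun V n) (E : Multiset (M × M)) {a : M} {l : List (M × V)}
    (hd : (l.map Prod.fst).Nodup) (ha : a ∈ l.map Prod.fst) :
    evalPts Y ((a, a) ::ₘ E) l = evalPts Y E l := by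
  by_cases h : l.length = n
  · obtain ⟨s, rfl⟩ := exists_eq_ofFn h
    obtain ⟨i, rfl⟩ := exists_index ha
    rw [evalPts_ofFn, evalPts_ofFn, quiverOn_cons_pts (injective_of_nodup hd) E i i,
      ofArrows_cons_self, ofArrows_val]
  · rw [evalPts_of_ne _ _ h, evalPts_of_ne _ _ h]

lemma arrowCount_add (E F : Multiset (M × M)) (S T : Set M) :
    arrowCount (E + F) S T = arrowCount E S T + arrowCount F S T := by
  classical exact Multiset.countP_add _ _ _

lemma arrowCount_eq_zero {E : Multiset (M × M)} {S T : Set M} (h : ∀ e ∈ E, e.1 ∈ S → e.2 ∉ T) :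
    arrowCount E S T = 0 := by
  classical exact Multiset.countP_eq_zero.2 fun e he h' => h e he h'.1 h'.2

lemma arrowCount_cons_of_mem {E : Multiset (M × M)} {S T : Set M} {a b : M} (ha : a ∈ S)
    (hb : b ∈ T) : arrowCount ((a, b) ::ₘ E) S T = arrowCount E S T + 1 := by
  classical exact Multiset.countP_cons_of_pos _ ⟨ha, hb⟩

lemma fst_mem_of_mem_chain_concat {u : List M} {x : M} {e : M × M} (h : e ∈ chain (u ++ [x])) :
    e.1 ∈ u := by
  induction u with
  | nil => simp at h
  | cons a u ih =>
    cases u with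
    | nil => simp_all
    | cons b u =>
      rw [List.cons_append, List.cons_append, chain_cons_cons, Multiset.mem_cons] at h
      rcases h with rfl | h
      · simp
      · exact List.mem_cons_of_mem _ (ih h)

lemma snd_mem_of_mem_chain_cons {v : List M} {x : M} {e : M × M} (h : e ∈ chain (x :: v)) :
    e.2 ∈ v := (List.of_mem_zip (show (e.1, e.2) ∈ (x :: v).zip (x :: v).tail from h)).2

end PointDifferential

/-! ### The differentials on unions of lines -/

section LineDifferential

variable {K M V : Type*} [Field K] [AddCommGroup V] [Module K V] {n : ℕ}

lemma neg_one_pow_zsmul (k : ℕ) (v : V) : (-1 : ℤ) ^ k • v = (-1 : K) ^ k • v := by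
  rw [← Int.cast_smul_eq_zsmul K]
  push_cast
  rfl

lemma linesArrows_split {M V : Type*} (A : List (List (M × V))) (u : List (M × V)) (x : M × V)
    (v : List (M × V)) (B : List (List (M × V))) : linesArrows (A ++ (u ++ x :: v) :: B) =
      chain (u.map Prod.fst ++ [x.1]) + chain (x.1 :: v.map Prod.fst) +
        (linesArrows A + linesArrows B) := by
  rw [linesArrows_append, linesArrows_cons, List.map_append, List.map_cons, chain_append]
  abel

section Counts

variable {M V : Type*} {A B : List (List (M × V))} {u v : List (M × V)} {x : M × V}

/-- In a union of lines the only arrow into `x` comes from the preceding letter of its line. -/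
lemma arrowCount_into (hx : x.1 ∉ (A.flatten ++ u ++ (v ++ B.flatten)).map Prod.fst) {S : Set M}
    (hS : ∀ p ∈ u, p.1 ∈ S) :
    arrowCount (linesArrows (A ++ (u ++ x :: v) :: B)) S {x.1} = if u = [] then 0 else 1 := by
  simp only [List.map_append, List.mem_append, not_or] at hx
  obtain ⟨⟨hA, hu⟩, hv, hB⟩ := hx
  rw [linesArrows_split, arrowCount_add, arrowCount_add, arrowCount_add,
    arrowCount_eq_zero (E := chain (x.1 :: _)), arrowCount_eq_zero (E := linesArrows A),
    arrowCount_eq_zero (E := linesArrows B), add_zero, add_zero, add_zero]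
  · rcases List.eq_nil_or_concat u with rfl | ⟨u, z, rfl⟩
    · rfl
    · have hz : z.1 ∈ S := hS z (by simp)
      simp only [List.concat_eq_append, List.map_append, List.map_cons, List.map_nil,
        List.append_assoc, List.cons_append, List.nil_append] at hu ⊢
      rw [chain_concat, arrowCount_cons_of_mem hz (Set.mem_singleton _), arrowCount_eq_zero, if_neg (by simp)]
      rintro e he - (he' : e.2 = x.1)
      exact hu (he' ▸ (mem_of_mem_chain he).2)
  · rintro e he - (he' : e.2 = x.1)
    exact hB (he' ▸ (mem_of_mem_linesArrows he).2)
  · rintro e he - (he' : e.2 = x.1)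
    exact hA (he' ▸ (mem_of_mem_linesArrows he).2)
  · rintro e he - (he' : e.2 = x.1)
    exact hv (he' ▸ snd_mem_of_mem_chain_cons he)

lemma arrowCount_into_eq_zero (hx : x.1 ∉ (A.flatten ++ u ++ (v ++ B.flatten)).map Prod.fst)
    {S : Set M} (hS : ∀ p ∈ u, p.1 ∉ S) :
    arrowCount (linesArrows (A ++ (u ++ x :: v) :: B)) S {x.1} = 0 := by
  simp only [List.map_append, List.mem_append, not_or] at hx
  obtain ⟨⟨hA, hu⟩, hv, hB⟩ := hx
  rw [linesArrows_split]
  apply arrowCount_eq_zero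
  rintro e he h (he' : e.2 = x.1)
  rw [Multiset.mem_add, Multiset.mem_add, Multiset.mem_add] at he
  rcases he with (he | he) | he | he
  · obtain ⟨p, hp, h'⟩ := List.mem_map.1 (fst_mem_of_mem_chain_concat he)
    exact hS p hp (h' ▸ h)
  · exact hv (he' ▸ snd_mem_of_mem_chain_cons he)
  · exact hA (he' ▸ (mem_of_mem_linesArrows he).2)
  · exact hB (he' ▸ (mem_of_mem_linesArrows he).2)

lemma arrowCount_from (hx : x.1 ∉ (A.flatten ++ u ++ (v ++ B.flatten)).map Prod.fst) {S : Set M} :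
    arrowCount (linesArrows (A ++ (u ++ x :: v) :: B)) {x.1} S =
      arrowCount (chain (x.1 :: v.map Prod.fst)) {x.1} S := by
  simp only [List.map_append, List.mem_append, not_or] at hx
  obtain ⟨⟨hA, hu⟩, hv, hB⟩ := hx
  rw [linesArrows_split, arrowCount_add, arrowCount_add, arrowCount_add,
    arrowCount_eq_zero (E := chain (_ ++ [x.1])), arrowCount_eq_zero (E := linesArrows A),
    arrowCount_eq_zero (E := linesArrows B), zero_add, add_zero, add_zero]
  · rintro e he (he' : e.1 = x.1)
    exact absurd (he' ▸ (mem_of_mem_linesArrows he).1) hB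
  · rintro e he (he' : e.1 = x.1)
    exact absurd (he' ▸ (mem_of_mem_linesArrows he).1) hA
  · rintro e he (he' : e.1 = x.1)
    exact absurd (he' ▸ fst_mem_of_mem_chain_concat he) hu

lemma arrowCount_chain_cons {a z : M} {v : List M} (ha : a ∉ z :: v) {S : Set M} (hz : z ∈ S) :
    arrowCount (chain (a :: z :: v)) {a} S = 1 := by
  rw [chain_cons_cons, arrowCount_cons_of_mem (Set.mem_singleton _) hz, arrowCount_eq_zero]
  rintro e he (he' : e.1 = a)
  exact absurd (he' ▸ (mem_of_mem_chain he).1) ha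

lemma arrowCount_chain_of_ne {a b : M} {v : List M} (ha : a ∉ v) (h : v.head? ≠ some b) :
    arrowCount (chain (a :: v)) {a} {b} = 0 := by
  apply arrowCount_eq_zero
  rintro e he (he' : e.1 = a) (rfl : e.2 = b)
  rcases v with _ | ⟨z, v⟩
  · simp at he
  rw [chain_cons_cons, Multiset.mem_cons] at he
  rcases he with rfl | he
  · exact h rfl
  · exact ha (he' ▸ (mem_of_mem_chain he).1)

end Counts

lemma evalList_cons_zero {f : QuivFun V n} (hf : ∀ Γ, f Γ ∈ multilinear K V n)
    (E : Multiset (M × M)) (S : Set M) (l : List (Set M × V)) : evalList f E ((S, 0) :: l) = 0 := by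
  obtain ⟨g, hg⟩ := exists_linear_head hf E S l
  rw [hg, map_zero]

lemma hochWords_eq_splitSum (m : V →ₗ[K] V →ₗ[K] V) (G : List (List V) → V) (ws : List (List V)) :
    hochWords m G ws = splitSum (fun A w B => (-1 : K) ^ A.flatten.length •
      hochList m (fun w' => G (A ++ w' :: B)) w) ws := by
  induction ws generalizing G with
  | nil => rfl
  | cons w ws ih =>
    rw [hochWords, ih, splitSum, smul_splitSum]
    simp [smul_smul, pow_add]

lemma splitSum_eq_zero {β W : Type*} [AddCommGroup W] {φ : List β → β → List β → W} {l : List β}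
    (h : ∀ A x B, l = A ++ x :: B → φ A x B = 0) : splitSum φ l = 0 :=
  (splitSum_congr h).trans (splitSum_zero l)

lemma evalPts_merge {Y : QuivFun V n} (hs : IsSkew Y) (E : Multiset (M × M)) {a b : M} (c : V)
    (P S : List (M × V)) (ha : a ∉ (P ++ S).map Prod.fst) (hb : b ∉ (P ++ S).map Prod.fst) :
    evalList Y E (({a} ∪ {b}, c) :: (P ++ S).map fun p => ({p.1}, p.2)) = (-1 : K) ^ P.length •
      evalPts Y (E.map fun e => (mergeMap a b e.1, mergeMap a b e.2)) (P ++ (a, c) :: S) := by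
  rw [evalList_merge _ _ _ ha hb]
  exact evalPts_move hs _ [] _ P S

/-- Merging two consecutive letters of a line. -/
lemma evalList_merge_next {Y : QuivFun V n} (hs : IsSkew Y) {A B : List (List (M × V))}
    {u v : List (M × V)} {x y : M × V} (c : V)
    (hd : ((A ++ (u ++ x :: y :: v) :: B).flatten.map Prod.fst).Nodup) :
    evalList Y (linesArrows (A ++ (u ++ x :: y :: v) :: B)) (({x.1} ∪ {y.1}, c) ::
      (A.flatten ++ u ++ (v ++ B.flatten)).map fun p => ({p.1}, p.2)) =
    (-1 : K) ^ (A.flatten ++ u).length •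
      lineValue Y ((A ++ (u ++ (x.1, c) :: v) :: B).map (List.map Prod.snd)) := by
  have hp : (A.flatten ++ (u ++ (x :: y :: (v ++ B.flatten)))).Perm
      (x :: y :: (A.flatten ++ u ++ (v ++ B.flatten))) := by
    rw [← List.append_assoc]
    exact List.perm_middle.trans ((List.perm_middle).cons _)
  have hd' : ((x :: y :: (A.flatten ++ u ++ (v ++ B.flatten))).map Prod.fst).Nodup :=
    (hp.map _).nodup_iff.1 (by simpa using hd)
  rw [List.map_cons, List.map_cons, List.nodup_cons, List.nodup_cons, List.mem_cons, not_or] at hd'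
  obtain ⟨⟨hxy, hx⟩, hy, hr⟩ := hd'
  have hd2 : ((A ++ (u ++ (x.1, c) :: v) :: B).flatten.map Prod.fst).Nodup := by
    have : ((A ++ (u ++ (x.1, c) :: v) :: B).flatten.map Prod.fst).Perm
        (x.1 :: (A.flatten ++ u ++ (v ++ B.flatten)).map Prod.fst) := by
      rw [← List.map_cons (f := Prod.fst) (a := (x.1, c))]
      apply List.Perm.map
      simp only [List.flatten_append, List.flatten_cons, List.append_assoc, List.cons_append]
      rw [← List.append_assoc, ← List.append_assoc]
      exact List.perm_middle
    exact this.nodup_iff.2 (List.nodup_cons.2 ⟨hx, hr⟩)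
  rw [evalPts_merge (K := K) hs _ c _ _ hx hy, ← evalLines_eq_lineValue _ _ hd2, evalLines,
    ← linesArrows_relabel]
  simp only [List.map_append, List.mem_append, not_or] at hx hy
  rw [List.map_append, List.map_cons, List.map_append, List.map_cons, List.map_cons,
    map_map_mergeMap hy.1.1, map_map_mergeMap hy.2.2, map_mergeMap hy.1.2, map_mergeMap hy.2.1,
    mergeMap_self, mergeMap_of_ne hxy]
  -- The identification turns the arrow from `x` to `y` into a loop, which does not matter.
  have e : linesArrows (A ++ (u ++ (x.1, x.2) :: (x.1, y.2) :: v) :: B) =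
      (x.1, x.1) ::ₘ linesArrows (A ++ (u ++ (x.1, c) :: v) :: B) := by
    rw [linesArrows_split, linesArrows_split, List.map_cons, chain_cons_cons]
    simp only [Multiset.add_cons, Multiset.cons_add]
  have e' : (A ++ (u ++ (x.1, c) :: v) :: B).flatten =
      A.flatten ++ u ++ (x.1, c) :: (v ++ B.flatten) := by simp
  rw [e, e', evalPts_cons_self _ _ (by rwa [← e']) (by simp)]

/-- Removing an end of a line. -/
lemma evalPts_remove_end (Y : QuivFun V n) {A B : List (List (M × V))} {u v : List (M × V)}
    {x : M × V} (hd : ((A.flatten ++ u ++ (v ++ B.flatten)).map Prod.fst).Nodup)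
    (hx : x.1 ∉ (A.flatten ++ u ++ (v ++ B.flatten)).map Prod.fst) (h : u = [] ∨ v = []) :
    evalPts Y (linesArrows (A ++ (u ++ x :: v) :: B)) (A.flatten ++ u ++ (v ++ B.flatten)) =
      lineValue Y ((A ++ (u ++ v) :: B).map (List.map Prod.snd)) := by
  have e : (A ++ (u ++ v) :: B).flatten = A.flatten ++ u ++ (v ++ B.flatten) := by simp
  -- `F` consists of the arrow that joins the end `x` to the rest of its line, if there is any.
  obtain ⟨F, hF, hF'⟩ : ∃ F : Multiset (M × M), (∀ e ∈ F, e.1 = x.1 ∨ e.2 = x.1) ∧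
      linesArrows (A ++ (u ++ x :: v) :: B) = linesArrows (A ++ (u ++ v) :: B) + F := by
    rw [linesArrows_split, linesArrows_append, linesArrows_cons]
    rcases h with rfl | rfl
    · rcases v with _ | ⟨z, v⟩
      · exact ⟨0, by simp, by simp⟩
      · refine ⟨{(x.1, z.1)}, by simp, ?_⟩
        rw [List.map_cons, chain_cons_cons, ← Multiset.singleton_add, List.map_nil, List.nil_append,
          List.nil_append, List.map_cons, chain_singleton]
        abel
    · rcases List.eq_nil_or_concat u with rfl | ⟨u, z, rfl⟩
      · exact ⟨0, by simp, by simp⟩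
      · refine ⟨{(z.1, x.1)}, by simp, ?_⟩
        simp only [List.concat_eq_append, List.map_append, List.map_cons, List.map_nil,
          List.append_assoc, List.cons_append, List.nil_append, List.append_nil]
        rw [chain_concat, ← Multiset.singleton_add, chain_singleton]
        abel
  rw [hF', evalPts_add_of_forall, ← evalLines_eq_lineValue _ _ (by rwa [e]), evalLines, e]
  intro e he
  rcases hF e he with h | h
  · exact Or.inl (h ▸ hx)
  · exact Or.inr (h ▸ hx)

namespace PoissonAlgebra

variable (A : PoissonAlgebra K V)

/-- The product requires exactly one arrow. A letter `x` acts on the value at the other letters only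
if it is one end of a line with several letters: an interior letter has two arrows, an isolated one
none. Two letters are multiplied only if they are consecutive in one line. These are the terms of
the Hochschild coboundary of each word, as arranged in `hochList_eq_splitSum`. -/
lemma lineValue_dv {Y : QuivFun V (n + 1)} (hY : Y ∈ finCx K V n) (hs : IsSkew Y)
    {ws : List (List V)} (hl : ws.flatten.length = n + 2) :
    lineValue (A.dv n Y) ws = (-1 : K) ^ n • hochWords A.mul (lineValue Y) ws := by
  obtain ⟨ws, rfl, hd⟩ := exists_labels ws
  rw [← evalLines_eq_lineValue _ _ hd, evalLines, dv, evalPts_lieBracket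
    (κ := mulCoeff) (b := fun x y => A.mul x y) (fun E x y => A.evalList_Xv E x y) Y _ (by
      rw [← List.map_flatten, List.length_map] at hl; exact hl) hd, hochWords_eq_splitSum,
    neg_one_pow_zsmul (K := K), ← smul_neg, pairSum, ← splitSum_add, splitSum_flatten, splitSum_map,
    ← splitSum_neg]
  congr 1
  refine splitSum_congr fun P w B h1 => ?_
  rw [hochList_eq_splitSum, splitSum_map, smul_splitSum, ← splitSum_neg]
  refine splitSum_congr fun u x v h2 => ?_
  subst h2
  subst h1
  have hp : (P.flatten ++ (u ++ (x :: (v ++ B.flatten)))).Perm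
      (x :: (P.flatten ++ u ++ (v ++ B.flatten))) := by
    rw [← List.append_assoc]
    exact List.perm_middle
  have hd' : ((x :: (P.flatten ++ u ++ (v ++ B.flatten))).map Prod.fst).Nodup :=
    (hp.map _).nodup_iff.1 (by simpa using hd)
  rw [List.map_cons, List.nodup_cons] at hd'
  obtain ⟨hx, hr⟩ := hd'
  have hx1 : x.1 ∉ v.map Prod.fst := fun h => hx (by simp only [List.map_append, List.mem_append]; tauto)
  have hsgn : ((-1 : K) ^ (List.map (List.map Prod.snd) P).flatten.length) *
      (-1 : K) ^ (u.map Prod.snd).length = (-1) ^ (P.flatten ++ u).length := by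
    rw [← List.map_flatten, List.length_map, List.length_map, List.length_append, pow_add]
  rw [smul_smul ((-1 : K) ^ _), hsgn, neg_one_pow_zsmul (K := K), smul_sub, neg_add, sub_eq_add_neg,
    ← smul_neg]
  refine congrArg₂ _ (congrArg _ ?_) (congrArg _ ?_)
  -- The coefficient is `-1` for the first letter of a line and `1` for the last one; it is zero if
  -- `x` is both or neither.
  · rw [arrowCount_into hx fun p hp => List.mem_map_of_mem (by simp [hp]), arrowCount_from hx]
    rcases u with _ | ⟨z, u⟩
    · rcases v with _ | ⟨z, v⟩
      · simp [mulCoeff, arrowCount]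
      · rw [evalPts_remove_end Y hr hx (Or.inl rfl), List.map_cons, arrowCount_chain_cons hx1 (by simp),
          A.mul_comm]
        simp [mulCoeff]
    · rcases v with _ | ⟨y, v⟩
      · rw [evalPts_remove_end Y hr hx (Or.inr rfl), A.mul_comm]
        simp [mulCoeff, arrowCount]
      · rw [List.map_cons (l := v), arrowCount_chain_cons hx1 (by simp)]
        simp [mulCoeff]
  -- A later letter that does not directly follow `x` in its line is not joined to `x` by an arrow.
  · have hzero : ∀ (Q : List (ℕ × V)) (y : ℕ × V) (S : List (ℕ × V)),
        v ++ B.flatten = Q ++ y :: S → (v.map Prod.fst).head? ≠ some y.1 →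
        evalList Y (linesArrows (P ++ (u ++ x :: v) :: B)) (({x.1} ∪ {y.1}, mulCoeff
          (arrowCount (linesArrows (P ++ (u ++ x :: v) :: B)) {x.1} {y.1})
          (arrowCount (linesArrows (P ++ (u ++ x :: v) :: B)) {y.1} {x.1}) •
          A.mul x.2 y.2) :: (P.flatten ++ u ++ (Q ++ S)).map fun p => ({p.1}, p.2)) = 0 := by
      intro Q y S h h'
      rw [arrowCount_from hx, arrowCount_chain_of_ne hx1 h', arrowCount_into_eq_zero hx]
      · simp only [mulCoeff, zero_ne_one, false_and, and_false, if_false, zero_smul]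
        exact evalList_cons_zero hY.1.1 _ _ _
      · rintro p hp (hp' : p.1 = y.1)
        rw [h, List.map_append, List.nodup_append] at hr
        exact hr.2.2 p.1 (List.mem_map_of_mem (List.mem_append_right _ hp)) y.1 (by simp) hp'
    rcases v with _ | ⟨y, v⟩
    · rw [splitSum_eq_zero]
      · simp [mergeNext]
      · intro Q y S h
        rw [hzero Q y S h (by simp), smul_zero]
    · have hy : y.1 ∉ (v ++ B.flatten).map Prod.fst := by
        have := (List.nodup_append.1 (by rwa [List.map_append] at hr)).2.1
        rw [List.cons_append, List.map_cons, List.nodup_cons] at this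
        exact this.1
      rw [List.cons_append, splitSum, splitSum_eq_zero, add_zero, arrowCount_from hx, List.map_cons,
        arrowCount_chain_cons hx1 (by simp), arrowCount_into_eq_zero hx]
      · rw [List.nil_append, List.length_nil, pow_zero, one_smul, evalList_merge_next (K := K) hs _ hd]
        simp [mulCoeff, mergeNext]
      · rintro p hp (hp' : p.1 = y.1)
        rw [List.map_append, List.nodup_append] at hr
        exact hr.2.2 p.1 (List.mem_map_of_mem (List.mem_append_right _ hp)) y.1 (by simp) hp'
      · intro Q z S h
        rw [hzero (y :: Q) z S (by rw [List.cons_append, h, List.cons_append]),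
          smul_zero]
        rw [List.map_cons, List.head?_cons]
        intro h'
        rw [h] at hy
        exact hy (by simp [Option.some.inj h'])

end PoissonAlgebra

end LineDifferential

/-! ### The Chevalley-Eilenberg coboundary -/

section Horizontal

variable {K M V : Type*} [Field K] [AddCommGroup V] [Module K V] {n : ℕ}

lemma linearCombination_concat {α N : Type*} [AddCommGroup N] [Module K N] (φ : List α → N)
    (X Z : Words K α) : Finsupp.linearCombination K φ (concat K X Z) =
      Finsupp.linearCombination K (fun a => Finsupp.linearCombination K (fun b => φ (a ++ b)) Z) X := by
  induction X using words_induction with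
  | h0 => simp
  | hadd x x' hx hx' => simp only [map_add, LinearMap.add_apply, hx, hx']
  | hsmul c x hx => simp only [map_smul, LinearMap.smul_apply, hx]
  | h1 a =>
    rw [concat, Finsupp.linearCombination_single, one_smul, Finsupp.linearCombination_single, one_smul]
    induction Z using words_induction with
    | h0 => simp
    | hadd x x' hx hx' => simp only [map_add, hx, hx']
    | hsmul c x hx => simp only [map_smul, hx]
    | h1 b => simp

lemma take_eq_of_lt {α : Type*} (l : List α) {i j : ℕ} (hij : i < j) (hj : j < l.length) :
    l.take j = l.take i ++ l[i] :: (l.drop (i + 1)).take (j - (i + 1)) := by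
  obtain ⟨k, rfl⟩ : ∃ k, j = i + 1 + k := ⟨j - (i + 1), by omega⟩
  rw [List.take_add, Nat.add_sub_cancel_left,
    (List.take_append_getElem (by omega : i < l.length)).symm, List.append_assoc]
  rfl

lemma eraseIdx_eraseIdx_of_lt {α : Type*} (l : List α) {i j : ℕ} (hij : i < j) (hj : j < l.length) :
    (l.eraseIdx j).eraseIdx i =
      l.take i ++ ((l.drop (i + 1)).take (j - (i + 1)) ++ l.drop (j + 1)) := by
  rw [List.eraseIdx_eq_take_drop_succ l, take_eq_of_lt l hij hj, List.append_assoc,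
    List.eraseIdx_append_of_length_le (by simp)]
  have : i - (l.take i).length = 0 := by rw [List.length_take]; omega
  rw [this]
  rfl

namespace PoissonAlgebra

variable (A : PoissonAlgebra K V)

lemma linearCombination_wordBracket {N : Type*} [AddCommGroup N] [Module K N] (φ : List V → N)
    (w w' : List V) : Finsupp.linearCombination K φ (A.wordBracket w w') =
      splitSum (fun u x v => splitSum (fun u' y v' => (-1 : K) ^ ((u'.length + 1) * v.length + u.length) •
        Finsupp.linearCombination K (fun a => Finsupp.linearCombination K (fun b =>
          φ (a ++ A.bracket x y :: b)) (shuffle K v v')) (shuffle K u u')) w') w := by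
  rw [wordBracket, map_sum, ← sum_fin_eq_splitSum]
  refine Finset.sum_congr rfl fun i _ => ?_
  rw [map_sum, ← sum_fin_eq_splitSum]
  refine Finset.sum_congr rfl fun j _ => ?_
  rw [map_smul, linearCombination_concat, List.length_take, List.length_take, List.length_drop,
    min_eq_left i.2.le, min_eq_left j.2.le, Nat.sub_sub, Nat.add_comm 1]
  congr 1
  refine congrArg (fun f => Finsupp.linearCombination K f _) (funext fun a => ?_)
  rw [linearCombination_concat]
  simp

lemma chevalleyEilenberg_eq_splitSum (F : List (List V) → V) (ws : List (List V)) :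
    A.chevalleyEilenberg F ws =
      splitSum (fun P w S => (-1 : K) ^ (w.length * P.flatten.length) • A.wordAct w (F (P ++ S))) ws -
      pairSum (fun P w Q w' S => (-1 : K) ^ (w.length * P.flatten.length +
        w'.length * ((P ++ w :: Q).flatten.length + w.length)) •
        Finsupp.linearCombination K (fun z => F (z :: (P ++ (Q ++ S)))) (A.wordBracket w w')) ws := by
  rw [chevalleyEilenberg, ← sum_fin_eq_splitSum, ← sum_lt_eq_pairSum]
  congr 1
  · refine Finset.sum_congr rfl fun i _ => ?_
    rw [List.eraseIdx_eq_take_drop_succ]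
    rfl
  · refine Finset.sum_congr rfl fun i _ => Finset.sum_congr rfl fun j _ => ?_
    split_ifs with hij
    · rw [eraseIdx_eraseIdx_of_lt ws hij j.2, lengthBefore, lengthBefore, take_eq_of_lt ws hij j.2]
      rfl
    · rfl

end PoissonAlgebra

lemma evalPts_regroup {Y : QuivFun V n} (hs : IsSkew Y) (E : Multiset (M × M)) (x : M × V)
    (a u v c u' v' d : List (M × V)) :
    evalPts Y E (x :: (a ++ u ++ (v ++ (c ++ u') ++ (v' ++ d)))) =
      (-1 : K) ^ (a.length * (u.length + v.length) + (a.length + c.length) * (u'.length + v'.length) +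
        v.length * u'.length + (u.length + u'.length)) •
      evalPts Y E (u ++ u' ++ (x :: (v ++ v' ++ (a ++ c ++ d)))) := by
  have h1 := evalPts_swap_blocks (K := K) hs E [x] a (u ++ v) (c ++ u' ++ v' ++ d)
  have h2 := evalPts_swap_blocks (K := K) hs E (x :: (u ++ v)) (a ++ c) (u' ++ v') d
  have h3 := evalPts_swap_blocks (K := K) hs E (x :: u) v u' (v' ++ a ++ c ++ d)
  have h4 := evalPts_swap_blocks (K := K) hs E [] [x] (u ++ u') (v ++ v' ++ a ++ c ++ d)
  simp only [List.append_assoc, List.cons_append, List.nil_append, List.length_append,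
    List.length_cons, List.length_nil] at h1 h2 h3 h4 ⊢
  rw [h1, h2, h3, h4, smul_smul, smul_smul, smul_smul, ← pow_add, ← pow_add, ← pow_add]
  congr 2
  ring

/-- Merging letters of two different lines. -/
lemma evalList_merge_lines {Y : QuivFun V n} (hY : Y ∈ finOp K V n) (hs : IsSkew Y)
    {A C D : List (List (M × V))} {u v u' v' : List (M × V)} {x y : M × V} (c : V)
    (hd : ((A ++ (u ++ x :: v) :: (C ++ (u' ++ y :: v') :: D)).flatten.map Prod.fst).Nodup) :
    evalList Y (linesArrows (A ++ (u ++ x :: v) :: (C ++ (u' ++ y :: v') :: D)))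
      (({x.1} ∪ {y.1}, c) :: (A.flatten ++ u ++ (v ++ (C.flatten ++ u') ++
        (v' ++ D.flatten))).map fun p => ({p.1}, p.2)) =
    (-1 : K) ^ (A.flatten.length * (u.length + v.length) +
        (A.flatten.length + C.flatten.length) * (u'.length + v'.length) +
        v.length * u'.length + (u.length + u'.length)) •
      Finsupp.linearCombination K (fun a => Finsupp.linearCombination K (fun b =>
        lineValue Y (((a ++ (x.1, c) :: b) :: (A ++ (C ++ D))).map (List.map Prod.snd)))
          (shuffle K v v')) (shuffle K u u') := by
  classical
  have hp : (A ++ (u ++ x :: v) :: (C ++ (u' ++ y :: v') :: D)).flatten.Perm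
      (y :: x :: (A.flatten ++ u ++ (v ++ (C.flatten ++ u') ++ (v' ++ D.flatten)))) := by
    rw [List.perm_iff_count]
    intro p
    simp only [List.flatten_append, List.flatten_cons, List.count_append, List.count_cons]
    ring
  have hd' := (hp.map Prod.fst).nodup_iff.1 hd
  rw [List.map_cons, List.map_cons, List.nodup_cons, List.nodup_cons, List.mem_cons, not_or] at hd'
  obtain ⟨⟨hxy, hy⟩, hx, hr⟩ := hd'
  have hmem : ∀ a b : List (M × V), a.Perm (u ++ u') → b.Perm (v ++ v') →
      ((a ++ (x.1, c) :: (b ++ (A ++ (C ++ D)).flatten)).map Prod.fst).Nodup := by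
    intro a b ha hb
    have : ((x.1, c) :: (A.flatten ++ u ++ (v ++ (C.flatten ++ u') ++ (v' ++ D.flatten)))).Perm
        (a ++ (x.1, c) :: (b ++ (A ++ (C ++ D)).flatten)) := by
      rw [List.perm_iff_count] at ha hb ⊢
      intro p
      have := ha p
      have := hb p
      simp only [List.flatten_append, List.count_append, List.count_cons] at *
      omega
    exact (this.map Prod.fst).nodup_iff.1 (List.nodup_cons.2 ⟨hx, hr⟩)
  rw [evalList_merge _ _ _ hx hy, evalPts_regroup (K := K) hs, ← linesArrows_relabel]
  simp only [List.map_append, List.mem_append, not_or] at hx hy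
  rw [List.map_append, List.map_cons, List.map_append, List.map_append, List.map_cons,
    List.map_cons, List.map_append, List.map_cons, map_map_mergeMap hy.1.1,
    map_mergeMap hy.1.2, map_mergeMap hy.2.1.1, map_map_mergeMap hy.2.1.2.1,
    map_mergeMap hy.2.1.2.2, map_mergeMap hy.2.2.1, map_map_mergeMap hy.2.2.2,
    mergeMap_self, mergeMap_of_ne (Ne.symm hxy)]
  have e : linesArrows (A ++ (u ++ (x.1, x.2) :: v) :: (C ++ (u' ++ (x.1, y.2) :: v') :: D)) =
      chain (u.map Prod.fst ++ [x.1]) + chain (u'.map Prod.fst ++ [x.1]) +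
        (chain (x.1 :: v.map Prod.fst) + chain (x.1 :: v'.map Prod.fst) +
          linesArrows (A ++ (C ++ D))) := by
    rw [linesArrows_split, linesArrows_append, linesArrows_cons, List.map_append, List.map_cons,
      chain_append (u'.map Prod.fst)]
    simp only [linesArrows_append]
    abel
  -- Both lines now pass through the point of `x`. First the two halves that end there are shuffled,
  -- then, for each resulting word `a`, the two halves that start there.
  have h1 := evalPts_shuffle_in hY hs x.1 u u' [] ((x.1, c) :: (v ++ v' ++ (A ++ (C ++ D)).flatten))
    (chain (x.1 :: v.map Prod.fst) + chain (x.1 :: v'.map Prod.fst) + linesArrows (A ++ (C ++ D)))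
    (by simpa using hmem (u ++ u') (v ++ v') (List.Perm.refl _) (List.Perm.refl _)) (by simp)
  rw [e]
  congr 1
  have e2 : A.flatten ++ C.flatten ++ D.flatten = (A ++ (C ++ D)).flatten := by simp
  rw [e2]
  refine h1.trans (linearCombination_shuffle_congr fun a ha => ?_)
  have h2 := evalPts_shuffle_out hY hs x.1 v v' (a ++ [(x.1, c)]) (A ++ (C ++ D)).flatten
    (chain (a.map Prod.fst ++ [x.1]) + linesArrows (A ++ (C ++ D)))
    (by simpa using hmem a (v ++ v') ha (List.Perm.refl _)) (by simp)
  simp only [List.append_assoc, List.cons_append, List.nil_append] at h2 ⊢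
  refine Eq.trans ?_ (h2.trans (linearCombination_shuffle_congr fun b hb => ?_))
  · congr 1
    abel
  · have e3 : (((a ++ (x.1, c) :: b) :: (A ++ (C ++ D))).flatten) =
        a ++ (x.1, c) :: (b ++ (A ++ (C ++ D)).flatten) := by simp
    rw [← evalLines_eq_lineValue _ _ (by rw [e3]; exact hmem a b ha hb), evalLines, e3,
      linesArrows_cons, List.map_append, List.map_cons,
      chain_append (a.map Prod.fst) x.1 (b.map Prod.fst)]
    congr 1
    abel

/-- Merging letters of one line that are not consecutive. -/
lemma evalList_merge_cycle {Y : QuivFun V n} (hY : Y ∈ finOp K V n)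
    {A B : List (List (M × V))} {u w v : List (M × V)} {x y z : M × V} (c : V)
    (hd : ((A ++ (u ++ x :: (z :: w ++ y :: v)) :: B).flatten.map Prod.fst).Nodup) :
    evalList Y (linesArrows (A ++ (u ++ x :: (z :: w ++ y :: v)) :: B)) (({x.1} ∪ {y.1}, c) ::
      (A.flatten ++ u ++ (z :: w ++ (v ++ B.flatten))).map fun p => ({p.1}, p.2)) = 0 := by
  classical
  have hp : (A ++ (u ++ x :: (z :: w ++ y :: v)) :: B).flatten.Perm
      (y :: x :: (A.flatten ++ u ++ (z :: w ++ (v ++ B.flatten)))) := by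
    rw [List.perm_iff_count]
    intro p
    simp only [List.flatten_append, List.flatten_cons, List.count_append, List.count_cons]
    ring
  have hd' := (hp.map Prod.fst).nodup_iff.1 hd
  rw [List.map_cons, List.map_cons, List.nodup_cons, List.mem_cons, not_or] at hd'
  obtain ⟨⟨hxy, hy⟩, hr⟩ := hd'
  have hx := (List.nodup_cons.1 hr).1
  rw [evalList_merge _ _ _ hx hy, ← linesArrows_relabel]
  simp only [List.map_append, List.mem_append, not_or] at hx hy
  rw [List.map_append, List.map_cons, List.map_append, List.map_cons, List.map_append,
    map_mergeMap hy.2.1, List.map_cons, map_map_mergeMap hy.1.1, map_mergeMap hy.1.2,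
    map_mergeMap hy.2.2.1, map_map_mergeMap hy.2.2.2, mergeMap_self, mergeMap_of_ne (Ne.symm hxy)]
  -- After the identification the part of the line from `x` through `z` returns to `x`, so the arrow
  -- from `x` to `z` closes a cycle.
  have e : linesArrows (A ++ (u ++ (x.1, x.2) :: (z :: w ++ (x.1, y.2) :: v)) :: B) =
      (x.1, z.1) ::ₘ (chain ((z :: w).map Prod.fst ++ [x.1]) + (chain (u.map Prod.fst ++ [x.1]) +
        chain (x.1 :: v.map Prod.fst) + (linesArrows A + linesArrows B))) := by
    rw [linesArrows_split, List.cons_append, List.map_cons, chain_cons_cons, List.map_append,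
      List.map_cons, ← List.cons_append, ← List.map_cons (l := w), chain_append ((z :: w).map Prod.fst), ← Multiset.singleton_add,
      ← Multiset.singleton_add]
    simp only [List.map_cons]
    abel
  rw [e]
  refine evalPts_conn hY (l := (x.1, c) :: _) hr (fun h => hx.2.1 (by simp [h])) (by simp) (by simp)
    (Multiset.le_add_right _ _) (fun e he => ?_) (conn_chain (by simp) (by simp))
  have hsub : ∀ m, m ∈ (z :: w).map Prod.fst ++ [x.1] →
      m ∈ ((x.1, c) :: (A.flatten ++ u ++ (z :: w ++ (v ++ B.flatten)))).map Prod.fst := by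
    intro m hm
    simp only [List.map_append, List.map_cons, List.mem_append, List.mem_cons,
      List.not_mem_nil, or_false] at hm ⊢
    tauto
  exact ⟨hsub _ (mem_of_mem_chain he).1, hsub _ (mem_of_mem_chain he).2⟩

end Horizontal

/-! ### The bracket with `X_h` on unions of lines. -/

section HorizontalDifferential

variable {K V : Type*} [Field K] [AddCommGroup V] [Module K V] {n : ℕ}

lemma neg_one_pow_congr {a b c d : ℕ} (h : a + 2 * c = b + 2 * d) : (-1 : K) ^ a = (-1) ^ b := by
  have := congrArg (fun k => (-1 : K) ^ k) h
  simpa [pow_add, pow_mul] using this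

namespace PoissonAlgebra

variable (A : PoissonAlgebra K V)

lemma wordAct_eq_zero {w : List V} (h : w.length ≠ 1) (m : V) : A.wordAct w m = 0 := by
  rcases w with _ | ⟨a, _ | ⟨b, w⟩⟩
  · rfl
  · simp at h
  · rfl

/-- The terms of the bracket with the part `X_h` in which a letter acts on the value. -/
lemma splitSum_act {Y : QuivFun V n} {ws : List (List (ℕ × V))}
    (hd : (ws.flatten.map Prod.fst).Nodup) {E : Multiset (ℕ × ℕ)} (hE : E = linesArrows ws) :
    splitSum (fun P x S => (-1 : ℤ) ^ P.length •
        bracketCoeff (arrowCount E {m | m ∈ (P ++ S).map Prod.fst} {x.1})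
          (arrowCount E {x.1} {m | m ∈ (P ++ S).map Prod.fst}) •
          A.bracket (evalPts Y E (P ++ S)) x.2) ws.flatten =
      -splitSum (fun P w S => (-1 : K) ^ (w.length * P.flatten.length) •
        A.wordAct w (lineValue Y (P ++ S))) (ws.map (List.map Prod.snd)) := by
  rw [splitSum_flatten, splitSum_map, ← splitSum_neg]
  refine splitSum_congr fun P w B h1 => ?_
  subst h1
  rw [List.length_map, ← List.map_flatten, List.length_map]
  have key : ∀ u x v, w = u ++ x :: v → x.1 ∉ (P.flatten ++ u ++ (v ++ B.flatten)).map Prod.fst ∧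
      ((P.flatten ++ u ++ (v ++ B.flatten)).map Prod.fst).Nodup := by
    rintro u x v rfl
    have hp : (P.flatten ++ (u ++ (x :: (v ++ B.flatten)))).Perm
        (x :: (P.flatten ++ u ++ (v ++ B.flatten))) := by
      rw [← List.append_assoc]
      exact List.perm_middle
    have := (hp.map Prod.fst).nodup_iff.1 (by simpa using hd)
    rwa [List.map_cons, List.nodup_cons] at this
  by_cases hw : w.length = 1
  · obtain ⟨x, rfl⟩ := List.length_eq_one_iff.1 hw
    obtain ⟨hx, hr⟩ := key [] x [] rfl
    have e := evalPts_remove_end Y hr hx (Or.inl rfl)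
    have h1 : arrowCount E {m | m ∈ (P.flatten ++ [] ++ ([] ++ B.flatten)).map Prod.fst} {x.1} = 0 := by
      rw [hE]
      exact arrowCount_into_eq_zero (u := []) (v := []) hx (by simp)
    have h2 : arrowCount E {x.1} {m | m ∈ (P.flatten ++ [] ++ ([] ++ B.flatten)).map Prod.fst} = 0 := by
      rw [hE]
      exact (arrowCount_from (u := []) (v := []) hx).trans (by simp [arrowCount])
    have h3 : lineValue Y ((P ++ ([] ++ []) :: B).map (List.map Prod.snd)) =
        lineValue Y (P.map (List.map Prod.snd) ++ B.map (List.map Prod.snd)) := by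
      have hr' : ((P ++ B).flatten.map Prod.fst).Nodup := by simpa using hr
      rw [← List.map_append, ← evalLines_eq_lineValue _ _ hr', ← evalLines_eq_lineValue]
      · simp [evalLines]
      · simpa using hr
    simp only [splitSum, add_zero]
    rw [h1, h2, hE]
    rw [List.nil_append] at e
    rw [e, h3, A.antisymm, neg_one_pow_zsmul (K := K)]
    simp [bracketCoeff, wordAct]
  -- In a longer line every letter is joined to another one by an arrow, so the coefficient of the
  -- bracket is zero.
  · rw [wordAct_eq_zero _ (by simpa using hw), smul_zero, neg_zero]
    refine splitSum_eq_zero fun u x v h => ?_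
    obtain ⟨hx, -⟩ := key u x v h
    have hx1 : x.1 ∉ v.map Prod.fst := fun h =>
      hx (by simp only [List.map_append, List.mem_append]; tauto)
    subst h
    rw [hE, arrowCount_into hx fun p hp => List.mem_map_of_mem (by simp [hp]), arrowCount_from hx]
    rcases u with _ | ⟨z, u⟩
    · rcases v with _ | ⟨z, v⟩
      · simp at hw
      · rw [List.map_cons (l := v), arrowCount_chain_cons hx1 (by simp)]
        simp [bracketCoeff]
    · simp [bracketCoeff]

/-- The terms of the bracket with the part `X_h` in which two letters are merged. -/
lemma pairSum_bracket {Y : QuivFun V n} (hf : Y ∈ finOp K V n) (hs : IsSkew Y)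
    {ws : List (List (ℕ × V))} (hd : (ws.flatten.map Prod.fst).Nodup) {E : Multiset (ℕ × ℕ)}
    (hE : E = linesArrows ws) :
    pairSum (fun P x Q y S => (-1 : ℤ) ^ Q.length • evalList Y E (({x.1} ∪ {y.1},
        bracketCoeff (arrowCount E {x.1} {y.1}) (arrowCount E {y.1} {x.1}) • A.bracket x.2 y.2) ::
          (P ++ (Q ++ S)).map fun p => ({p.1}, p.2))) ws.flatten =
      pairSum (fun P w Q w' S => (-1 : K) ^ (w.length * P.flatten.length +
        w'.length * ((P ++ w :: Q).flatten.length + w.length)) •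
        Finsupp.linearCombination K (fun z => lineValue Y (z :: (P ++ (Q ++ S))))
          (A.wordBracket w w')) (ws.map (List.map Prod.snd)) := by
  subst hE
  rw [pairSum_flatten, splitSum_eq_zero, zero_add, pairSum_map]
  -- Two letters of different words have no arrow between them, so the coefficient is one and
  -- `evalList_merge_lines` gives the bracket of the words.
  · refine pairSum_congr fun P w C w' D h1 => ?_
    rw [linearCombination_wordBracket, smul_splitSum, splitSum_map]
    refine splitSum_congr fun u x v h2 => ?_
    rw [smul_splitSum, splitSum_map]
    refine splitSum_congr fun u' y v' h3 => ?_
    subst h2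
    subst h3
    subst h1
    have hp : (P ++ (u ++ x :: v) :: (C ++ (u' ++ y :: v') :: D)).flatten.Perm
        (y :: x :: (P.flatten ++ u ++ (v ++ (C.flatten ++ u') ++ (v' ++ D.flatten)))) := by
      classical
      rw [List.perm_iff_count]
      intro p
      simp only [List.flatten_append, List.flatten_cons, List.count_append, List.count_cons]
      ring
    have hd' := (hp.map Prod.fst).nodup_iff.1 hd
    rw [List.map_cons, List.map_cons, List.nodup_cons, List.nodup_cons, List.mem_cons, not_or] at hd'
    obtain ⟨⟨hxy, hy⟩, hx, -⟩ := hd'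
    have hx' : x.1 ∉ (P.flatten ++ u ++ (v ++ (C ++ (u' ++ y :: v') :: D).flatten)).map Prod.fst := by
      simp only [List.flatten_append, List.flatten_cons, List.map_append, List.map_cons,
        List.mem_append, List.mem_cons] at hx ⊢
      rw [eq_comm] at hxy
      tauto
    have hx1 : x.1 ∉ v.map Prod.fst := fun h =>
      hx (by simp only [List.map_append, List.mem_append]; tauto)
    have hy1 : y.1 ∉ v.map Prod.fst := fun h =>
      hy (by simp only [List.map_append, List.mem_append]; tauto)
    rw [arrowCount_from hx', arrowCount_chain_of_ne hx1 fun h => hy1 (List.mem_of_mem_head? h),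
      arrowCount_into_eq_zero hx' (by
        rintro p hp' (h : p.1 = y.1)
        exact hy (h ▸ List.mem_map_of_mem (by simp [hp'])))]
    rw [evalList_merge_lines hf hs _ hd, neg_one_pow_zsmul (K := K), smul_smul, smul_smul,
      ← pow_add, ← pow_add, linearCombination_shuffle_map]
    -- The two exponents agree only modulo two; `c` and `d` are the halves of the even numbers by
    -- which they have to be increased.
    refine congrArg₂ _ (neg_one_pow_congr (c := P.flatten.length + (u'.length + 1 + v'.length) * (u.length + 1 + v.length)) (d := u'.length) ?_) ?_
    · simp only [List.length_map, List.length_append, List.length_cons, List.flatten_append,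
        List.flatten_cons, ← List.map_flatten]
      ring
    · refine congrArg (fun f => Finsupp.linearCombination K f _) (funext fun a => ?_)
      rw [linearCombination_shuffle_map]
      refine congrArg (fun f => Finsupp.linearCombination K f _) (funext fun b => ?_)
      simp [bracketCoeff]
  · intro P w B h1
    refine splitSum_eq_zero fun u x R h2 => splitSum_eq_zero fun c y v h3 => ?_
    subst h3
    subst h2
    subst h1
    beta_reduce
    -- Within one word, consecutive letters are joined by an arrow and the coefficient vanishes;
    -- merging other letters closes a cycle.
    rcases c with _ | ⟨z, c⟩
    · have hp : (P.flatten ++ (u ++ (x :: (y :: v ++ B.flatten)))).Perm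
          (x :: (P.flatten ++ u ++ (y :: v ++ B.flatten))) := by
        rw [← List.append_assoc]
        exact List.perm_middle
      have := (hp.map Prod.fst).nodup_iff.1 (by simpa using hd)
      rw [List.map_cons, List.nodup_cons] at this
      have hx1 : x.1 ∉ (y :: v).map Prod.fst := fun h =>
        this.1 (by simp only [List.map_append, List.mem_append]; tauto)
      rw [List.nil_append, arrowCount_from this.1, List.map_cons, arrowCount_chain_cons hx1 (by simp),
        bracketCoeff, if_neg (by simp), zero_smul, evalList_cons_zero hf.1, smul_zero]
    · rw [evalList_merge_cycle hf _ hd, smul_zero]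

lemma lineValue_dh {Y : QuivFun V (n + 1)} (hY : Y ∈ finCx K V n) (hs : IsSkew Y)
    {ws : List (List V)} (hl : ws.flatten.length = n + 2) :
    lineValue (A.dh n Y) ws = (-1 : K) ^ n • A.chevalleyEilenberg (lineValue Y) ws := by
  obtain ⟨ws, rfl, hd⟩ := exists_labels ws
  rw [← evalLines_eq_lineValue _ _ hd, evalLines, dh, evalPts_lieBracket
    (κ := bracketCoeff) (b := fun x y => A.bracket x y) (fun E x y => A.evalList_Xh E x y) Y _ (by
      rw [← List.map_flatten, List.length_map] at hl; exact hl) hd, splitSum_act A hd rfl,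
    pairSum_bracket A hY.1 hs hd rfl, chevalleyEilenberg_eq_splitSum, neg_one_pow_zsmul (K := K),
    ← smul_neg, neg_add, neg_neg, sub_eq_add_neg]

end PoissonAlgebra

end HorizontalDifferential

/-! ### Compatibility with the differentials and the Harrison complex. -/

section Compatibility

variable {K V : Type*} [Field K] [AddCommGroup V] [Module K V] {n : ℕ}

namespace PoissonAlgebra

variable (A : PoissonAlgebra K V)

/-- On `p + 1` nonempty words with `n + 1` letters the coboundary uses `F` only on `p` nonempty
words with `n` letters, as a word acts nontrivially only if it has one letter and the bracket of
words loses one letter. The restriction matters because `toSymmetric_ofSymmetric` holds only for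
such lists. -/
lemma chevalleyEilenberg_congr {p : ℕ} {F G : List (List V) → V}
    (h : ∀ ws : List (List V), (∀ w ∈ ws, w ≠ []) → ws.length = p → ws.flatten.length = n →
      F ws = G ws) {ws : List (List V)} (hws : ∀ w ∈ ws, w ≠ []) (hp : ws.length = p + 1)
    (hn : ws.flatten.length = n + 1) :
    A.chevalleyEilenberg F ws = A.chevalleyEilenberg G ws := by
  rw [chevalleyEilenberg_eq_splitSum, chevalleyEilenberg_eq_splitSum]
  congr 1
  · refine splitSum_congr fun P w S hw => ?_
    subst hw
    by_cases h1 : w.length = 1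
    · rw [h (P ++ S)]
      · intro w' hw'
        refine hws w' ?_
        simp only [List.mem_append, List.mem_cons] at hw' ⊢
        tauto
      · simp only [List.length_append, List.length_cons] at hp ⊢
        omega
      · simp only [List.flatten_append, List.flatten_cons, List.length_append] at hn ⊢
        omega
    · rw [wordAct_eq_zero _ h1, wordAct_eq_zero _ h1]
  · refine pairSum_congr fun P w Q w' S hw => ?_
    subst hw
    rw [linearCombination_wordBracket, linearCombination_wordBracket]
    congr 1
    refine splitSum_congr fun u x v h1 => splitSum_congr fun u' y v' h2 => ?_
    congr 1
    refine linearCombination_shuffle_congr fun a ha => linearCombination_shuffle_congr fun b hb => ?_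
    have e1 := ha.length_eq
    have e2 := hb.length_eq
    subst h1
    subst h2
    apply h
    · intro z hz
      rcases List.mem_cons.1 hz with rfl | hz
      · simp
      · refine hws z ?_
        simp only [List.mem_append, List.mem_cons] at hz ⊢
        tauto
    · simp only [List.length_append, List.length_cons] at hp ⊢
      omega
    · simp only [List.flatten_append, List.flatten_cons, List.length_append, List.length_cons] at *
      omega

/-- The factor `(-1) ^ n` of `lineValue_dv` is cancelled by the change of the sign in `cochainOf`,
as the binomial coefficient in its exponent grows by `n`. -/
lemma cochainOf_dv (p : ℕ) {Y : QuivFun V (n + 1)} (hY : Y ∈ finCx K V n) :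
    cochainOf K p (n + 1) (A.dv n Y) = A.hochschild (cochainOf K p n Y) := by
  funext v
  rw [cochainOf_apply, hochschild_cochainOf, cutSum_congr (H := fun ws =>
    (-1 : K) ^ n • hochWords A.mul (lineValue Y) ws) fun ws h _ _ =>
      A.lineValue_dv hY hY.2 (by rw [h, List.length_ofFn]), cutSum_smul, smul_smul,
    Nat.choose_succ_succ' n 1, Nat.choose_one_right, add_comm, pow_add, _root_.mul_assoc,
    neg_one_pow_mul_self, mul_one]

lemma cochainOf_dh [CharZero K] (p : ℕ) {Y : QuivFun V (n + 1)} (hY : Y ∈ finCx K V n) :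
    cochainOf K (p + 1) (n + 1) (A.dh n Y) = A.deltaCE p (cochainOf K p n Y) := by
  funext v
  -- The sign is absorbed into `Y`, so that the cochain is `ofSymmetric` of a function `lineValue`
  -- and `toSymmetric` recovers that function.
  set c := (-1 : K) ^ n.choose 2 with hc
  have hcY := Submodule.smul_mem _ c hY
  have h1 : cochainOf K p n Y = ofSymmetric (n + 1) p (lineValue (c • Y)) := by
    funext w
    rw [cochainOf_apply, ofSymmetric_eq_cutSum, ← cutSum_smul]
    exact cutSum_congr fun ws _ _ _ => (lineValue_smul c Y ws).symm
  rw [cochainOf_apply, deltaCE, ofSymmetric_eq_cutSum, ← cutSum_smul]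
  refine cutSum_congr fun ws h2 h3 h4 => ?_
  have h5 : ws.flatten.length = n + 2 := by rw [h2, List.length_ofFn]
  rw [A.chevalleyEilenberg_congr (G := lineValue (c • Y)) (p := p) (n := n + 1)
    (fun ws h6 h7 h8 => by
      rw [h1]
      exact toSymmetric_ofSymmetric (lineValue_killsShuffles hcY.1 hcY.2)
        (lineValue_koszulSymmetric hcY.2) h6 h7 h8) h4 h3 h5]
  have h9 := A.lineValue_dh hcY hcY.2 h5
  rw [dh_smul, lineValue_smul] at h9
  have h10 := congrArg ((-1 : K) ^ n • ·) h9
  simp only [smul_smul, neg_one_pow_mul_self, one_smul] at h10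
  rw [← h10, Nat.choose_succ_succ' n 1, Nat.choose_one_right, pow_add]

end PoissonAlgebra

lemma lineMap_eq_zero {p : ℕ} (hp : p ≠ 1) {Y : QuivFun V (n + 1)} (hY : Y ∈ finBi K V p n) :
    lineMap n Y = 0 := by
  have h : Y (Quiv.line n) = 0 := by
    refine hY.2 [List.finRange (n + 1)] _ ⟨?_, ?_, ?_, ?_⟩ ?_ ?_
    · simp
    · simp
    · intro l hl x hx y hy
      obtain rfl := List.mem_singleton.1 hl
      rw [List.finRange_succ, List.head?_cons, Option.mem_some] at hx
      exact hx ▸ Fin.zero_le y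
    · simp
    · rw [← chain_finRange, lineArrows_eq_sum]
      simp
    · simpa using hp.symm
  rw [lineMap, h, smul_zero]

lemma lineMap_image [CharZero K] (n : ℕ) :
    lineMap n '' (finCx K V n : Set (QuivFun V (n + 1))) =
      (harrison K V (n + 1) : Set ((Fin (n + 1) → V) → V)) := by
  rw [← poisBi_one_eq_harrison]
  ext f
  constructor
  · rintro ⟨Y, hY, rfl⟩
    rw [← cochainOf_one (K := K)]
    exact cochainOf_mem hY
  · intro hf
    obtain ⟨Y, hY, rfl⟩ := cochainOf_surjective hf
    exact ⟨Y, hY.1, (cochainOf_one n Y).symm⟩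

/-- The horizontal differential raises the number of lines. The component with no lines is zero, so
nothing arrives in the component with one line, the only one that `lineMap` sees. -/
lemma PoissonAlgebra.lineMap_dh (A : PoissonAlgebra K V) {Y : QuivFun V (n + 1)}
    (hY : Y ∈ finCx K V n) : lineMap (n + 1) (A.dh n Y) = 0 := by
  have h0 : lineMap (n + 1) (A.dh n (0 : QuivFun V (n + 1))) = 0 := by
    have : A.dh n (0 : QuivFun V (n + 1)) = 0 := by
      simpa using A.dh_smul (n := n) 0 (Y := 0)
    rw [this]
    exact smul_zero _
  have hlin : ∀ s : Finset ℕ, lineMap (n + 1) (A.dh n (∑ p ∈ s, gradedPart p Y)) = 0 := by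
    intro s
    induction s using Finset.induction_on with
    | empty => exact h0
    | insert p s hp ih =>
      rw [Finset.sum_insert hp, dh_add, ← cochainOf_one (K := K), map_add, cochainOf_one,
        cochainOf_one, ih, add_zero]
      have h1 := gradedPart_mem_finBi hY p
      rcases p with _ | p
      · rw [finBi_eq_bot (Or.inl rfl), Submodule.mem_bot] at h1
        rw [h1, h0]
      · exact lineMap_eq_zero (by omega) (A.dh_mem_finBi h1)
  rw [← sum_gradedPart hY]
  exact hlin _

end Compatibility

end PoissonFinite

end

/-- The finite cohomology complex `finCx K V` of a Poisson algebra, its bigrading `finBi`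
(`finBi K V p n` is the component of bidegree `(p, q)`, `q = n - p`), and the isomorphism with
the Poisson cohomology bicomplex (`poisBi K V p (n + 1)` is its component of bidegree
`(p, n + 1 - p) = (p, q + 1)`). -/
theorem theoremA {K V : Type*} [Field K] [CharZero K] [AddCommGroup V] [Module K V]
    (A : PoissonFinite.PoissonAlgebra K V) :
    -- `X` is a Maurer-Cartan element
    (A.X ∈ PoissonFinite.finCx K V 1 ∧
      PoissonFinite.lieBracket (a := 1) (b := 1) (N := 2) rfl A.X A.X = 0) ∧
    -- each degree is the direct sum of its components, which are zero unless `1 ≤ p ≤ n + 1`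
    (∀ n, iSupIndep (fun p => PoissonFinite.finBi K V p n) ∧
      ⨆ p, PoissonFinite.finBi K V p n = PoissonFinite.finCx K V n) ∧
    (∀ p n, (p = 0 ∨ n + 1 < p) → PoissonFinite.finBi K V p n = ⊥) ∧
    ∃ (D : ∀ n, PoissonFinite.finCx K V n →ₗ[K] PoissonFinite.finCx K V (n + 1))
      (Dh : ∀ p n, PoissonFinite.finBi K V p n →ₗ[K] PoissonFinite.finBi K V (p + 1) (n + 1))
      (Dv : ∀ p n, PoissonFinite.finBi K V p n →ₗ[K] PoissonFinite.finBi K V p (n + 1))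
      (Φ : ∀ p n, PoissonFinite.finBi K V p n ≃ₗ[K] PoissonFinite.poisBi K V p (n + 1)),
      -- `D`, `Dh`, `Dv` are the brackets with `X` and its two parts
      (∀ n Y, (D n Y).1 = A.dX n Y.1) ∧
      (∀ p n Y, (Dh p n Y).1 = A.dh n Y.1) ∧
      (∀ p n Y, (Dv p n Y).1 = A.dv n Y.1) ∧
      -- complex, splitting of the differential, bicomplex
      (∀ n Y, D (n + 1) (D n Y) = 0) ∧
      (∀ n, ∀ Y ∈ PoissonFinite.finCx K V n, A.dX n Y = A.dh n Y + A.dv n Y) ∧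
      (∀ p n Y, Dh (p + 1) (n + 1) (Dh p n Y) = 0) ∧
      (∀ p n Y, Dv p (n + 1) (Dv p n Y) = 0) ∧
      (∀ p n Y, Dh p (n + 1) (Dv p n Y) + Dv (p + 1) (n + 1) (Dh p n Y) = 0) ∧
      -- `Φ` is an isomorphism of bicomplexes
      (∀ p n Y, (Φ (p + 1) (n + 1) (Dh p n Y)).1 = A.deltaCE p (Φ p n Y).1) ∧
      (∀ p n Y, (Φ p (n + 1) (Dv p n Y)).1 = A.hochschild (Φ p n Y).1) ∧
      -- on `p = 1` it is the surjective cochain map onto the Harrison complex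
      (∀ n Y, (Φ 1 n Y).1 = PoissonFinite.lineMap n Y.1) ∧
      (∀ n, PoissonFinite.poisBi K V 1 (n + 1) = PoissonFinite.harrison K V (n + 1)) ∧
      (∀ n, PoissonFinite.lineMap n ''
          (PoissonFinite.finCx K V n : Set (PoissonFinite.QuivFun V (n + 1))) =
        (PoissonFinite.harrison K V (n + 1) : Set ((Fin (n + 1) → V) → V))) ∧
      (∀ n, ∀ Y ∈ PoissonFinite.finCx K V n,
        PoissonFinite.lineMap (n + 1) (A.dX n Y) = A.hochschild (PoissonFinite.lineMap n Y)) ∧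
      (∀ p n, p ≠ 1 → ∀ Y ∈ PoissonFinite.finBi K V p n, PoissonFinite.lineMap n Y = 0) := by
  refine ⟨⟨A.X_mem_finCx, A.lieBracket_X_X⟩,
    fun n => ⟨PoissonFinite.iSupIndep_finBi, PoissonFinite.iSup_finBi⟩,
    fun p n h => PoissonFinite.finBi_eq_bot h,
    fun n => ⟨⟨fun Y => ⟨A.dX n Y.1, A.dX_mem_finCx Y.2⟩, fun Y Z => Subtype.ext A.dX_add⟩,
      fun c Y => Subtype.ext (A.dX_smul c)⟩,
    fun p n => ⟨⟨fun Y => ⟨A.dh n Y.1, A.dh_mem_finBi Y.2⟩, fun Y Z => Subtype.ext A.dh_add⟩,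
      fun c Y => Subtype.ext (A.dh_smul c)⟩,
    fun p n => ⟨⟨fun Y => ⟨A.dv n Y.1, A.dv_mem_finBi Y.2⟩, fun Y Z => Subtype.ext A.dv_add⟩,
      fun c Y => Subtype.ext (A.dv_smul c)⟩,
    PoissonFinite.cochainEquiv K V,
    fun n Y => rfl, fun p n Y => rfl, fun p n Y => rfl,
    fun n Y => Subtype.ext (A.dX_dX Y.2), fun n Y hY => A.dX_eq hY,
    fun p n Y => Subtype.ext (A.dh_dh Y.2.1), fun p n Y => Subtype.ext (A.dv_dv Y.2.1),
    fun p n Y => Subtype.ext (A.dh_dv_add Y.2.1),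
    fun p n Y => A.cochainOf_dh p Y.2.1, fun p n Y => A.cochainOf_dv p Y.2.1,
    fun n Y => PoissonFinite.cochainOf_one n Y.1,
    fun n => PoissonFinite.poisBi_one_eq_harrison n, PoissonFinite.lineMap_image,
    fun n Y hY => ?_, fun p n hp Y hY => PoissonFinite.lineMap_eq_zero hp hY⟩
  -- For an arbitrary element of the complex only `d_v` contributes on the single line, and there it
  -- is the Hochschild coboundary.
  rw [A.dX_eq hY, ← PoissonFinite.cochainOf_one (K := K), map_add, PoissonFinite.cochainOf_one,
    A.lineMap_dh hY, zero_add, A.cochainOf_dv 1 hY, PoissonFinite.cochainOf_one]
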